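/- **Conventions.** Let $\hat f(\xi)=\int_{\mathbb R^2}e^{-ix\cdot\xi}f(x)\,dx$, let $m(D)$ denote the Fourier multiplier on $L^2(\mathbb R^2)$ with symbol $m(\xi)$, and let $\langle\xi\rangle=(1+|\xi|^2)^{1/2}$. *Radial cutoffs.* Fix an even $\rho\in C_c^\infty(-2,2)$ with $0\le\rho\le1$ and $\rho=1$ on $[-1,1]$. For $k\in\mathbb Z$ put $\chi_k(\xi)=\rho(2^{-k}|\xi|)-\rho(2^{-k+1}|\xi|)$, $\tilde\chi_k=\chi_{k-1}+\chi_k+\chi_{k+1}$, and $\tilde A_{\le k}=\operatorname{supp}\sum_{l\le k}\tilde\chi_l$. *Caps.* For each integer $l\ge0$ fix a finite collection $\mathcal K_l$ of arcs (caps) $\kappa\subset\mathbb S^1$ of diameter (arc length) $2^{-l}$, with centre $\omega(\kappa)$, which covers $\mathbb S^1$, is symmetric ($\kappa\in\mathcal K_l\Rightarrow-\kappa\in\mathcal K_l$), and is finitely overlapping: every point of $\mathbb S^1$ lies in at most $N$ caps of $\mathcal K_l$, with $N$ independent of $l$. For $a>0$ let $a\Gamma_\kappa$ be the cone with vertex $0$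 over the concentric arc of diameter $a2^{-l}$. Fix real functions $\eta_\kappa\ge0$, $\tilde\eta_\kappa$ ($\kappa\in\mathcal K_l$), smooth and homogeneous of degree $0$ on $\mathbb R^2\setminus\{0\}$, supported in $\frac32\Gamma_\kappa$ and $2\Gamma_\kappa$ respectively, with $\sum_{\kappa\in\mathcal K_l}\eta_\kappa=1$ and $\tilde\eta_\kappa\eta_\kappa=\eta_\kappa$ on $\mathbb R^2\setminus\{0\}$, such that $g=\eta_\kappa$ and $g=\tilde\eta_\kappa$ satisfy $|\partial^\beta g(\xi)|\le C_{|\beta|}2^{l|\beta|}|\xi|^{-|\beta|}$ and $|(\omega(\kappa)\cdot\nabla)^ng(\xi)|\le C_n|\xi|^{-n}$ with constants independent of $l,\kappa$. Put $\tilde P_\kappa=\tilde\eta_\kappa(D)$ and $\tilde A_{k,\kappa}=\operatorname{supp}(\tilde\eta_\kappa\tilde\chi_k)$. *Frames.* For $\lambda\in\mathbb R$ and $\omega=(\omega_1,\omega_2)\in\mathbb S^1$ let $\omega^\perp=(-\omega_2,\omega_1)$. For the frame $\Theta=\Theta_{\lambda,\omega}$ define on $\mathbb R\times\mathbb R^2\ni(t,x)$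 the orthonormal coordinates $$t_\Theta=\frac{\lambda t+x\cdot\omega}{\sqrt{1+\lambda^2}},\qquad x^1_\Theta=\frac{-t+\lambda\,x\cdot\omega}{\sqrt{1+\lambda^2}},\qquad x^2_\Theta=x\cdot\omega^\perp,\qquad x_\Theta=(x^1_\Theta,x^2_\Theta).$$ For a finite set $S$ of frames and mixed norms $\|\cdot\|_{Y_\Theta}$ put $$\|\phi\|_{\sum_SY_\Theta}=\inf\Big\{\sum_{\Theta\in S}\|\phi_\Theta\|_{Y_\Theta}\;:\;\phi=\sum_{\Theta\in S}\phi_\Theta\ \text{a.e., each }\phi_\Theta\text{ measurable}\Big\}.$$ *Frame sets.* Let $r\ge1$ be an integer, let $\lambda(k)=(1+2^{-2k})^{-1/2}$, and let $R$ be the rotation of $\mathbb R^2$ by the angle $2^{-r}$. For $\omega\in\mathbb S^1$ define sets of pairs $(\lambda,\omega)$, which stand for the frames $\Theta_{\lambda,\omega}$: * for $k\le99$: $\Lambda_{k,\omega}=\{i2^{-r}:i\in\mathbb Z,\ |i|\le 2^r(1+2^{-2k-4})^{-1/2}\}\times\{\omega\}$; * for $100\le k<r+20$: $\Lambda_{k,\omega}=\{(1+m^{-2})^{-1/2}:m\in2^{2k-r-20}\mathbb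 Z\cap[2^{k-3},2^{k+3}]\}\times\{\omega\}$; * for $k\ge100$, $k\ge r+20$: $\Lambda_{k,\omega}=\{\lambda(k)\}\times\{\omega\}$; * for $k\ge100$: $\Omega_{k,\omega}=\{\lambda(k)\}\times\{R^i\omega:i\in\mathbb Z,\ |i|\le2^{-k-8+r}\}$. For a cap $\kappa$ write $\Lambda_{k,\kappa}=\Lambda_{k,\omega(\kappa)}$ and $\Omega_{k,\kappa}=\Omega_{k,\omega(\kappa)}$. **Theorem 2.1.** There is a constant $C$, depending only on the fixed choice of $\rho$, $\mathcal K_l$, $\eta_\kappa$, $\tilde\eta_\kappa$ (in particular not on $r$, $T$, $k$, $l$, the direction, the caps, or $f$), such that the following holds for all integers $r>0$ and all $T\in(0,2^r]$. (i) For all integers $k\le99$, all $\omega\in\mathbb S^1$ and all $f\in L^2(\mathbb R^2)$ with $\operatorname{supp}\hat f\subset\tilde A_{\le k}$, $$\big\|1_{[-T,T]}(t)e^{it\langle D\rangle}f\big\|_{\sum_{\Lambda_{k,\omega}}L^2_{t_\Theta}L^\infty_{x_\Theta}}\le C\|f\|_{L^2}.$$ (ii) For all integers $k\ge100$, all $\kappa\in\mathcal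 K_{k+10}$ and all $f\in L^2(\mathbb R^2)$ with $\operatorname{supp}\hat f\subset\tilde A_{k,\kappa}$, $$\big\|1_{[-T,T]}(t)e^{it\langle D\rangle}f\big\|_{\sum_{\Lambda_{k,\kappa}}L^2_{t_\Theta}L^\infty_{x_\Theta}}\le C\|f\|_{L^2},$$ $$\big\|1_{[-T,T]}(t)e^{it\langle D\rangle}f\big\|_{\sum_{\Omega_{k,\kappa}}L^2_{x^2_\Theta}L^\infty_{(t,x^1)_\Theta}}\le C\,2^{k/2}\|f\|_{L^2}.$$ (iii) For all integers $k\ge100$ and $1\le l\le k$, all $\kappa_1\in\mathcal K_l$ and all $f\in L^2(\mathbb R^2)$ with $\operatorname{supp}\hat f\subset\tilde A_{k,\kappa_1}$, $$\sum_{\kappa\in\mathcal K_k}\big\|1_{[-T,T]}(t)e^{it\langle D\rangle}\tilde P_\kappa f\big\|_{\sum_{\Lambda_{k,\kappa}}L^2_{t_\Theta}L^\infty_{x_\Theta}}\le C\,2^{(k-l)/2}\|f\|_{L^2}.$$ -/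

import Mathlib

open MeasureTheory
open scoped ENNReal FourierTransform

noncomputable section

namespace KleinGordon

/-- Physical space `ℝ²` with the Euclidean norm. -/
abbrev Plane : Type := EuclideanSpace ℝ (Fin 2)

/-- `L²(ℝ²; ℂ)`. -/
abbrev L2 : Type := Lp ℂ 2 (volume : Measure Plane)

/-- `ω^⊥ = (-ω₂, ω₁)`. -/
def perp (ω : Plane) : Plane := !₂[-ω 1, ω 0]

/-! ### Frequency cutoffs -/

/-- An even smooth cutoff `ρ ∈ C_c^∞(-2,2)` with `0 ≤ ρ ≤ 1` and `ρ = 1` on `[-1,1]`. -/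
structure IsRadialCutoff (ρ : ℝ → ℝ) : Prop where
  smooth : ContDiff ℝ (⊤ : ℕ∞) ρ
  supp : tsupport ρ ⊆ Set.Ioo (-2) 2
  even : ∀ s, ρ (-s) = ρ s
  eq_one : ∀ s, |s| ≤ 1 → ρ s = 1
  nonneg : ∀ s, 0 ≤ ρ s
  le_one : ∀ s, ρ s ≤ 1

/-- `χ_k(ξ) = ρ(2^{-k}|ξ|) - ρ(2^{-k+1}|ξ|)`. -/
def chi (ρ : ℝ → ℝ) (k : ℤ) (ξ : Plane) : ℝ :=
  ρ ((2 : ℝ) ^ (-k) * ‖ξ‖) - ρ ((2 : ℝ) ^ (-k + 1) * ‖ξ‖)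

/-- `χ̃_k = χ_{k-1} + χ_k + χ_{k+1}`. -/
def chiTilde (ρ : ℝ → ℝ) (k : ℤ) (ξ : Plane) : ℝ :=
  chi ρ (k - 1) ξ + chi ρ k ξ + chi ρ (k + 1) ξ

/-- `χ_{≤k}`, the telescoped sum `∑_{l ≤ k} χ_l`, that is `ρ(2^{-k}|ξ|)` (for `ξ ≠ 0`, and
extended smoothly to `ξ = 0`). -/
def chiLe (ρ : ℝ → ℝ) (k : ℤ) (ξ : Plane) : ℝ := ρ ((2 : ℝ) ^ (-k) * ‖ξ‖)

/-- `χ̃_{≤k} = ∑_{l ≤ k} χ̃_l = χ_{≤k-1} + χ_{≤k} + χ_{≤k+1}`. -/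
def chiTildeLe (ρ : ℝ → ℝ) (k : ℤ) (ξ : Plane) : ℝ :=
  chiLe ρ (k - 1) ξ + chiLe ρ k ξ + chiLe ρ (k + 1) ξ

/-- `Ã_{≤k} = supp χ̃_{≤k}` (closed support). -/
def supportLe (ρ : ℝ → ℝ) (k : ℤ) : Set Plane := tsupport (chiTildeLe ρ k)

/-! ### Caps and angular cutoffs -/

/-- The arc (cap) of the unit circle of diameter (arc length) `2^{-l}` centred at `ω`. -/
def arc (l : ℕ) (ω : Plane) : Set Plane :=
  {x | ‖x‖ = 1 ∧ InnerProductGeometry.angle x ω ≤ (2 : ℝ) ^ (-(l : ℤ)) / 2}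

/-- `a Γ_κ` for the arc `κ` of diameter `2^{-l}` centred at `ω`: the cone over the concentric arc
of diameter `a 2^{-l}`. -/
def cone (a : ℝ) (l : ℕ) (ω : Plane) : Set Plane :=
  {ξ | ξ = 0 ∨ InnerProductGeometry.angle ξ ω ≤ a * ((2 : ℝ) ^ (-(l : ℤ)) / 2)}

/-- `g` is an angular cutoff adapted to the cap of diameter `2^{-l}` centred at `ω`: smooth and
homogeneous of degree zero away from the origin, supported in the cone `a Γ_κ`, with
`|∂^β g(ξ)| ≤ C_{|β|} 2^{l|β|} |ξ|^{-|β|}` and `|(ω·∇)^n g(ξ)| ≤ C_n |ξ|^{-n}`.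
The value of `g` at the origin is irrelevant. -/
structure IsAngularCutoff (C : ℕ → ℝ) (a : ℝ) (l : ℕ) (ω : Plane) (g : Plane → ℝ) : Prop where
  smooth : ContDiffOn ℝ (⊤ : ℕ∞) g {0}ᶜ
  homogeneous : ∀ ξ : Plane, ξ ≠ 0 → ∀ c : ℝ, 0 < c → g (c • ξ) = g ξ
  supp : ∀ ξ : Plane, ξ ≠ 0 → g ξ ≠ 0 → ξ ∈ cone a l ω
  deriv_bound : ∀ (n : ℕ) (ξ : Plane), ξ ≠ 0 →
    ‖iteratedFDeriv ℝ n g ξ‖ ≤ C n * (2 : ℝ) ^ (l * n) * (‖ξ‖ ^ n)⁻¹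
  radial_bound : ∀ (n : ℕ) (ξ : Plane), ξ ≠ 0 →
    |iteratedFDeriv ℝ n g ξ (fun _ => ω)| ≤ C n * (‖ξ‖ ^ n)⁻¹

/-- The caps `𝒦_l`, `l ∈ ℕ`, with the functions `η_κ`, `η̃_κ`. A cap `κ ∈ 𝒦_l` is the arc of
diameter `2^{-l}` about its centre `ω(κ)`, and is represented by this centre. -/
structure CapSystem where
  /-- the centres `ω(κ)` of the caps `κ ∈ 𝒦_l` -/
  caps : ℕ → Finset Plane
  norm_center : ∀ l, ∀ κ ∈ caps l, ‖κ‖ = 1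
  symmetric : ∀ l, ∀ κ ∈ caps l, -κ ∈ caps l
  cover : ∀ l (x : Plane), ‖x‖ = 1 → ∃ κ ∈ caps l, x ∈ arc l κ
  finite_overlap : ∃ N : ℕ, ∀ l (x : Plane), ‖x‖ = 1 →
    {κ : Plane | κ ∈ caps l ∧ x ∈ arc l κ}.ncard ≤ N
  /-- the functions `η_κ`, for `κ ∈ 𝒦_l` -/
  eta : ℕ → Plane → Plane → ℝ
  /-- the functions `η̃_κ`, for `κ ∈ 𝒦_l` -/
  etaTilde : ℕ → Plane → Plane → ℝ
  eta_nonneg : ∀ l, ∀ κ ∈ caps l, ∀ ξ, 0 ≤ eta l κ ξ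
  eta_sum : ∀ l (ξ : Plane), ξ ≠ 0 → ∑ κ ∈ caps l, eta l κ ξ = 1
  eta_cutoff : ∃ C : ℕ → ℝ, ∀ l, ∀ κ ∈ caps l, IsAngularCutoff C (3 / 2) l κ (eta l κ)
  etaTilde_cutoff : ∃ C : ℕ → ℝ, ∀ l, ∀ κ ∈ caps l, IsAngularCutoff C 2 l κ (etaTilde l κ)
  etaTilde_mul_eta : ∀ l, ∀ κ ∈ caps l, ∀ ξ : Plane, ξ ≠ 0 →
    etaTilde l κ ξ * eta l κ ξ = eta l κ ξ

/-- `Ã_{k,κ} = supp (η̃_κ χ̃_k)` for `κ ∈ 𝒦_l` (closed support). -/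
def CapSystem.supportCap (K : CapSystem) (ρ : ℝ → ℝ) (k : ℤ) (l : ℕ) (κ : Plane) : Set Plane :=
  tsupport (fun ξ => K.etaTilde l κ ξ * chiTilde ρ k ξ)

/-! ### Fourier multipliers on `L²`

Mathlib's Fourier transform has the kernel `e^{-2πi x·ξ}`, whereas the frequency variable here is
dual to `x` through `e^{-i x·ξ}`; hence the dilation by `2π` in the next definitions. -/

/-- The closed set `S` contains the support of `f̂`, where `f̂(ξ) = ∫ e^{-i x·ξ} f(x) dx`. -/
def FourierSupportedIn (f : L2) (S : Set Plane) : Prop :=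
  ∀ᵐ ξ : Plane, (2 * Real.pi) • ξ ∉ S → (𝓕 f : L2) ξ = 0

open Classical in
/-- The Fourier multiplier `m(D)` on `L²` (on its domain, which is all of `L²` for the bounded
symbols used below; set to zero off its domain). -/
def multiplier (m : Plane → ℂ) (f : L2) : L2 :=
  𝓕⁻ (if h : MemLp (fun ξ : Plane => m ((2 * Real.pi) • ξ) * (𝓕 f : L2) ξ) 2 volume
    then h.toLp _ else (0 : L2))

/-- The domain of `m(D)` is `L²` if the symbol is continuous and bounded off the origin. -/
theorem memLp_symbol_mul (m : Plane → ℂ) (hm : ContinuousOn m {0}ᶜ) (B : ℝ)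
    (hB : ∀ ξ, ξ ≠ 0 → ‖m ξ‖ ≤ B) (g : L2) :
    MemLp (fun ξ : Plane => m ((2 * Real.pi) • ξ) * g ξ) 2 volume := by
  have hpi : (2 * Real.pi) ≠ 0 := by positivity
  have h0 : ∀ᵐ ξ : Plane, ξ ≠ 0 := by
    simp [ae_iff]
  have hcont : ContinuousOn (fun ξ : Plane => m ((2 * Real.pi) • ξ)) {0}ᶜ := by
    refine hm.comp (by fun_prop) ?_
    intro ξ hξ
    simpa [hpi, Real.pi_ne_zero] using hξ
  have hmeas : AEStronglyMeasurable (fun ξ : Plane => m ((2 * Real.pi) • ξ)) volume := by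
    have h1 := hcont.aestronglyMeasurable (μ := (volume : Measure Plane))
      (measurableSet_singleton 0).compl
    rwa [Measure.restrict_eq_self_of_ae_mem (by simpa using h0)] at h1
  refine MemLp.of_le_mul (c := B) (Lp.memLp g) (hmeas.mul (Lp.aestronglyMeasurable g)) ?_
  filter_upwards [h0] with ξ hξ
  rw [norm_mul]
  exact mul_le_mul_of_nonneg_right (hB _ (smul_ne_zero hpi hξ)) (norm_nonneg _)

/-- The symbol `⟨ξ⟩ = (1 + |ξ|²)^{1/2}`. -/
def japanese (ξ : Plane) : ℝ := Real.sqrt (1 + ‖ξ‖ ^ 2)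

/-- The propagator `e^{it⟨D⟩}`. -/
def propagator (t : ℝ) (f : L2) : L2 :=
  multiplier (fun ξ => Complex.exp (Complex.I * t * japanese ξ)) f

/-- `P̃_κ = η̃_κ(D)` for `κ ∈ 𝒦_l`. -/
def CapSystem.projTilde (K : CapSystem) (l : ℕ) (κ : Plane) (f : L2) : L2 :=
  multiplier (fun ξ => (K.etaTilde l κ ξ : ℂ)) f

/-- `e^{it⟨D⟩}` is defined on all of `L²`, through its symbol. -/
theorem fourier_propagator (t : ℝ) (f : L2) :
    ∀ᵐ ξ : Plane, (𝓕 (propagator t f) : L2) ξ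
      = Complex.exp (Complex.I * t * japanese ((2 * Real.pi) • ξ)) * (𝓕 f : L2) ξ := by
  have h := memLp_symbol_mul (fun ξ => Complex.exp (Complex.I * t * japanese ξ))
    (by unfold japanese; fun_prop) 1
    (by
      intro ξ _
      have : Complex.I * t * japanese ξ = ((t * japanese ξ : ℝ) : ℂ) * Complex.I := by
        push_cast; ring
      rw [this, Complex.norm_exp_ofReal_mul_I]) (𝓕 f : L2)
  unfold propagator multiplier
  rw [dif_pos h, FourierTransform.fourier_fourierInv_eq]
  exact h.coeFn_toLp

/-- `P̃_κ` is defined on all of `L²`, through its symbol. -/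
theorem CapSystem.fourier_projTilde (K : CapSystem) (l : ℕ) (κ : Plane) (hκ : κ ∈ K.caps l)
    (f : L2) :
    ∀ᵐ ξ : Plane, (𝓕 (K.projTilde l κ f) : L2) ξ
      = (K.etaTilde l κ ((2 * Real.pi) • ξ) : ℂ) * (𝓕 f : L2) ξ := by
  obtain ⟨C, hC⟩ := K.etaTilde_cutoff
  have hc := hC l κ hκ
  have h := memLp_symbol_mul (fun ξ => (K.etaTilde l κ ξ : ℂ))
    (Complex.continuous_ofReal.comp_continuousOn hc.smooth.continuousOn) (C 0)
    (by
      intro ξ hξ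
      have := hc.deriv_bound 0 ξ hξ
      simpa using this) (𝓕 f : L2)
  unfold CapSystem.projTilde multiplier
  rw [dif_pos h, FourierTransform.fourier_fourierInv_eq]
  exact h.coeFn_toLp

/-- The space-time function `1_{[-T,T]}(t) e^{it⟨D⟩} f`. -/
def truncatedWave (T : ℝ) (f : L2) : ℝ → Plane → ℂ :=
  Set.indicator (Set.Icc (-T) T) (fun t => (propagator t f : Plane → ℂ))

/-! ### Frames -/

/-- `t_Θ`, for `Θ = (λ, ω)`: the component of `(t,x)` along `(1+λ²)^{-1/2} (λ, ω)`. -/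
def coordT (Θ : ℝ × Plane) (p : ℝ × Plane) : ℝ :=
  (Θ.1 * p.1 + inner ℝ p.2 Θ.2) / Real.sqrt (1 + Θ.1 ^ 2)

/-- `x¹_Θ`: the component of `(t,x)` along `(1+λ²)^{-1/2} (-1, λω)`. -/
def coordX1 (Θ : ℝ × Plane) (p : ℝ × Plane) : ℝ :=
  (-p.1 + Θ.1 * inner ℝ p.2 Θ.2) / Real.sqrt (1 + Θ.1 ^ 2)

/-- `x²_Θ`: the component of `(t,x)` along `(0, ω^⊥)`. -/
def coordX2 (Θ : ℝ × Plane) (p : ℝ × Plane) : ℝ := inner ℝ p.2 (perp Θ.2)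

/-- The space-time point with coordinates `t_Θ = s`, `x¹_Θ = y₁`, `x²_Θ = y₂`. -/
def framePoint (Θ : ℝ × Plane) (s y₁ y₂ : ℝ) : ℝ × Plane :=
  ((Θ.1 * s - y₁) / Real.sqrt (1 + Θ.1 ^ 2),
    ((s + Θ.1 * y₁) / Real.sqrt (1 + Θ.1 ^ 2)) • Θ.2 + y₂ • perp Θ.2)

theorem framePoint_spec (Θ : ℝ × Plane) (hω : ‖Θ.2‖ = 1) (s y₁ y₂ : ℝ) :
    coordT Θ (framePoint Θ s y₁ y₂) = s ∧ coordX1 Θ (framePoint Θ s y₁ y₂) = y₁ ∧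
      coordX2 Θ (framePoint Θ s y₁ y₂) = y₂ := by
  have h1 : Θ.2 0 ^ 2 + Θ.2 1 ^ 2 = 1 := by
    have := EuclideanSpace.norm_sq_eq Θ.2
    rw [hω] at this
    simpa [Fin.sum_univ_two] using this.symm
  have hpos : 0 < 1 + Θ.1 ^ 2 := by positivity
  have hs : Real.sqrt (1 + Θ.1 ^ 2) ≠ 0 := (Real.sqrt_pos.2 hpos).ne'
  have hs2 : Real.sqrt (1 + Θ.1 ^ 2) ^ 2 = 1 + Θ.1 ^ 2 := Real.sq_sqrt hpos.le
  have e1 : inner ℝ (framePoint Θ s y₁ y₂).2 Θ.2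
      = (s + Θ.1 * y₁) / Real.sqrt (1 + Θ.1 ^ 2) := by
    simp only [framePoint, perp, PiLp.inner_apply, Fin.sum_univ_two]
    simp
    linear_combination ((s + Θ.1 * y₁) / Real.sqrt (1 + Θ.1 ^ 2)) * h1
  have e2 : inner ℝ (framePoint Θ s y₁ y₂).2 (perp Θ.2) = y₂ := by
    simp only [framePoint, perp, PiLp.inner_apply, Fin.sum_univ_two]
    simp
    linear_combination y₂ * h1
  refine ⟨?_, ?_, e2⟩
  · rw [coordT, e1]
    simp only [framePoint]
    field_simp
    rw [hs2]; ring
  · rw [coordX1, e1]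
    simp only [framePoint]
    field_simp
    rw [hs2]; ring

/-- The norm of `L²_{t_Θ} L^∞_{x_Θ}`. -/
def normL2TLinfX (Θ : ℝ × Plane) (φ : ℝ × Plane → ℂ) : ℝ≥0∞ :=
  (∫⁻ s : ℝ, eLpNorm (fun y : ℝ × ℝ => φ (framePoint Θ s y.1 y.2)) ∞ volume ^ 2) ^ (1 / 2 : ℝ)

/-- The norm of `L²_{x²_Θ} L^∞_{(t,x¹)_Θ}`. -/
def normL2X2LinfTX1 (Θ : ℝ × Plane) (φ : ℝ × Plane → ℂ) : ℝ≥0∞ :=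
  (∫⁻ y₂ : ℝ, eLpNorm (fun q : ℝ × ℝ => φ (framePoint Θ q.1 q.2 y₂)) ∞ volume ^ 2) ^ (1 / 2 : ℝ)

/-- The norm of the sum over the frames `Θ ∈ S` of the spaces with norms `N Θ`: the infimum of
`∑_Θ N Θ φ_Θ` over all decompositions `u = ∑_Θ φ_Θ` into measurable functions, where equality is
understood almost everywhere (it is `∞` if there is no decomposition of finite norm). -/
def sumNorm (N : ℝ × Plane → (ℝ × Plane → ℂ) → ℝ≥0∞) (S : Finset (ℝ × Plane))
    (u : ℝ → Plane → ℂ) : ℝ≥0∞ :=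
  ⨅ (φ : ℝ × Plane → ℝ × Plane → ℂ) (_ : ∀ Θ ∈ S, Measurable (φ Θ))
    (_ : ∀ᵐ t : ℝ, ∀ᵐ x : Plane, u t x = ∑ Θ ∈ S, φ Θ (t, x)),
    ∑ Θ ∈ S, N Θ (φ Θ)

/-- `λ(k) = (1 + 2^{-2k})^{-1/2}`. -/
def lam (k : ℤ) : ℝ := 1 / Real.sqrt (1 + (2 : ℝ) ^ (-2 * k))

/-- The speeds of the frames in `Λ_{k,ω}` (on the time scale `2^r`). -/
def speeds (r k : ℤ) : Set ℝ :=
  if k ≤ 99 then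
    {v | ∃ i : ℤ, |(i : ℝ)| ≤ (2 : ℝ) ^ r / Real.sqrt (1 + (2 : ℝ) ^ (-2 * k - 4)) ∧
      v = i * (2 : ℝ) ^ (-r)}
  else if k < r + 20 then
    {v | ∃ m : ℝ, (∃ i : ℤ, m = (2 : ℝ) ^ (2 * k - r - 20) * i) ∧
      m ∈ Set.Icc ((2 : ℝ) ^ (k - 3)) ((2 : ℝ) ^ (k + 3)) ∧
      v = 1 / Real.sqrt (1 + (m ^ 2)⁻¹)}
  else {lam k}

theorem finite_int_abs_le (B : ℝ) : {i : ℤ | |(i : ℝ)| ≤ B}.Finite := by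
  refine (Set.finite_Icc (-⌈B⌉) ⌈B⌉).subset ?_
  intro i hi
  have hi' := abs_le.1 (show |(i : ℝ)| ≤ B from hi)
  have hB := Int.le_ceil B
  constructor
  · have : ((-⌈B⌉ : ℤ) : ℝ) ≤ i := by push_cast; linarith
    exact_mod_cast this
  · have : (i : ℝ) ≤ (⌈B⌉ : ℤ) := by linarith
    exact_mod_cast this

theorem finite_speeds (r k : ℤ) : (speeds r k).Finite := by
  unfold speeds
  split_ifs
  · refine ((finite_int_abs_le
      ((2 : ℝ) ^ r / Real.sqrt (1 + (2 : ℝ) ^ (-2 * k - 4)))).image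
      (fun i : ℤ => (i : ℝ) * (2 : ℝ) ^ (-r))).subset ?_
    rintro v ⟨i, hi, rfl⟩
    exact ⟨i, hi, rfl⟩
  · refine ((finite_int_abs_le ((2 : ℝ) ^ (k + 3) / (2 : ℝ) ^ (2 * k - r - 20))).image
      (fun i : ℤ => 1 / Real.sqrt (1 + (((2 : ℝ) ^ (2 * k - r - 20) * i) ^ 2)⁻¹))).subset ?_
    rintro v ⟨m, ⟨i, rfl⟩, hm, rfl⟩
    refine ⟨i, ?_, rfl⟩
    have hp : (0 : ℝ) < (2 : ℝ) ^ (2 * k - r - 20) := by positivity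
    have h3 : (0 : ℝ) < (2 : ℝ) ^ (k - 3) := by positivity
    have h0 : (0 : ℝ) < i := by
      have := lt_of_lt_of_le h3 hm.1
      exact (mul_pos_iff_of_pos_left hp).1 this
    show |(i : ℝ)| ≤ _
    rw [abs_of_pos h0, le_div_iff₀ hp, mul_comm]
    exact hm.2
  · exact Set.finite_singleton _

/-- The set of frames `Λ_{k,ω}`, a frame `Θ_{λ,ω}` being given by the pair `(λ, ω)`. -/
def framesLambda (r k : ℤ) (ω : Plane) : Finset (ℝ × Plane) :=
  ((finite_speeds r k).prod (Set.finite_singleton ω)).toFinset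

/-- The rotation of the plane by the angle `θ`. -/
def rotate (θ : ℝ) (ω : Plane) : Plane := Real.cos θ • ω + Real.sin θ • perp ω

/-- The directions of the frames in `Ω_{k,ω}`: `R^i ω` with `R` the rotation by `2^{-r}`. -/
def directions (r k : ℤ) (ω : Plane) : Set Plane :=
  {v | ∃ i : ℤ, |(i : ℝ)| ≤ (2 : ℝ) ^ (-k - 8 + r) ∧ v = rotate (i * (2 : ℝ) ^ (-r)) ω}

theorem finite_directions (r k : ℤ) (ω : Plane) : (directions r k ω).Finite := by
  refine ((finite_int_abs_le ((2 : ℝ) ^ (-k - 8 + r))).image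
    (fun i : ℤ => rotate (i * (2 : ℝ) ^ (-r)) ω)).subset ?_
  rintro v ⟨i, hi, rfl⟩
  exact ⟨i, hi, rfl⟩

/-- The set of frames `Ω_{k,ω}`. -/
def framesOmega (r k : ℤ) (ω : Plane) : Finset (ℝ × Plane) :=
  ((Set.finite_singleton (lam k)).prod (finite_directions r k ω)).toFinset

end KleinGordon

end

/-!
The norm of a finite sum of spaces `L²_{t_Θ} L^∞_{x_Θ}` is dual to the largest of the norms
`L²_{t_Θ} L¹_{x_Θ}`. Since the infimum in `sumNorm` asks for an actual decomposition, the duality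
is proved in the form `exists_decomposition`: after multiplication by a Gaussian weight, the functions
with a decomposition of total norm at most `C` form the image of a bounded closed convex subset of a
Hilbert space under a bounded linear map. Such an image is closed (`isClosed_image_of_convex`), so
Hahn–Banach separates every other function from it.

By duality and `T T^*` the estimates follow from a pointwise majorant of the convolution kernel
`K(t, x) = ∫ a(ξ) e^{-i(x·ξ + t⟨ξ⟩)} dξ` at times `|t| ≤ 2T`: if `|K| ≤ ∑_Θ M_Θ(t_Θ)`, then Schur's
test in each coordinate `t_Θ` bounds the square of the constant by `∑_Θ ‖M_Θ‖_{L¹}`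
(`sumNorm_truncatedWave_le`). The majorants have the form
`A · #{Θ : |t_Θ| ≤ c} + B / (1 + (β t_{Θ₀})²)` (`sumNorm_le_of_majorant`), and likewise with `x²_Θ`
in place of `t_Θ` for the frames `Ω_{k,κ}`.

The tail in one frame `Θ₀` covers the points outside the region of group velocities, where the phase
is nonstationary; two integrations by parts on lines give it (`norm_integral_exp_mul_le`,
`IsBumpPair.exists_tail`, `IsBumpPair.exists_tail_perp`). Inside that region the kernel is bounded
by the smaller of the trivial bound and the dispersive bound `O(1/|t|)`, and a point with group
velocity `w` has small `t_Θ` for all frames of the grid whose speed is within about `c / |t|` of `w`.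
As `|t| ≤ 2T ≤ 2^{r+1}`, the grid is fine enough for the number of these frames to be bounded below by
a multiple of the minimum of the two bounds (`le_card_framesLambda_low`,
`le_card_framesLambda_grid`, `le_card_framesOmega`). For `k ≥ r + 20` a single frame is enough in
`Λ_{k,ω}`: the speeds in the sector differ by `O(2^{-2k})`, which moves points by less than
`2^{-k}` at these times.

For the dispersive estimate the cutoffs carry a factor `e^{-ε⟨ξ⟩} / ⟨ξ⟩`. The kernel of
`e^{-z⟨D⟩} ⟨D⟩⁻¹` is explicit, because it is Lorentz invariant and so depends only on `z² + |x|²`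
(`expKernel_eq_expKernel_zero`, `norm_expKernel_le`). Smooth cutoffs in `ξ·ω` and `ξ·ω^⊥` only
average this kernel over translates in `x`, so the bound, which is uniform in `x`, survives them
with constants independent of the scales (`exists_norm_freqKernel_bump_le`).

The third estimate follows from the first bound for frequencies over one cap, since only `O(2^{k-l})`
caps of `𝒦_k` contribute and the operators `P̃_κ` are almost orthogonal
(`CapSystem.exists_sum_projTilde_le`).
-/

open MeasureTheory Filter Topology
open scoped ENNReal FourierTransform

noncomputable section

namespace KleinGordon

/-! ### Images of bounded closed convex sets -/

/-- Cantor's intersection theorem for bounded convex sets of a Hilbert space. -/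
theorem exists_mem_forall_of_antitone_convex {X : Type*} [NormedAddCommGroup X]
    [InnerProductSpace ℝ X] [CompleteSpace X] (D : ℕ → Set X) (hanti : Antitone D)
    (hne : ∀ n, (D n).Nonempty) (hcl : ∀ n, IsClosed (D n)) (hconv : ∀ n, Convex ℝ (D n))
    (R : ℝ) (hR : ∀ n, ∀ x ∈ D n, ‖x‖ ≤ R) : ∃ x, ∀ n, x ∈ D n := by
  set d : ℕ → ℝ := fun n => Metric.infDist 0 (D n) with hd
  have hle : ∀ n, ∀ x ∈ D n, d n ≤ ‖x‖ := fun n x hx => by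
    simpa using Metric.infDist_le_dist_of_mem (x := (0 : X)) hx
  have hmono : Monotone d := fun m n hmn =>
    Metric.infDist_le_infDist_of_subset (hanti hmn) (hne n)
  have hbdd : BddAbove (Set.range d) := ⟨R, by
    rintro _ ⟨n, rfl⟩
    obtain ⟨x, hx⟩ := hne n
    exact (hle n x hx).trans (hR n x hx)⟩
  have hlim : Tendsto d atTop (𝓝 (⨆ n, d n)) := tendsto_atTop_ciSup hmono hbdd
  -- almost minimal elements of `D n`; they form a Cauchy sequence
  have hex : ∀ n : ℕ, ∃ x ∈ D n, ‖x‖ < d n + 1 / ((n : ℝ) + 1) := fun n => by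
    have hlt : Metric.infDist 0 (D n) < d n + 1 / ((n : ℝ) + 1) := by
      have : (0 : ℝ) < 1 / ((n : ℝ) + 1) := by positivity
      simp only [hd]; linarith
    obtain ⟨x, hx, h⟩ := (Metric.infDist_lt_iff (hne n)).1 hlt
    exact ⟨x, hx, by simpa using h⟩
  choose x hxD hx using hex
  set S := ⨆ n, d n with hS
  -- the squared distances are controlled by `b`, through the parallelogram law
  set b : ℕ → ℝ := fun n => 4 * ((S + 1 / ((n : ℝ) + 1)) ^ 2 - d n ^ 2) with hb
  have hblim : Tendsto b atTop (𝓝 0) := by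
    have h1 := (((tendsto_const_nhds (x := S)).add
      (tendsto_one_div_add_atTop_nhds_zero_nat (𝕜 := ℝ))).pow 2).sub (hlim.pow 2)
    simpa [hb] using h1.const_mul 4
  have hdS : ∀ n, d n ≤ S := fun n => le_ciSup hbdd n
  have hd0 : ∀ n, 0 ≤ d n := fun n => Metric.infDist_nonneg
  have hdist : ∀ n m, n ≤ m → ‖x n - x m‖ ^ 2 ≤ b n := by
    intro n m hnm
    have hmid : (1 / 2 : ℝ) • x n + (1 / 2 : ℝ) • x m ∈ D n :=
      hconv n (hxD n) (hanti hnm (hxD m)) (by norm_num) (by norm_num) (by norm_num)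
    have h1 := hle n _ hmid
    have h2 : ‖x n + x m‖ = 2 * ‖(1 / 2 : ℝ) • x n + (1 / 2 : ℝ) • x m‖ := by
      rw [← smul_add, norm_smul]
      norm_num
      ring
    have h3 := parallelogram_law_with_norm ℝ (x n) (x m)
    have hn1 : (1 : ℝ) / ((m : ℝ) + 1) ≤ 1 / ((n : ℝ) + 1) := by
      have : (n : ℝ) ≤ m := by exact_mod_cast hnm
      gcongr
    have h4 : ‖x n‖ ≤ S + 1 / ((n : ℝ) + 1) := by linarith [hx n, hdS n]
    have h5 : ‖x m‖ ≤ S + 1 / ((n : ℝ) + 1) := by linarith [hx m, hdS m]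
    have h6 : ‖x n‖ ^ 2 ≤ (S + 1 / ((n : ℝ) + 1)) ^ 2 := by gcongr
    have h7 : ‖x m‖ ^ 2 ≤ (S + 1 / ((n : ℝ) + 1)) ^ 2 := by gcongr
    have h8 : d n ^ 2 ≤ ‖(1 / 2 : ℝ) • x n + (1 / 2 : ℝ) • x m‖ ^ 2 := by
      gcongr
      exact hd0 n
    simp only [hb]
    rw [h2] at h3
    nlinarith
  have hcauchy : CauchySeq x := by
    refine cauchySeq_of_le_tendsto_0' (fun n => Real.sqrt (b n)) (fun n m hnm => ?_) ?_
    · rw [dist_eq_norm]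
      exact Real.le_sqrt_of_sq_le (hdist n m hnm)
    · have h := (Real.continuous_sqrt.tendsto 0).comp hblim
      rwa [Real.sqrt_zero] at h
  obtain ⟨y, hy⟩ := cauchySeq_tendsto_of_complete hcauchy
  refine ⟨y, fun n => (hcl n).mem_of_tendsto hy ?_⟩
  filter_upwards [eventually_ge_atTop n] with m hm
  exact hanti hm (hxD m)

/-- A bounded linear map sends bounded closed convex subsets of a Hilbert space to closed sets. -/
theorem isClosed_image_of_convex {X Y : Type*} [NormedAddCommGroup X] [InnerProductSpace ℝ X]
    [CompleteSpace X] [NormedAddCommGroup Y] [NormedSpace ℝ Y] (L : X →L[ℝ] Y) (s : Set X)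
    (hcl : IsClosed s) (hconv : Convex ℝ s) (R : ℝ) (hR : ∀ x ∈ s, ‖x‖ ≤ R) :
    IsClosed (L '' s) := by
  refine isClosed_of_closure_subset fun v hv => ?_
  -- the points of `s` that `L` maps to within `1 / (n + 1)` of `v`
  set D : ℕ → Set X := fun n => s ∩ L ⁻¹' Metric.closedBall v (1 / ((n : ℝ) + 1)) with hD
  obtain ⟨x, hx⟩ := exists_mem_forall_of_antitone_convex D
    (fun m n hmn x hx => ⟨hx.1, Metric.closedBall_subset_closedBall
      (by have : (m : ℝ) ≤ n := by exact_mod_cast hmn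
          gcongr) hx.2⟩)
    (fun n => by
      obtain ⟨_, ⟨x, hx, rfl⟩, hy⟩ := Metric.mem_closure_iff.1 hv (1 / ((n : ℝ) + 1))
        (by positivity)
      exact ⟨x, hx, by rw [Set.mem_preimage, Metric.mem_closedBall, dist_comm]; exact hy.le⟩)
    (fun n => hcl.inter (Metric.isClosed_closedBall.preimage L.continuous))
    (fun n => hconv.inter ((convex_closedBall _ _).linear_preimage (L : X →ₗ[ℝ] Y)))
    R (fun n x hx => hR x hx.1)
  refine ⟨x, (hx 0).1, ?_⟩
  have h0 : ∀ n : ℕ, dist (L x) v ≤ 1 / ((n : ℝ) + 1) := fun n => (hx n).2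
  have h1 := ge_of_tendsto' (tendsto_one_div_add_atTop_nhds_zero_nat (𝕜 := ℝ)) h0
  exact dist_le_zero.1 h1

/-! ### Mixed norms in a chart -/

/-- Space-time `ℝ × ℝ²`. -/
abbrev SpaceTime : Type := ℝ × Plane

/-- The Gaussian weight `e^{-(t² + |x|²)}`. -/
def gauss (p : SpaceTime) : ℝ := Real.exp (-(p.1 ^ 2 + ‖p.2‖ ^ 2))

theorem gauss_pos (p : SpaceTime) : 0 < gauss p := Real.exp_pos _

theorem continuous_gauss : Continuous gauss := by unfold gauss; fun_prop

/-- A measure preserving parametrisation `e (s, y)` of space-time whose slices `s = const` are the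
level sets of the linear coordinate `σ`. -/
structure IsChart (e : ℝ × (ℝ × ℝ) → SpaceTime) (σ : SpaceTime → ℝ) : Prop where
  /-- `e` preserves the measure -/
  mp : MeasurePreserving e volume volume
  meas : Measurable σ
  /-- `σ` is the first coordinate -/
  coord : ∀ s y, σ (e (s, y)) = s
  /-- the Gaussian weight factors, because the coordinates are orthonormal -/
  gauss_apply : ∀ s y, gauss (e (s, y)) = Real.exp (-s ^ 2) * Real.exp (-(y.1 ^ 2 + y.2 ^ 2))
  /-- `σ` is additive; only differences of points occur -/
  map_sub : ∀ p q, σ (p - q) = σ p - σ q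

/-- The norm of `L²_s L^∞_y` in the coordinates `(s, y)` given by `e`. -/
def mixedNorm (e : ℝ × (ℝ × ℝ) → SpaceTime) (φ : SpaceTime → ℂ) : ℝ≥0∞ :=
  (∫⁻ s : ℝ, eLpNorm (fun y : ℝ × ℝ => φ (e (s, y))) ∞ volume ^ 2) ^ (1 / 2 : ℝ)

/-- The `L¹` norms on the slices `s = const`. -/
def sliceL1 (e : ℝ × (ℝ × ℝ) → SpaceTime) (G : SpaceTime → ℂ) (s : ℝ) : ℝ≥0∞ :=
  ∫⁻ y : ℝ × ℝ, ‖G (e (s, y))‖ₑ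

section

variable {e : ℝ × (ℝ × ℝ) → SpaceTime} {σ : SpaceTime → ℝ}

theorem IsChart.lintegral_eq (h : IsChart e σ) {F : SpaceTime → ℝ≥0∞} (hF : Measurable F) :
    ∫⁻ p, F p = ∫⁻ s, ∫⁻ y, F (e (s, y)) := by
  rw [← h.mp.lintegral_comp hF]
  exact lintegral_prod _ (hF.comp h.mp.measurable).aemeasurable

theorem measurable_sliceL1 (h : IsChart e σ) {G : SpaceTime → ℂ} (hG : Measurable G) :
    Measurable (sliceL1 e G) :=
  (hG.comp h.mp.measurable).enorm.lintegral_prod_right'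

theorem IsChart.lintegral_coord_mul (h : IsChart e σ) {k : ℝ → ℝ≥0∞} (hk : Measurable k)
    {G : SpaceTime → ℂ} (hG : Measurable G) :
    ∫⁻ p, k (σ p) * ‖G p‖ₑ = ∫⁻ s, k s * sliceL1 e G s := by
  rw [h.lintegral_eq (F := fun p => k (σ p) * ‖G p‖ₑ) ((hk.comp h.meas).mul hG.enorm)]
  refine lintegral_congr fun s => ?_
  simp only [h.coord]
  exact lintegral_const_mul _ ((hG.comp h.mp.measurable).comp measurable_prodMk_left).enorm

theorem IsChart.quasiMeasurePreserving_coord (h : IsChart e σ) :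
    Measure.QuasiMeasurePreserving σ volume volume := by
  refine ⟨h.meas, fun s hs => ?_⟩
  obtain ⟨t, hst, ht, ht0⟩ := exists_measurable_superset_of_null hs
  refine le_antisymm ((measure_mono hst).trans ?_) zero_le
  rw [Measure.map_apply h.meas ht, ← h.mp.measure_preimage (h.meas ht).nullMeasurableSet]
  have : e ⁻¹' (σ ⁻¹' t) = t ×ˢ Set.univ := by
    ext ⟨s, y⟩
    simp [h.coord]
  rw [this, Measure.volume_eq_prod, Measure.prod_prod, ht0, zero_mul]

/-- `∫ e^{-2|y|²} dy` over the plane. -/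
def gaussMass : ℝ≥0∞ := ∫⁻ y : ℝ × ℝ, ENNReal.ofReal (Real.exp (-(y.1 ^ 2 + y.2 ^ 2))) ^ 2

theorem gaussMass_lt_top : gaussMass < ∞ := by
  have h1 : Integrable (fun y : ℝ × ℝ => Real.exp (-2 * y.1 ^ 2) * Real.exp (-2 * y.2 ^ 2)) :=
    (integrable_exp_neg_mul_sq (by norm_num : (0 : ℝ) < 2)).mul_prod
      (integrable_exp_neg_mul_sq (by norm_num : (0 : ℝ) < 2))
  have h2 := h1.lintegral_lt_top
  unfold gaussMass
  convert h2 using 4 with y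
  rw [← ENNReal.ofReal_pow (Real.exp_pos _).le, ← Real.exp_nat_mul, ← Real.exp_add]
  congr 2
  push_cast; ring

/-- Cauchy–Schwarz on a slice: the Gaussian weight embeds `L²` into `L²_s L¹_y`. -/
theorem IsChart.sliceL1_gauss_sq_le (h : IsChart e σ) {F : SpaceTime → ℂ} (hF : Measurable F)
    (s : ℝ) : sliceL1 e (fun p => gauss p * F p) s ^ 2
      ≤ gaussMass * ∫⁻ y, ‖F (e (s, y))‖ₑ ^ 2 := by
  have hF' : Measurable fun y : ℝ × ℝ => F (e (s, y)) :=
    (hF.comp h.mp.measurable).comp measurable_prodMk_left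
  have h1 : sliceL1 e (fun p => gauss p * F p) s
      ≤ ∫⁻ y : ℝ × ℝ, ENNReal.ofReal (Real.exp (-(y.1 ^ 2 + y.2 ^ 2))) * ‖F (e (s, y))‖ₑ := by
    refine lintegral_mono fun y => ?_
    rw [enorm_mul]
    gcongr
    rw [← ofReal_norm, Complex.norm_real, Real.norm_of_nonneg (gauss_pos _).le, h.gauss_apply]
    refine ENNReal.ofReal_le_ofReal ?_
    refine mul_le_of_le_one_left (Real.exp_pos _).le (Real.exp_le_one_iff.2 ?_)
    nlinarith [sq_nonneg s]
  have h2 := ENNReal.lintegral_mul_le_Lp_mul_Lq (volume : Measure (ℝ × ℝ))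
    (Real.HolderConjugate.two_two) (f := fun y =>
      ENNReal.ofReal (Real.exp (-(y.1 ^ 2 + y.2 ^ 2)))) (g := fun y => ‖F (e (s, y))‖ₑ)
    (by fun_prop) hF'.enorm.aemeasurable
  have h3 := h1.trans h2
  simp only [ENNReal.rpow_two] at h3
  calc _ ≤ (_ * _) ^ 2 := pow_le_pow_left' h3 2
    _ = _ := by
      rw [mul_pow, ← ENNReal.rpow_two, ← ENNReal.rpow_mul, ← ENNReal.rpow_two, ← ENNReal.rpow_mul,
        show (1 / 2 : ℝ) * 2 = 1 by norm_num, ENNReal.rpow_one, ENNReal.rpow_one]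
      rfl

theorem IsChart.lintegral_sliceL1_lt_top (h : IsChart e σ) {F : SpaceTime → ℂ} (hF : Measurable F)
    (hF2 : ∫⁻ p, ‖F p‖ₑ ^ 2 < ∞) :
    ∫⁻ s, sliceL1 e (fun p => gauss p * F p) s ^ 2 < ∞ := by
  refine (lintegral_mono fun s => h.sliceL1_gauss_sq_le hF s).trans_lt ?_
  rw [lintegral_const_mul' _ _ gaussMass_lt_top.ne, ← h.lintegral_eq (hF.enorm.pow_const 2)]
  exact ENNReal.mul_lt_top gaussMass_lt_top hF2

theorem IsChart.lintegral_gauss_coord_le (h : IsChart e σ) {k : ℝ → ℝ≥0∞} (hk : Measurable k) :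
    ∫⁻ p, (ENNReal.ofReal (gauss p) * k (σ p)) ^ 2 ≤ gaussMass * ∫⁻ s, k s ^ 2 := by
  rw [h.lintegral_eq (by
    have := continuous_gauss.measurable
    have := h.meas
    fun_prop), ← lintegral_const_mul' _ _ gaussMass_lt_top.ne]
  refine lintegral_mono fun s => ?_
  simp only [h.coord, mul_pow]
  rw [lintegral_mul_const]
  · gcongr
    refine lintegral_mono fun y => ?_
    rw [h.gauss_apply]
    gcongr
    refine mul_le_of_le_one_left (Real.exp_pos _).le (Real.exp_le_one_iff.2 ?_)
    nlinarith [sq_nonneg s]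
  · have := continuous_gauss.measurable
    have := h.mp.measurable
    fun_prop

/-! ### Duality for sums of mixed norms -/

theorem lintegral_enorm_sq_eq {α E : Type*} [MeasurableSpace α] [NormedAddCommGroup E]
    {μ : Measure α} (f : Lp E 2 μ) : ∫⁻ x, ‖f x‖ₑ ^ 2 ∂μ = ENNReal.ofReal (‖f‖ ^ 2) := by
  have h2 := eLpNorm_eq_lintegral_rpow_enorm_toReal (μ := μ) (f := f) (p := 2) (by norm_num)
    (by norm_num)
  have h3 : (eLpNorm f 2 μ) ^ 2 = ∫⁻ x, ‖f x‖ₑ ^ 2 ∂μ := by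
    rw [h2, ← ENNReal.rpow_two, ← ENNReal.rpow_mul]
    norm_num
  rw [← h3, ENNReal.ofReal_pow (norm_nonneg _), Lp.norm_def f,
    ENNReal.ofReal_toReal (Lp.eLpNorm_ne_top f)]

/-- Pairs `(ψ, h) ∈ L²(ℝ × ℝ²) × L²(ℝ)` with `|ψ| ≤ g · h(σ)`, for the Gaussian weight `g`. The
function `h` bounds the `L^∞` norms of `ψ / g` on the slices `σ = const`. -/
def dominatedPairs (σ : SpaceTime → ℝ) :
    Set (WithLp 2 (Lp ℂ 2 (volume : Measure SpaceTime) × Lp ℝ 2 (volume : Measure ℝ))) :=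
  {x | ∀ᵐ p, ‖x.fst p‖ ≤ gauss p * x.snd (σ p)}

theorem IsChart.convex_dominatedPairs (h : IsChart e σ) : Convex ℝ (dominatedPairs σ) := by
  intro x hx y hy a b ha hb _
  have e1 : ∀ᵐ p, (a • x + b • y).fst p = a • x.fst p + b • y.fst p := by
    rw [WithLp.add_fst, WithLp.smul_fst, WithLp.smul_fst]
    filter_upwards [Lp.coeFn_add (a • x.fst) (b • y.fst), Lp.coeFn_smul a x.fst,
      Lp.coeFn_smul b y.fst] with p h1 h2 h3
    rw [h1, Pi.add_apply, h2, h3]; rfl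
  have e2 : ∀ᵐ s, (a • x + b • y).snd s = a * x.snd s + b * y.snd s := by
    rw [WithLp.add_snd, WithLp.smul_snd, WithLp.smul_snd]
    filter_upwards [Lp.coeFn_add (a • x.snd) (b • y.snd), Lp.coeFn_smul a x.snd,
      Lp.coeFn_smul b y.snd] with p h1 h2 h3
    rw [h1, Pi.add_apply, h2, h3]; rfl
  show ∀ᵐ p, _
  filter_upwards [e1, h.quasiMeasurePreserving_coord.ae e2, hx, hy] with p h1 h2 h3 h4
  rw [h1, h2]
  calc _ ≤ ‖a • x.fst p‖ + ‖b • y.fst p‖ := norm_add_le _ _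
    _ = a * ‖x.fst p‖ + b * ‖y.fst p‖ := by
      rw [norm_smul, norm_smul, Real.norm_of_nonneg ha, Real.norm_of_nonneg hb]
    _ ≤ a * (gauss p * x.snd (σ p)) + b * (gauss p * y.snd (σ p)) := by gcongr
    _ = _ := by ring

/-- Convergence in `L²` gives convergence almost everywhere along a subsequence, under which the
domination is preserved. -/
theorem IsChart.isClosed_dominatedPairs (h : IsChart e σ) : IsClosed (dominatedPairs σ) := by
  refine IsSeqClosed.isClosed fun x y hx hxy => ?_
  have h1 : Tendsto (fun n => (x n).fst) atTop (𝓝 y.fst) :=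
    ((WithLp.fstL 2 ℝ _ _).continuous.tendsto y).comp hxy
  have h2 : Tendsto (fun n => (x n).snd) atTop (𝓝 y.snd) :=
    ((WithLp.sndL 2 ℝ _ _).continuous.tendsto y).comp hxy
  obtain ⟨ns, hns, h3⟩ := (tendstoInMeasure_of_tendsto_Lp h1).exists_seq_tendsto_ae
  obtain ⟨ms, hms, h4⟩ := (tendstoInMeasure_of_tendsto_Lp
    (h2.comp hns.tendsto_atTop)).exists_seq_tendsto_ae
  have h5 : ∀ᵐ p, ∀ n, ‖(x n).fst p‖ ≤ gauss p * (x n).snd (σ p) := ae_all_iff.2 hx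
  show ∀ᵐ p, _
  filter_upwards [h3, h.quasiMeasurePreserving_coord.ae h4, h5] with p h6 h7 h8
  refine le_of_tendsto_of_tendsto' (h6.norm.comp hms.tendsto_atTop) (h7.const_mul (gauss p))
    fun n => ?_
  exact h8 (ns (ms n))

theorem IsChart.norm_sq_fst_le (h : IsChart e σ)
    {x : WithLp 2 (Lp ℂ 2 (volume : Measure SpaceTime) × Lp ℝ 2 (volume : Measure ℝ))}
    (hx : x ∈ dominatedPairs σ) : ‖x.fst‖ ^ 2 ≤ gaussMass.toReal * ‖x.snd‖ ^ 2 := by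
  have h1 : ∫⁻ p, ‖x.fst p‖ₑ ^ 2 ≤ gaussMass * ∫⁻ s, ‖x.snd s‖ₑ ^ 2 := by
    refine le_trans (lintegral_mono_ae ?_) (h.lintegral_gauss_coord_le
      (Lp.stronglyMeasurable x.snd).measurable.enorm)
    have hx' : ∀ᵐ p, ‖x.fst p‖ ≤ gauss p * x.snd (σ p) := hx
    filter_upwards [hx'] with p hp
    gcongr
    rw [← ofReal_norm, ← ofReal_norm, ← ENNReal.ofReal_mul (gauss_pos p).le]
    refine ENNReal.ofReal_le_ofReal (hp.trans ?_)
    have := gauss_pos p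
    gcongr
    exact Real.le_norm_self _
  rw [lintegral_enorm_sq_eq, lintegral_enorm_sq_eq] at h1
  have h2 := ENNReal.toReal_mono (ENNReal.mul_lt_top gaussMass_lt_top ENNReal.ofReal_lt_top).ne h1
  rwa [ENNReal.toReal_mul, ENNReal.toReal_ofReal (by positivity),
    ENNReal.toReal_ofReal (by positivity)] at h2

/-- The mixed norm of `ψ / g` for a dominated pair `(ψ, h)` is at most `‖h‖`. -/
theorem IsChart.mixedNorm_le (h : IsChart e σ)
    {x : WithLp 2 (Lp ℂ 2 (volume : Measure SpaceTime) × Lp ℝ 2 (volume : Measure ℝ))}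
    (hx : x ∈ dominatedPairs σ) :
    mixedNorm e (fun p => (gauss p : ℂ)⁻¹ * x.fst p) ≤ ENNReal.ofReal ‖x.snd‖ := by
  have h1 : ∀ᵐ q : ℝ × (ℝ × ℝ), ‖x.fst (e q)‖ ≤ gauss (e q) * x.snd (σ (e q)) :=
    h.mp.quasiMeasurePreserving.ae hx
  have h2 : ∀ᵐ s : ℝ, ∀ᵐ y : ℝ × ℝ, ‖x.fst (e (s, y))‖ ≤ gauss (e (s, y)) * x.snd s := by
    have := Measure.ae_ae_of_ae_prod h1
    simpa only [h.coord] using this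
  have h3 : ∫⁻ s : ℝ, eLpNorm (fun y : ℝ × ℝ => (gauss (e (s, y)) : ℂ)⁻¹ * x.fst (e (s, y))) ∞
      volume ^ 2 ≤ ∫⁻ s, ‖x.snd s‖ₑ ^ 2 := by
    refine lintegral_mono_ae ?_
    filter_upwards [h2] with s hs
    gcongr
    refine eLpNormEssSup_le_of_ae_enorm_bound ?_
    filter_upwards [hs] with y hy
    have hg := gauss_pos (e (s, y))
    rw [← ofReal_norm, ← ofReal_norm, norm_mul, norm_inv, Complex.norm_real,
      Real.norm_of_nonneg hg.le]
    refine ENNReal.ofReal_le_ofReal ?_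
    rw [inv_mul_le_iff₀ hg]
    refine hy.trans ?_
    gcongr
    exact Real.le_norm_self _
  rw [lintegral_enorm_sq_eq] at h3
  unfold mixedNorm
  calc _ ≤ (ENNReal.ofReal (‖x.snd‖ ^ 2)) ^ (1 / 2 : ℝ) := by
        gcongr
    _ = _ := by
      rw [ENNReal.ofReal_rpow_of_nonneg (by positivity) (by norm_num), ← Real.sqrt_eq_rpow,
        Real.sqrt_sq (norm_nonneg _)]

/-- Every `L¹`-slice norm is attained by testing against a dominated pair. -/
theorem IsChart.exists_dominatedPair (h : IsChart e σ) (F : Lp ℂ 2 (volume : Measure SpaceTime))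
    {C : ℝ} (hC : 0 ≤ C) : ∃ x ∈ dominatedPairs σ, ‖x.snd‖ ≤ C ∧ 0 ≤ inner ℝ F x.fst ∧
      ENNReal.ofReal (C ^ 2) * ∫⁻ s, sliceL1 e (fun p => gauss p * F p) s ^ 2
        ≤ ENNReal.ofReal (inner ℝ F x.fst ^ 2) := by
  have hFm : Measurable (F : SpaceTime → ℂ) := (Lp.stronglyMeasurable F).measurable
  set m := sliceL1 e (fun p => gauss p * F p) with hm
  have hgF : Measurable fun p => (gauss p : ℂ) * F p :=
    (Complex.continuous_ofReal.comp continuous_gauss).measurable.mul hFm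
  have hmm : Measurable m := measurable_sliceL1 h hgF
  have hI : ∫⁻ s, m s ^ 2 < ∞ := h.lintegral_sliceL1_lt_top hFm (by
    rw [lintegral_enorm_sq_eq]; exact ENNReal.ofReal_lt_top)
  by_cases h0 : ∫⁻ s, m s ^ 2 = 0
  · refine ⟨0, ?_, by simpa using hC, by simp, by rw [h0]; simp⟩
    show ∀ᵐ p, _
    filter_upwards [Lp.coeFn_zero ℂ 2 (volume : Measure SpaceTime),
      h.quasiMeasurePreserving_coord.ae (Lp.coeFn_zero ℝ 2 (volume : Measure ℝ))] with p h1 h2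
    rw [WithLp.zero_fst, WithLp.zero_snd, h1, h2]; simp
  set n := Real.sqrt (∫⁻ s, m s ^ 2).toReal with hn
  have hnpos : 0 < n := Real.sqrt_pos.2 (ENNReal.toReal_pos h0 hI.ne)
  have hn2 : ENNReal.ofReal (n ^ 2) = ∫⁻ s, m s ^ 2 := by
    rw [hn, Real.sq_sqrt ENNReal.toReal_nonneg, ENNReal.ofReal_toReal hI.ne]
  -- `m` is finite almost everywhere
  have hfin : ∀ᵐ s, m s < ∞ := by
    filter_upwards [ae_lt_top (hmm.pow_const 2) hI.ne] with s hs
    exact lt_of_not_ge fun hh => by simp [top_le_iff.1 hh] at hs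
  -- the extremal profile for Cauchy–Schwarz against `m`, of norm `C`
  set k : ℝ → ℝ := fun s => C / n * (m s).toReal with hk
  have hkm : Measurable k := hmm.ennreal_toReal.const_mul _
  have hk0 : ∀ s, 0 ≤ k s := fun s => by positivity
  have hke : ∀ᵐ s, ‖k s‖ₑ = ENNReal.ofReal (C / n) * m s := by
    filter_upwards [hfin] with s hs
    rw [← ofReal_norm, Real.norm_of_nonneg (hk0 s), hk, ENNReal.ofReal_mul (by positivity),
      ENNReal.ofReal_toReal hs.ne]
  have hk2 : ∫⁻ s, ‖k s‖ₑ ^ 2 = ENNReal.ofReal (C ^ 2) := by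
    have : ∫⁻ s, ‖k s‖ₑ ^ 2 = ∫⁻ s, ENNReal.ofReal (C / n) ^ 2 * m s ^ 2 := by
      refine lintegral_congr_ae ?_
      filter_upwards [hke] with s hs
      rw [hs, mul_pow]
    rw [this, lintegral_const_mul _ (hmm.pow_const 2), ← hn2, ← ENNReal.ofReal_pow (by positivity),
      ← ENNReal.ofReal_mul (by positivity)]
    congr 1
    field_simp
  have hkL : MemLp k 2 volume := by
    refine ⟨hkm.aestronglyMeasurable, ?_⟩
    rw [eLpNorm_lt_top_iff_lintegral_rpow_enorm_lt_top (by norm_num) (by norm_num)]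
    simp only [ENNReal.toReal_ofNat, ENNReal.rpow_two]
    rw [hk2]; exact ENNReal.ofReal_lt_top
  -- the phase of `F` makes `⟪F, ψ⟫` the integral of `g · k(σ) · |F|`; where `F` vanishes, division
  -- by zero gives `ψ = 0`
  set ψ : SpaceTime → ℂ := fun p => gauss p * k (σ p) * (F p / ‖F p‖) with hψ
  have hψm : Measurable ψ := by
    have := continuous_gauss.measurable
    have := h.meas
    fun_prop
  have hψn : ∀ p, ‖ψ p‖ ≤ gauss p * k (σ p) := by
    intro p
    simp only [hψ]
    rw [norm_mul, norm_mul, norm_div, Complex.norm_real, Complex.norm_real, Complex.norm_real,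
      norm_norm, Real.norm_of_nonneg (gauss_pos p).le, Real.norm_of_nonneg (hk0 _)]
    exact mul_le_of_le_one_right (mul_nonneg (gauss_pos p).le (hk0 _)) (div_self_le_one _)
  have hψL : MemLp ψ 2 volume := by
    refine ⟨hψm.aestronglyMeasurable, ?_⟩
    rw [eLpNorm_lt_top_iff_lintegral_rpow_enorm_lt_top (by norm_num) (by norm_num)]
    simp only [ENNReal.toReal_ofNat, ENNReal.rpow_two]
    refine (lintegral_mono fun p => ?_).trans_lt ((h.lintegral_gauss_coord_le hkm.enorm).trans_lt
      (by rw [hk2]; exact ENNReal.mul_lt_top gaussMass_lt_top ENNReal.ofReal_lt_top))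
    dsimp only
    gcongr
    rw [← ofReal_norm, ← ofReal_norm, ← ENNReal.ofReal_mul (gauss_pos p).le,
      Real.norm_of_nonneg (hk0 _)]
    exact ENNReal.ofReal_le_ofReal (hψn p)
  have hinner : inner ℝ F (hψL.toLp ψ) = C * n := by
    rw [L2.inner_def]
    have h1 : ∀ᵐ p, inner ℝ (F p) (hψL.toLp ψ p) = gauss p * k (σ p) * ‖F p‖ := by
      filter_upwards [hψL.coeFn_toLp] with p hp
      rw [hp]
      simp only [hψ]
      rw [show (gauss p : ℂ) * k (σ p) * (F p / ‖F p‖)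
          = (gauss p * k (σ p) * ‖F p‖⁻¹ : ℝ) • F p by
        rw [Complex.real_smul]; push_cast; ring, inner_smul_right, real_inner_self_eq_norm_sq]
      by_cases hF0 : ‖F p‖ = 0
      · simp [hF0]
      · field_simp
    rw [integral_congr_ae h1, integral_eq_lintegral_of_nonneg_ae]
    · have h2 : ∀ p, ENNReal.ofReal (gauss p * k (σ p) * ‖F p‖)
          = ‖k (σ p)‖ₑ * ‖(gauss p : ℂ) * F p‖ₑ := by
        intro p
        rw [← ofReal_norm, ← ofReal_norm, norm_mul (gauss p : ℂ), Complex.norm_real,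
          Real.norm_of_nonneg (gauss_pos p).le, Real.norm_of_nonneg (hk0 _),
          ← ENNReal.ofReal_mul (hk0 _)]
        congr 1; ring
      simp only [h2]
      rw [h.lintegral_coord_mul (k := fun s => ‖k s‖ₑ) hkm.enorm hgF]
      have h3 : ∫⁻ s, ‖k s‖ₑ * m s = ∫⁻ s, ENNReal.ofReal (C / n) * m s ^ 2 := by
        refine lintegral_congr_ae ?_
        filter_upwards [hke] with s hs
        rw [hs]; ring
      rw [← hm, h3, lintegral_const_mul _ (hmm.pow_const 2), ← hn2,
        ← ENNReal.ofReal_mul (by positivity), ENNReal.toReal_ofReal (by positivity)]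
      field_simp
    · refine Eventually.of_forall fun p => ?_
      have := (gauss_pos p).le
      have := hk0 (σ p)
      simp only [Pi.zero_apply]
      positivity
    · have := continuous_gauss.measurable
      have := h.meas
      exact Measurable.aestronglyMeasurable (by fun_prop)
  refine ⟨WithLp.toLp 2 (hψL.toLp ψ, hkL.toLp k), ?_, ?_, ?_, ?_⟩
  · show ∀ᵐ p, _
    filter_upwards [hψL.coeFn_toLp, h.quasiMeasurePreserving_coord.ae hkL.coeFn_toLp] with p h1 h2
    rw [WithLp.toLp_fst, WithLp.toLp_snd, h1, h2]
    exact hψn p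
  · rw [WithLp.toLp_snd]
    have h1 := lintegral_enorm_sq_eq (hkL.toLp k)
    have h2 : ∫⁻ s, ‖hkL.toLp k s‖ₑ ^ 2 = ∫⁻ s, ‖k s‖ₑ ^ 2 := by
      refine lintegral_congr_ae ?_
      filter_upwards [hkL.coeFn_toLp] with s hs
      rw [hs]
    rw [h2, hk2, ENNReal.ofReal_eq_ofReal_iff (by positivity) (by positivity)] at h1
    exact (pow_le_pow_iff_left₀ (norm_nonneg _) hC two_ne_zero).1 h1.ge
  · rw [WithLp.toLp_fst, hinner]; positivity
  · rw [WithLp.toLp_fst, hinner, ← hn2, ← ENNReal.ofReal_mul (by positivity), mul_pow]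

/-- Duality between a sum of mixed-norm spaces `L²_s L^∞_y` and the intersection of the spaces
`L²_s L¹_y`: a bound for the pairings of `v` by the largest dual norm produces a decomposition. -/
theorem exists_decomposition {ι : Type*} (S : Finset ι) (e : ι → ℝ × (ℝ × ℝ) → SpaceTime)
    (σ : ι → SpaceTime → ℝ) (hch : ∀ Θ ∈ S, IsChart (e Θ) (σ Θ))
    (v : Lp ℂ 2 (volume : Measure SpaceTime)) {C : ℝ} (hC : 0 ≤ C)
    (hdual : ∀ (F : Lp ℂ 2 (volume : Measure SpaceTime)) (c : ℝ), 0 ≤ c →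
      (∀ Θ ∈ S, ENNReal.ofReal (C ^ 2) * ∫⁻ s, sliceL1 (e Θ) (fun p => gauss p * F p) s ^ 2
        ≤ ENNReal.ofReal (c ^ 2)) → inner ℝ F v ≤ c) :
    ∃ φ : ι → SpaceTime → ℂ, (∀ Θ ∈ S, Measurable (φ Θ)) ∧
      (∀ᵐ p, v p = gauss p * ∑ Θ ∈ S, φ Θ p) ∧
      ∑ Θ ∈ S, mixedNorm (e Θ) (φ Θ) ≤ ENNReal.ofReal C := by
  classical
  set P := WithLp 2 (Lp ℂ 2 (volume : Measure SpaceTime) × Lp ℝ 2 (volume : Measure ℝ)) with hP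
  -- a family of dominated pairs, one for each frame, of total norm at most `C`
  let X := PiLp 2 (fun _ : S => P)
  let 𝒦 : Set X := (⋂ Θ : S, (PiLp.proj (𝕜 := ℝ) 2 (fun _ : S => P) Θ) ⁻¹' dominatedPairs (σ Θ)) ∩
    {x | ∑ Θ : S, ‖(x Θ).snd‖ ≤ C}
  let L : X →L[ℝ] Lp ℂ 2 (volume : Measure SpaceTime) :=
    ∑ Θ : S, (WithLp.fstL 2 ℝ _ _).comp (PiLp.proj (𝕜 := ℝ) 2 (fun _ : S => P) Θ)
  have hL : ∀ x : X, L x = ∑ Θ : S, (x Θ).fst := fun x => by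
    simp only [L, sum_apply]; rfl
  have hmem : ∀ x : X, x ∈ 𝒦 ↔
      (∀ Θ : S, x Θ ∈ dominatedPairs (σ Θ)) ∧ ∑ Θ : S, ‖(x Θ).snd‖ ≤ C := fun x => by
    simp only [𝒦, Set.mem_inter_iff, Set.mem_iInter, Set.mem_preimage, Set.mem_ofPred_eq]; rfl
  have hcont : ∀ Θ : S, Continuous fun x : X => (x Θ).snd := fun Θ =>
    ((WithLp.sndL 2 ℝ _ _).comp (PiLp.proj (𝕜 := ℝ) 2 (fun _ : S => P) Θ)).continuous
  have hcl : IsClosed 𝒦 := by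
    refine IsClosed.inter (isClosed_iInter fun Θ =>
      ((hch Θ Θ.2).isClosed_dominatedPairs).preimage (ContinuousLinearMap.continuous _)) ?_
    exact isClosed_le (continuous_finsetSum _ fun Θ _ => (hcont Θ).norm) continuous_const
  have hconv : Convex ℝ 𝒦 := by
    refine Convex.inter (convex_iInter fun Θ =>
      (hch Θ Θ.2).convex_dominatedPairs.linear_preimage
        (PiLp.proj (𝕜 := ℝ) 2 (fun _ : S => P) Θ : X →ₗ[ℝ] P)) ?_
    intro x hx y hy a b ha hb hab
    have hx' : ∑ Θ : S, ‖(x Θ).snd‖ ≤ C := hx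
    have hy' : ∑ Θ : S, ‖(y Θ).snd‖ ≤ C := hy
    show ∑ Θ : S, ‖((a • x + b • y) Θ).snd‖ ≤ C
    calc _ ≤ ∑ Θ : S, (a * ‖(x Θ).snd‖ + b * ‖(y Θ).snd‖) := by
          refine Finset.sum_le_sum fun Θ _ => ?_
          rw [PiLp.add_apply, PiLp.smul_apply, PiLp.smul_apply, WithLp.add_snd, WithLp.smul_snd,
            WithLp.smul_snd]
          refine (norm_add_le _ _).trans ?_
          rw [norm_smul, norm_smul, Real.norm_of_nonneg ha, Real.norm_of_nonneg hb]
      _ = a * ∑ Θ : S, ‖(x Θ).snd‖ + b * ∑ Θ : S, ‖(y Θ).snd‖ := by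
          rw [Finset.sum_add_distrib, Finset.mul_sum, Finset.mul_sum]
      _ ≤ a * C + b * C := by gcongr
      _ = C := by rw [← add_mul, hab, one_mul]
  have hbd : ∀ x ∈ 𝒦, ‖x‖ ≤ Real.sqrt (∑ Θ : S, (gaussMass.toReal * C ^ 2 + C ^ 2)) := by
    intro x hx
    rw [hmem] at hx
    refine Real.le_sqrt_of_sq_le ?_
    rw [PiLp.norm_sq_eq_of_L2]
    refine Finset.sum_le_sum fun Θ _ => ?_
    have h1 : ‖(x Θ).snd‖ ≤ C := le_trans
      (Finset.single_le_sum (f := fun Θ : S => ‖(x Θ).snd‖) (fun i _ => norm_nonneg _)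
        (Finset.mem_univ Θ)) hx.2
    have h2 := (hch Θ Θ.2).norm_sq_fst_le (hx.1 Θ)
    have h3 : ‖(x Θ).snd‖ ^ 2 ≤ C ^ 2 := by gcongr
    have h4 : (0 : ℝ) ≤ gaussMass.toReal := ENNReal.toReal_nonneg
    rw [WithLp.prod_norm_sq_eq_of_L2]
    nlinarith
  have himcl : IsClosed (L '' 𝒦) := isClosed_image_of_convex L 𝒦 hcl hconv _ hbd
  have himconv : Convex ℝ (L '' 𝒦) := hconv.linear_image L.toLinearMap
  have hzero : ∀ Θ ∈ S, (0 : P) ∈ dominatedPairs (σ Θ) := by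
    intro Θ hΘ
    show ∀ᵐ p, _
    filter_upwards [Lp.coeFn_zero ℂ 2 (volume : Measure SpaceTime),
      (hch Θ hΘ).quasiMeasurePreserving_coord.ae
        (Lp.coeFn_zero ℝ 2 (volume : Measure ℝ))] with p h1 h2
    rw [WithLp.zero_fst, WithLp.zero_snd, h1, h2]; simp
  -- otherwise some `F` separates `v` from the image, and families concentrated in one frame show
  -- that `F` satisfies the assumption of `hdual`
  have hvmem : v ∈ L '' 𝒦 := by
    by_contra hv
    obtain ⟨f, u, hfu, huv⟩ := geometric_hahn_banach_closed_point himconv himcl hv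
    obtain ⟨F, rfl⟩ := (InnerProductSpace.toDual ℝ (Lp ℂ 2 (volume : Measure SpaceTime))).surjective f
    simp only [InnerProductSpace.toDual_apply_apply] at hfu huv
    have hu0 : 0 ≤ u := by
      have h0 : (0 : X) ∈ 𝒦 := (hmem 0).2 ⟨fun Θ => hzero Θ Θ.2, by simpa using hC⟩
      have := hfu _ ⟨0, h0, rfl⟩
      rw [map_zero, inner_zero_right] at this
      exact this.le
    refine absurd (hdual F u hu0 fun Θ hΘ => ?_) (not_le.2 huv)
    obtain ⟨x, hx, hxC, hx0, hxF⟩ := (hch Θ hΘ).exists_dominatedPair F hC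
    refine hxF.trans (ENNReal.ofReal_le_ofReal ?_)
    set z : X := WithLp.toLp 2 (Pi.single (⟨Θ, hΘ⟩ : S) x) with hz
    have hzi : ∀ i : S, z i = if i = ⟨Θ, hΘ⟩ then x else 0 := fun i => by
      rw [hz]; simp [Pi.single_apply]
    have hz𝒦 : z ∈ 𝒦 := by
      rw [hmem]
      refine ⟨fun i => ?_, ?_⟩
      · rw [hzi]
        split_ifs with hi
        · rw [hi]; exact hx
        · exact hzero i i.2
      · rw [Finset.sum_eq_single (⟨Θ, hΘ⟩ : S)]
        · rw [hzi, if_pos rfl]; exact hxC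
        · intro i _ hi
          rw [hzi, if_neg hi]; simp
        · simp
    have hLz : L z = x.fst := by
      rw [hL, Finset.sum_eq_single (⟨Θ, hΘ⟩ : S)]
      · rw [hzi, if_pos rfl]
      · intro i _ hi
        rw [hzi, if_neg hi]; rfl
      · simp
    have := hfu _ ⟨z, hz𝒦, rfl⟩
    have h2 : inner ℝ F x.fst < u := by rw [← hLz]; exact this
    gcongr
  obtain ⟨x, hx, rfl⟩ := hvmem
  rw [hmem] at hx
  refine ⟨fun Θ p => if hΘ : Θ ∈ S then (gauss p : ℂ)⁻¹ * (x ⟨Θ, hΘ⟩).fst p else 0, ?_, ?_, ?_⟩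
  · intro Θ hΘ
    simp only [dif_pos hΘ]
    exact (Complex.continuous_ofReal.comp continuous_gauss).measurable.inv.mul
      (Lp.stronglyMeasurable _).measurable
  · have h1 : ∀ᵐ p, (L x) p = ∑ Θ : S, (x Θ).fst p := by
      rw [hL]
      filter_upwards [Lp.coeFn_finsetSum Finset.univ fun Θ : S => (x Θ).fst] with p hp
      rw [hp]; simp
    filter_upwards [h1] with p hp
    rw [hp, ← Finset.sum_coe_sort S, Finset.mul_sum]
    refine Finset.sum_congr rfl fun Θ _ => ?_
    have : (gauss p : ℂ) ≠ 0 := by exact_mod_cast (gauss_pos p).ne'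
    rw [dif_pos Θ.2]
    exact (mul_inv_cancel_left₀ this _).symm
  · rw [← Finset.sum_coe_sort S]
    calc _ ≤ ∑ Θ : S, ENNReal.ofReal ‖(x Θ).snd‖ := by
          refine Finset.sum_le_sum fun Θ _ => ?_
          have h1 := (hch Θ Θ.2).mixedNorm_le (hx.1 Θ)
          have h2 : (fun p => if hΘ : (Θ : ι) ∈ S then (gauss p : ℂ)⁻¹ * (x ⟨Θ, hΘ⟩).fst p else 0)
              = fun p => (gauss p : ℂ)⁻¹ * (x Θ).fst p := by
            funext p
            rw [dif_pos Θ.2]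
          exact (congrArg (mixedNorm (e Θ)) h2).trans_le h1
      _ = ENNReal.ofReal (∑ Θ : S, ‖(x Θ).snd‖) :=
          (ENNReal.ofReal_sum_of_nonneg fun _ _ => norm_nonneg _).symm
      _ ≤ _ := ENNReal.ofReal_le_ofReal hx.2

end

/-! ### Waves as oscillatory integrals -/

/-- On `L¹ ∩ L²` the inverse Fourier transform of `L²` is given by the inversion integral. -/
theorem fourierInv_ae_eq_of_integrable (g : L2) (hg : Integrable (g : Plane → ℂ)) :
    ((𝓕⁻ g : L2) : Plane → ℂ) =ᵐ[volume] 𝓕⁻ (g : Plane → ℂ) := by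
  have hcont : Continuous (𝓕⁻ (g : Plane → ℂ)) :=
    VectorFourier.fourierIntegral_continuous Real.continuous_fourierChar
      (L := -innerₗ Plane) (by
        have : Continuous fun p : Plane × Plane => -(inner ℝ p.1 p.2 : ℝ) := by fun_prop
        exact this) hg
  refine ae_eq_of_integral_contDiff_smul_eq ((Lp.memLp _).locallyIntegrable (by norm_num))
    hcont.locallyIntegrable fun φ hφ hφc => ?_
  have hφ' : ContDiff ℝ (⊤ : ℕ∞) (fun x => (φ x : ℂ)) := Complex.ofRealCLM.contDiff.comp hφ
  have hφc' : HasCompactSupport (fun x => (φ x : ℂ)) := hφc.comp_left (g := Complex.ofReal) rfl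
  set s : SchwartzMap Plane ℂ := hφc'.toSchwartzMap hφ' with hs
  have hsx : ∀ x, s x = φ x := fun x => rfl
  have h1 := congrArg (fun D => D s) (Lp.fourierInv_toTemperedDistribution_eq g)
  simp only [TemperedDistribution.fourierInv_apply, Lp.toTemperedDistribution_apply] at h1
  have h2 : ∫ x, φ x • (𝓕⁻ g : L2) x = ∫ x, s x • (𝓕⁻ g : L2) x := by
    refine integral_congr_ae (Eventually.of_forall fun x => ?_)
    simp only [hsx]; exact (Complex.real_smul).trans (smul_eq_mul ..).symm
  have h3 : ∫ x, φ x • 𝓕⁻ (g : Plane → ℂ) x = ∫ x, s x • 𝓕⁻ (g : Plane → ℂ) x := by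
    refine integral_congr_ae (Eventually.of_forall fun x => ?_)
    simp only [hsx]; exact (Complex.real_smul).trans (smul_eq_mul ..).symm
  rw [h2, h3, ← h1]
  have h4 := VectorFourier.integral_fourierIntegral_smul_eq_flip (μ := volume) (ν := volume)
    (L := -innerₗ Plane) (f := (s : Plane → ℂ)) (g := (g : Plane → ℂ)) Real.continuous_fourierChar
    (by
      have : Continuous fun p : Plane × Plane => -(inner ℝ p.1 p.2 : ℝ) := by fun_prop
      exact this) s.integrable hg
  have h5 : (-innerₗ Plane).flip = -innerₗ Plane := by
    ext x y; simp [real_inner_comm]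
  rw [h5] at h4
  have h6 : ∀ x, (𝓕⁻ s : SchwartzMap Plane ℂ) x = VectorFourier.fourierIntegral Real.fourierChar volume
      (-innerₗ Plane) (s : Plane → ℂ) x := by
    intro x
    rw [SchwartzMap.fourierInv_coe]; rfl
  simp only [h6]
  exact h4

/-- The plane wave `e^{i(2π x·ξ + t⟨2πξ⟩)}`. -/
def planeWave (ξ : Plane) (p : SpaceTime) : ℂ :=
  Complex.exp (((2 * Real.pi * inner ℝ ξ p.2 + p.1 * japanese ((2 * Real.pi) • ξ) : ℝ) : ℂ)
    * Complex.I)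

theorem norm_planeWave (ξ : Plane) (p : SpaceTime) : ‖planeWave ξ p‖ = 1 :=
  Complex.norm_exp_ofReal_mul_I _

theorem continuous_planeWave : Continuous fun q : Plane × SpaceTime => planeWave q.1 q.2 := by
  unfold planeWave japanese; fun_prop

theorem planeWave_mul_conj (ξ : Plane) (p q : SpaceTime) :
    planeWave ξ p * (starRingEnd ℂ) (planeWave ξ q) = planeWave ξ (p - q) := by
  unfold planeWave
  rw [← Complex.exp_conj, map_mul, Complex.conj_I, Complex.conj_ofReal, ← Complex.exp_add,
    Prod.snd_sub, Prod.fst_sub, inner_sub_right]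
  congr 1
  push_cast; ring

/-- The wave `e^{it⟨D⟩} f`, as a function on space-time. -/
def wave (f : L2) (p : SpaceTime) : ℂ := ∫ ξ, planeWave ξ p * (𝓕 f : L2) ξ

theorem norm_wave_le (f : L2) (p : SpaceTime) :
    ‖wave f p‖ ≤ ∫ ξ, ‖(𝓕 f : L2) ξ‖ := by
  refine (norm_integral_le_integral_norm _).trans (le_of_eq ?_)
  simp [norm_planeWave]

theorem continuous_wave (f : L2) (hf : Integrable ((𝓕 f : L2) : Plane → ℂ)) :
    Continuous (wave f) := by
  refine continuous_of_dominated (bound := fun ξ => ‖(𝓕 f : L2) ξ‖) (fun p => ?_)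
    (fun p => Eventually.of_forall fun ξ => ?_) hf.norm (Eventually.of_forall fun ξ => ?_)
  · exact (continuous_planeWave.comp (Continuous.prodMk_left p)).aestronglyMeasurable.mul hf.1
  · rw [norm_mul, norm_planeWave, one_mul]
  · exact (continuous_planeWave.comp (Continuous.prodMk_right ξ)).mul continuous_const

/-- For integrable `f̂` the propagator is given by the oscillatory integral, which makes sense
pointwise in space-time. -/
theorem propagator_ae_eq_wave (f : L2) (hf : Integrable ((𝓕 f : L2) : Plane → ℂ)) (t : ℝ) :
    ∀ᵐ x, propagator t f x = wave f (t, x) := by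
  have h1 := fourier_propagator t f
  have h2 : Integrable ((𝓕 (propagator t f) : L2) : Plane → ℂ) := by
    refine hf.mono (Lp.aestronglyMeasurable _) ?_
    filter_upwards [h1] with ξ hξ
    rw [hξ, norm_mul]
    refine mul_le_of_le_one_left (norm_nonneg _) (le_of_eq ?_)
    rw [show Complex.I * t * japanese ((2 * Real.pi) • ξ)
      = ((t * japanese ((2 * Real.pi) • ξ) : ℝ) : ℂ) * Complex.I by push_cast; ring]
    exact Complex.norm_exp_ofReal_mul_I _
  have h3 := fourierInv_ae_eq_of_integrable _ h2
  rw [FourierTransform.fourierInv_fourier_eq] at h3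
  filter_upwards [h3] with x hx
  rw [hx, Real.fourierInv_eq']
  refine integral_congr_ae ?_
  filter_upwards [h1] with ξ hξ
  rw [hξ, smul_eq_mul, ← mul_assoc, ← Complex.exp_add]
  unfold planeWave
  congr 2
  push_cast; ring

/-- The Fourier transform of `G` restricted to the characteristic surface. -/
def surfaceTransform (G : SpaceTime → ℂ) (ξ : Plane) : ℂ :=
  ∫ p, (starRingEnd ℂ) (planeWave ξ p) * G p

theorem integrable_planeWave_mul {G : SpaceTime → ℂ} (hG : Integrable G) (ξ : Plane) :
    Integrable fun p => (starRingEnd ℂ) (planeWave ξ p) * G p := by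
  refine hG.mono ?_ (Eventually.of_forall fun p => ?_)
  · exact (Complex.continuous_conj.comp (continuous_planeWave.comp
      (Continuous.prodMk_right ξ))).aestronglyMeasurable.mul hG.1
  · rw [norm_mul, RCLike.norm_conj, norm_planeWave, one_mul]

theorem continuous_surfaceTransform {G : SpaceTime → ℂ} (hG : Integrable G) :
    Continuous (surfaceTransform G) := by
  refine continuous_of_dominated (bound := fun p => ‖G p‖) (fun ξ => ?_)
    (fun ξ => Eventually.of_forall fun p => ?_) hG.norm (Eventually.of_forall fun p => ?_)
  · exact (integrable_planeWave_mul hG ξ).1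
  · rw [norm_mul, RCLike.norm_conj, norm_planeWave, one_mul]
  · exact (Complex.continuous_conj.comp (continuous_planeWave.comp
      (Continuous.prodMk_left p))).mul continuous_const

/-- The kernel of `T T^*` for the weight `b`, where `T f` is the wave with data `f`. -/
def waveKernel (b : Plane → ℝ) (p : SpaceTime) : ℂ :=
  ∫ ξ, (starRingEnd ℂ) (planeWave ξ p) * b ξ

/-- Fubini in the form used for oscillatory integrals: `k` is the oscillating factor. -/
theorem integral_integral_mul_swap {α β : Type*} [MeasurableSpace α] [MeasurableSpace β]
    {μ : Measure α} {ν : Measure β} [SFinite μ] [SFinite ν] (b : α → ℂ) (k : α → β → ℂ)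
    (H : β → ℂ) (h : Integrable (fun w : α × β => b w.1 * (k w.1 w.2 * H w.2)) (μ.prod ν)) :
    ∫ ξ, (∫ z, b ξ * (k ξ z * H z) ∂ν) ∂μ = ∫ z, (∫ ξ, k ξ z * b ξ ∂μ) * H z ∂ν := by
  rw [integral_integral_swap h]
  refine integral_congr_ae (Eventually.of_forall fun z => ?_)
  dsimp only
  rw [← integral_mul_const]
  refine integral_congr_ae (Eventually.of_forall fun ξ => ?_)
  dsimp only
  ring

/-- The square function of the dual operator, written as a quadratic form with the convolution
kernel `waveKernel b`. -/
theorem ofReal_integral_surfaceTransform_le {G : SpaceTime → ℂ} (hG : Integrable G)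
    {b : Plane → ℝ} (hb : Integrable b) :
    ENNReal.ofReal (∫ ξ, b ξ * ‖surfaceTransform G ξ‖ ^ 2)
      ≤ ∫⁻ p, ∫⁻ q, ‖G p‖ₑ * ‖G q‖ₑ * ‖waveKernel b (p - q)‖ₑ := by
  have hGc : Integrable fun q => (starRingEnd ℂ) (G q) := by
    refine hG.mono (Complex.continuous_conj.comp_aestronglyMeasurable hG.1)
      (Eventually.of_forall fun q => ?_)
    rw [RCLike.norm_conj]
  obtain ⟨H, hH, hHi⟩ : ∃ H : SpaceTime × SpaceTime → ℂ,
      (∀ z, H z = G z.1 * (starRingEnd ℂ) (G z.2)) ∧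
        Integrable H ((volume : Measure SpaceTime).prod (volume : Measure SpaceTime)) :=
    ⟨_, fun _ => rfl, hG.mul_prod hGc⟩
  set μ := (volume : Measure SpaceTime).prod (volume : Measure SpaceTime) with hμ
  have h1 : ∀ ξ, ((b ξ * ‖surfaceTransform G ξ‖ ^ 2 : ℝ) : ℂ)
      = ∫ z : SpaceTime × SpaceTime, ((b ξ : ℂ) * ((starRingEnd ℂ) (planeWave ξ (z.1 - z.2)) * H z))
        ∂μ := by
    intro ξ
    push_cast
    rw [integral_const_mul]
    congr 1
    rw [← Complex.mul_conj']
    unfold surfaceTransform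
    rw [← integral_conj, ← integral_prod_mul, ← hμ]
    refine integral_congr_ae (Eventually.of_forall fun z => ?_)
    simp only [hH]
    rw [← planeWave_mul_conj]
    simp only [map_mul, Complex.conj_conj]
    ring
  have h2 : Integrable (fun w : Plane × (SpaceTime × SpaceTime) =>
      (b w.1 : ℂ) * ((starRingEnd ℂ) (planeWave w.1 (w.2.1 - w.2.2)) * H w.2))
      ((volume : Measure Plane).prod μ) := by
    have hbc : Integrable fun ξ => (b ξ : ℂ) := hb.ofReal
    have hc : Continuous fun w : Plane × (SpaceTime × SpaceTime) => (w.1, w.2.1 - w.2.2) := by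
      fun_prop
    have hw : AEStronglyMeasurable (fun w : Plane × (SpaceTime × SpaceTime) =>
        (starRingEnd ℂ) (planeWave w.1 (w.2.1 - w.2.2)))
        ((volume : Measure Plane).prod μ) :=
      (Complex.continuous_conj.comp (continuous_planeWave.comp hc)).aestronglyMeasurable
    refine (hbc.mul_prod hHi).mono (hbc.1.comp_fst.mul (hw.mul hHi.1.comp_snd))
      (Eventually.of_forall fun w => ?_)
    rw [norm_mul (b w.1 : ℂ), norm_mul ((starRingEnd ℂ) _), RCLike.norm_conj, norm_planeWave,
      one_mul, ← norm_mul]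
  have h3 : ((∫ ξ, b ξ * ‖surfaceTransform G ξ‖ ^ 2 : ℝ) : ℂ)
      = ∫ z : SpaceTime × SpaceTime, waveKernel b (z.1 - z.2) * H z ∂μ := by
    have h4 : ∫ ξ, ((b ξ * ‖surfaceTransform G ξ‖ ^ 2 : ℝ) : ℂ) = ∫ ξ, ∫ z : SpaceTime × SpaceTime,
        ((b ξ : ℂ) * ((starRingEnd ℂ) (planeWave ξ (z.1 - z.2)) * H z)) ∂μ :=
      integral_congr_ae (Eventually.of_forall h1)
    have h5 := integral_integral_mul_swap (μ := volume) (ν := μ) (fun ξ => (b ξ : ℂ))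
      (fun ξ z => (starRingEnd ℂ) (planeWave ξ (z.1 - z.2))) H h2
    rw [← integral_complex_ofReal, h4, h5]
    rfl
  calc ENNReal.ofReal (∫ ξ, b ξ * ‖surfaceTransform G ξ‖ ^ 2)
      ≤ ‖((∫ ξ, b ξ * ‖surfaceTransform G ξ‖ ^ 2 : ℝ) : ℂ)‖ₑ := by
        rw [← ofReal_norm, Complex.norm_real]
        exact ENNReal.ofReal_le_ofReal (Real.le_norm_self _)
    _ ≤ ∫⁻ z : SpaceTime × SpaceTime, ‖waveKernel b (z.1 - z.2) * H z‖ₑ ∂μ := by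
        rw [h3]; exact enorm_integral_le_lintegral_enorm _
    _ = ∫⁻ z : SpaceTime × SpaceTime, ‖G z.1‖ₑ * ‖G z.2‖ₑ * ‖waveKernel b (z.1 - z.2)‖ₑ
          ∂μ := by
        refine lintegral_congr fun z => ?_
        simp only [hH]
        rw [enorm_mul, enorm_mul, ← ofReal_norm ((starRingEnd ℂ) (G z.2)), RCLike.norm_conj,
          ofReal_norm]
        ring
    _ ≤ _ := lintegral_prod_le _

/-- Schur's test in the direction of the coordinate `σ`. -/
theorem IsChart.lintegral_schur_le {e : ℝ × (ℝ × ℝ) → SpaceTime} {σ : SpaceTime → ℝ}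
    (h : IsChart e σ) {G : SpaceTime → ℂ} (hG : Measurable G) {M : ℝ → ℝ≥0∞} (hM : Measurable M) :
    ∫⁻ p, ∫⁻ q, ‖G p‖ₑ * ‖G q‖ₑ * M (σ (p - q)) ≤ (∫⁻ s, M s) * ∫⁻ s, sliceL1 e G s ^ 2 := by
  set m := sliceL1 e G with hm
  have hmm : Measurable m := measurable_sliceL1 h hG
  have h1 : ∀ p, ∫⁻ q, ‖G p‖ₑ * ‖G q‖ₑ * M (σ (p - q))
      = (∫⁻ s', M (σ p - s') * m s') * ‖G p‖ₑ := by
    intro p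
    rw [← h.lintegral_coord_mul (k := fun s' => M (σ p - s')) (by fun_prop) hG,
      ← lintegral_mul_const _ (by have := h.meas; fun_prop)]
    refine lintegral_congr fun q => ?_
    rw [h.map_sub]; ring
  simp only [h1]
  rw [h.lintegral_coord_mul (k := fun s => ∫⁻ s', M (s - s') * m s') (by
    refine Measurable.lintegral_prod_right' (f := fun z : ℝ × ℝ => M (z.1 - z.2) * m z.2) ?_
    fun_prop) hG]
  have h2 : ∀ a b : ℝ≥0∞, a * b ≤ (a ^ 2 + b ^ 2) / 2 := by
    intro a b
    rcases eq_or_ne a ∞ with rfl | ha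
    · simp [ENNReal.top_div]
    rcases eq_or_ne b ∞ with rfl | hb
    · simp [ENNReal.top_div]
    lift a to NNReal using ha
    lift b to NNReal using hb
    rw [ENNReal.le_div_iff_mul_le (by simp) (by simp)]
    norm_cast
    have := two_mul_le_add_sq (a : ℝ) b
    have h3 : ((a * b * 2 : NNReal) : ℝ) ≤ ((a ^ 2 + b ^ 2 : NNReal) : ℝ) := by
      push_cast; linarith
    exact_mod_cast h3
  calc ∫⁻ s, (∫⁻ s', M (s - s') * m s') * m s
      = ∫⁻ s, ∫⁻ s', M (s - s') * (m s' * m s) := by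
        refine lintegral_congr fun s => ?_
        rw [← lintegral_mul_const _ (by fun_prop)]
        refine lintegral_congr fun s' => by ring
    _ ≤ ∫⁻ s, ∫⁻ s', (M (s - s') * m s' ^ 2 * 2⁻¹ + M (s - s') * m s ^ 2 * 2⁻¹) := by
        refine lintegral_mono fun s => lintegral_mono fun s' => ?_
        calc M (s - s') * (m s' * m s) ≤ M (s - s') * ((m s' ^ 2 + m s ^ 2) / 2) := by
              gcongr; exact h2 _ _
          _ = _ := by rw [div_eq_mul_inv]; ring
    _ = (∫⁻ s, ∫⁻ s', M (s - s') * m s' ^ 2 * 2⁻¹)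
        + ∫⁻ s, ∫⁻ s', M (s - s') * m s ^ 2 * 2⁻¹ := by
        rw [← lintegral_add_left]
        · refine lintegral_congr fun s => ?_
          rw [lintegral_add_left (by fun_prop)]
        · refine Measurable.lintegral_prod_right'
            (f := fun z : ℝ × ℝ => M (z.1 - z.2) * m z.2 ^ 2 * 2⁻¹) ?_
          fun_prop
    _ = ((∫⁻ s, M s) * ∫⁻ s, m s ^ 2) * 2⁻¹ + ((∫⁻ s, M s) * ∫⁻ s, m s ^ 2) * 2⁻¹ := by
        congr 1
        · rw [lintegral_lintegral_swap (by fun_prop)]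
          have h3 : ∀ s', ∫⁻ s, M (s - s') * m s' ^ 2 * 2⁻¹ = (∫⁻ s, M s) * 2⁻¹ * m s' ^ 2 := by
            intro s'
            rw [lintegral_mul_const _ (by fun_prop), lintegral_mul_const _ (by fun_prop),
              lintegral_sub_right_eq_self M s']
            ring
          simp only [h3]
          rw [lintegral_const_mul _ (by fun_prop)]; ring
        · have h3 : ∀ s, ∫⁻ s', M (s - s') * m s ^ 2 * 2⁻¹ = (∫⁻ s, M s) * 2⁻¹ * m s ^ 2 := by
            intro s
            rw [lintegral_mul_const _ (by fun_prop), lintegral_mul_const _ (by fun_prop),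
              lintegral_sub_left_eq_self M s]
            ring
          simp only [h3]
          rw [lintegral_const_mul _ (by fun_prop)]; ring
    _ = _ := by rw [← mul_add, ENNReal.inv_two_add_inv_two, mul_one]

/-! ### Frames as charts -/

theorem norm_perp (ω : Plane) : ‖perp ω‖ = ‖ω‖ := by
  rw [← sq_eq_sq₀ (norm_nonneg _) (norm_nonneg _), EuclideanSpace.norm_sq_eq,
    EuclideanSpace.norm_sq_eq]
  simp [perp, Fin.sum_univ_two, add_comm]

theorem inner_perp_self (ω : Plane) : inner ℝ ω (perp ω) = 0 := by
  simp [perp, PiLp.inner_apply, Fin.sum_univ_two]; ring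

theorem inner_self_of_norm_one {ω : Plane} (hω : ‖ω‖ = 1) : inner ℝ ω ω = 1 := by
  rw [real_inner_self_eq_norm_sq, hω, one_pow]

/-- The point with coordinates `(u, v)` in the orthonormal basis `ω, ω^⊥`. -/
def planeMap (ω : Plane) (z : ℝ × ℝ) : Plane := z.1 • ω + z.2 • perp ω

theorem norm_sq_planeMap {ω : Plane} (hω : ‖ω‖ = 1) (z : ℝ × ℝ) :
    ‖planeMap ω z‖ ^ 2 = z.1 ^ 2 + z.2 ^ 2 := by
  unfold planeMap
  rw [norm_add_sq_real, norm_smul, norm_smul, norm_perp, hω, inner_smul_left, inner_smul_right,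
    inner_perp_self]
  simp

theorem inner_planeMap {ω : Plane} (hω : ‖ω‖ = 1) (z : ℝ × ℝ) :
    inner ℝ (planeMap ω z) ω = z.1 := by
  unfold planeMap
  rw [inner_add_left, inner_smul_left, inner_smul_left, inner_self_of_norm_one hω,
    real_inner_comm, inner_perp_self]
  simp

theorem inner_planeMap_perp {ω : Plane} (hω : ‖ω‖ = 1) (z : ℝ × ℝ) :
    inner ℝ (planeMap ω z) (perp ω) = z.2 := by
  unfold planeMap
  rw [inner_add_left, inner_smul_left, inner_smul_left, inner_perp_self,
    inner_self_of_norm_one ((norm_perp ω).trans hω)]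
  simp

theorem measurePreserving_planeMap {ω : Plane} (hω : ‖ω‖ = 1) :
    MeasurePreserving (planeMap ω) volume volume := by
  let L : Plane →ₗᵢ[ℝ] Plane :=
    { toFun := fun x => planeMap ω (x 0, x 1)
      map_add' := fun x y => by simp only [planeMap, PiLp.add_apply]; module
      map_smul' := fun c x => by
        simp only [planeMap, PiLp.smul_apply, smul_eq_mul, RingHom.id_apply]; module
      norm_map' := fun x => by
        rw [← sq_eq_sq₀ (norm_nonneg _) (norm_nonneg _)]
        show ‖planeMap ω (x 0, x 1)‖ ^ 2 = _
        rw [norm_sq_planeMap hω, EuclideanSpace.norm_sq_eq]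
        simp [Fin.sum_univ_two] }
  have h1 := (L.toLinearIsometryEquiv rfl).measurePreserving
  have h2 := (PiLp.volume_preserving_toLp (Fin 2)).comp (volume_preserving_finTwoArrow ℝ).symm
  have h3 := h1.comp h2
  exact h3

theorem measurePreserving_framePoint (Θ : ℝ × Plane) (hω : ‖Θ.2‖ = 1) :
    MeasurePreserving (fun q : ℝ × (ℝ × ℝ) => framePoint Θ q.1 q.2.1 q.2.2) volume volume := by
  have hpos : 0 < 1 + Θ.1 ^ 2 := by positivity
  have hs : Real.sqrt (1 + Θ.1 ^ 2) ≠ 0 := (Real.sqrt_pos.2 hpos).ne'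
  have hs2 : Real.sqrt (1 + Θ.1 ^ 2) ^ 2 = 1 + Θ.1 ^ 2 := Real.sq_sqrt hpos.le
  -- the change of variables in the `(t, x·ω)` plane is itself a rotation
  set ω₀ : Plane := !₂[Θ.1 / Real.sqrt (1 + Θ.1 ^ 2), 1 / Real.sqrt (1 + Θ.1 ^ 2)] with hω₀
  have hω₀n : ‖ω₀‖ = 1 := by
    rw [← sq_eq_sq₀ (norm_nonneg _) zero_le_one, EuclideanSpace.norm_sq_eq]
    simp only [hω₀, Fin.sum_univ_two, Real.norm_eq_abs, sq_abs]
    simp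
    field_simp
    rw [hs2]; ring
  have h1 : MeasurePreserving (fun z : ℝ × ℝ => (planeMap ω₀ z 0, planeMap ω₀ z 1))
      volume volume :=
    ((volume_preserving_finTwoArrow ℝ).comp (PiLp.volume_preserving_ofLp (Fin 2))).comp
      (measurePreserving_planeMap hω₀n)
  have h2 := (h1.prod (MeasurePreserving.id (volume : Measure ℝ)))
  have h3 := ((MeasurePreserving.id (volume : Measure ℝ)).prod (measurePreserving_planeMap hω))
  have h4 := h3.comp ((volume_preserving_prodAssoc (α₁ := ℝ) (β₁ := ℝ) (γ₁ := ℝ)).comp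
    (h2.comp (volume_preserving_prodAssoc (α₁ := ℝ) (β₁ := ℝ) (γ₁ := ℝ)).symm))
  refine (congrArg (fun F => MeasurePreserving F volume volume) (funext fun q => ?_)).mp h4
  simp only [framePoint, Function.comp, planeMap, hω₀]
  refine Prod.ext ?_ ?_
  · simp [MeasurableEquiv.prodAssoc, perp]; ring
  · simp only [MeasurableEquiv.prodAssoc, perp, Prod.map]
    simp only [MeasurableEquiv.coe_mk, MeasurableEquiv.symm_mk,
      Equiv.prodAssoc_apply, Equiv.prodAssoc_symm_apply, id]
    simp only [planeMap, perp]
    congr 2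
    simp
    ring

theorem norm_sq_framePoint (Θ : ℝ × Plane) (hω : ‖Θ.2‖ = 1) (s y₁ y₂ : ℝ) :
    (framePoint Θ s y₁ y₂).1 ^ 2 + ‖(framePoint Θ s y₁ y₂).2‖ ^ 2 = s ^ 2 + y₁ ^ 2 + y₂ ^ 2 := by
  have hpos : 0 < 1 + Θ.1 ^ 2 := by positivity
  have hs2 : Real.sqrt (1 + Θ.1 ^ 2) ^ 2 = 1 + Θ.1 ^ 2 := Real.sq_sqrt hpos.le
  have h := norm_sq_planeMap hω ((s + Θ.1 * y₁) / Real.sqrt (1 + Θ.1 ^ 2), y₂)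
  simp only [planeMap] at h
  simp only [framePoint]
  rw [h]
  have hs : Real.sqrt (1 + Θ.1 ^ 2) ≠ 0 := (Real.sqrt_pos.2 hpos).ne'
  field_simp
  rw [hs2]; ring

/-- The coordinates `(t_Θ, x_Θ)`, sliced by `t_Θ`. -/
theorem isChart_coordT (Θ : ℝ × Plane) (hω : ‖Θ.2‖ = 1) :
    IsChart (fun q => framePoint Θ q.1 q.2.1 q.2.2) (coordT Θ) where
  mp := measurePreserving_framePoint Θ hω
  meas := by unfold coordT; fun_prop
  coord s y := (framePoint_spec Θ hω s y.1 y.2).1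
  gauss_apply s y := by
    unfold gauss
    rw [norm_sq_framePoint Θ hω, ← Real.exp_add]
    congr 1; ring
  map_sub p q := by
    simp only [coordT, Prod.fst_sub, Prod.snd_sub, inner_sub_left]; ring

/-- The coordinates `(x²_Θ, (t_Θ, x¹_Θ))`, sliced by `x²_Θ`. -/
theorem isChart_coordX2 (Θ : ℝ × Plane) (hω : ‖Θ.2‖ = 1) :
    IsChart (fun q => framePoint Θ q.2.1 q.2.2 q.1) (coordX2 Θ) where
  mp := by
    have h1 : MeasurePreserving (Prod.swap : ℝ × (ℝ × ℝ) → (ℝ × ℝ) × ℝ) volume volume :=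
      Measure.measurePreserving_swap
    exact (measurePreserving_framePoint Θ hω).comp
      ((volume_preserving_prodAssoc (α₁ := ℝ) (β₁ := ℝ) (γ₁ := ℝ)).comp h1)
  meas := by unfold coordX2; fun_prop
  coord s y := (framePoint_spec Θ hω y.1 y.2 s).2.2
  gauss_apply s y := by
    unfold gauss
    rw [norm_sq_framePoint Θ hω, ← Real.exp_add]
    congr 1; ring
  map_sub p q := by
    simp only [coordX2, Prod.snd_sub, inner_sub_left]

/-! ### The `T T^*` argument -/

theorem memLp_gauss : MemLp gauss 2 (volume : Measure SpaceTime) := by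
  refine ⟨continuous_gauss.aestronglyMeasurable, ?_⟩
  rw [eLpNorm_lt_top_iff_lintegral_rpow_enorm_lt_top (by norm_num) (by norm_num)]
  simp only [ENNReal.toReal_ofNat, ENNReal.rpow_two]
  -- any orthonormal frame will do
  have hch := isChart_coordT ((0, !₂[1, 0]) : ℝ × Plane) (by
    rw [← sq_eq_sq₀ (norm_nonneg _) zero_le_one, EuclideanSpace.norm_sq_eq]
    simp [Fin.sum_univ_two])
  rw [hch.lintegral_eq (continuous_gauss.measurable.enorm.pow_const 2)]
  have h1 : ∀ (s : ℝ) (y : ℝ × ℝ), ‖gauss (framePoint ((0, !₂[1, 0]) : ℝ × Plane) s y.1 y.2)‖ₑ ^ 2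
      = ENNReal.ofReal (Real.exp (-s ^ 2)) ^ 2
        * ENNReal.ofReal (Real.exp (-(y.1 ^ 2 + y.2 ^ 2))) ^ 2 := by
    intro s y
    rw [← mul_pow, ← ENNReal.ofReal_mul (Real.exp_pos _).le, ← hch.gauss_apply s y, ← ofReal_norm,
      Real.norm_of_nonneg (gauss_pos _).le]
  simp only [h1]
  have h2 : ∀ s : ℝ, ∫⁻ y : ℝ × ℝ, ENNReal.ofReal (Real.exp (-s ^ 2)) ^ 2
        * ENNReal.ofReal (Real.exp (-(y.1 ^ 2 + y.2 ^ 2))) ^ 2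
      = ENNReal.ofReal (Real.exp (-2 * s ^ 2)) * gaussMass := by
    intro s
    rw [lintegral_const_mul _ (by fun_prop), ← ENNReal.ofReal_pow (Real.exp_pos _).le,
      ← Real.exp_nat_mul, gaussMass]
    congr 3
    push_cast; ring
  simp only [h2]
  rw [lintegral_mul_const _ (by fun_prop)]
  exact ENNReal.mul_lt_top
    (integrable_exp_neg_mul_sq (by norm_num : (0 : ℝ) < 2)).lintegral_lt_top gaussMass_lt_top

theorem integral_mul_integral_swap {α β : Type*} [MeasurableSpace α] [MeasurableSpace β]
    {μ : Measure α} {ν : Measure β} [SFinite μ] [SFinite ν] (b : α → ℂ) (k : α → β → ℂ)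
    (H : β → ℂ) (h : Integrable (fun w : α × β => b w.1 * (k w.1 w.2 * H w.2)) (μ.prod ν)) :
    ∫ ξ, b ξ * ∫ z, k ξ z * H z ∂ν ∂μ = ∫ z, (∫ ξ, k ξ z * b ξ ∂μ) * H z ∂ν := by
  rw [← integral_integral_mul_swap b k H h]
  simp only [integral_const_mul]

theorem integral_mul_planeWave {G : SpaceTime → ℂ} (hG : Integrable G) {g : Plane → ℂ}
    (hg : Integrable g) :
    ∫ p, G p * ∫ ξ, planeWave ξ p * g ξ = ∫ ξ, (∫ p, planeWave ξ p * G p) * g ξ := by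
  have hw : AEStronglyMeasurable (fun w : SpaceTime × Plane => planeWave w.2 w.1)
      ((volume : Measure SpaceTime).prod (volume : Measure Plane)) :=
    (continuous_planeWave.comp continuous_swap).aestronglyMeasurable
  have h1 : Integrable (fun w : SpaceTime × Plane => G w.1 * g w.2)
      ((volume : Measure SpaceTime).prod (volume : Measure Plane)) := hG.mul_prod hg
  have h4 : Integrable (fun w : SpaceTime × Plane => G w.1 * (planeWave w.2 w.1 * g w.2))
      ((volume : Measure SpaceTime).prod (volume : Measure Plane)) := by
    refine h1.mono (hG.1.comp_fst.mul (hw.mul hg.1.comp_snd)) (Eventually.of_forall fun w => ?_)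
    rw [norm_mul (G w.1), norm_mul (planeWave _ _), norm_planeWave, one_mul, ← norm_mul]
  exact integral_mul_integral_swap G (fun p ξ => planeWave ξ p) g h4

theorem integral_conj_mul_planeWave {G : SpaceTime → ℂ} (hG : Integrable G) {g : Plane → ℂ}
    (hg : Integrable g) :
    ∫ p, (starRingEnd ℂ) (G p) * ∫ ξ, planeWave ξ p * g ξ
      = ∫ ξ, (starRingEnd ℂ) (surfaceTransform G ξ) * g ξ := by
  have hGc : Integrable fun p => (starRingEnd ℂ) (G p) := by
    refine hG.mono (Complex.continuous_conj.comp_aestronglyMeasurable hG.1)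
      (Eventually.of_forall fun q => ?_)
    rw [RCLike.norm_conj]
  have h6 : ∀ ξ, ∫ p, planeWave ξ p * (starRingEnd ℂ) (G p)
      = (starRingEnd ℂ) (surfaceTransform G ξ) := by
    intro ξ
    unfold surfaceTransform
    rw [← integral_conj]
    simp only [map_mul, Complex.conj_conj]
  have h5 := integral_mul_planeWave hGc hg
  simp only [h6] at h5
  exact h5

theorem norm_surfaceTransform_le (G : SpaceTime → ℂ) (ξ : Plane) :
    ‖surfaceTransform G ξ‖ ≤ ∫ p, ‖G p‖ := by
  refine (norm_integral_le_integral_norm _).trans (le_of_eq ?_)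
  simp [norm_planeWave]

/-- Cauchy–Schwarz with a weight `b` that is at least one on the support of `f̂`. -/
theorem norm_integral_conj_mul_wave_le {G : SpaceTime → ℂ} (hG : Integrable G) (f : L2)
    (hf : Integrable ((𝓕 f : L2) : Plane → ℂ)) {b : Plane → ℝ} (hbi : Integrable b)
    (hb0 : ∀ ξ, 0 ≤ b ξ) (hb1 : ∀ᵐ ξ : Plane, (𝓕 f : L2) ξ ≠ 0 → 1 ≤ b ξ) :
    ‖∫ p, (starRingEnd ℂ) (G p) * wave f p‖
      ≤ ‖f‖ * Real.sqrt (∫ ξ, b ξ * ‖surfaceTransform G ξ‖ ^ 2) := by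
  have hstc := continuous_surfaceTransform hG
  have hstb := norm_surfaceTransform_le G
  set g : Plane → ℝ := fun ξ => Real.sqrt (b ξ) * ‖surfaceTransform G ξ‖ with hg
  have hgsq : ∀ ξ, g ξ ^ 2 = b ξ * ‖surfaceTransform G ξ‖ ^ 2 := fun ξ => by
    rw [hg, mul_pow, Real.sq_sqrt (hb0 ξ)]
  have hgm : AEStronglyMeasurable g volume :=
    (Real.continuous_sqrt.comp_aestronglyMeasurable hbi.1).mul
      hstc.norm.aestronglyMeasurable
  have hg2i : Integrable fun ξ => b ξ * ‖surfaceTransform G ξ‖ ^ 2 :=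
    hbi.mul_bdd (c := (∫ p, ‖G p‖) ^ 2) (hstc.norm.pow 2).aestronglyMeasurable
      (Eventually.of_forall fun ξ => by
        rw [norm_pow, norm_norm]
        exact pow_le_pow_left₀ (norm_nonneg _) (hstb ξ) 2)
  have hg2 : MemLp g 2 volume := by
    rw [memLp_two_iff_integrable_sq hgm]
    simpa only [hgsq] using hg2i
  have hfn2 : MemLp (fun ξ => ‖(𝓕 f : L2) ξ‖) 2 (volume : Measure Plane) := (Lp.memLp _).norm
  have h8 : ∫ ξ, ‖(𝓕 f : L2) ξ‖ * ‖surfaceTransform G ξ‖ ≤ ∫ ξ, ‖(𝓕 f : L2) ξ‖ * g ξ := by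
    refine integral_mono_ae (hf.norm.mul_bdd (c := ∫ p, ‖G p‖) hstc.norm.aestronglyMeasurable
      (Eventually.of_forall fun ξ => by rw [norm_norm]; exact hstb ξ))
      (hfn2.integrable_mul hg2) ?_
    filter_upwards [hb1] with ξ hξ
    rcases eq_or_ne ((𝓕 f : L2) ξ) 0 with h0 | h0
    · simp [h0]
    · gcongr
      refine le_mul_of_one_le_left (norm_nonneg _) ?_
      rw [Real.one_le_sqrt]; exact hξ h0
  have h9 : (∫ ξ, ‖(𝓕 f : L2) ξ‖ * g ξ) ≤ ‖f‖ * Real.sqrt (∫ ξ, g ξ ^ 2) := by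
    have := integral_mul_le_Lp_mul_Lq_of_nonneg (μ := (volume : Measure Plane))
      Real.HolderConjugate.two_two (f := fun ξ => ‖(𝓕 f : L2) ξ‖) (g := g)
      (Eventually.of_forall fun ξ => norm_nonneg _)
      (Eventually.of_forall fun ξ => by simp only [hg, Pi.zero_apply]; positivity)
      (by simpa using hfn2) (by simpa using hg2)
    refine this.trans (le_of_eq ?_)
    have h10 : ∫ ξ, ‖(𝓕 f : L2) ξ‖ ^ (2 : ℝ) = ‖f‖ ^ 2 := by
      have h11 := lintegral_enorm_sq_eq (𝓕 f : L2)
      rw [Lp.norm_fourier_eq] at h11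
      rw [integral_eq_lintegral_of_nonneg_ae (Eventually.of_forall fun ξ => by
        simp only [Pi.zero_apply]; positivity) (by
          simp only [Real.rpow_two]
          exact (Lp.aestronglyMeasurable (𝓕 f : L2)).norm.pow 2)]
      rw [← ENNReal.toReal_ofReal (sq_nonneg ‖f‖), ← h11]
      congr 1
      refine lintegral_congr fun ξ => ?_
      rw [Real.rpow_two, ENNReal.ofReal_pow (norm_nonneg _), ofReal_norm]
    rw [h10, ← Real.sqrt_eq_rpow, Real.sqrt_sq (norm_nonneg _), ← Real.sqrt_eq_rpow]
    simp only [Real.rpow_two]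
  have h6 : ∫ p, (starRingEnd ℂ) (G p) * wave f p
      = ∫ ξ, (starRingEnd ℂ) (surfaceTransform G ξ) * (𝓕 f : L2) ξ :=
    integral_conj_mul_planeWave hG hf
  rw [h6]
  simp only [hgsq] at h9
  refine le_trans ((norm_integral_le_integral_norm _).trans (le_of_eq ?_)) (h8.trans h9)
  refine integral_congr_ae (Eventually.of_forall fun ξ => ?_)
  dsimp only
  rw [norm_mul, RCLike.norm_conj, mul_comm]

/-- `T T^*` with Schur's test in every frame. The support of `G` in `|t| ≤ T` restricts the kernel
to times at most `2T`. -/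
theorem ofReal_integral_surfaceTransform_le_sum {ι : Type*} (S : Finset ι)
    (e : ι → ℝ × (ℝ × ℝ) → SpaceTime) (σ : ι → SpaceTime → ℝ)
    (hch : ∀ Θ ∈ S, IsChart (e Θ) (σ Θ)) {T : ℝ} {G : SpaceTime → ℂ} (hGi : Integrable G)
    (hGm : Measurable G) (hGT : ∀ p, ¬ |p.1| ≤ T → G p = 0) {b : Plane → ℝ} (hbi : Integrable b)
    (M : ι → ℝ → ℝ≥0∞) (hM : ∀ Θ ∈ S, Measurable (M Θ))
    (hK : ∀ p : SpaceTime, |p.1| ≤ 2 * T → ‖waveKernel b p‖ₑ ≤ ∑ Θ ∈ S, M Θ (σ Θ p)) :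
    ENNReal.ofReal (∫ ξ, b ξ * ‖surfaceTransform G ξ‖ ^ 2)
      ≤ ∑ Θ ∈ S, (∫⁻ s, M Θ s) * ∫⁻ s, sliceL1 (e Θ) G s ^ 2 := by
  calc _ ≤ _ := ofReal_integral_surfaceTransform_le hGi hbi
    _ ≤ ∫⁻ p, ∫⁻ q, ∑ Θ ∈ S, ‖G p‖ₑ * ‖G q‖ₑ * M Θ (σ Θ (p - q)) := by
      refine lintegral_mono fun p => lintegral_mono fun q => ?_
      dsimp only
      rw [← Finset.mul_sum]
      by_cases hp : |p.1| ≤ T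
      · by_cases hq : |q.1| ≤ T
        · gcongr
          refine hK _ ?_
          have := abs_sub p.1 q.1
          rw [Prod.fst_sub]; linarith
        · simp [hGT q hq]
      · simp [hGT p hp]
    _ = ∑ Θ ∈ S, ∫⁻ p, ∫⁻ q, ‖G p‖ₑ * ‖G q‖ₑ * M Θ (σ Θ (p - q)) := by
      have h13 : ∀ Θ ∈ S, Measurable fun w : SpaceTime × SpaceTime =>
          ‖G w.1‖ₑ * ‖G w.2‖ₑ * M Θ (σ Θ (w.1 - w.2)) := by
        intro Θ hΘ
        have h14 := (hM Θ hΘ).comp ((hch Θ hΘ).meas.comp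
          (measurable_fst.sub measurable_snd : Measurable fun w : SpaceTime × SpaceTime =>
            w.1 - w.2))
        exact ((hGm.comp measurable_fst).enorm.mul (hGm.comp measurable_snd).enorm).mul h14
      rw [← lintegral_finsetSum' _ fun Θ hΘ =>
        (h13 Θ hΘ).lintegral_prod_right'.aemeasurable]
      refine lintegral_congr fun p => ?_
      exact lintegral_finsetSum' _ fun Θ hΘ =>
        ((h13 Θ hΘ).comp measurable_prodMk_left).aemeasurable
    _ ≤ ∑ Θ ∈ S, (∫⁻ s, M Θ s) * ∫⁻ s, sliceL1 (e Θ) G s ^ 2 :=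
      Finset.sum_le_sum fun Θ hΘ => (hch Θ hΘ).lintegral_schur_le hGm (hM Θ hΘ)

/-- The `T T^*` argument. A majorant of the kernel by functions of the coordinates `σ_Θ` controls
the sum of the mixed norms. -/
theorem sumNorm_truncatedWave_le (S : Finset (ℝ × Plane))
    (e : ℝ × Plane → ℝ × (ℝ × ℝ) → SpaceTime) (σ : ℝ × Plane → SpaceTime → ℝ)
    (hch : ∀ Θ ∈ S, IsChart (e Θ) (σ Θ)) (f : L2)
    (hf : Integrable ((𝓕 f : L2) : Plane → ℂ)) (T : ℝ)
    (b : Plane → ℝ) (hbi : Integrable b) (hb0 : ∀ ξ, 0 ≤ b ξ)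
    (hb1 : ∀ᵐ ξ : Plane, (𝓕 f : L2) ξ ≠ 0 → 1 ≤ b ξ)
    (M : ℝ × Plane → ℝ → ℝ≥0∞) (hM : ∀ Θ ∈ S, Measurable (M Θ))
    (hK : ∀ p : SpaceTime, |p.1| ≤ 2 * T → ‖waveKernel b p‖ₑ ≤ ∑ Θ ∈ S, M Θ (σ Θ p))
    {B : ℝ} (hB : 0 < B) (hMB : ∑ Θ ∈ S, ∫⁻ s, M Θ s ≤ ENNReal.ofReal (B ^ 2)) :
    sumNorm (fun Θ => mixedNorm (e Θ)) S (truncatedWave T f) ≤ ENNReal.ofReal (B * ‖f‖) := by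
  classical
  set I : Set SpaceTime := {p | |p.1| ≤ T} with hI
  have hIm : MeasurableSet I := measurableSet_le (by fun_prop) measurable_const
  -- the weighted wave lies in `L²`, because the wave is bounded
  set v₀ : SpaceTime → ℂ := fun p => gauss p * I.indicator (wave f) p with hv₀
  have hwm : Measurable (I.indicator (wave f)) := (continuous_wave f hf).measurable.indicator hIm
  have hv₀m : Measurable v₀ :=
    (Complex.continuous_ofReal.comp continuous_gauss).measurable.mul hwm
  have hv₀L : MemLp v₀ 2 volume := by
    refine MemLp.of_le_mul (c := ∫ ξ, ‖(𝓕 f : L2) ξ‖) memLp_gauss hv₀m.aestronglyMeasurable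
      (Eventually.of_forall fun p => ?_)
    rw [hv₀, norm_mul, Complex.norm_real, mul_comm]
    gcongr
    rw [Set.indicator_apply]
    split_ifs
    · exact norm_wave_le f p
    · rw [norm_zero]; exact integral_nonneg fun _ => norm_nonneg _
  obtain ⟨φ, hφm, hφs, hφN⟩ := exists_decomposition S e σ hch (hv₀L.toLp v₀)
    (C := B * ‖f‖) (by positivity) (by
    intro F c hc hFc
    have hFm : Measurable (F : SpaceTime → ℂ) := (Lp.stronglyMeasurable F).measurable
    set G : SpaceTime → ℂ := I.indicator (fun p => gauss p * F p) with hG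
    have hgFm : Measurable fun p => (gauss p : ℂ) * F p :=
      (Complex.continuous_ofReal.comp continuous_gauss).measurable.mul hFm
    have hGm : Measurable G := hgFm.indicator hIm
    have hgFi : Integrable fun p => (gauss p : ℂ) * F p := by
      have h1 : MemLp (fun p => (gauss p : ℂ)) 2 (volume : Measure SpaceTime) := memLp_gauss.ofReal
      exact h1.integrable_mul (Lp.memLp F)
    have hGi : Integrable G := hgFi.indicator hIm
    have h1 : inner ℝ F (hv₀L.toLp v₀)
        ≤ ‖f‖ * Real.sqrt (∫ ξ, b ξ * ‖surfaceTransform G ξ‖ ^ 2) := by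
      have h2 : ∀ᵐ p, inner ℝ (F p) (hv₀L.toLp v₀ p)
          = ((starRingEnd ℂ) (G p) * wave f p).re := by
        filter_upwards [hv₀L.coeFn_toLp] with p hp
        rw [hp, hv₀, hG, Complex.inner]
        by_cases hpI : p ∈ I
        · simp only [Set.indicator_of_mem hpI, map_mul, Complex.conj_ofReal]
          congr 1; ring
        · simp only [Set.indicator_of_notMem hpI]; simp
      have hGc : Integrable fun p => (starRingEnd ℂ) (G p) := by
        refine hGi.mono (Complex.continuous_conj.comp_aestronglyMeasurable hGi.1)
          (Eventually.of_forall fun q => ?_)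
        rw [RCLike.norm_conj]
      have h3 : Integrable fun p => (starRingEnd ℂ) (G p) * wave f p :=
        hGc.mul_bdd (c := ∫ ξ, ‖(𝓕 f : L2) ξ‖) (continuous_wave f hf).aestronglyMeasurable
          (Eventually.of_forall fun p => norm_wave_le f p)
      have h7 : ∫ p, ((starRingEnd ℂ) (G p) * wave f p).re
          = (∫ p, (starRingEnd ℂ) (G p) * wave f p).re := integral_re h3
      rw [L2.inner_def, integral_congr_ae h2, h7]
      exact (Complex.re_le_norm _).trans (norm_integral_conj_mul_wave_le hGi f hf hbi hb0 hb1)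
    have h12 : ENNReal.ofReal (∫ ξ, b ξ * ‖surfaceTransform G ξ‖ ^ 2)
        ≤ ∑ Θ ∈ S, (∫⁻ s, M Θ s) * ∫⁻ s, sliceL1 (e Θ) (fun p => gauss p * F p) s ^ 2 := by
      refine (ofReal_integral_surfaceTransform_le_sum S e σ hch hGi hGm
        (fun p hp => Set.indicator_of_notMem (s := I) hp _) hbi M hM hK).trans ?_
      refine Finset.sum_le_sum fun Θ hΘ => ?_
      gcongr with s
      refine lintegral_mono fun y => ?_
      simp only [hG, Set.indicator_apply]
      split_ifs
      · exact le_rfl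
      · simp
    -- combine Cauchy–Schwarz with the dual bound in every frame
    set J : ℝ := ∫ ξ, b ξ * ‖surfaceTransform G ξ‖ ^ 2 with hJ
    have h15 : ENNReal.ofReal (B ^ 2) * ENNReal.ofReal (‖f‖ ^ 2 * J)
        ≤ ENNReal.ofReal (B ^ 2) * ENNReal.ofReal (c ^ 2) := by
      calc _ = ENNReal.ofReal ((B * ‖f‖) ^ 2) * ENNReal.ofReal (J) := by
            rw [← ENNReal.ofReal_mul (by positivity), ← ENNReal.ofReal_mul (by positivity)]
            congr 1; ring
        _ ≤ ENNReal.ofReal ((B * ‖f‖) ^ 2) * ∑ Θ ∈ S, (∫⁻ s, M Θ s) *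
              ∫⁻ s, sliceL1 (e Θ) (fun p => gauss p * F p) s ^ 2 := by gcongr
        _ = ∑ Θ ∈ S, (∫⁻ s, M Θ s) * (ENNReal.ofReal ((B * ‖f‖) ^ 2) *
              ∫⁻ s, sliceL1 (e Θ) (fun p => gauss p * F p) s ^ 2) := by
            rw [Finset.mul_sum]
            exact Finset.sum_congr rfl fun Θ _ => by ring
        _ ≤ ∑ Θ ∈ S, (∫⁻ s, M Θ s) * ENNReal.ofReal (c ^ 2) :=
            Finset.sum_le_sum fun Θ hΘ => by gcongr; exact hFc Θ hΘ
        _ = (∑ Θ ∈ S, ∫⁻ s, M Θ s) * ENNReal.ofReal (c ^ 2) := by rw [Finset.sum_mul]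
        _ ≤ _ := by gcongr
    have h16 : ‖f‖ ^ 2 * J ≤ c ^ 2 := by
      rw [← ENNReal.ofReal_mul (by positivity), ← ENNReal.ofReal_mul (by positivity),
        ENNReal.ofReal_le_ofReal_iff (by positivity)] at h15
      exact le_of_mul_le_mul_left h15 (by positivity)
    refine h1.trans ?_
    have h17 : 0 ≤ J := integral_nonneg fun ξ => mul_nonneg (hb0 ξ) (sq_nonneg _)
    refine abs_le_of_sq_le_sq' ?_ hc |>.2
    rw [mul_pow, Real.sq_sqrt h17]
    exact h16)
  refine le_trans ?_ hφN
  unfold sumNorm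
  refine iInf_le_of_le φ (iInf_le_of_le hφm (iInf_le_of_le ?_ le_rfl))
  have h1 : ∀ᵐ p : SpaceTime, I.indicator (wave f) p = ∑ Θ ∈ S, φ Θ p := by
    filter_upwards [hφs, hv₀L.coeFn_toLp] with p hp1 hp2
    have h0 : (gauss p : ℂ) ≠ 0 := by exact_mod_cast (gauss_pos p).ne'
    rw [hp2] at hp1
    exact mul_left_cancel₀ h0 hp1
  have h2 : ∀ᵐ t : ℝ, ∀ᵐ x : Plane, I.indicator (wave f) (t, x) = ∑ Θ ∈ S, φ Θ (t, x) :=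
    Measure.ae_ae_of_ae_prod h1
  filter_upwards [h2] with t ht
  filter_upwards [ht, propagator_ae_eq_wave f hf t] with x hx hx2
  rw [← hx]
  unfold truncatedWave
  by_cases htI : |t| ≤ T
  · rw [Set.indicator_of_mem (Set.mem_Icc.2 (abs_le.1 htI)), hx2,
      Set.indicator_of_mem (show (t, x) ∈ I from htI)]
  · rw [Set.indicator_of_notMem (fun h => htI (abs_le.2 (Set.mem_Icc.1 h))),
      Set.indicator_of_notMem (show (t, x) ∉ I from htI)]
    rfl

/-! ### Derivatives of the kernel of `e^{-z⟨D⟩} ⟨D⟩⁻¹` -/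

theorem one_le_japanese (ξ : Plane) : 1 ≤ japanese ξ := by
  rw [japanese, Real.one_le_sqrt]; nlinarith [sq_nonneg ‖ξ‖]

theorem japanese_pos (ξ : Plane) : 0 < japanese ξ := zero_lt_one.trans_le (one_le_japanese ξ)

theorem japanese_ofReal_ne_zero (ξ : Plane) : (japanese ξ : ℂ) ≠ 0 := by
  exact_mod_cast (japanese_pos ξ).ne'

theorem norm_le_japanese (ξ : Plane) : ‖ξ‖ ≤ japanese ξ :=
  Real.le_sqrt_of_sq_le (by linarith [sq_nonneg ‖ξ‖])

theorem continuous_japanese : Continuous japanese := by unfold japanese; fun_prop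

theorem integrable_exp_japanese {c : ℝ} (hc : 0 < c) :
    Integrable fun ξ : Plane => Real.exp (-c * japanese ξ) := by
  have h1 : Integrable fun ξ : Plane => (1 + ‖ξ‖) ^ (-(3 : ℝ)) :=
    integrable_one_add_norm (by simp; norm_num)
  refine (h1.const_mul (8 * (6 / c ^ 3))).mono' (by
    have := continuous_japanese
    exact Continuous.aestronglyMeasurable (by fun_prop)) (Eventually.of_forall fun ξ => ?_)
  have hJ := japanese_pos ξ
  have h2 := Real.pow_div_factorial_le_exp (c * japanese ξ) (by positivity) 3
  have h3 : 1 + ‖ξ‖ ≤ 2 * japanese ξ := by linarith [one_le_japanese ξ, norm_le_japanese ξ]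
  have h4 : (1 + ‖ξ‖) ^ 3 ≤ (2 * japanese ξ) ^ 3 := by gcongr
  rw [Real.norm_of_nonneg (Real.exp_pos _).le, neg_mul, Real.exp_neg, Real.rpow_neg (by positivity),
    show (3 : ℝ) = ((3 : ℕ) : ℝ) by norm_num, Real.rpow_natCast]
  rw [inv_le_comm₀ (Real.exp_pos _) (by positivity), mul_inv, inv_inv]
  refine le_trans ?_ h2
  rw [show ((Nat.factorial 3 : ℕ) : ℝ) = 6 by norm_num [Nat.factorial]]
  calc _ ≤ (8 * (6 / c ^ 3))⁻¹ * (2 * japanese ξ) ^ 3 := by gcongr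
    _ = _ := by field_simp; norm_num

theorem hasLineDerivAt_japanese (ξ x : Plane) :
    HasDerivAt (fun τ : ℝ => japanese (ξ + τ • x)) (inner ℝ x ξ / japanese ξ) 0 := by
  have h1 : ∀ τ : ℝ, japanese (ξ + τ • x)
      = Real.sqrt (1 + (‖ξ‖ ^ 2 + 2 * (τ * inner ℝ x ξ) + τ ^ 2 * ‖x‖ ^ 2)) := by
    intro τ
    rw [japanese, norm_add_sq_real, inner_smul_right, norm_smul, mul_pow, Real.norm_eq_abs, sq_abs,
      real_inner_comm]
  simp only [h1]
  have h2 : HasDerivAt (fun τ : ℝ => 1 + (‖ξ‖ ^ 2 + 2 * (τ * inner ℝ x ξ) + τ ^ 2 * ‖x‖ ^ 2))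
      (2 * inner ℝ x ξ) 0 := by
    have h3 := (((hasDerivAt_id (0 : ℝ)).mul_const (inner ℝ x ξ)).const_mul 2).const_add (‖ξ‖ ^ 2)
    have h4 := (h3.add (((hasDerivAt_id (0 : ℝ)).pow 2).mul_const (‖x‖ ^ 2))).const_add 1
    exact h4.congr_deriv (by simp)
  have h3 := h2.sqrt (by simp; positivity)
  refine h3.congr_deriv ?_
  simp only [japanese]
  simp
  ring

/-- `∫ e^{i x·ξ} e^{-z⟨ξ⟩} ⟨ξ⟩⁻¹ dξ`, the kernel of `e^{-z⟨D⟩} ⟨D⟩⁻¹` up to a constant. -/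
def expKernel (z : ℂ) (x : Plane) : ℂ :=
  ∫ ξ : Plane, Complex.exp (Complex.I * (inner ℝ x ξ : ℝ) - z * japanese ξ) / japanese ξ

theorem norm_exp_phase (z : ℂ) (a J : ℝ) :
    ‖Complex.exp (Complex.I * (a : ℝ) - z * J)‖ = Real.exp (-z.re * J) := by
  rw [Complex.norm_exp]
  congr 1
  simp

/-- Integration by parts behind the Lorentz invariance of `expKernel`: the derivative of
`e^{i s x·ξ} e^{-z⟨ξ⟩}` in the direction `x` has integral zero. -/
theorem lorentz_identity {z : ℂ} (hz : 0 < z.re) (x : Plane) (s : ℝ) :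
    z * ∫ ξ : Plane, (inner ℝ x ξ : ℝ) *
        Complex.exp (Complex.I * (s * inner ℝ x ξ : ℝ) - z * japanese ξ) / japanese ξ
      = Complex.I * s * ‖x‖ ^ 2 *
        ∫ ξ : Plane, Complex.exp (Complex.I * (s * inner ℝ x ξ : ℝ) - z * japanese ξ) := by
  have hJc := continuous_japanese
  set f : Plane → ℂ := fun ξ => Complex.exp (Complex.I * (s * inner ℝ x ξ : ℝ)) with hf
  set g : Plane → ℂ := fun ξ => Complex.exp (-z * japanese ξ) with hg
  set f' : Plane → ℂ := fun ξ => f ξ * (Complex.I * (s * ‖x‖ ^ 2 : ℝ)) with hf'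
  set g' : Plane → ℂ := fun ξ => g ξ * (-z * (inner ℝ x ξ / japanese ξ : ℝ)) with hg'
  have hfn : ∀ ξ, ‖f ξ‖ = 1 := fun ξ => by
    rw [hf, Complex.norm_exp]; simp
  have hgn : ∀ ξ, ‖g ξ‖ = Real.exp (-z.re * japanese ξ) := fun ξ => by
    rw [hg, Complex.norm_exp]; simp
  have hfc : Continuous f := by simp only [hf]; fun_prop
  have hgc : Continuous g := by simp only [hg]; fun_prop
  have hgi : Integrable g := (integrable_exp_japanese hz).mono' hgc.aestronglyMeasurable
    (Eventually.of_forall fun ξ => (hgn ξ).le)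
  have hJ0 := japanese_ofReal_ne_zero
  have hg'i : Integrable g' := by
    refine ((integrable_exp_japanese hz).const_mul (‖z‖ * ‖x‖)).mono' ?_
      (Eventually.of_forall fun ξ => ?_)
    · refine Continuous.aestronglyMeasurable (hgc.mul (continuous_const.mul
        (Complex.continuous_ofReal.comp ?_)))
      exact Continuous.div (by fun_prop) hJc fun ξ => (japanese_pos ξ).ne'
    · rw [hg', norm_mul, norm_mul, hgn, norm_neg, Complex.norm_real, norm_div, mul_comm]
      gcongr
      rw [Real.norm_of_nonneg (japanese_pos ξ).le, div_le_iff₀ (japanese_pos ξ)]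
      refine (norm_inner_le_norm _ _).trans ?_
      gcongr
      exact norm_le_japanese ξ
  have key := integral_bilinear_hasLineDerivAt_right_eq_neg_left_of_integrable
    (μ := (volume : Measure Plane)) (f := f) (f' := f') (g := g) (g' := g') (v := x)
    (B := ContinuousLinearMap.mul ℝ ℂ) ?_ ?_ ?_ ?_ ?_
  · simp only [ContinuousLinearMap.mul_apply'] at key
    have e1 : ∀ ξ, f ξ * g' ξ = -z * ((inner ℝ x ξ : ℝ) *
        Complex.exp (Complex.I * (s * inner ℝ x ξ : ℝ) - z * japanese ξ) / japanese ξ) := by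
      intro ξ
      simp only [hf, hg', hg]
      rw [sub_eq_add_neg, Complex.exp_add, ← neg_mul]
      push_cast
      ring
    have e2 : ∀ ξ, f' ξ * g ξ = Complex.I * s * ‖x‖ ^ 2 *
        Complex.exp (Complex.I * (s * inner ℝ x ξ : ℝ) - z * japanese ξ) := by
      intro ξ
      simp only [hf', hf, hg]
      rw [sub_eq_add_neg, Complex.exp_add, ← neg_mul]
      push_cast
      ring
    simp only [e1, e2] at key
    rw [integral_const_mul, integral_const_mul, neg_mul] at key
    exact neg_injective key
  · simp only [ContinuousLinearMap.mul_apply', hf']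
    have : (fun ξ => f ξ * (Complex.I * (s * ‖x‖ ^ 2 : ℝ)) * g ξ)
        = fun ξ => (Complex.I * (s * ‖x‖ ^ 2 : ℝ)) * (f ξ * g ξ) := by
      funext ξ; ring
    rw [this]
    exact (hgi.bdd_mul (c := 1) hfc.aestronglyMeasurable
      (Eventually.of_forall fun ξ => (hfn ξ).le)).const_mul _
  · simp only [ContinuousLinearMap.mul_apply']
    exact hg'i.bdd_mul (c := 1) hfc.aestronglyMeasurable (Eventually.of_forall fun ξ => (hfn ξ).le)
  · simp only [ContinuousLinearMap.mul_apply']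
    exact hgi.bdd_mul (c := 1) hfc.aestronglyMeasurable (Eventually.of_forall fun ξ => (hfn ξ).le)
  · intro ξ _
    have h1 : HasDerivAt (fun τ : ℝ => s * inner ℝ x (ξ + τ • x)) (s * ‖x‖ ^ 2) 0 := by
      have h2 : ∀ τ : ℝ, s * inner ℝ x (ξ + τ • x) = s * (inner ℝ x ξ + τ * ‖x‖ ^ 2) := fun τ => by
        rw [inner_add_right, inner_smul_right, real_inner_self_eq_norm_sq]
      simp only [h2]
      simpa using (((hasDerivAt_id (0 : ℝ)).mul_const (‖x‖ ^ 2)).const_add (inner ℝ x ξ)).const_mul s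
    have h3 := (h1.ofReal_comp.const_mul Complex.I).cexp
    simpa [HasLineDerivAt, hf', hf] using h3
  · intro ξ _
    have h3 := ((hasLineDerivAt_japanese ξ x).ofReal_comp.const_mul (-z)).cexp
    simpa [HasLineDerivAt, hg', hg] using h3

/-! ### Lorentz invariance and dispersion -/

/-- The square root in the slit plane. -/
def slitSqrt (q : ℂ) : ℂ := Complex.exp (Complex.log q / 2)

theorem slitSqrt_sq {q : ℂ} (hq : q ≠ 0) : slitSqrt q ^ 2 = q := by
  rw [slitSqrt, ← Complex.exp_nat_mul]
  push_cast
  rw [mul_div_cancel₀ _ two_ne_zero, Complex.exp_log hq]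

theorem slitSqrt_re_pos {q : ℂ} (hq : q ∈ Complex.slitPlane) : 0 < (slitSqrt q).re := by
  rw [slitSqrt, Complex.exp_re]
  refine mul_pos (Real.exp_pos _) (Real.cos_pos_of_mem_Ioo ?_)
  have h1 := Complex.neg_pi_lt_arg q
  have h2 := lt_of_le_of_ne (Complex.arg_le_pi q) (Complex.mem_slitPlane_iff_arg.1 hq).1
  have h3 : (Complex.log q / 2).im = q.arg / 2 := by
    rw [show Complex.log q / 2 = Complex.log q / ((2 : ℝ) : ℂ) by norm_num, Complex.div_ofReal_im,
      Complex.log_im]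
  rw [h3]
  constructor <;> linarith

theorem slitSqrt_sq_self {z : ℂ} (hz : 0 < z.re) (hq : z ^ 2 ∈ Complex.slitPlane) :
    slitSqrt (z ^ 2) = z := by
  have h1 := slitSqrt_sq (Complex.slitPlane_ne_zero hq)
  have h2 := slitSqrt_re_pos hq
  rcases sq_eq_sq_iff_eq_or_eq_neg.1 h1 with h | h
  · exact h
  · rw [h, Complex.neg_re] at h2; linarith

theorem sq_add_mem_slitPlane {z : ℂ} (hz : 0 < z.re) {a : ℝ} (ha : 0 ≤ a) :
    z ^ 2 + a ∈ Complex.slitPlane := by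
  rw [Complex.mem_slitPlane_iff]
  have h1 : (z ^ 2 + a).re = z.re ^ 2 - z.im ^ 2 + a := by simp [sq]
  have h2 : (z ^ 2 + a).im = 2 * z.re * z.im := by simp [sq]; ring
  rw [h1, h2]
  by_cases h : z.im = 0
  · left; rw [h]; nlinarith [sq_pos_of_pos hz]
  · right; exact mul_ne_zero (mul_ne_zero two_ne_zero hz.ne') h

/-- Convergence is due to `e^{-Re z ⟨ξ⟩}`. -/
theorem integrable_exp_phase {z : ℂ} (hz : 0 < z.re) (x : Plane) (s : ℝ) :
    Integrable fun ξ : Plane =>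
      Complex.exp (Complex.I * (s * inner ℝ x ξ : ℝ) - z * japanese ξ) := by
  have hJc := continuous_japanese
  refine (integrable_exp_japanese hz).mono' (Continuous.aestronglyMeasurable (by fun_prop))
    (Eventually.of_forall fun ξ => ?_)
  rw [norm_exp_phase]

theorem integrable_exp_phase_div {z : ℂ} (hz : 0 < z.re) (x : Plane) (s : ℝ) :
    Integrable fun ξ : Plane =>
      Complex.exp (Complex.I * (s * inner ℝ x ξ : ℝ) - z * japanese ξ) / japanese ξ := by
  have hJc := continuous_japanese
  refine (integrable_exp_japanese hz).mono' (Continuous.aestronglyMeasurable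
    (Continuous.div (by fun_prop) (by fun_prop) japanese_ofReal_ne_zero))
    (Eventually.of_forall fun ξ => ?_)
  rw [norm_div, norm_exp_phase, Complex.norm_real, Real.norm_of_nonneg (japanese_pos ξ).le]
  exact div_le_self (Real.exp_pos _).le (one_le_japanese ξ)

theorem integrable_inner_mul_exp_phase_div {z : ℂ} (hz : 0 < z.re) (x : Plane) (s : ℝ) :
    Integrable fun ξ : Plane => (inner ℝ x ξ : ℝ) *
      Complex.exp (Complex.I * (s * inner ℝ x ξ : ℝ) - z * japanese ξ) / japanese ξ := by
  have hJc := continuous_japanese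
  refine ((integrable_exp_japanese hz).const_mul ‖x‖).mono' (Continuous.aestronglyMeasurable
    (Continuous.div (by fun_prop) (by fun_prop) japanese_ofReal_ne_zero))
    (Eventually.of_forall fun ξ => ?_)
  rw [norm_div, norm_mul, norm_exp_phase, Complex.norm_real, Complex.norm_real,
    Real.norm_of_nonneg (japanese_pos ξ).le, div_le_iff₀ (japanese_pos ξ)]
  calc _ ≤ ‖x‖ * ‖ξ‖ * Real.exp (-z.re * japanese ξ) := by
        gcongr; exact norm_inner_le_norm _ _
    _ ≤ ‖x‖ * japanese ξ * Real.exp (-z.re * japanese ξ) := by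
        gcongr; exact norm_le_japanese ξ
    _ = _ := by ring

/-- Differentiation of the kernel along a curve `(s x, w s)`. -/
theorem hasDerivAt_expKernel_curve (x : Plane) {w : ℝ → ℂ} {s₀ : ℝ} {w' : ℝ → ℂ}
    (hw : ∀ᶠ s in 𝓝 s₀, HasDerivAt w (w' s) s) (hw' : ContinuousAt w' s₀) (hre : 0 < (w s₀).re) :
    HasDerivAt (fun s : ℝ => ∫ ξ : Plane,
        Complex.exp (Complex.I * (s * inner ℝ x ξ : ℝ) - w s * japanese ξ) / japanese ξ)
      (∫ ξ : Plane, Complex.exp (Complex.I * (s₀ * inner ℝ x ξ : ℝ) - w s₀ * japanese ξ)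
        * (Complex.I * (inner ℝ x ξ : ℝ) - w' s₀ * japanese ξ) / japanese ξ) s₀ := by
  have hJc := continuous_japanese
  set c := (w s₀).re / 2 with hc
  have hcpos : 0 < c := half_pos hre
  have hwc : ContinuousAt w s₀ := hw.self_of_nhds.continuousAt
  have h1 : ∀ᶠ s in 𝓝 s₀, c < (w s).re :=
    (Complex.continuous_re.continuousAt.comp hwc).eventually (lt_mem_nhds (half_lt_self hre))
  have h2 : ∀ᶠ s in 𝓝 s₀, ‖w' s‖ < ‖w' s₀‖ + 1 :=
    (hw'.norm).eventually (gt_mem_nhds (lt_add_one _))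
  set t : Set ℝ := {s | HasDerivAt w (w' s) s ∧ c < (w s).re ∧ ‖w' s‖ < ‖w' s₀‖ + 1} with ht
  have htn : t ∈ 𝓝 s₀ := hw.and (h1.and h2)
  refine (hasDerivAt_integral_of_dominated_loc_of_deriv_le (μ := (volume : Measure Plane))
    (F := fun (s : ℝ) (ξ : Plane) =>
      Complex.exp (Complex.I * (s * inner ℝ x ξ : ℝ) - w s * japanese ξ) / japanese ξ)
    (F' := fun (s : ℝ) (ξ : Plane) =>
      Complex.exp (Complex.I * (s * inner ℝ x ξ : ℝ) - w s * japanese ξ)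
        * (Complex.I * (inner ℝ x ξ : ℝ) - w' s * japanese ξ) / japanese ξ)
    (bound := fun ξ => (‖x‖ + (‖w' s₀‖ + 1)) * Real.exp (-c * japanese ξ))
    htn ?_ ?_ ?_ ?_ ?_ ?_).2
  · filter_upwards [htn] with s hs
    exact (integrable_exp_phase_div (hcpos.trans hs.2.1) x s).1
  · exact integrable_exp_phase_div hre x s₀
  · exact Continuous.aestronglyMeasurable
      (Continuous.div (by fun_prop) (by fun_prop) japanese_ofReal_ne_zero)
  · refine Eventually.of_forall fun ξ s hs => ?_
    have hJ := japanese_pos ξ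
    rw [norm_div, norm_mul, norm_exp_phase, Complex.norm_real, Real.norm_of_nonneg hJ.le,
      div_le_iff₀ hJ]
    have h3 : ‖Complex.I * (inner ℝ x ξ : ℝ) - w' s * japanese ξ‖
        ≤ (‖x‖ + (‖w' s₀‖ + 1)) * japanese ξ := by
      refine (norm_sub_le _ _).trans ?_
      rw [norm_mul, norm_mul, Complex.norm_I, one_mul, Complex.norm_real, Complex.norm_real,
        Real.norm_of_nonneg hJ.le, add_mul]
      gcongr
      · refine (norm_inner_le_norm _ _).trans ?_
        gcongr
        exact norm_le_japanese ξ
      · exact hs.2.2.le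
    have h4 : Real.exp (-(w s).re * japanese ξ) ≤ Real.exp (-c * japanese ξ) := by
      gcongr
      exact hs.2.1.le
    calc _ ≤ Real.exp (-c * japanese ξ) * ((‖x‖ + (‖w' s₀‖ + 1)) * japanese ξ) := by gcongr
      _ = _ := by ring
  · exact (integrable_exp_japanese hcpos).const_mul _
  · refine Eventually.of_forall fun ξ s hs => ?_
    have h5 : HasDerivAt (fun s : ℝ => ((s * inner ℝ x ξ : ℝ) : ℂ)) ((inner ℝ x ξ : ℝ) : ℂ) s := by
      simpa using ((hasDerivAt_id s).mul_const (inner ℝ x ξ)).ofReal_comp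
    exact (((h5.const_mul Complex.I).sub (hs.1.mul_const _)).cexp).div_const _

/-- Lorentz invariance: the kernel at `(x, z)` is the kernel at `(0, √(z² + |x|²))`. -/
theorem expKernel_eq_expKernel_zero {z : ℂ} (hz : 0 < z.re) (x : Plane) :
    expKernel z x = expKernel (slitSqrt (z ^ 2 + (‖x‖ ^ 2 : ℝ))) 0 := by
  set q : ℝ → ℂ := fun s => z ^ 2 + (‖x‖ ^ 2 * (1 - s ^ 2) : ℝ) with hq
  set w : ℝ → ℂ := fun s => slitSqrt (q s) with hw
  have hqc : Continuous q := by simp only [hq]; fun_prop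
  have hqs : ∀ s ∈ Set.Icc (0 : ℝ) 1, q s ∈ Complex.slitPlane := fun s hs =>
    sq_add_mem_slitPlane hz (mul_nonneg (sq_nonneg _) (by nlinarith [hs.1, hs.2]))
  -- the kernel along the curve `(s x, √(z² + |x|² (1 - s²)))`, on which it is constant
  set F : ℝ → ℂ := fun s => ∫ ξ : Plane,
    Complex.exp (Complex.I * (s * inner ℝ x ξ : ℝ) - w s * japanese ξ) / japanese ξ with hF
  set w' : ℝ → ℂ := fun s => w s * ((-(2 * s * ‖x‖ ^ 2) : ℝ) / q s / 2) with hw'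
  have hderw : ∀ s, q s ∈ Complex.slitPlane → HasDerivAt w (w' s) s := by
    intro s hs
    have h1 : HasDerivAt q ((-(2 * s * ‖x‖ ^ 2) : ℝ) : ℂ) s := by
      have h2 : HasDerivAt (fun s : ℝ => ‖x‖ ^ 2 * (1 - s ^ 2)) (-(2 * s * ‖x‖ ^ 2)) s := by
        refine ((((hasDerivAt_id s).pow 2).const_sub 1).const_mul (‖x‖ ^ 2)).congr_deriv ?_
        simp; ring
      exact h2.ofReal_comp.const_add _
    exact ((h1.clog_real hs).div_const 2).cexp
  have hder : ∀ s ∈ Set.Icc (0 : ℝ) 1, HasDerivAt F 0 s := by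
    intro s hs
    have hev : ∀ᶠ s' in 𝓝 s, q s' ∈ Complex.slitPlane :=
      hqc.continuousAt.eventually (Complex.isOpen_slitPlane.mem_nhds (hqs s hs))
    have hre := slitSqrt_re_pos (hqs s hs)
    have hq0 := Complex.slitPlane_ne_zero (hqs s hs)
    have hwsq : w s ^ 2 = q s := slitSqrt_sq hq0
    have hw0 : w s ≠ 0 := by
      intro h0; rw [h0] at hwsq; exact hq0 (by rw [← hwsq]; ring)
    have hcw : ContinuousAt w s := (hderw s (hqs s hs)).continuousAt
    refine (hasDerivAt_expKernel_curve x (w := w) (w' := w') (hev.mono fun s' => hderw s') ?_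
      hre).congr_deriv ?_
    · refine hcw.mul (ContinuousAt.div_const (ContinuousAt.div ?_ hqc.continuousAt hq0) 2)
      exact Continuous.continuousAt (by fun_prop)
    · have hl := lorentz_identity hre x s
      have hJ0 := japanese_ofReal_ne_zero
      have e1 : ∀ ξ : Plane, Complex.exp (Complex.I * (s * inner ℝ x ξ : ℝ) - w s * japanese ξ)
            * (Complex.I * (inner ℝ x ξ : ℝ) - w' s * japanese ξ) / japanese ξ
          = Complex.I * ((inner ℝ x ξ : ℝ) *
            Complex.exp (Complex.I * (s * inner ℝ x ξ : ℝ) - w s * japanese ξ) / japanese ξ)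
            - w' s * Complex.exp (Complex.I * (s * inner ℝ x ξ : ℝ) - w s * japanese ξ) := by
        intro ξ
        have := hJ0 ξ
        field_simp
      simp only [e1]
      rw [integral_sub ((integrable_inner_mul_exp_phase_div hre x s).const_mul _)
        ((integrable_exp_phase hre x s).const_mul _), integral_const_mul, integral_const_mul]
      have hw's : w' s = -(s * ‖x‖ ^ 2) / w s := by
        simp only [hw']
        rw [← hwsq]
        push_cast
        field_simp
      have hl' : (∫ ξ : Plane, (inner ℝ x ξ : ℝ) *
          Complex.exp (Complex.I * (s * inner ℝ x ξ : ℝ) - w s * japanese ξ) / japanese ξ)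
          = Complex.I * s * ‖x‖ ^ 2 / w s * ∫ ξ : Plane,
            Complex.exp (Complex.I * (s * inner ℝ x ξ : ℝ) - w s * japanese ξ) := by
        rw [div_mul_eq_mul_div, eq_div_iff hw0, mul_comm]
        exact hl
      rw [hl', hw's]
      generalize (∫ ξ : Plane,
        Complex.exp (Complex.I * (s * inner ℝ x ξ : ℝ) - w s * japanese ξ)) = A
      field_simp
      rw [Complex.I_sq]
      ring
  have hconst := constant_of_has_deriv_right_zero (f := F) (a := 0) (b := 1)
    (fun s hs => (hder s hs).continuousAt.continuousWithinAt)
    (fun s hs => (hder s ⟨hs.1, hs.2.le⟩).hasDerivWithinAt) 1 (by norm_num)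
  have h1 : F 1 = expKernel z x := by
    have : w 1 = z := by
      have h2 : q 1 = z ^ 2 := by simp [hq]
      have h3 := hqs 1 (by norm_num)
      simp only [hw]
      rw [h2] at h3 ⊢
      exact slitSqrt_sq_self hz h3
    simp only [hF, expKernel, this, one_mul]
  have h0 : F 0 = expKernel (slitSqrt (z ^ 2 + (‖x‖ ^ 2 : ℝ))) 0 := by
    have : w 0 = slitSqrt (z ^ 2 + (‖x‖ ^ 2 : ℝ)) := by simp [hw, hq]
    simp only [hF, expKernel, this, zero_mul, inner_zero_left]
  rw [← h1, hconst, h0]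

/-- In polar coordinates `r e^{-w⟨r⟩} / ⟨r⟩` is a derivative. -/
theorem expKernel_apply_zero {w : ℂ} (hw : 0 < w.re) :
    expKernel w 0 = 2 * Real.pi * Complex.exp (-w) / w := by
  have hw0 : w ≠ 0 := fun h => by simp [h] at hw
  set J : ℝ → ℝ := fun r => Real.sqrt (1 + r ^ 2) with hJ
  have hJpos : ∀ r, 0 < J r := fun r => Real.sqrt_pos.2 (by positivity)
  have h1 : expKernel w 0
      = ∫ ξ : Plane, (fun r : ℝ => Complex.exp (-w * J r) / J r) ‖ξ‖ := by
    unfold expKernel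
    refine integral_congr_ae (Eventually.of_forall fun ξ => ?_)
    simp [hJ, japanese]
  have hint : Integrable fun ξ : Plane => (fun r : ℝ => Complex.exp (-w * J r) / J r) ‖ξ‖ := by
    have := integrable_exp_phase_div hw 0 0
    refine this.congr (Eventually.of_forall fun ξ => ?_)
    simp [hJ, japanese]
  have hint2 := (integrable_fun_norm_addHaar (volume : Measure Plane)
    (f := fun r : ℝ => Complex.exp (-w * J r) / J r)).1 hint
  have hvol : (volume : Measure Plane).real (Metric.ball 0 1) = Real.pi := by
    rw [Measure.real, EuclideanSpace.volume_ball_fin_two]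
    simp [Real.pi_pos.le]
  have hfr : Module.finrank ℝ Plane = 2 := by simp
  rw [hfr] at hint2
  rw [h1, integral_fun_norm_addHaar (volume : Measure Plane)
    (fun r : ℝ => Complex.exp (-w * J r) / J r), hfr, hvol]
  have hder : ∀ r : ℝ, HasDerivAt (fun r : ℝ => -(Complex.exp (-w * J r) / w))
      (r ^ (2 - 1) • (Complex.exp (-w * J r) / J r)) r := by
    intro r
    have h2 : HasDerivAt J (r / J r) r := by
      have h3 : HasDerivAt (fun r : ℝ => 1 + r ^ 2) (2 * r) r := by
        simpa using ((hasDerivAt_id r).pow 2).const_add 1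
      refine (h3.sqrt (by positivity)).congr_deriv ?_
      simp only [hJ]; field_simp
    refine ((((h2.ofReal_comp.const_mul (-w)).cexp).div_const w).neg).congr_deriv ?_
    have := (hJpos r).ne'
    have h4 : (J r : ℂ) ≠ 0 := by exact_mod_cast this
    push_cast
    rw [Complex.real_smul]
    field_simp
  have hlim : Tendsto (fun r : ℝ => -(Complex.exp (-w * J r) / w)) atTop (𝓝 0) := by
    rw [show (0 : ℂ) = -(0 / w) by simp]
    refine ((tendsto_zero_iff_norm_tendsto_zero.2 ?_).div_const w).neg
    have h5 : ∀ r, ‖Complex.exp (-w * J r)‖ = Real.exp (-(w.re * J r)) := fun r => by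
      rw [Complex.norm_exp]; simp
    simp only [h5]
    refine Real.tendsto_exp_neg_atTop_nhds_zero.comp (Tendsto.const_mul_atTop hw ?_)
    refine tendsto_atTop_mono (fun r => ?_) tendsto_id
    exact Real.le_sqrt_of_sq_le (by simp)
  rw [integral_Ioi_of_hasDerivAt_of_tendsto' (fun r _ => hder r) hint2 hlim]
  simp [hJ, Complex.real_smul]
  ring

/-- The dispersive estimate, uniform in `x`. -/
theorem norm_expKernel_le {ε t : ℝ} (hε : 0 < ε) (ht : t ≠ 0) (x : Plane) :
    ‖expKernel (ε + Complex.I * t) x‖ ≤ 2 * Real.pi / (ε * |t|) := by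
  set z : ℂ := ε + Complex.I * t with hz
  have hzre : z.re = ε := by simp [hz]
  have hzim : z.im = t := by simp [hz]
  have hzpos : 0 < z.re := by rw [hzre]; exact hε
  have hq := sq_add_mem_slitPlane hzpos (sq_nonneg ‖x‖)
  set w := slitSqrt (z ^ 2 + (‖x‖ ^ 2 : ℝ)) with hw
  have hwre : 0 < w.re := slitSqrt_re_pos hq
  have hwsq : w ^ 2 = z ^ 2 + (‖x‖ ^ 2 : ℝ) := slitSqrt_sq (Complex.slitPlane_ne_zero hq)
  -- the imaginary part of `w² = z² + |x|²` does not depend on `x`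
  have him : w.re * w.im = ε * t := by
    have h1 := congrArg Complex.im hwsq
    have h2 : (w ^ 2).im = 2 * (w.re * w.im) := by simp [sq]; ring
    have h3 : (z ^ 2 + (‖x‖ ^ 2 : ℝ)).im = 2 * (z.re * z.im) := by
      rw [Complex.add_im, Complex.ofReal_im]; simp [sq]; ring
    rw [h2, h3, hzre, hzim] at h1
    linarith
  rw [expKernel_eq_expKernel_zero hzpos, expKernel_apply_zero hwre, norm_div, norm_mul, norm_mul, Complex.norm_exp]
  have hn : 0 < ‖w‖ := norm_pos_iff.2 fun h => by rw [h] at hwre; simp at hwre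
  have habs : ε * |t| ≤ ‖w‖ * Real.exp w.re := by
    calc ε * |t| = |w.re * w.im| := by rw [him, abs_mul, abs_of_pos hε]
      _ = w.re * |w.im| := by rw [abs_mul, abs_of_pos hwre]
      _ ≤ Real.exp w.re * ‖w‖ := by
        gcongr
        · linarith [Real.add_one_le_exp w.re]
        · exact Complex.abs_im_le_norm w
      _ = _ := mul_comm _ _
  have ht' : 0 < ε * |t| := mul_pos hε (abs_pos.2 ht)
  rw [Complex.neg_re, Real.exp_neg, Complex.norm_real, Real.norm_of_nonneg Real.pi_pos.le,
    Complex.norm_ofNat, div_le_div_iff₀ hn ht']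
  calc 2 * Real.pi * (Real.exp w.re)⁻¹ * (ε * |t|)
      ≤ 2 * Real.pi * (Real.exp w.re)⁻¹ * (‖w‖ * Real.exp w.re) := by gcongr
    _ = _ := by field_simp

/-! ### Majorants of the kernel and the sum of mixed norms -/

/-- The kernel `∫ a(ξ) e^{-i(x·ξ + t⟨ξ⟩)} dξ` with amplitude `a`. -/
def freqKernel (a : Plane → ℝ) (p : SpaceTime) : ℂ :=
  ∫ ξ, a ξ * Complex.exp (-(Complex.I * (inner ℝ p.2 ξ + p.1 * japanese ξ)))

/-- The factor `2π` passes between the normalizations `e^{2πi x·ξ}` and `e^{i x·ξ}`. -/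
theorem waveKernel_dilate (a : Plane → ℝ) (p : SpaceTime) :
    waveKernel (fun ξ => a ((2 * Real.pi) • ξ)) p
      = ((2 * Real.pi) ^ 2)⁻¹ • freqKernel a p := by
  have h : ∀ ξ : Plane, (starRingEnd ℂ) (planeWave ξ p) * (a ((2 * Real.pi) • ξ) : ℝ)
      = (fun η : Plane => (a η : ℂ)
          * Complex.exp (-(Complex.I * (inner ℝ p.2 η + p.1 * japanese η))))
        ((2 * Real.pi) • ξ) := by
    intro ξ
    rw [mul_comm]
    unfold planeWave
    simp only [← Complex.exp_conj]
    congr 2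
    have h2 : (starRingEnd ℂ) 2 = 2 := Complex.conj_ofReal 2
    simp [inner_smul_right, real_inner_comm, h2]
    ring
  unfold waveKernel
  rw [integral_congr_ae (Eventually.of_forall h), Measure.integral_comp_smul volume
    (fun η : Plane => (a η : ℂ) * Complex.exp (-(Complex.I * (inner ℝ p.2 η + p.1 * japanese η))))]
  simp only [finrank_euclideanSpace, Fintype.card_fin]
  rw [abs_of_pos (by positivity)]
  rfl

theorem enorm_waveKernel_dilate_le (a : Plane → ℝ) (p : SpaceTime) :
    ‖waveKernel (fun ξ => a ((2 * Real.pi) • ξ)) p‖ₑ ≤ ENNReal.ofReal ‖freqKernel a p‖ := by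
  rw [waveKernel_dilate, ← ofReal_norm, norm_smul]
  refine ENNReal.ofReal_le_ofReal (mul_le_of_le_one_left (norm_nonneg _) ?_)
  rw [Real.norm_of_nonneg (by positivity)]
  exact inv_le_one_of_one_le₀ (one_le_pow₀ (by linarith [Real.pi_gt_three]))

theorem integrable_fourier_of_supported {f : L2} {D : Set Plane} (hD : Bornology.IsBounded D)
    (hf : FourierSupportedIn f D) : Integrable ((𝓕 f : L2) : Plane → ℂ) := by
  obtain ⟨R, hR⟩ := hD.subset_closedBall 0
  have h2 : IntegrableOn ((𝓕 f : L2) : Plane → ℂ) (Metric.closedBall 0 R) := by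
    have : IsFiniteMeasure ((volume : Measure Plane).restrict (Metric.closedBall 0 R)) :=
      ⟨by rw [Measure.restrict_apply_univ]; exact measure_closedBall_lt_top⟩
    exact ((Lp.memLp (𝓕 f : L2)).restrict _).integrable (by norm_num)
  refine h2.integrable_of_ae_notMem_eq_zero ?_
  filter_upwards [hf] with ξ hξ hnot
  by_contra hmem
  refine hmem (hξ fun hD' => hnot ?_)
  have h3 := hR hD'
  rw [mem_closedBall_zero_iff] at h3 ⊢
  refine le_trans ?_ h3
  rw [norm_smul, Real.norm_of_nonneg (by positivity)]
  nlinarith [norm_nonneg ξ, Real.pi_gt_three]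

theorem lintegral_indicator_abs_le (A c : ℝ) (hA : 0 ≤ A) :
    ∫⁻ s : ℝ, (Set.Icc (-c) c).indicator (fun _ => ENNReal.ofReal A) s
      = ENNReal.ofReal (2 * c * A) := by
  rw [lintegral_indicator measurableSet_Icc, setLIntegral_const, Real.volume_Icc,
    ← ENNReal.ofReal_mul hA]
  congr 1; ring

theorem lintegral_div_one_add_sq {B β : ℝ} (hB : 0 ≤ B) (hβ : 0 < β) :
    ∫⁻ s : ℝ, ENNReal.ofReal (B / (1 + (β * s) ^ 2)) = ENNReal.ofReal (Real.pi * B / β) := by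
  have h1 : (fun s : ℝ => B / (1 + (β * s) ^ 2)) = fun s => B * (fun x : ℝ => (1 + x ^ 2)⁻¹) (β * s) := by
    ext s; rw [div_eq_mul_inv]
  have hi : Integrable fun s : ℝ => B / (1 + (β * s) ^ 2) := by
    rw [h1]
    exact (integrable_inv_one_add_sq.comp_mul_left' hβ.ne').const_mul B
  rw [← ofReal_integral_eq_lintegral_ofReal hi (Eventually.of_forall fun s => by positivity), h1,
    integral_const_mul, Measure.integral_comp_mul_left (fun x : ℝ => (1 + x ^ 2)⁻¹) β, integral_univ_inv_one_add_sq,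
    abs_of_pos (by positivity)]
  congr 1
  simp only [smul_eq_mul]; ring

/-- The `TT^*` bound in the form in which it is used: the kernel is dominated by `A` times the
number of frames whose coordinate is at most `c`, plus a tail in the coordinate of one frame. -/
theorem sumNorm_le_of_majorant {S : Finset (ℝ × Plane)} {e : ℝ × Plane → ℝ × (ℝ × ℝ) → SpaceTime}
    {σ : ℝ × Plane → SpaceTime → ℝ} (hch : ∀ Θ ∈ S, IsChart (e Θ) (σ Θ)) {f : L2} {D : Set Plane}
    (hD : Bornology.IsBounded D) (hf : FourierSupportedIn f D) (T : ℝ) {a : Plane → ℝ}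
    (hai : Integrable a) (ha0 : ∀ ξ, 0 ≤ a ξ) (ha1 : ∀ ξ ∈ D, 1 ≤ a ξ)
    {Θ₀ : ℝ × Plane} (hΘ₀ : Θ₀ ∈ S) {A B c β L : ℝ} (hA : 0 ≤ A) (hB : 0 ≤ B) (hc : 0 ≤ c)
    (hβ : 0 < β) (hL : 0 < L)
    (hK : ∀ p : SpaceTime, |p.1| ≤ 2 * T → ‖freqKernel a p‖
      ≤ A * (S.filter fun Θ => |σ Θ p| ≤ c).card + B / (1 + (β * σ Θ₀ p) ^ 2))
    (hsum : 2 * c * A * S.card + Real.pi * B / β ≤ L ^ 2) :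
    sumNorm (fun Θ => mixedNorm (e Θ)) S (truncatedWave T f) ≤ ENNReal.ofReal (L * ‖f‖) := by
  classical
  have hpi : (2 * Real.pi) ≠ 0 := by positivity
  -- every frame carries the indicator of `|s| ≤ c`, and `Θ₀` also the tail
  set M : ℝ × Plane → ℝ → ℝ≥0∞ := fun Θ s =>
    (Set.Icc (-c) c).indicator (fun _ => ENNReal.ofReal A) s
      + if Θ = Θ₀ then ENNReal.ofReal (B / (1 + (β * s) ^ 2)) else 0 with hM
  have hm1 : Measurable fun s : ℝ =>
      (Set.Icc (-c) c).indicator (fun _ => ENNReal.ofReal A) s :=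
    measurable_const.indicator measurableSet_Icc
  have hmeas : ∀ Θ, Measurable (M Θ) := by
    intro Θ
    refine hm1.add ?_
    split_ifs
    · fun_prop
    · exact measurable_const
  refine sumNorm_truncatedWave_le S e σ hch f (integrable_fourier_of_supported hD hf) T
    (fun ξ => a ((2 * Real.pi) • ξ)) (hai.comp_smul hpi) (fun ξ => ha0 _) ?_ M
    (fun Θ _ => hmeas Θ) ?_ hL ?_
  · filter_upwards [hf] with ξ hξ hne
    by_contra hlt
    exact hne (hξ fun hmem => hlt (ha1 _ hmem))
  · intro p hp
    refine (enorm_waveKernel_dilate_le a p).trans ((ENNReal.ofReal_le_ofReal (hK p hp)).trans ?_)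
    rw [ENNReal.ofReal_add (by positivity) (by positivity)]
    simp only [hM]
    rw [Finset.sum_add_distrib]
    refine add_le_add ?_ ?_
    · have h1 : ∀ Θ, (Set.Icc (-c) c).indicator (fun _ => ENNReal.ofReal A) (σ Θ p)
          = if |σ Θ p| ≤ c then ENNReal.ofReal A else 0 := by
        intro Θ
        simp only [Set.indicator_apply, Set.mem_Icc, abs_le]
      simp only [h1]
      rw [← Finset.sum_filter, Finset.sum_const, nsmul_eq_mul, ENNReal.ofReal_mul hA,
        ENNReal.ofReal_natCast, mul_comm]
    · rw [Finset.sum_ite_eq' S Θ₀, if_pos hΘ₀]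
  · have h1 : ∀ Θ, ∫⁻ s, M Θ s
        = ENNReal.ofReal (2 * c * A) + if Θ = Θ₀ then ENNReal.ofReal (Real.pi * B / β) else 0 := by
      intro Θ
      simp only [hM]
      rw [lintegral_add_left hm1, lintegral_indicator_abs_le A c hA]
      congr 1
      split_ifs
      · exact lintegral_div_one_add_sq hB hβ
      · simp
    simp only [h1]
    rw [Finset.sum_add_distrib, Finset.sum_ite_eq' S Θ₀, if_pos hΘ₀, Finset.sum_const,
      nsmul_eq_mul, ← ENNReal.ofReal_natCast, ← ENNReal.ofReal_mul (by positivity),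
      ← ENNReal.ofReal_add (by positivity) (by positivity)]
    refine ENNReal.ofReal_le_ofReal (le_trans (le_of_eq ?_) hsum)
    ring

/-! ### Dispersion of localized kernels -/

/-- Fourier inversion: a bump function is an absolutely convergent superposition of characters. -/
theorem exists_fourier_superposition {β : ℝ → ℝ} (hβ : ContDiff ℝ (⊤ : ℕ∞) β)
    (hc : HasCompactSupport β) :
    ∃ φ : ℝ → ℂ, Integrable φ ∧ Continuous φ ∧
      ∀ s : ℝ, (β s : ℂ) = ∫ η : ℝ, Complex.exp (Complex.I * (2 * Real.pi * η * s)) * φ η := by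
  have hc' : HasCompactSupport fun s => (β s : ℂ) := hc.comp_left (g := fun x : ℝ => (x : ℂ)) rfl
  have hs' : ContDiff ℝ (⊤ : ℕ∞) fun s => (β s : ℂ) := Complex.ofRealCLM.contDiff.comp hβ
  set S : SchwartzMap ℝ ℂ := hc'.toSchwartzMap hs' with hS
  refine ⟨(𝓕 S : SchwartzMap ℝ ℂ), (𝓕 S : SchwartzMap ℝ ℂ).integrable,
    (𝓕 S : SchwartzMap ℝ ℂ).continuous, fun s => ?_⟩
  have h1 : (β s : ℂ) = (𝓕⁻ (𝓕 S : SchwartzMap ℝ ℂ) : SchwartzMap ℝ ℂ) s := by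
    rw [FourierTransform.fourierInv_fourier_eq]; simp [hS]
  rw [h1, SchwartzMap.fourierInv_coe, Real.fourierInv_eq']
  refine integral_congr_ae (Eventually.of_forall fun η => ?_)
  simp only [smul_eq_mul]
  congr 2
  simp
  ring

/-- Multiplication of an amplitude by a bump function of a linear functional averages the
oscillatory integral over translates; hence bounds uniform in `x` are preserved. -/
theorem exists_bump_multiplier {β : ℝ → ℝ} (hβ : ContDiff ℝ (⊤ : ℕ∞) β)
    (hc : HasCompactSupport β) :
    ∃ C : ℝ, 0 ≤ C ∧ ∀ (G : Plane → ℂ) (M : ℝ), Integrable G →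
      (∀ v : Plane, ‖∫ ξ, Complex.exp (Complex.I * (inner ℝ v ξ : ℝ)) * G ξ‖ ≤ M) →
      ∀ ν v : Plane, ‖∫ ξ, Complex.exp (Complex.I * (inner ℝ v ξ : ℝ))
        * ((β (inner ℝ ν ξ) : ℂ) * G ξ)‖ ≤ C * M := by
  obtain ⟨φ, hφ, hφc, hrep⟩ := exists_fourier_superposition hβ hc
  refine ⟨∫ η, ‖φ η‖, integral_nonneg fun _ => norm_nonneg _, fun G M hG hM ν v => ?_⟩
  let k : Plane → ℝ → ℂ := fun ξ η =>
    Complex.exp (Complex.I * (2 * Real.pi * η * (inner ℝ ν ξ : ℝ)))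
  let b : Plane → ℂ := fun ξ => Complex.exp (Complex.I * (inner ℝ v ξ : ℝ)) * G ξ
  have hbi : Integrable b := by
    refine (hG.bdd_mul (c := 1) ?_ ?_)
    · exact Continuous.aestronglyMeasurable (by fun_prop)
    · refine Eventually.of_forall fun ξ => ?_
      rw [mul_comm, Complex.norm_exp_ofReal_mul_I]
  have hkn : ∀ ξ η, ‖k ξ η‖ = 1 := by
    intro ξ η
    have : Complex.I * (2 * Real.pi * η * (inner ℝ ν ξ : ℝ))
        = ((2 * Real.pi * η * inner ℝ ν ξ : ℝ) : ℂ) * Complex.I := by push_cast; ring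
    simp only [k]
    rw [this, Complex.norm_exp_ofReal_mul_I]
  have hkm : AEStronglyMeasurable (fun w : Plane × ℝ => k w.1 w.2)
      ((volume : Measure Plane).prod (volume : Measure ℝ)) :=
    Continuous.aestronglyMeasurable (by simp only [k]; fun_prop)
  have hint0 : Integrable (fun w : Plane × ℝ => b w.1 * φ w.2)
      ((volume : Measure Plane).prod (volume : Measure ℝ)) := hbi.mul_prod hφ
  have hint : Integrable (fun w : Plane × ℝ => b w.1 * (k w.1 w.2 * φ w.2))
      ((volume : Measure Plane).prod (volume : Measure ℝ)) := by
    have h1 : Integrable (fun w : Plane × ℝ => k w.1 w.2 * (b w.1 * φ w.2))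
        ((volume : Measure Plane).prod (volume : Measure ℝ)) :=
      hint0.bdd_mul (c := 1) hkm (Eventually.of_forall fun w => (hkn _ _).le)
    refine h1.congr (Eventually.of_forall fun w => ?_)
    simp only; ring
  have hswap := integral_integral_mul_swap b k φ hint
  have hleft : ∀ ξ, ∫ η, b ξ * (k ξ η * φ η)
      = Complex.exp (Complex.I * (inner ℝ v ξ : ℝ)) * ((β (inner ℝ ν ξ) : ℂ) * G ξ) := by
    intro ξ
    rw [integral_const_mul, ← hrep]
    simp only [b]; ring
  rw [integral_congr_ae (Eventually.of_forall hleft)] at hswap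
  rw [hswap, ← integral_mul_const]
  refine norm_integral_le_of_norm_le (hφ.norm.mul_const M) (Eventually.of_forall fun η => ?_)
  rw [norm_mul, mul_comm]
  refine mul_le_mul_of_nonneg_left ?_ (norm_nonneg _)
  have h2 : ∫ ξ, k ξ η * b ξ
      = ∫ ξ, Complex.exp (Complex.I * (inner ℝ (v + (2 * Real.pi * η) • ν) ξ : ℝ)) * G ξ := by
    refine integral_congr_ae (Eventually.of_forall fun ξ => ?_)
    simp only [k, b]
    rw [← mul_assoc, ← Complex.exp_add, inner_add_left, real_inner_smul_left]
    congr 2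
    push_cast; ring
  rw [h2]
  exact hM _

/-- The amplitude `β₁(ξ·ω/X) β₂(ξ·ω^⊥/Y) e^{-ε⟨ξ⟩} / ⟨ξ⟩`. -/
def bump (β₁ β₂ : ℝ → ℝ) (X Y ε : ℝ) (ω : Plane) (ξ : Plane) : ℝ :=
  β₁ (inner ℝ ω ξ / X) * β₂ (inner ℝ (perp ω) ξ / Y) * (Real.exp (-(ε * japanese ξ)) / japanese ξ)

theorem continuous_bump {β₁ β₂ : ℝ → ℝ} (h₁ : Continuous β₁) (h₂ : Continuous β₂) (X Y ε : ℝ)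
    (ω : Plane) : Continuous (bump β₁ β₂ X Y ε ω) := by
  unfold bump
  have := continuous_japanese
  refine Continuous.mul (by fun_prop) (Continuous.div (by fun_prop) this ?_)
  exact fun ξ => (japanese_pos ξ).ne'

theorem integrable_exp_mul_div_japanese {ε : ℝ} (hε : 0 < ε) (t : ℝ) :
    Integrable fun ξ : Plane => Complex.exp (-((ε + Complex.I * t) * japanese ξ)) / japanese ξ := by
  have h := integrable_exp_phase_div (z := ε + Complex.I * t) (by simpa using hε) 0 0
  refine h.congr (Eventually.of_forall fun ξ => ?_)
  simp

theorem integrable_bump {β₁ β₂ : ℝ → ℝ} (h₁ : Continuous β₁) (h₂ : Continuous β₂)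
    (hc₁ : HasCompactSupport β₁) (hc₂ : HasCompactSupport β₂) (X Y : ℝ) {ε : ℝ} (hε : 0 < ε)
    (ω : Plane) : Integrable (bump β₁ β₂ X Y ε ω) := by
  obtain ⟨C₁, hC₁⟩ := hc₁.exists_bound_of_continuous h₁
  obtain ⟨C₂, hC₂⟩ := hc₂.exists_bound_of_continuous h₂
  have h := (integrable_exp_mul_div_japanese hε 0).norm.const_mul (C₁ * C₂)
  refine h.mono' (continuous_bump h₁ h₂ X Y ε ω).aestronglyMeasurable
    (Eventually.of_forall fun ξ => ?_)
  have h3 : ‖Complex.exp (-((ε + Complex.I * (0 : ℝ)) * japanese ξ)) / japanese ξ‖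
      = ‖Real.exp (-(ε * japanese ξ)) / japanese ξ‖ := by
    rw [norm_div, norm_div, Complex.norm_exp, Complex.norm_real, Real.norm_of_nonneg
      (Real.exp_pos _).le]
    simp
  rw [h3]
  unfold bump
  rw [norm_mul, norm_mul]
  have := (norm_nonneg _).trans (hC₁ 0)
  gcongr
  · exact hC₁ _
  · exact hC₂ _

theorem freqKernel_bump (β₁ β₂ : ℝ → ℝ) (X Y ε : ℝ) (ω : Plane) (p : SpaceTime) :
    freqKernel (bump β₁ β₂ X Y ε ω) p
      = ∫ ξ, Complex.exp (Complex.I * (inner ℝ (-p.2) ξ : ℝ)) *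
        ((β₁ (inner ℝ (X⁻¹ • ω) ξ) : ℂ) * ((β₂ (inner ℝ (Y⁻¹ • perp ω) ξ) : ℂ) *
          (Complex.exp (-((ε + Complex.I * p.1) * japanese ξ)) / japanese ξ))) := by
  unfold freqKernel bump
  refine integral_congr_ae (Eventually.of_forall fun ξ => ?_)
  simp only [real_inner_smul_left, inner_neg_left]
  rw [div_eq_inv_mul (inner ℝ ω ξ), div_eq_inv_mul (inner ℝ (perp ω) ξ)]
  push_cast
  have h1 : Complex.exp (-((ε + Complex.I * p.1) * japanese ξ))
      = Complex.exp (-(ε * japanese ξ)) * Complex.exp (-(Complex.I * (p.1 * japanese ξ))) := by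
    rw [← Complex.exp_add]; congr 1; ring
  have h2 : Complex.exp (-(Complex.I * ((inner ℝ p.2 ξ : ℝ) + p.1 * japanese ξ)))
      = Complex.exp (Complex.I * -(inner ℝ p.2 ξ : ℝ))
        * Complex.exp (-(Complex.I * (p.1 * japanese ξ))) := by
    rw [← Complex.exp_add]; congr 1; ring
  rw [h1, h2]
  ring

/-- The dispersive estimate for the localized kernels, with a constant that does not depend on the
scales of localization. -/
theorem exists_norm_freqKernel_bump_le {β₁ β₂ : ℝ → ℝ} (h₁ : ContDiff ℝ (⊤ : ℕ∞) β₁)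
    (h₂ : ContDiff ℝ (⊤ : ℕ∞) β₂) (hc₁ : HasCompactSupport β₁) (hc₂ : HasCompactSupport β₂) :
    ∃ C : ℝ, 0 ≤ C ∧ ∀ (X Y ε : ℝ) (ω : Plane) (p : SpaceTime), 0 < ε → p.1 ≠ 0 →
      ‖freqKernel (bump β₁ β₂ X Y ε ω) p‖ ≤ C / (ε * |p.1|) := by
  obtain ⟨C₁, h0₁, hC₁⟩ := exists_bump_multiplier h₁ hc₁
  obtain ⟨C₂, h0₂, hC₂⟩ := exists_bump_multiplier h₂ hc₂
  refine ⟨C₁ * (C₂ * (2 * Real.pi)), by positivity, fun X Y ε ω p hε ht => ?_⟩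
  have hG := integrable_exp_mul_div_japanese hε p.1
  have hM : ∀ v : Plane, ‖∫ ξ, Complex.exp (Complex.I * (inner ℝ v ξ : ℝ)) *
      (Complex.exp (-((ε + Complex.I * p.1) * japanese ξ)) / japanese ξ)‖
      ≤ 2 * Real.pi / (ε * |p.1|) := by
    intro v
    refine le_trans (le_of_eq ?_) (norm_expKernel_le hε ht v)
    unfold expKernel
    congr 1
    refine integral_congr_ae (Eventually.of_forall fun ξ => ?_)
    simp only
    rw [← mul_div_assoc, ← Complex.exp_add]
    congr 2
  have h3 := hC₂ _ _ hG hM (Y⁻¹ • perp ω)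
  obtain ⟨B, hB⟩ := hc₂.exists_bound_of_continuous h₂.continuous
  have hG' : Integrable fun ξ : Plane => (β₂ (inner ℝ (Y⁻¹ • perp ω) ξ) : ℂ) *
      (Complex.exp (-((ε + Complex.I * p.1) * japanese ξ)) / japanese ξ) := by
    refine hG.bdd_mul (c := B) ?_ (Eventually.of_forall fun ξ => ?_)
    · have := h₂.continuous
      exact Continuous.aestronglyMeasurable (by fun_prop)
    · rw [Complex.norm_real]; exact hB _
  have h4 := hC₁ _ _ hG' h3 (X⁻¹ • ω) (-p.2)
  rw [freqKernel_bump]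
  refine h4.trans (le_of_eq ?_)
  ring

/-! ### Nonstationary phase -/

/-- Nonstationary phase: integrating by parts twice gains `(ΦX)^{-2}`, where `Φ` is a lower bound
of the derivative of the phase and `X` the scale on which phase and amplitude vary. -/
theorem norm_integral_exp_mul_le {a b : ℝ} (hab : a ≤ b) {ψ g g₁ g₂ A A₁ A₂ : ℝ → ℂ}
    (hψ : ∀ u, HasDerivAt ψ (g u) u) (hg : ∀ u, HasDerivAt g (g₁ u) u)
    (hg₁ : ∀ u, HasDerivAt g₁ (g₂ u) u) (hA : ∀ u, HasDerivAt A (A₁ u) u)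
    (hA₁ : ∀ u, HasDerivAt A₁ (A₂ u) u) (hg₂ : Continuous g₂) (hA₂ : Continuous A₂)
    (hAa : A a = 0) (hAb : A b = 0) (hA₁a : A₁ a = 0) (hA₁b : A₁ b = 0)
    {Φ X B M : ℝ} (hΦ : 0 < Φ) (hX : 0 < X) (hB : 0 ≤ B) (hM : 0 ≤ M)
    (hre : ∀ u ∈ Set.Icc a b, (ψ u).re ≤ 0) (hgΦ : ∀ u ∈ Set.Icc a b, Φ ≤ ‖g u‖)
    (hg₁B : ∀ u ∈ Set.Icc a b, ‖g₁ u‖ ≤ B * Φ / X)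
    (hg₂B : ∀ u ∈ Set.Icc a b, ‖g₂ u‖ ≤ B * Φ / X ^ 2)
    (hAM : ∀ u ∈ Set.Icc a b, ‖A u‖ ≤ M) (hA₁M : ∀ u ∈ Set.Icc a b, ‖A₁ u‖ ≤ M / X)
    (hA₂M : ∀ u ∈ Set.Icc a b, ‖A₂ u‖ ≤ M / X ^ 2) :
    ‖∫ u in a..b, Complex.exp (ψ u) * A u‖
      ≤ M * (1 + 4 * B + 3 * B ^ 2) / (X * Φ) ^ 2 * (b - a) := by
  have hgne : ∀ u ∈ Set.Icc a b, g u ≠ 0 := fun u hu h => by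
    have := hgΦ u hu; rw [h, norm_zero] at this; linarith
  -- `H` is the sum of the boundary terms of two integrations by parts, and `e^ψ Q` the integrand
  -- that remains
  let Q : ℝ → ℂ := fun u => A₂ u / g u ^ 2 - 3 * A₁ u * g₁ u / g u ^ 3 - A u * g₂ u / g u ^ 3
    + 3 * A u * g₁ u ^ 2 / g u ^ 4
  let H : ℝ → ℂ := fun u =>
    Complex.exp (ψ u) * (A u / g u - (A₁ u / g u ^ 2 - A u * g₁ u / g u ^ 3))
  have hH : ∀ u ∈ Set.Icc a b,
      HasDerivAt H (Complex.exp (ψ u) * A u - Complex.exp (ψ u) * Q u) u := by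
    intro u hu
    have h0 := hgne u hu
    have h := (hψ u).cexp.mul (((hA u).div (hg u) h0).sub
      (((hA₁ u).div ((hg u).pow 2) (pow_ne_zero 2 h0)).sub
        (((hA u).mul (hg₁ u)).div ((hg u).pow 3) (pow_ne_zero 3 h0))))
    refine h.congr_deriv ?_
    simp only [Q, Pi.pow_apply, Pi.div_apply, Pi.sub_apply, Pi.mul_apply]
    field_simp
    push_cast
    ring
  have cψ : Continuous ψ := continuous_iff_continuousAt.2 fun u => (hψ u).continuousAt
  have cg : Continuous g := continuous_iff_continuousAt.2 fun u => (hg u).continuousAt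
  have cg₁ : Continuous g₁ := continuous_iff_continuousAt.2 fun u => (hg₁ u).continuousAt
  have cA : Continuous A := continuous_iff_continuousAt.2 fun u => (hA u).continuousAt
  have cA₁ : Continuous A₁ := continuous_iff_continuousAt.2 fun u => (hA₁ u).continuousAt
  have cQ : ContinuousOn Q (Set.Icc a b) := by
    have : ∀ (n : ℕ), ∀ u ∈ Set.Icc a b, g u ^ n ≠ 0 := fun n u hu => pow_ne_zero n (hgne u hu)
    refine (((ContinuousOn.div (by fun_prop) (by fun_prop) (this 2)).sub
      (ContinuousOn.div (by fun_prop) (by fun_prop) (this 3))).sub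
      (ContinuousOn.div (by fun_prop) (by fun_prop) (this 3))).add
      (ContinuousOn.div (by fun_prop) (by fun_prop) (this 4))
  have i1 : IntervalIntegrable (fun u => Complex.exp (ψ u) * A u) volume a b :=
    Continuous.intervalIntegrable (by fun_prop) a b
  have i2 : IntervalIntegrable (fun u => Complex.exp (ψ u) * Q u) volume a b := by
    refine ContinuousOn.intervalIntegrable ?_
    rw [Set.uIcc_of_le hab]
    exact (by fun_prop : Continuous fun u => Complex.exp (ψ u)).continuousOn.mul cQ
  have hFTC := intervalIntegral.integral_eq_sub_of_hasDerivAt (a := a) (b := b) (f := H)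
    (by rw [Set.uIcc_of_le hab]; exact hH) (i1.sub i2)
  have hHa : H a = 0 := by simp [H, hAa, hA₁a]
  have hHb : H b = 0 := by simp [H, hAb, hA₁b]
  rw [intervalIntegral.integral_sub i1 i2, hHa, hHb, sub_zero, sub_eq_zero] at hFTC
  rw [hFTC]
  have hQ : ∀ u ∈ Set.Icc a b, ‖Q u‖ ≤ M * (1 + 4 * B + 3 * B ^ 2) / (X * Φ) ^ 2 := by
    intro u hu
    have hG := hgΦ u hu
    have hpow : ∀ n : ℕ, Φ ^ n ≤ ‖g u‖ ^ n := fun n => pow_le_pow_left₀ hΦ.le hG n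
    have e1 : ‖A₂ u / g u ^ 2‖ ≤ (M / X ^ 2) / Φ ^ 2 := by
      rw [norm_div, norm_pow]
      exact div_le_div₀ (by positivity) (hA₂M u hu) (by positivity) (hpow 2)
    have e2 : ‖3 * A₁ u * g₁ u / g u ^ 3‖ ≤ (3 * (M / X) * (B * Φ / X)) / Φ ^ 3 := by
      rw [norm_div, norm_pow, norm_mul, norm_mul, Complex.norm_ofNat]
      refine div_le_div₀ (by positivity) ?_ (by positivity) (hpow 3)
      gcongr
      · exact hA₁M u hu
      · exact hg₁B u hu
    have e3 : ‖A u * g₂ u / g u ^ 3‖ ≤ (M * (B * Φ / X ^ 2)) / Φ ^ 3 := by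
      rw [norm_div, norm_pow, norm_mul]
      refine div_le_div₀ (by positivity) ?_ (by positivity) (hpow 3)
      gcongr
      · exact hAM u hu
      · exact hg₂B u hu
    have e4 : ‖3 * A u * g₁ u ^ 2 / g u ^ 4‖ ≤ (3 * M * (B * Φ / X) ^ 2) / Φ ^ 4 := by
      rw [norm_div, norm_pow, norm_mul, norm_mul, Complex.norm_ofNat, norm_pow]
      refine div_le_div₀ (by positivity) ?_ (by positivity) (hpow 4)
      gcongr
      · exact hAM u hu
      · exact hg₁B u hu
    calc ‖Q u‖ ≤ ‖A₂ u / g u ^ 2‖ + ‖3 * A₁ u * g₁ u / g u ^ 3‖ + ‖A u * g₂ u / g u ^ 3‖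
          + ‖3 * A u * g₁ u ^ 2 / g u ^ 4‖ :=
          (norm_add_le _ _).trans (add_le_add_left ((norm_sub_le _ _).trans
            (add_le_add_left (norm_sub_le _ _) _)) _)
      _ ≤ (M / X ^ 2) / Φ ^ 2 + (3 * (M / X) * (B * Φ / X)) / Φ ^ 3
          + (M * (B * Φ / X ^ 2)) / Φ ^ 3 + (3 * M * (B * Φ / X) ^ 2) / Φ ^ 4 := by gcongr
      _ = _ := by field_simp; ring
  have hbd := intervalIntegral.norm_integral_le_of_norm_le_const (a := a) (b := b)
    (f := fun u => Complex.exp (ψ u) * Q u) (C := M * (1 + 4 * B + 3 * B ^ 2) / (X * Φ) ^ 2)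
    (by
      intro u hu
      rw [Set.uIoc_of_le hab] at hu
      have hu' := Set.Ioc_subset_Icc_self hu
      rw [norm_mul, Complex.norm_exp]
      exact (mul_le_of_le_one_left (norm_nonneg _) (Real.exp_le_one_iff.2 (hre u hu'))).trans
        (hQ u hu'))
  rwa [abs_of_nonneg (by linarith)] at hbd

/-- The restriction of `⟨ξ⟩` to a line. -/
def lineJ (p u : ℝ) : ℝ := Real.sqrt (p + u ^ 2)

theorem lineJ_sq {p : ℝ} (hp : 1 ≤ p) (u : ℝ) : lineJ p u ^ 2 = p + u ^ 2 :=
  Real.sq_sqrt (by positivity)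

theorem lineJ_pos {p : ℝ} (hp : 1 ≤ p) (u : ℝ) : 0 < lineJ p u :=
  Real.sqrt_pos.2 (by positivity)

theorem abs_le_lineJ {p : ℝ} (hp : 1 ≤ p) (u : ℝ) : |u| ≤ lineJ p u :=
  Real.le_sqrt_of_sq_le (by rw [sq_abs]; linarith)

theorem hasDerivAt_lineJ {p : ℝ} (hp : 1 ≤ p) (u : ℝ) :
    HasDerivAt (lineJ p) (u / lineJ p u) u := by
  have h : HasDerivAt (fun u : ℝ => p + u ^ 2) (2 * u) u := by
    simpa using ((hasDerivAt_id u).pow 2).const_add p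
  refine (h.sqrt (by positivity)).congr_deriv ?_
  have := (lineJ_pos hp u).ne'
  unfold lineJ at *
  field_simp

theorem hasDerivAt_div_lineJ {p : ℝ} (hp : 1 ≤ p) (u : ℝ) :
    HasDerivAt (fun u => u / lineJ p u) (p / lineJ p u ^ 3) u := by
  have h0 := (lineJ_pos hp u).ne'
  refine ((hasDerivAt_id u).div (hasDerivAt_lineJ hp u) h0).congr_deriv ?_
  have := lineJ_sq hp u
  simp only [id]
  field_simp
  linear_combination this

theorem hasDerivAt_inv_lineJ {p : ℝ} (hp : 1 ≤ p) (u : ℝ) :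
    HasDerivAt (fun u => 1 / lineJ p u) (-(u / lineJ p u ^ 3)) u := by
  have h0 := (lineJ_pos hp u).ne'
  refine ((hasDerivAt_const u (1 : ℝ)).div (hasDerivAt_lineJ hp u) h0).congr_deriv ?_
  field_simp
  ring

theorem hasDerivAt_const_div_lineJ_pow {p : ℝ} (hp : 1 ≤ p) (u : ℝ) :
    HasDerivAt (fun u => p / lineJ p u ^ 3) (-(3 * p * u / lineJ p u ^ 5)) u := by
  have h0 := (lineJ_pos hp u).ne'
  refine ((hasDerivAt_const u p).div ((hasDerivAt_lineJ hp u).pow 3)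
    (pow_ne_zero 3 h0)).congr_deriv ?_
  simp only [Pi.pow_apply]
  field_simp
  push_cast
  ring

theorem hasDerivAt_neg_div_lineJ_pow {p : ℝ} (hp : 1 ≤ p) (u : ℝ) :
    HasDerivAt (fun u => -(u / lineJ p u ^ 3)) (-(1 / lineJ p u ^ 3 - 3 * u ^ 2 / lineJ p u ^ 5))
      u := by
  have h0 := (lineJ_pos hp u).ne'
  refine (((hasDerivAt_id u).div ((hasDerivAt_lineJ hp u).pow 3)
    (pow_ne_zero 3 h0)).neg).congr_deriv ?_
  simp only [Pi.pow_apply, id]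
  field_simp
  push_cast
  ring

theorem continuous_lineJ (p : ℝ) : Continuous (lineJ p) := by unfold lineJ; fun_prop

/-! ### Oscillatory integrals on a line -/

/-- The integrand of a localized kernel on a line parallel to an axis; `p` is one plus the square
of the frozen frequency variable. -/
def lineIntegrand (β : ℝ → ℝ) (X p ε t y u : ℝ) : ℂ :=
  Complex.exp (-(Complex.I * (y * u)) - (ε + Complex.I * t) * lineJ p u)
    * ((β (u / X) * (1 / lineJ p u) : ℝ) : ℂ)

/-- A common bound for a bump function and its first two derivatives. -/
theorem exists_bump_bounds {β : ℝ → ℝ} (hβ : ContDiff ℝ (⊤ : ℕ∞) β) (hc : HasCompactSupport β) :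
    ∃ M : ℝ, 0 ≤ M ∧ (∀ s, |β s| ≤ M) ∧ (∀ s, |deriv β s| ≤ M) ∧ ∀ s, |deriv (deriv β) s| ≤ M := by
  have h1 : ContDiff ℝ (⊤ : ℕ∞) (deriv β) := ((contDiff_infty_iff_deriv).1 hβ).2
  have h2 : ContDiff ℝ (⊤ : ℕ∞) (deriv (deriv β)) := ((contDiff_infty_iff_deriv).1 h1).2
  obtain ⟨M₀, hM₀⟩ := hc.exists_bound_of_continuous hβ.continuous
  obtain ⟨M₁, hM₁⟩ := hc.deriv.exists_bound_of_continuous h1.continuous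
  obtain ⟨M₂, hM₂⟩ := hc.deriv.deriv.exists_bound_of_continuous h2.continuous
  refine ⟨max (max M₀ M₁) M₂, ?_, fun s => ?_, fun s => ?_, fun s => ?_⟩
  · exact ((norm_nonneg _).trans (hM₀ 0)).trans (le_max_of_le_left (le_max_left _ _))
  · exact (hM₀ s).trans (le_max_of_le_left (le_max_left _ _))
  · exact (hM₁ s).trans (le_max_of_le_left (le_max_right _ _))
  · exact (hM₂ s).trans (le_max_right _ _)

theorem norm_exp_line_le {p ε t y u : ℝ} (hp : 1 ≤ p) (hε : 0 ≤ ε) :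
    ‖Complex.exp (-(Complex.I * (y * u)) - (ε + Complex.I * t) * lineJ p u)‖ ≤ 1 := by
  rw [Complex.norm_exp, Real.exp_le_one_iff]
  have := mul_nonneg hε (lineJ_pos hp u).le
  simpa using this

theorem integral_lineIntegrand_eq {β : ℝ → ℝ} {a b X : ℝ} (hX : 0 < X)
    (hsupp : tsupport β ⊆ Set.Ioo a b) (p ε t y : ℝ) :
    ∫ u, lineIntegrand β X p ε t y u = ∫ u in (X * a)..(X * b), lineIntegrand β X p ε t y u := by
  symm
  apply intervalIntegral.integral_eq_integral_of_support_subset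
  intro u hu
  have h1 : β (u / X) ≠ 0 := by
    intro h
    apply hu
    simp [lineIntegrand, h]
  have h2 := hsupp (subset_tsupport _ h1)
  rw [Set.mem_Ioo, lt_div_iff₀ hX, div_lt_iff₀ hX] at h2
  exact ⟨by linarith [h2.1], by linarith [h2.2]⟩

/-- The bound by the length of the support and the size `1 / j` of the amplitude. -/
theorem exists_norm_integral_line_le_trivial {β : ℝ → ℝ} (hβ : ContDiff ℝ (⊤ : ℕ∞) β)
    (hc : HasCompactSupport β) {a b : ℝ} (hab : a ≤ b) (hsupp : tsupport β ⊆ Set.Ioo a b) :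
    ∃ C : ℝ, 0 ≤ C ∧ ∀ X j p ε t y : ℝ, 0 < X → 0 < j → 1 ≤ p → 0 ≤ ε →
      (∀ u ∈ Set.Icc (X * a) (X * b), j ≤ lineJ p u) →
      ‖∫ u, lineIntegrand β X p ε t y u‖ ≤ C * (X / j) := by
  obtain ⟨M, hM, hM₀, -, -⟩ := exists_bump_bounds hβ hc
  have hba : 0 ≤ b - a := sub_nonneg.2 hab
  refine ⟨M * (b - a), by positivity, fun X j p ε t y hX hj hp hε hJ => ?_⟩
  have hle : X * a ≤ X * b := by gcongr
  rw [integral_lineIntegrand_eq hX hsupp]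
  refine (intervalIntegral.norm_integral_le_of_norm_le_const (C := M / j) fun u hu => ?_).trans ?_
  · rw [Set.uIoc_of_le hle] at hu
    unfold lineIntegrand
    rw [norm_mul, Complex.norm_real, Real.norm_eq_abs, abs_mul, abs_div, abs_one,
      abs_of_pos (lineJ_pos hp u), mul_one_div]
    refine (mul_le_of_le_one_left (by have := lineJ_pos hp u; positivity)
      (norm_exp_line_le hp hε)).trans ?_
    exact div_le_div₀ hM (hM₀ _) hj (hJ u (Set.Ioc_subset_Icc_self hu))
  · rw [abs_of_nonneg (by linarith)]
    apply le_of_eq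
    ring

/-- The second derivative of the phase is `O(Φ / X)`, as nonstationary phase requires. Here `p /
⟨ξ⟩³` is the derivative of the speed `u / ⟨ξ⟩`, and `e` collects the constants. -/
theorem line_speed_bound {p e ε t X Φ u : ℝ} (hp : 1 ≤ p) (he : 0 < e) (hX : 0 < X)
    (hXΦ : 1 ≤ X * Φ) (hεX : ε * X ≤ e) (hXJ : X ≤ e * lineJ p u)
    (ht : |t| * (p / lineJ p u ^ 3) * X ≤ e * Φ) :
    (ε + |t|) * (p / lineJ p u ^ 3) ≤ (e ^ 2 + e) * Φ / X := by
  have hJ := lineJ_pos hp u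
  have h1 : p / lineJ p u ^ 3 ≤ e / X := by
    rw [div_le_div_iff₀ (by positivity) hX]
    have h2 : p ≤ lineJ p u ^ 2 := by rw [lineJ_sq hp]; nlinarith [sq_nonneg u]
    calc p * X ≤ lineJ p u ^ 2 * (e * lineJ p u) := by gcongr
      _ = _ := by ring
  have h3 : ε ≤ e / X := by rwa [le_div_iff₀ hX]
  have h4 : |t| * (p / lineJ p u ^ 3) ≤ e * Φ / X := by rwa [le_div_iff₀ hX]
  have h5 : 1 / X ≤ Φ := by rw [div_le_iff₀ hX]; linarith
  calc (ε + |t|) * (p / lineJ p u ^ 3) = ε * (p / lineJ p u ^ 3) + |t| * (p / lineJ p u ^ 3) := by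
        ring
    _ ≤ e / X * (e / X) + e * Φ / X := by gcongr
    _ = e ^ 2 / X * (1 / X) + e * Φ / X := by ring
    _ ≤ e ^ 2 / X * Φ + e * Φ / X := by gcongr
    _ = _ := by ring

/-- Each derivative of the amplitude `β(u/X) / ⟨ξ⟩` costs a factor `1 / X`, since `X = O(⟨ξ⟩)`. The
numbers `b₀, b₁, b₂` stand for the values of `β` and its first two derivatives. -/
theorem abs_amplitude_deriv_le {p e X j M u b₀ b₁ b₂ : ℝ} (hp : 1 ≤ p) (he : 0 < e) (hX : 0 < X)
    (hj : 0 < j) (hM : 0 ≤ M) (hjJ : j ≤ lineJ p u) (hXJ : X ≤ e * lineJ p u)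
    (h₀ : |b₀| ≤ M) (h₁ : |b₁| ≤ M) (h₂ : |b₂| ≤ M) :
    |b₀ * (1 / lineJ p u)| ≤ M / j ∧
    |b₁ / X * (1 / lineJ p u) + b₀ * -(u / lineJ p u ^ 3)| ≤ M * (1 + e) / j / X ∧
    |b₂ / X / X * (1 / lineJ p u) + b₁ / X * -(u / lineJ p u ^ 3)
      + (b₁ / X * -(u / lineJ p u ^ 3)
        + b₀ * -(1 / lineJ p u ^ 3 - 3 * u ^ 2 / lineJ p u ^ 5))|
      ≤ M * (1 + 2 * e + 4 * e ^ 2) / j / X ^ 2 := by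
  have hJ := lineJ_pos hp u
  obtain ⟨i, hi⟩ : ∃ i, i = 1 / lineJ p u := ⟨_, rfl⟩
  have hipos : 0 < i := by rw [hi]; positivity
  have hij : i ≤ 1 / j := by rw [hi]; gcongr
  have hiX : i ≤ e / X := by
    rw [hi, div_le_div_iff₀ hJ hX]; linarith
  have hr : |u * i| ≤ 1 := by
    rw [hi, mul_one_div, abs_div, abs_of_pos hJ]
    exact (div_le_one₀ hJ).2 (abs_le_lineJ hp u)
  have hr2 : (u * i) ^ 2 ≤ 1 := by rw [← sq_abs]; exact pow_le_one₀ (abs_nonneg _) hr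
  have e3 : u / lineJ p u ^ 3 = (u * i) * i * i := by rw [hi]; field_simp
  have e4 : 1 / lineJ p u ^ 3 - 3 * u ^ 2 / lineJ p u ^ 5 = (1 - 3 * (u * i) ^ 2) * (i * i * i) := by
    rw [hi]; field_simp
  have hd : |1 - 3 * (u * i) ^ 2| ≤ 4 := by
    rw [abs_le]; constructor <;> nlinarith [sq_nonneg (u * i)]
  rw [e3, e4, ← hi]
  have k1 : |b₁ / X| ≤ M / X := by rw [abs_div, abs_of_pos hX]; gcongr
  have k2 : |b₂ / X / X| ≤ M / X / X := by
    rw [abs_div, abs_div, abs_of_pos hX]; gcongr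
  have k3 : |(u * i) * i * i| ≤ 1 * (1 / j) * (e / X) := by
    rw [abs_mul, abs_mul, abs_of_pos hipos]; gcongr
  have k4 : |(1 - 3 * (u * i) ^ 2) * (i * i * i)| ≤ 4 * ((1 / j) * (e / X) * (e / X)) := by
    rw [abs_mul, abs_of_pos (a := i * i * i) (by positivity)]; gcongr
  have k5 : |i| ≤ 1 / j := by rwa [abs_of_pos hipos]
  refine ⟨?_, ?_, ?_⟩
  · rw [abs_mul]
    calc |b₀| * |i| ≤ M * (1 / j) := by gcongr
      _ = _ := by ring
  · refine (abs_add_le _ _).trans ?_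
    rw [abs_mul, abs_mul, abs_neg]
    calc |b₁ / X| * |i| + |b₀| * |u * i * i * i|
        ≤ M / X * (1 / j) + M * (1 * (1 / j) * (e / X)) := by gcongr
      _ = _ := by ring
  · refine (abs_add_le _ _).trans ((add_le_add (abs_add_le _ _) (abs_add_le _ _)).trans ?_)
    rw [abs_mul, abs_mul, abs_mul, abs_neg, abs_neg]
    calc |b₂ / X / X| * |i| + |b₁ / X| * |u * i * i * i| + (|b₁ / X| * |u * i * i * i|
          + |b₀| * |(1 - 3 * (u * i) ^ 2) * (i * i * i)|)
        ≤ M / X / X * (1 / j) + M / X * (1 * (1 / j) * (e / X)) + (M / X * (1 * (1 / j) * (e / X))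
          + M * (4 * ((1 / j) * (e / X) * (e / X)))) := by gcongr
      _ = _ := by ring

/-- The tail estimate on a line: `Φ` bounds the speed of the phase from below, `X` is the scale of
the bump, and `j` a lower bound of `⟨ξ⟩` on its support. -/
theorem exists_norm_integral_line_le {β : ℝ → ℝ} (hβ : ContDiff ℝ (⊤ : ℕ∞) β)
    (hc : HasCompactSupport β) {a b : ℝ} (hab : a ≤ b) (hsupp : tsupport β ⊆ Set.Ioo a b)
    {c : ℝ} (hcpos : 0 < c) :
    ∃ C : ℝ, 0 ≤ C ∧ ∀ X j p ε t y Φ : ℝ, 0 < X → 0 < j → 1 ≤ p → 0 ≤ ε → 0 ≤ Φ →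
      c * X ≤ j → ε * X ≤ c⁻¹ →
      (∀ u ∈ Set.Icc (X * a) (X * b), j ≤ lineJ p u ∧ |t| * (p / lineJ p u ^ 3) * X ≤ c⁻¹ * Φ ∧
        Φ ≤ |y + t * (u / lineJ p u)|) →
      ‖∫ u, lineIntegrand β X p ε t y u‖ ≤ C * (X / j) / (1 + (X * Φ) ^ 2) := by
  obtain ⟨C₀, hC₀, htriv⟩ := exists_norm_integral_line_le_trivial hβ hc hab hsupp
  obtain ⟨M, hM, hM₀, hM₁, hM₂⟩ := exists_bump_bounds hβ hc
  have hba : 0 ≤ b - a := sub_nonneg.2 hab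
  set e : ℝ := c⁻¹ with he
  have hepos : 0 < e := by positivity
  have hec : e * c = 1 := inv_mul_cancel₀ hcpos.ne'
  set B : ℝ := (e ^ 2 + e) * (1 + 3 * e) with hB
  set K : ℝ := 1 + 3 * e + 6 * e ^ 2 with hK
  refine ⟨2 * (C₀ + M * K * (1 + 4 * B + 3 * B ^ 2) * (b - a)), by positivity,
    fun X j p ε t y Φ hX hj hp hε hΦ hcX hεX hcond => ?_⟩
  have hle : X * a ≤ X * b := by gcongr
  by_cases hXΦ : X * Φ < 1
  · -- if `XΦ < 1`, the decay factor is at least `1/2`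
    refine (htriv X j p ε t y hX hj hp hε fun u hu => (hcond u hu).1).trans ?_
    rw [le_div_iff₀ (by positivity)]
    have h1 : (X * Φ) ^ 2 ≤ 1 := by
      have : 0 ≤ X * Φ := by positivity
      nlinarith
    have h2 : 0 ≤ M * K * (1 + 4 * B + 3 * B ^ 2) * (b - a) := by positivity
    have h3 : 0 ≤ X / j := by positivity
    calc C₀ * (X / j) * (1 + (X * Φ) ^ 2) ≤ C₀ * (X / j) * 2 := by gcongr; linarith
      _ ≤ 2 * (C₀ + M * K * (1 + 4 * B + 3 * B ^ 2) * (b - a)) * (X / j) := by nlinarith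
  push Not at hXΦ
  have hΦpos : 0 < Φ := by
    rcases hΦ.lt_or_eq with h | h
    · exact h
    · rw [← h] at hXΦ; norm_num at hXΦ
  have hXj : X ≤ e * j := by
    calc X = e * (c * X) := by rw [← mul_assoc, hec, one_mul]
      _ ≤ e * j := by gcongr
  -- the phase
  have hz : ‖(ε : ℂ) + Complex.I * t‖ ≤ ε + |t| := by
    refine (norm_add_le _ _).trans ?_
    simp [abs_of_nonneg hε]
  have hcJ := continuous_lineJ p
  have hJne : ∀ u, lineJ p u ≠ 0 := fun u => (lineJ_pos hp u).ne'
  have dβ : ∀ u, HasDerivAt (fun u => β (u / X)) (deriv β (u / X) / X) u := fun u => by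
    have := (((hβ.differentiable (by simp)) (u / X)).hasDerivAt).comp u ((hasDerivAt_id u).div_const X)
    exact this.congr_deriv (by simp; ring)
  have hβ1 : ContDiff ℝ (⊤ : ℕ∞) (deriv β) := ((contDiff_infty_iff_deriv).1 hβ).2
  have dβ1 : ∀ u, HasDerivAt (fun u => deriv β (u / X) / X) (deriv (deriv β) (u / X) / X / X) u :=
    fun u => by
    have := ((((hβ1.differentiable (by simp)) (u / X)).hasDerivAt).comp u
      ((hasDerivAt_id u).div_const X)).div_const X
    exact this.congr_deriv (by simp; ring)
  have hβ2 : Continuous (deriv (deriv β)) := (((contDiff_infty_iff_deriv).1 hβ1).2).continuous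
  have cβ := hβ.continuous
  have cβ1 := hβ1.continuous
  have hend : ∀ s, s ∉ Set.Ioo a b → β s = 0 ∧ deriv β s = 0 := by
    intro s hs
    have h1 : s ∉ tsupport β := fun h => hs (hsupp h)
    exact ⟨image_eq_zero_of_notMem_tsupport h1,
      image_eq_zero_of_notMem_tsupport fun h => h1 (tsupport_deriv_subset h)⟩
  have hXa : X * a / X = a := by field_simp
  have hXb : X * b / X = b := by field_simp
  have hJj : ∀ u ∈ Set.Icc (X * a) (X * b), j ≤ lineJ p u := fun u hu => (hcond u hu).1
  have hXJ : ∀ u ∈ Set.Icc (X * a) (X * b), X ≤ e * lineJ p u := fun u hu =>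
    hXj.trans (by gcongr; exact hJj u hu)
  -- the derivative of `u / ⟨ξ⟩` is `p / ⟨ξ⟩³`, and it bounds all higher derivatives of the phase
  have hspeed : ∀ u ∈ Set.Icc (X * a) (X * b),
      (ε + |t|) * (p / lineJ p u ^ 3) ≤ (e ^ 2 + e) * Φ / X := fun u hu =>
    line_speed_bound hp hepos hX hXΦ hεX (hXJ u hu) (hcond u hu).2.1
  have hmain := norm_integral_exp_mul_le hle
    (ψ := fun u => -(Complex.I * (y * u)) - (ε + Complex.I * t) * lineJ p u)
    (g := fun u => -(Complex.I * y) - (ε + Complex.I * t) * ((u / lineJ p u : ℝ) : ℂ))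
    (g₁ := fun u => -((ε + Complex.I * t) * ((p / lineJ p u ^ 3 : ℝ) : ℂ)))
    (g₂ := fun u => -((ε + Complex.I * t) * ((-(3 * p * u / lineJ p u ^ 5) : ℝ) : ℂ)))
    (A := fun u => ((β (u / X) * (1 / lineJ p u) : ℝ) : ℂ))
    (A₁ := fun u => ((deriv β (u / X) / X * (1 / lineJ p u)
      + β (u / X) * -(u / lineJ p u ^ 3) : ℝ) : ℂ))
    (A₂ := fun u => ((deriv (deriv β) (u / X) / X / X * (1 / lineJ p u)
      + deriv β (u / X) / X * -(u / lineJ p u ^ 3)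
      + (deriv β (u / X) / X * -(u / lineJ p u ^ 3)
        + β (u / X) * -(1 / lineJ p u ^ 3 - 3 * u ^ 2 / lineJ p u ^ 5)) : ℝ) : ℂ))
    (Φ := Φ) (X := X) (B := B) (M := M * K / j)
    (by
      intro u
      have h1 : HasDerivAt (fun u : ℝ => Complex.I * ((y : ℂ) * (u : ℂ))) (Complex.I * y) u := by
        have := ((hasDerivAt_id u).ofReal_comp.const_mul (y : ℂ)).const_mul Complex.I
        exact this.congr_deriv (by simp)
      exact h1.neg.sub ((hasDerivAt_lineJ hp u).ofReal_comp.const_mul _))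
    (by
      intro u
      exact (((hasDerivAt_div_lineJ hp u).ofReal_comp.const_mul _).const_sub _))
    (by
      intro u
      exact ((hasDerivAt_const_div_lineJ_pow hp u).ofReal_comp.const_mul _).neg)
    (by
      intro u
      exact ((dβ u).mul (hasDerivAt_inv_lineJ hp u)).ofReal_comp)
    (by
      intro u
      exact (((dβ1 u).mul (hasDerivAt_inv_lineJ hp u)).add
        ((dβ u).mul (hasDerivAt_neg_div_lineJ_pow hp u))).ofReal_comp)
    (by
      have : Continuous fun u => -(3 * p * u / lineJ p u ^ 5) :=
        (Continuous.div (by fun_prop) (by fun_prop) fun u => pow_ne_zero 5 (hJne u)).neg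
      fun_prop)
    (by
      have c1 : Continuous fun u => 1 / lineJ p u :=
        Continuous.div (by fun_prop) (by fun_prop) hJne
      have c2 : Continuous fun u => u / lineJ p u ^ 3 :=
        Continuous.div (by fun_prop) (by fun_prop) fun u => pow_ne_zero 3 (hJne u)
      have c3 : Continuous fun u => 1 / lineJ p u ^ 3 :=
        Continuous.div (by fun_prop) (by fun_prop) fun u => pow_ne_zero 3 (hJne u)
      have c4 : Continuous fun u => 3 * u ^ 2 / lineJ p u ^ 5 :=
        Continuous.div (by fun_prop) (by fun_prop) fun u => pow_ne_zero 5 (hJne u)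
      fun_prop)
    (by simp [hXa, (hend a (by simp)).1]) (by simp [hXb, (hend b (by simp)).1])
    (by simp [hXa, (hend a (by simp)).1, (hend a (by simp)).2])
    (by simp [hXb, (hend b (by simp)).1, (hend b (by simp)).2])
    hΦpos hX (by positivity) (by positivity)
    (by
      intro u _
      have := mul_nonneg hε (lineJ_pos hp u).le
      simpa using this)
    (by
      intro u hu
      refine (hcond u hu).2.2.trans (le_trans (le_of_eq ?_) (Complex.abs_im_le_norm _))
      rw [← abs_neg]
      congr 1
      simp only [Complex.sub_im, Complex.neg_im, Complex.mul_im, Complex.add_im, Complex.add_re,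
        Complex.mul_re, Complex.I_re, Complex.I_im, Complex.ofReal_re, Complex.ofReal_im]
      ring)
    (by
      intro u hu
      rw [norm_neg, norm_mul, Complex.norm_real, Real.norm_of_nonneg
        (by have := lineJ_pos hp u; positivity)]
      refine (mul_le_mul_of_nonneg_right hz (by have := lineJ_pos hp u; positivity)).trans
        ((hspeed u hu).trans ?_)
      rw [hB]
      have h7 : (e ^ 2 + e) ≤ (e ^ 2 + e) * (1 + 3 * e) := by
        nlinarith [mul_pos (by positivity : 0 < e ^ 2 + e) hepos]
      gcongr)
    (by
      intro u hu
      have hJ := lineJ_pos hp u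
      rw [norm_neg, norm_mul, Complex.norm_real, Real.norm_eq_abs, abs_neg]
      have h7 : |3 * p * u / lineJ p u ^ 5| ≤ p / lineJ p u ^ 3 * (3 * e / X) := by
        have h8 : 3 * p * u / lineJ p u ^ 5 = p / lineJ p u ^ 3 * (3 * (u / lineJ p u) * (1 / lineJ p u)) := by
          field_simp
        have h9 : |u / lineJ p u| ≤ 1 := by
          rw [abs_div, abs_of_pos hJ]; exact (div_le_one₀ hJ).2 (abs_le_lineJ hp u)
        have h10 : 1 / lineJ p u ≤ e / X := by
          rw [div_le_div_iff₀ hJ hX]; linarith [hXJ u hu]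
        rw [h8, abs_mul, abs_of_nonneg (a := p / lineJ p u ^ 3) (by positivity)]
        gcongr
        rw [abs_mul, abs_mul, abs_of_pos (a := 1 / lineJ p u) (by positivity),
          abs_of_pos (by norm_num : (0 : ℝ) < 3)]
        calc 3 * |u / lineJ p u| * (1 / lineJ p u) ≤ 3 * 1 * (e / X) := by gcongr
          _ = _ := by ring
      calc ‖(ε : ℂ) + Complex.I * t‖ * |3 * p * u / lineJ p u ^ 5|
          ≤ (ε + |t|) * (p / lineJ p u ^ 3 * (3 * e / X)) := by gcongr
        _ = (ε + |t|) * (p / lineJ p u ^ 3) * (3 * e / X) := by ring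
        _ ≤ (e ^ 2 + e) * Φ / X * (3 * e / X) := by
            have := hspeed u hu
            gcongr
        _ = (e ^ 2 + e) * (3 * e) * Φ / X ^ 2 := by ring
        _ ≤ B * Φ / X ^ 2 := by
            rw [hB]
            have : (e ^ 2 + e) * (3 * e) ≤ (e ^ 2 + e) * (1 + 3 * e) := by gcongr; linarith
            gcongr)
    (by
      intro u hu
      rw [Complex.norm_real, Real.norm_eq_abs]
      refine (abs_amplitude_deriv_le hp hepos hX hj hM (hJj u hu) (hXJ u hu) (hM₀ (u / X))
        (hM₁ (u / X)) (hM₂ (u / X))).1.trans ?_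
      have : M ≤ M * K := le_mul_of_one_le_right hM (by rw [hK]; nlinarith)
      gcongr)
    (by
      intro u hu
      rw [Complex.norm_real, Real.norm_eq_abs]
      refine (abs_amplitude_deriv_le hp hepos hX hj hM (hJj u hu) (hXJ u hu) (hM₀ (u / X))
        (hM₁ (u / X)) (hM₂ (u / X))).2.1.trans ?_
      have : 1 + e ≤ K := by rw [hK]; nlinarith
      gcongr)
    (by
      intro u hu
      rw [Complex.norm_real, Real.norm_eq_abs]
      refine (abs_amplitude_deriv_le hp hepos hX hj hM (hJj u hu) (hXJ u hu) (hM₀ (u / X))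
        (hM₁ (u / X)) (hM₂ (u / X))).2.2.trans ?_
      have : 1 + 2 * e + 4 * e ^ 2 ≤ K := by rw [hK]; nlinarith
      gcongr)
  rw [integral_lineIntegrand_eq hX hsupp]
  refine hmain.trans ?_
  have h4 : (1 + (X * Φ) ^ 2) ≤ 2 * (X * Φ) ^ 2 := by nlinarith
  have h5 : 0 ≤ C₀ * (X / j) := by positivity
  have h6 : 0 ≤ M * K * (1 + 4 * B + 3 * B ^ 2) * (b - a) * (X / j) := by positivity
  calc M * K / j * (1 + 4 * B + 3 * B ^ 2) / (X * Φ) ^ 2 * (X * b - X * a)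
      = 2 * (M * K * (1 + 4 * B + 3 * B ^ 2) * (b - a) * (X / j)) / (2 * (X * Φ) ^ 2) := by
        field_simp
    _ ≤ 2 * (M * K * (1 + 4 * B + 3 * B ^ 2) * (b - a) * (X / j)) / (1 + (X * Φ) ^ 2) := by
        gcongr
    _ ≤ _ := by
        refine div_le_div_of_nonneg_right ?_ (by positivity)
        linarith

/-! ### Decay of localized kernels -/

theorem japanese_planeMap {ω : Plane} (hω : ‖ω‖ = 1) (u v : ℝ) :
    japanese (planeMap ω (u, v)) = lineJ (1 + v ^ 2) u := by
  unfold japanese lineJ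
  rw [norm_sq_planeMap hω]
  congr 1; ring

theorem lineJ_comm (u v : ℝ) : lineJ (1 + v ^ 2) u = lineJ (1 + u ^ 2) v := by
  unfold lineJ; congr 1; ring

/-- The integrand of a localized kernel in the coordinates `ξ = u ω + v ω^⊥`. -/
def bumpIntegrand (β₁ β₂ : ℝ → ℝ) (X Y ε t y₁ y₂ : ℝ) (z : ℝ × ℝ) : ℂ :=
  (Complex.exp (-(Complex.I * (y₂ * z.2))) * (β₂ (z.2 / Y) : ℂ))
    * lineIntegrand β₁ X (1 + z.2 ^ 2) ε t y₁ z.1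

theorem bumpIntegrand_comm (β₁ β₂ : ℝ → ℝ) (X Y ε t y₁ y₂ : ℝ) (z : ℝ × ℝ) :
    bumpIntegrand β₁ β₂ X Y ε t y₁ y₂ z = bumpIntegrand β₂ β₁ Y X ε t y₂ y₁ z.swap := by
  have h : ∀ a b c d e : ℂ, ∀ p q : ℝ, Complex.exp (-a) * (p : ℂ)
      * (Complex.exp (-b - c) * ((q * (1 / lineJ (1 + z.2 ^ 2) z.1) : ℝ) : ℂ))
      = Complex.exp (-b) * (q : ℂ)
        * (Complex.exp (-a - c) * ((p * (1 / lineJ (1 + z.2 ^ 2) z.1) : ℝ) : ℂ)) := by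
    intro a b c d e p q
    rw [sub_eq_add_neg, sub_eq_add_neg, Complex.exp_add, Complex.exp_add]
    push_cast; ring
  unfold bumpIntegrand lineIntegrand
  simp only [Prod.fst_swap, Prod.snd_swap, ← lineJ_comm z.1 z.2]
  exact h _ _ _ 0 0 _ _

theorem bump_phase_planeMap (β₁ β₂ : ℝ → ℝ) (X Y ε : ℝ) {ω : Plane} (hω : ‖ω‖ = 1)
    (p : SpaceTime) (z : ℝ × ℝ) :
    (bump β₁ β₂ X Y ε ω (planeMap ω z) : ℂ) * Complex.exp (-(Complex.I *
        (inner ℝ p.2 (planeMap ω z) + p.1 * japanese (planeMap ω z))))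
      = bumpIntegrand β₁ β₂ X Y ε p.1 (inner ℝ p.2 ω) (inner ℝ p.2 (perp ω)) z := by
  obtain ⟨u, v⟩ := z
  have h1 : inner ℝ p.2 (planeMap ω (u, v))
      = u * inner ℝ p.2 ω + v * inner ℝ p.2 (perp ω) := by
    simp only [planeMap, inner_add_right, inner_smul_right]
  unfold bump bumpIntegrand lineIntegrand
  rw [real_inner_comm, inner_planeMap hω, real_inner_comm, inner_planeMap_perp hω,
    japanese_planeMap hω, h1]
  have h2 : Complex.exp (-(Complex.I * (((u * inner ℝ p.2 ω + v * inner ℝ p.2 (perp ω) : ℝ) : ℂ)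
      + p.1 * lineJ (1 + v ^ 2) u)))
      = Complex.exp (-(Complex.I * ((inner ℝ p.2 (perp ω) : ℝ) * (v : ℂ))))
        * Complex.exp (-(Complex.I * ((inner ℝ p.2 ω : ℝ) * (u : ℂ)))
          - Complex.I * p.1 * lineJ (1 + v ^ 2) u) := by
    rw [← Complex.exp_add]; congr 1; push_cast; ring
  have h3 : Complex.exp (-(Complex.I * ((inner ℝ p.2 ω : ℝ) * (u : ℂ)))
      - (ε + Complex.I * p.1) * lineJ (1 + v ^ 2) u)
      = Complex.exp (-(ε * lineJ (1 + v ^ 2) u)) * Complex.exp (-(Complex.I *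
        ((inner ℝ p.2 ω : ℝ) * (u : ℂ))) - Complex.I * p.1 * lineJ (1 + v ^ 2) u) := by
    rw [← Complex.exp_add]; congr 1; ring
  rw [h2, h3]
  push_cast
  ring

theorem integrable_bump_phase {β₁ β₂ : ℝ → ℝ} (h₁ : Continuous β₁) (h₂ : Continuous β₂)
    (hc₁ : HasCompactSupport β₁) (hc₂ : HasCompactSupport β₂) (X Y : ℝ) {ε : ℝ} (hε : 0 < ε)
    (ω : Plane) (p : SpaceTime) :
    Integrable fun ξ => (bump β₁ β₂ X Y ε ω ξ : ℂ) * Complex.exp (-(Complex.I *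
        (inner ℝ p.2 ξ + p.1 * japanese ξ))) := by
  have hcJ := continuous_japanese
  refine (integrable_bump h₁ h₂ hc₁ hc₂ X Y hε ω).ofReal.mul_bdd (c := 1)
    (Continuous.aestronglyMeasurable (by fun_prop)) (Eventually.of_forall fun ξ => ?_)
  have : -(Complex.I * (((inner ℝ p.2 ξ : ℝ) : ℂ) + p.1 * japanese ξ))
      = ((-(inner ℝ p.2 ξ + p.1 * japanese ξ) : ℝ) : ℂ) * Complex.I := by push_cast; ring
  rw [this, Complex.norm_exp_ofReal_mul_I]

theorem integrable_bumpIntegrand {β₁ β₂ : ℝ → ℝ} (h₁ : Continuous β₁) (h₂ : Continuous β₂)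
    (hc₁ : HasCompactSupport β₁) (hc₂ : HasCompactSupport β₂) (X Y : ℝ) {ε : ℝ} (hε : 0 < ε)
    {ω : Plane} (hω : ‖ω‖ = 1) (p : SpaceTime) :
    Integrable (bumpIntegrand β₁ β₂ X Y ε p.1 (inner ℝ p.2 ω) (inner ℝ p.2 (perp ω)))
      ((volume : Measure ℝ).prod volume) := by
  have h := (measurePreserving_planeMap hω).integrable_comp_of_integrable
    (integrable_bump_phase h₁ h₂ hc₁ hc₂ X Y hε ω p)
  exact h.congr (Eventually.of_forall fun z => bump_phase_planeMap β₁ β₂ X Y ε hω p z)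

/-- The kernel in the coordinates along `ω` and `ω^⊥`. -/
theorem freqKernel_bump_eq {β₁ β₂ : ℝ → ℝ} (h₁ : Continuous β₁) (h₂ : Continuous β₂)
    (hc₁ : HasCompactSupport β₁) (hc₂ : HasCompactSupport β₂) (X Y : ℝ) {ε : ℝ} (hε : 0 < ε)
    {ω : Plane} (hω : ‖ω‖ = 1) (p : SpaceTime) :
    freqKernel (bump β₁ β₂ X Y ε ω) p
      = ∫ z, bumpIntegrand β₁ β₂ X Y ε p.1 (inner ℝ p.2 ω) (inner ℝ p.2 (perp ω)) z
        ∂((volume : Measure ℝ).prod volume) := by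
  unfold freqKernel
  have hmp := measurePreserving_planeMap hω
  have hm := (integrable_bump_phase h₁ h₂ hc₁ hc₂ X Y hε ω p).1
  rw [← hmp.map_eq] at hm ⊢
  rw [integral_map hmp.measurable.aemeasurable hm]
  exact integral_congr_ae (Eventually.of_forall fun z => bump_phase_planeMap β₁ β₂ X Y ε hω p z)

/-- The frozen variable contributes the length of its support. -/
theorem norm_integral_bump_mul_le {β : ℝ → ℝ} {M : ℝ} (hM : ∀ s, |β s| ≤ M) {a b : ℝ}
    (hab : a ≤ b) (hsupp : tsupport β ⊆ Set.Ioo a b) {Y : ℝ} (hY : 0 < Y) {G : ℝ → ℂ} {D : ℝ}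
    (hG : ∀ v ∈ Set.Icc (Y * a) (Y * b), ‖G v‖ ≤ D) (y : ℝ) :
    ‖∫ v : ℝ, (Complex.exp (-(Complex.I * (y * v))) * (β (v / Y) : ℂ)) * G v‖
      ≤ M * (b - a) * Y * D := by
  have hle : Y * a ≤ Y * b := by gcongr
  have hM0 : 0 ≤ M := (abs_nonneg _).trans (hM 0)
  have h1 : ∫ v : ℝ, (Complex.exp (-(Complex.I * (y * v))) * (β (v / Y) : ℂ)) * G v
      = ∫ v in (Y * a)..(Y * b), (Complex.exp (-(Complex.I * (y * v))) * (β (v / Y) : ℂ)) * G v := by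
    symm
    apply intervalIntegral.integral_eq_integral_of_support_subset
    intro u hu
    have h1 : β (u / Y) ≠ 0 := by
      intro h
      apply hu
      simp [h]
    have h2 := hsupp (subset_tsupport _ h1)
    rw [Set.mem_Ioo, lt_div_iff₀ hY, div_lt_iff₀ hY] at h2
    exact ⟨by linarith [h2.1], by linarith [h2.2]⟩
  rw [h1]
  refine (intervalIntegral.norm_integral_le_of_norm_le_const (C := M * D) fun u hu => ?_).trans ?_
  · rw [Set.uIoc_of_le hle] at hu
    have : -(Complex.I * ((y : ℂ) * u)) = ((-(y * u) : ℝ) : ℂ) * Complex.I := by push_cast; ring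
    rw [norm_mul, norm_mul, this, Complex.norm_exp_ofReal_mul_I, one_mul, Complex.norm_real]
    exact mul_le_mul (hM _) (hG u (Set.Ioc_subset_Icc_self hu)) (norm_nonneg _) hM0
  · rw [abs_of_nonneg (by linarith)]
    apply le_of_eq; ring

/-- Smooth functions `β₁, β₂` with compact supports in the intervals `(a₁, b₁)`, `(a₂, b₂)`: the
cutoffs in the directions `ω` and `ω^⊥`. -/
structure IsBumpPair (β₁ β₂ : ℝ → ℝ) (a₁ b₁ a₂ b₂ : ℝ) : Prop where
  smooth₁ : ContDiff ℝ (⊤ : ℕ∞) β₁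
  smooth₂ : ContDiff ℝ (⊤ : ℕ∞) β₂
  compact₁ : HasCompactSupport β₁
  compact₂ : HasCompactSupport β₂
  le₁ : a₁ ≤ b₁
  le₂ : a₂ ≤ b₂
  supp₁ : tsupport β₁ ⊆ Set.Ioo a₁ b₁
  supp₂ : tsupport β₂ ⊆ Set.Ioo a₂ b₂

section

variable {β₁ β₂ : ℝ → ℝ} {a₁ b₁ a₂ b₂ : ℝ}

theorem IsBumpPair.norm_freqKernel_le_of_line (h : IsBumpPair β₁ β₂ a₁ b₁ a₂ b₂) {M : ℝ}
    (hM : ∀ s, |β₂ s| ≤ M) {X Y ε D : ℝ} (hY : 0 < Y) (hε : 0 < ε) {ω : Plane}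
    (hω : ‖ω‖ = 1) (p : SpaceTime)
    (hline : ∀ v ∈ Set.Icc (Y * a₂) (Y * b₂),
      ‖∫ u, lineIntegrand β₁ X (1 + v ^ 2) ε p.1 (inner ℝ p.2 ω) u‖ ≤ D) :
    ‖freqKernel (bump β₁ β₂ X Y ε ω) p‖ ≤ M * (b₂ - a₂) * Y * D := by
  rw [freqKernel_bump_eq h.smooth₁.continuous h.smooth₂.continuous h.compact₁ h.compact₂ X Y hε hω,
    integral_prod_symm _ (integrable_bumpIntegrand h.smooth₁.continuous h.smooth₂.continuous
      h.compact₁ h.compact₂ X Y hε hω p)]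
  unfold bumpIntegrand
  simp only [integral_const_mul]
  exact norm_integral_bump_mul_le hM h.le₂ h.supp₂ hY hline _

theorem IsBumpPair.norm_freqKernel_le_of_line_perp (h : IsBumpPair β₁ β₂ a₁ b₁ a₂ b₂) {M : ℝ}
    (hM : ∀ s, |β₁ s| ≤ M) {X Y ε D : ℝ} (hX : 0 < X) (hε : 0 < ε) {ω : Plane}
    (hω : ‖ω‖ = 1) (p : SpaceTime)
    (hline : ∀ u ∈ Set.Icc (X * a₁) (X * b₁),
      ‖∫ v, lineIntegrand β₂ Y (1 + u ^ 2) ε p.1 (inner ℝ p.2 (perp ω)) v‖ ≤ D) :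
    ‖freqKernel (bump β₁ β₂ X Y ε ω) p‖ ≤ M * (b₁ - a₁) * X * D := by
  rw [freqKernel_bump_eq h.smooth₁.continuous h.smooth₂.continuous h.compact₁ h.compact₂ X Y hε hω,
    integral_prod _ (integrable_bumpIntegrand h.smooth₁.continuous h.smooth₂.continuous
      h.compact₁ h.compact₂ X Y hε hω p)]
  simp only [bumpIntegrand_comm β₁ β₂]
  unfold bumpIntegrand
  simp only [Prod.swap_prod_mk, integral_const_mul]
  exact norm_integral_bump_mul_le hM h.le₁ h.supp₁ hX hline _

/-- The trivial bound: area of the support times the size `1 / j` of the amplitude. -/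
theorem IsBumpPair.exists_trivial (h : IsBumpPair β₁ β₂ a₁ b₁ a₂ b₂) :
    ∃ C : ℝ, 0 ≤ C ∧ ∀ (X Y j ε : ℝ) (ω : Plane) (p : SpaceTime), 0 < X → 0 < Y → 0 < j → 0 < ε →
      ‖ω‖ = 1 → (∀ u ∈ Set.Icc (X * a₁) (X * b₁), ∀ v ∈ Set.Icc (Y * a₂) (Y * b₂),
        j ≤ lineJ (1 + v ^ 2) u) →
      ‖freqKernel (bump β₁ β₂ X Y ε ω) p‖ ≤ C * (X * Y / j) := by
  obtain ⟨C, hC, hline⟩ := exists_norm_integral_line_le_trivial h.smooth₁ h.compact₁ h.le₁ h.supp₁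
  obtain ⟨M, hM, hM₀, -, -⟩ := exists_bump_bounds h.smooth₂ h.compact₂
  have hba : 0 ≤ b₂ - a₂ := sub_nonneg.2 h.le₂
  refine ⟨M * (b₂ - a₂) * C, by positivity, fun X Y j ε ω p hX hY hj hε hω hJ => ?_⟩
  refine (h.norm_freqKernel_le_of_line hM₀ hY hε (D := C * (X / j)) hω p
    fun v hv => hline X j _ ε _ _ hX hj (by nlinarith [sq_nonneg v]) hε.le
      fun u hu => hJ u hu v hv).trans (le_of_eq (by ring))

/-- Decay of a localized kernel along `ω`. -/
theorem IsBumpPair.exists_tail (h : IsBumpPair β₁ β₂ a₁ b₁ a₂ b₂) {c : ℝ} (hc : 0 < c) :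
    ∃ C : ℝ, 0 ≤ C ∧ ∀ (X Y j ε Φ : ℝ) (ω : Plane) (p : SpaceTime), 0 < X → 0 < Y → 0 < j →
      0 < ε → 0 ≤ Φ → ‖ω‖ = 1 → c * X ≤ j → ε * X ≤ c⁻¹ →
      (∀ u ∈ Set.Icc (X * a₁) (X * b₁), ∀ v ∈ Set.Icc (Y * a₂) (Y * b₂),
        j ≤ lineJ (1 + v ^ 2) u ∧
        |p.1| * ((1 + v ^ 2) / lineJ (1 + v ^ 2) u ^ 3) * X ≤ c⁻¹ * Φ ∧
        Φ ≤ |inner ℝ p.2 ω + p.1 * (u / lineJ (1 + v ^ 2) u)|) →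
      ‖freqKernel (bump β₁ β₂ X Y ε ω) p‖ ≤ C * (X * Y / j) / (1 + (X * Φ) ^ 2) := by
  obtain ⟨C, hC, hline⟩ := exists_norm_integral_line_le h.smooth₁ h.compact₁ h.le₁ h.supp₁ hc
  obtain ⟨M, hM, hM₀, -, -⟩ := exists_bump_bounds h.smooth₂ h.compact₂
  have hba : 0 ≤ b₂ - a₂ := sub_nonneg.2 h.le₂
  refine ⟨M * (b₂ - a₂) * C, by positivity,
    fun X Y j ε Φ ω p hX hY hj hε hΦ hω hcX hεX hJ => ?_⟩
  refine (h.norm_freqKernel_le_of_line hM₀ hY hε (D := C * (X / j) / (1 + (X * Φ) ^ 2))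
    hω p fun v hv => hline X j _ ε _ _ Φ hX hj (by nlinarith [sq_nonneg v]) hε.le
      hΦ hcX hεX fun u hu => hJ u hu v hv).trans (le_of_eq (by ring))

/-- Decay of a localized kernel along `ω^⊥`. -/
theorem IsBumpPair.exists_tail_perp (h : IsBumpPair β₁ β₂ a₁ b₁ a₂ b₂) {c : ℝ} (hc : 0 < c) :
    ∃ C : ℝ, 0 ≤ C ∧ ∀ (X Y j ε Φ : ℝ) (ω : Plane) (p : SpaceTime), 0 < X → 0 < Y → 0 < j →
      0 < ε → 0 ≤ Φ → ‖ω‖ = 1 → c * Y ≤ j → ε * Y ≤ c⁻¹ →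
      (∀ u ∈ Set.Icc (X * a₁) (X * b₁), ∀ v ∈ Set.Icc (Y * a₂) (Y * b₂),
        j ≤ lineJ (1 + u ^ 2) v ∧
        |p.1| * ((1 + u ^ 2) / lineJ (1 + u ^ 2) v ^ 3) * Y ≤ c⁻¹ * Φ ∧
        Φ ≤ |inner ℝ p.2 (perp ω) + p.1 * (v / lineJ (1 + u ^ 2) v)|) →
      ‖freqKernel (bump β₁ β₂ X Y ε ω) p‖ ≤ C * (X * Y / j) / (1 + (Y * Φ) ^ 2) := by
  obtain ⟨C, hC, hline⟩ := exists_norm_integral_line_le h.smooth₂ h.compact₂ h.le₂ h.supp₂ hc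
  obtain ⟨M, hM, hM₀, -, -⟩ := exists_bump_bounds h.smooth₁ h.compact₁
  have hba : 0 ≤ b₁ - a₁ := sub_nonneg.2 h.le₁
  refine ⟨M * (b₁ - a₁) * C, by positivity,
    fun X Y j ε Φ ω p hX hY hj hε hΦ hω hcY hεY hJ => ?_⟩
  refine (h.norm_freqKernel_le_of_line_perp hM₀ hX hε (D := C * (Y / j) / (1 + (Y * Φ) ^ 2))
    hω p fun u hu => hline Y j _ ε _ _ Φ hY hj (by nlinarith [sq_nonneg u]) hε.le
      hΦ hcY hεY fun v hv => hJ u hu v hv).trans (le_of_eq (by ring))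

end

/-! ### Counting integers and frames -/

theorem le_card_Icc_ceil_floor (a b : ℝ) :
    b - a - 1 ≤ ((Finset.Icc ⌈a⌉ ⌊b⌋).card : ℝ) := by
  rw [Int.card_Icc]
  have h1 : ((⌊b⌋ + 1 - ⌈a⌉ : ℤ) : ℝ) ≤ (((⌊b⌋ + 1 - ⌈a⌉).toNat : ℤ) : ℝ) := by
    exact_mod_cast Int.self_le_toNat _
  have h2 := Int.lt_floor_add_one b
  have h3 := Int.ceil_lt_add_one a
  push_cast at h1
  linarith

theorem card_Icc_ceil_floor_le {a b : ℝ} (hab : a ≤ b) :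
    ((Finset.Icc ⌈a⌉ ⌊b⌋).card : ℝ) ≤ b - a + 1 := by
  rw [Int.card_Icc]
  have h2 := Int.floor_le b
  have h3 := Int.le_ceil a
  rcases le_total 0 (⌊b⌋ + 1 - ⌈a⌉) with h | h
  · have h1 : (((⌊b⌋ + 1 - ⌈a⌉).toNat : ℤ) : ℝ) = ((⌊b⌋ + 1 - ⌈a⌉ : ℤ) : ℝ) := by
      exact_mod_cast Int.toNat_of_nonneg h
    push_cast at h1
    linarith
  · rw [Int.toNat_of_nonpos h]
    push_cast
    linarith

theorem exists_int_finset_of_subinterval {a L : ℝ} (hL : 2 ≤ L) :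
    ∃ s : Finset ℤ, (∀ i ∈ s, a ≤ (i : ℝ) ∧ (i : ℝ) ≤ a + L) ∧ L / 2 ≤ (s.card : ℝ) := by
  refine ⟨Finset.Icc ⌈a⌉ ⌊a + L⌋, fun i hi => ?_, ?_⟩
  · rw [Finset.mem_Icc, Int.ceil_le, Int.le_floor] at hi
    exact hi
  · have := le_card_Icc_ceil_floor a (a + L)
    linarith

/-- A lower bound for the number of integers of an interval near a given point of it. -/
theorem exists_int_finset_near {N₁ N₂ z D : ℝ} (h₁ : N₁ ≤ z) (h₂ : z ≤ N₂) (hD : 2 ≤ D)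
    (hN : 4 ≤ N₂ - N₁) :
    ∃ s : Finset ℤ, (∀ i ∈ s, N₁ ≤ (i : ℝ) ∧ (i : ℝ) ≤ N₂ ∧ |(i : ℝ) - z| ≤ D) ∧
      min D ((N₂ - N₁) / 2) / 2 ≤ (s.card : ℝ) := by
  set L := min D ((N₂ - N₁) / 2) with hLdef
  have hL : 2 ≤ L := le_min hD (by linarith)
  have hLD : L ≤ D := min_le_left _ _
  have hLN : L ≤ (N₂ - N₁) / 2 := min_le_right _ _
  rcases le_total z ((N₁ + N₂) / 2) with hz | hz
  · obtain ⟨s, hs, hcard⟩ := exists_int_finset_of_subinterval (a := z) hL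
    refine ⟨s, fun i hi => ?_, hcard⟩
    obtain ⟨k1, k2⟩ := hs i hi
    exact ⟨by linarith, by linarith, abs_le.2 ⟨by linarith, by linarith⟩⟩
  · obtain ⟨s, hs, hcard⟩ := exists_int_finset_of_subinterval (a := z - L) hL
    refine ⟨s, fun i hi => ?_, hcard⟩
    obtain ⟨k1, k2⟩ := hs i hi
    exact ⟨by linarith, by linarith, abs_le.2 ⟨by linarith, by linarith⟩⟩

/-- The symmetric variant, in which short intervals are allowed. -/
theorem exists_int_finset_near_symm {N z D : ℝ} (hz : |z| ≤ N) (hD : 1 ≤ D) :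
    ∃ s : Finset ℤ, (∀ i ∈ s, |(i : ℝ)| ≤ N ∧ |(i : ℝ) - z| ≤ D) ∧ 1 ≤ (s.card : ℝ) ∧
      min D N / 2 ≤ (s.card : ℝ) := by
  obtain ⟨hz1, hz2⟩ := abs_le.1 hz
  by_cases hL : 2 ≤ min D N
  · obtain ⟨s, hs, hcard⟩ := exists_int_finset_near hz1 hz2 (hL.trans (min_le_left _ _))
      (by have := hL.trans (min_le_right _ _); linarith)
    have h2 : (N - -N) / 2 = N := by ring
    rw [h2] at hcard
    exact ⟨s, fun i hi => ⟨abs_le.2 ⟨(hs i hi).1, (hs i hi).2.1⟩, (hs i hi).2.2⟩,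
      by linarith, hcard⟩
  · push Not at hL
    rcases le_total 0 z with h0 | h0
    · refine ⟨{⌊z⌋}, fun i hi => ?_, by simp, by simp; linarith⟩
      rw [Finset.mem_singleton] at hi
      subst hi
      have k1 := Int.floor_le z
      have k2 := Int.lt_floor_add_one z
      have k3 : (0 : ℝ) ≤ ⌊z⌋ := by exact_mod_cast Int.floor_nonneg.2 h0
      exact ⟨abs_le.2 ⟨by linarith, by linarith⟩, abs_le.2 ⟨by linarith, by linarith⟩⟩
    · refine ⟨{⌈z⌉}, fun i hi => ?_, by simp, by simp; linarith⟩
      rw [Finset.mem_singleton] at hi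
      subst hi
      have k1 := Int.le_ceil z
      have k2 := Int.ceil_lt_add_one z
      have k3 : ((⌈z⌉ : ℤ) : ℝ) ≤ 0 := by exact_mod_cast Int.ceil_le.2 (by simpa using h0)
      exact ⟨abs_le.2 ⟨by linarith, by linarith⟩, abs_le.2 ⟨by linarith, by linarith⟩⟩

theorem mem_framesLambda {r k : ℤ} {ω : Plane} {Θ : ℝ × Plane} :
    Θ ∈ framesLambda r k ω ↔ Θ.1 ∈ speeds r k ∧ Θ.2 = ω := by
  unfold framesLambda
  rw [Set.Finite.mem_toFinset, Set.prod_eq, Set.mem_inter_iff]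
  simp

theorem mem_framesOmega {r k : ℤ} {ω : Plane} {Θ : ℝ × Plane} :
    Θ ∈ framesOmega r k ω ↔ Θ.1 = lam k ∧ Θ.2 ∈ directions r k ω := by
  unfold framesOmega
  rw [Set.Finite.mem_toFinset, Set.prod_eq, Set.mem_inter_iff]
  simp

theorem card_le_of_forall_exists {S : Finset (ℝ × Plane)} (s : Finset ℤ) (φ : ℤ → ℝ × Plane)
    (h : ∀ Θ ∈ S, ∃ i ∈ s, φ i = Θ) : S.card ≤ s.card := by
  classical
  exact (Finset.card_le_card fun Θ hΘ => Finset.mem_image.2 (h Θ hΘ)).trans Finset.card_image_le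

theorem freqKernel_const_mul (c : ℝ) (a : Plane → ℝ) (p : SpaceTime) :
    freqKernel (fun ξ => c * a ξ) p = c * freqKernel a p := by
  unfold freqKernel
  rw [← integral_const_mul]
  refine integral_congr_ae (Eventually.of_forall fun ξ => ?_)
  push_cast
  ring

/-- A smooth bump that equals one on `[c - r, c + r]` and is supported in `(c - R, c + R)`. -/
theorem exists_bump (c : ℝ) {r R : ℝ} (hr : 0 < r) (hrR : r < R) :
    ∃ β : ℝ → ℝ, ContDiff ℝ (⊤ : ℕ∞) β ∧ HasCompactSupport β ∧
      tsupport β ⊆ Set.Ioo (c - R) (c + R) ∧ (∀ s, 0 ≤ β s) ∧ ∀ s, |s - c| ≤ r → β s = 1 := by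
  let f : ContDiffBump c := ⟨r, (r + R) / 2, hr, by linarith⟩
  refine ⟨f, f.contDiff, f.hasCompactSupport, ?_, fun s => f.nonneg, fun s hs => ?_⟩
  · rw [f.tsupport_eq, Real.closedBall_eq_Icc]
    intro s hs
    have h1 : f.rOut = (r + R) / 2 := rfl
    rw [h1] at hs
    exact ⟨by linarith [hs.1], by linarith [hs.2]⟩
  · exact f.one_of_mem_closedBall (by rw [Metric.mem_closedBall, Real.dist_eq]; exact hs)

theorem bump_nonneg {β₁ β₂ : ℝ → ℝ} (h₁ : ∀ s, 0 ≤ β₁ s) (h₂ : ∀ s, 0 ≤ β₂ s) (X Y ε : ℝ)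
    (ω ξ : Plane) : 0 ≤ bump β₁ β₂ X Y ε ω ξ := by
  unfold bump
  have := japanese_pos ξ
  exact mul_nonneg (mul_nonneg (h₁ _) (h₂ _)) (by positivity)

/-! ### Low frequencies -/

/-- The support of `ρ` is compact in an open interval, which leaves a gap below the radius `2`. -/
theorem IsRadialCutoff.exists_radius {ρ : ℝ → ℝ} (hρ : IsRadialCutoff ρ) :
    ∃ b : ℝ, 1 ≤ b ∧ b < 2 ∧ ∀ s, ρ s ≠ 0 → |s| ≤ b := by
  have hcomp : IsCompact (tsupport ρ) :=
    (isCompact_Icc (a := (-2 : ℝ)) (b := 2)).of_isClosed_subset (isClosed_tsupport ρ)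
      (hρ.supp.trans Set.Ioo_subset_Icc_self)
  have h1 : (1 : ℝ) ∈ tsupport ρ := subset_tsupport _ (by
    rw [Function.mem_support, hρ.eq_one 1 (by simp)]; norm_num)
  obtain ⟨s₀, hs₀, hmax⟩ := hcomp.exists_isMaxOn ⟨1, h1⟩ continuous_abs.continuousOn
  refine ⟨|s₀|, ?_, abs_lt.2 (hρ.supp hs₀), fun s hs => hmax (subset_tsupport _ hs)⟩
  simpa using hmax h1

theorem norm_le_of_mem_supportLe {ρ : ℝ → ℝ} {b : ℝ}
    (hb : ∀ s, ρ s ≠ 0 → |s| ≤ b) {k : ℤ} {ξ : Plane} (hξ : ξ ∈ supportLe ρ k) :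
    ‖ξ‖ ≤ b * (2 : ℝ) ^ (k + 1) := by
  have hsub : Function.support (chiTildeLe ρ k) ⊆ Metric.closedBall 0 (b * (2 : ℝ) ^ (k + 1)) := by
    have key : ∀ j : ℤ, j ≤ k + 1 → ∀ η : Plane, ρ ((2 : ℝ) ^ (-j) * ‖η‖) ≠ 0 →
        ‖η‖ ≤ b * (2 : ℝ) ^ (k + 1) := by
      intro j hj η hη
      have h1 := hb _ hη
      rw [abs_of_nonneg (by positivity)] at h1
      have hb0 : 0 ≤ b := le_trans (by positivity) h1
      have h2 : (0 : ℝ) < 2 ^ j := by positivity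
      calc ‖η‖ = 2 ^ j * ((2 : ℝ) ^ (-j) * ‖η‖) := by
            rw [zpow_neg, ← mul_assoc, mul_inv_cancel₀ h2.ne', one_mul]
        _ ≤ 2 ^ j * b := by gcongr
        _ ≤ 2 ^ (k + 1) * b := by gcongr; norm_num
        _ = _ := mul_comm _ _
    intro η hη
    rw [mem_closedBall_zero_iff]
    by_contra hlt
    apply hη
    have z : ∀ j : ℤ, j ≤ k + 1 → ρ ((2 : ℝ) ^ (-j) * ‖η‖) = 0 := fun j hj => by
      by_contra h; exact hlt (key j hj η h)
    simp only [chiTildeLe, chiLe]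
    rw [z (k - 1) (by linarith), z k (by linarith), z (k + 1) le_rfl]
    simp
  have := closure_minimal hsub Metric.isClosed_closedBall hξ
  rwa [mem_closedBall_zero_iff] at this

/-- For frequencies of size at most `b P`, with `b < 2`, the speeds `u/⟨ξ⟩` stay below a fixed fraction
of the speed `V` at radius `2P`. -/
theorem exists_speed_margin {b P₀ : ℝ} (hb0 : 0 ≤ b) (hb : b < 2) (hP₀ : 0 < P₀) :
    ∃ θ : ℝ, 0 ≤ θ ∧ θ < 1 ∧ ∀ P V : ℝ, 0 < P → P ≤ P₀ → 0 < V →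
      V ^ 2 * (1 + 4 * P ^ 2) = 4 * P ^ 2 →
      ∀ u v : ℝ, |u| ≤ P * b → |u / lineJ (1 + v ^ 2) u| ≤ θ * V := by
  set q := b ^ 2 / 4 with hq
  have hq1 : q < 1 := by rw [hq]; nlinarith
  have hq0 : 0 ≤ q := by positivity
  have hfrac : (1 - q) / (1 + 4 * P₀ ^ 2) ≤ 1 := by
    rw [div_le_one₀ (by positivity)]; nlinarith [sq_nonneg P₀]
  have hfrac0 : 0 < (1 - q) / (1 + 4 * P₀ ^ 2) := div_pos (by linarith) (by positivity)
  refine ⟨Real.sqrt (1 - (1 - q) / (1 + 4 * P₀ ^ 2)), Real.sqrt_nonneg _,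
    (Real.sqrt_lt' one_pos).2 (by linarith), fun P V hP hPP₀ hV hVP u v hu => ?_⟩
  set θ := Real.sqrt (1 - (1 - q) / (1 + 4 * P₀ ^ 2)) with hθ
  have hθ2 : θ ^ 2 = 1 - (1 - q) / (1 + 4 * P₀ ^ 2) := Real.sq_sqrt (by linarith)
  have hp : (1 : ℝ) ≤ 1 + v ^ 2 := by nlinarith [sq_nonneg v]
  have hJ := lineJ_pos hp u
  have hJ2 := lineJ_sq hp u
  refine abs_le_of_sq_le_sq ?_ (by positivity)
  rw [div_pow, hJ2, mul_pow, div_le_iff₀ (by positivity)]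
  have hu2 : u ^ 2 ≤ 4 * q * P ^ 2 := by
    have := pow_le_pow_left₀ (abs_nonneg u) hu 2
    rw [sq_abs] at this
    rw [hq]; linarith
  have hcore : q * (1 + 4 * P ^ 2) ≤ θ ^ 2 * (1 + 4 * q * P ^ 2) := by
    rw [hθ2]
    have h1 : (1 - q) / (1 + 4 * P₀ ^ 2) * (1 + 4 * q * P ^ 2) ≤ 1 - q := by
      rw [div_mul_eq_mul_div, div_le_iff₀ (by positivity)]
      have : q * P ^ 2 ≤ 1 * P₀ ^ 2 := by gcongr
      have h1q : 0 ≤ 1 - q := by linarith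
      nlinarith [mul_le_mul_of_nonneg_left this h1q]
    linarith
  have hV2 : V ^ 2 ≤ 1 := by nlinarith [sq_nonneg V, sq_nonneg P, mul_pos hP hP]
  have hx : θ ^ 2 * V ^ 2 ≤ 1 := by
    have hθ1 : θ ^ 2 ≤ 1 := by rw [hθ2]; linarith
    nlinarith [sq_nonneg θ, sq_nonneg V]
  -- the worst case is `|u| = 2 √q P`, `v = 0`
  have h4 : 4 * q * P ^ 2 * (1 - θ ^ 2 * V ^ 2) ≤ θ ^ 2 * V ^ 2 := by
    have h5 : V ^ 2 * (θ ^ 2 * (1 + 4 * q * P ^ 2)) ≥ V ^ 2 * (q * (1 + 4 * P ^ 2)) := by gcongr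
    have h6 : V ^ 2 * (q * (1 + 4 * P ^ 2)) = 4 * q * P ^ 2 := by
      calc V ^ 2 * (q * (1 + 4 * P ^ 2)) = q * (V ^ 2 * (1 + 4 * P ^ 2)) := by ring
        _ = _ := by rw [hVP]; ring
    nlinarith
  have h7 : u ^ 2 * (1 - θ ^ 2 * V ^ 2) ≤ 4 * q * P ^ 2 * (1 - θ ^ 2 * V ^ 2) := by
    have : 0 ≤ 1 - θ ^ 2 * V ^ 2 := by linarith
    gcongr
  have h8 : 0 ≤ θ ^ 2 * V ^ 2 * v ^ 2 := by positivity
  nlinarith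

/-- Where the cutoffs are one, the constant `C` compensates the factor `e^{-ε⟨ξ⟩} / ⟨ξ⟩`. -/
theorem one_le_amplitude {C J₀ : ℝ} {β₁ β₂ : ℝ → ℝ} {X Y ε : ℝ} {ω ξ : Plane} (hε : 0 ≤ ε)
    (h₁ : β₁ (inner ℝ ω ξ / X) = 1) (h₂ : β₂ (inner ℝ (perp ω) ξ / Y) = 1)
    (hJ : japanese ξ ≤ J₀) (hC : J₀ * Real.exp (ε * J₀) ≤ C) :
    1 ≤ C * bump β₁ β₂ X Y ε ω ξ := by
  unfold bump
  have hpos := japanese_pos ξ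
  rw [h₁, h₂, one_mul, one_mul, Real.exp_neg, ← mul_div_assoc, le_div_iff₀ hpos, one_mul,
    ← div_eq_mul_inv, le_div_iff₀ (Real.exp_pos _)]
  refine le_trans ?_ hC
  have : 0 < J₀ := hpos.trans_le hJ
  gcongr

/-- The frames of speed at most `V` on the grid of mesh `2^{-r}` that are counted by the inner
region `|y| ≤ V|t|`. -/
theorem le_card_framesLambda_low {r k : ℤ} (hk : k ≤ 99) {ω : Plane} {V : ℝ}
    (hV : V = 1 / Real.sqrt (1 + (2 : ℝ) ^ (-2 * k - 4))) {p : SpaceTime} (hp0 : p.1 ≠ 0)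
    (hp : |p.1| ≤ 2 * (2 : ℝ) ^ r) (hy : |inner ℝ p.2 ω| ≤ V * |p.1|) :
    (2 : ℝ) ^ r * min (2 / |p.1|) V / 2
      ≤ ((framesLambda r k ω).filter fun Θ => |coordT Θ p| ≤ 2).card := by
  have hr : (0 : ℝ) < 2 ^ r := by positivity
  have ht := abs_pos.2 hp0
  -- frames `i 2^{-r}` whose speed is within `2 / |t|` of `-x·ω / t`
  obtain ⟨s, hs, -, hcard⟩ := exists_int_finset_near_symm
    (N := 2 ^ r * V) (z := -inner ℝ p.2 ω * 2 ^ r / p.1) (D := 2 ^ r * (2 / |p.1|))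
    (by
      rw [abs_div, abs_mul, abs_neg, abs_of_pos hr, div_le_iff₀ ht]
      nlinarith)
    (by
      rw [← mul_div_assoc, le_div_iff₀ ht]; linarith)
  rw [← mul_min_of_nonneg _ _ hr.le] at hcard
  refine hcard.trans ?_
  have hle : s.card ≤ ((framesLambda r k ω).filter fun Θ => |coordT Θ p| ≤ 2).card := by
    refine Finset.card_le_card_of_injOn (fun i => ((i : ℝ) * (2 : ℝ) ^ (-r), ω)) ?_ ?_
    · intro i hi
      obtain ⟨h1, h2⟩ := hs i hi
      simp only [Finset.coe_filter, Set.mem_ofPred_eq, mem_framesLambda]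
      refine ⟨⟨?_, trivial⟩, ?_⟩
      · unfold speeds
        rw [if_pos hk]
        exact ⟨i, by rw [hV, mul_one_div] at h1; exact h1, rfl⟩
      · unfold coordT
        simp only
        rw [abs_div, abs_of_nonneg (Real.sqrt_nonneg _)]
        have hs1 : 1 ≤ Real.sqrt (1 + ((i : ℝ) * (2 : ℝ) ^ (-r)) ^ 2) :=
          Real.one_le_sqrt.2 (by nlinarith [sq_nonneg ((i : ℝ) * (2 : ℝ) ^ (-r))])
        refine (div_le_self (abs_nonneg _) hs1).trans ?_
        have e1 : (i : ℝ) * (2 : ℝ) ^ (-r) * p.1 + inner ℝ p.2 ω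
            = (2 : ℝ) ^ (-r) * p.1 * ((i : ℝ) - -inner ℝ p.2 ω * 2 ^ r / p.1) := by
          rw [zpow_neg]; field_simp; ring
        rw [e1, abs_mul, abs_mul, abs_of_pos (by positivity : (0 : ℝ) < 2 ^ (-r))]
        calc (2 : ℝ) ^ (-r) * |p.1| * |(i : ℝ) - -inner ℝ p.2 ω * 2 ^ r / p.1|
            ≤ (2 : ℝ) ^ (-r) * |p.1| * (2 ^ r * (2 / |p.1|)) := by gcongr
          _ = 2 := by rw [zpow_neg]; field_simp
    · intro i _ j _ hij
      have h1 := congrArg Prod.fst hij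
      simp only at h1
      have h2 : (0 : ℝ) < 2 ^ (-r) := by positivity
      exact_mod_cast mul_right_cancel₀ h2.ne' h1
  exact_mod_cast hle

theorem card_framesLambda_low_le {r k : ℤ} (hr : 0 < r) (hk : k ≤ 99) (ω : Plane) :
    ((framesLambda r k ω).card : ℝ) ≤ 3 * 2 ^ r := by
  have hr1 : (1 : ℝ) ≤ 2 ^ r := one_le_zpow₀ (by norm_num) hr.le
  have h := card_le_of_forall_exists (S := framesLambda r k ω)
    (Finset.Icc ⌈-(2 : ℝ) ^ r⌉ ⌊(2 : ℝ) ^ r⌋) (fun i => ((i : ℝ) * (2 : ℝ) ^ (-r), ω)) (by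
      intro Θ hΘ
      obtain ⟨h1, h2⟩ := mem_framesLambda.1 hΘ
      unfold speeds at h1
      rw [if_pos hk] at h1
      obtain ⟨i, hi, hv⟩ := h1
      have hle : |(i : ℝ)| ≤ 2 ^ r := hi.trans (div_le_self (by positivity)
        (Real.one_le_sqrt.2 (by
          have : (0 : ℝ) < 2 ^ (-2 * k - 4) := by positivity
          linarith)))
      obtain ⟨h3, h4⟩ := abs_le.1 hle
      exact ⟨i, Finset.mem_Icc.2 ⟨Int.ceil_le.2 h3, Int.le_floor.2 h4⟩,
        Prod.ext hv.symm h2.symm⟩)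
  have h2 := card_Icc_ceil_floor_le (a := -(2 : ℝ) ^ r) (b := 2 ^ r) (by linarith)
  have h3 : ((framesLambda r k ω).card : ℝ)
      ≤ ((Finset.Icc ⌈-(2 : ℝ) ^ r⌉ ⌊(2 : ℝ) ^ r⌋).card : ℝ) := by exact_mod_cast h
  linarith

set_option maxHeartbeats 2000000 in
/-- The estimate for frequencies at most `2^k`, `k ≤ 99`. -/
theorem exists_sumNorm_low_frequency {ρ : ℝ → ℝ} (hρ : IsRadialCutoff ρ) :
    ∃ C : ℝ, 0 ≤ C ∧ ∀ (r k : ℤ) (T : ℝ) (ω : Plane) (f : L2), 0 < r → T ≤ (2 : ℝ) ^ r →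
      k ≤ 99 → ‖ω‖ = 1 → FourierSupportedIn f (supportLe ρ k) →
      sumNorm normL2TLinfX (framesLambda r k ω) (truncatedWave T f)
        ≤ ENNReal.ofReal (C * ‖f‖) := by
  obtain ⟨b, hb1, hb2, hb⟩ := hρ.exists_radius
  obtain ⟨β, hβ, hβc, hβs, hβ0, hβone⟩ := exists_bump 0 (r := b) (R := (b + 2) / 2)
    (by linarith) (by linarith)
  -- `b'` lies strictly between the radius `b` of `supp ρ` and `2`; the room up to `2` keeps the
  -- group velocities below the largest frame speed `V`
  obtain ⟨b', hb'⟩ : ∃ x : ℝ, x = (b + 2) / 2 := ⟨_, rfl⟩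
  rw [zero_sub, zero_add, ← hb'] at hβs
  have hb'2 : b' < 2 := by rw [hb']; linarith
  have hb'0 : 0 ≤ b' := by rw [hb']; linarith
  obtain ⟨P₀, hP₀⟩ : ∃ P₀ : ℝ, P₀ = 2 ^ (100 : ℤ) := ⟨_, rfl⟩
  have hP₀pos : 0 < P₀ := by rw [hP₀]; positivity
  obtain ⟨θ, hθ0, hθ1, hθ⟩ := exists_speed_margin hb'0 hb'2 hP₀pos
  have hpair : IsBumpPair β β (-b') b' (-b') b' :=
    ⟨hβ, hβ, hβc, hβc, by linarith, by linarith, hβs, hβs⟩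
  obtain ⟨J₀, hJ₀⟩ : ∃ x : ℝ, x = 1 + 2 * P₀ := ⟨_, rfl⟩
  have hJ₀pos : 0 < J₀ := by rw [hJ₀]; positivity
  obtain ⟨c, hc⟩ : ∃ x : ℝ, x = (J₀ / (1 - θ))⁻¹ := ⟨_, rfl⟩
  have hθpos : 0 < 1 - θ := by linarith
  have hcpos : 0 < c := by rw [hc]; positivity
  have hcinv : c⁻¹ = J₀ / (1 - θ) := by rw [hc, inv_inv]
  have hcP : P₀ ≤ c⁻¹ := by
    rw [hcinv, le_div_iff₀ hθpos, hJ₀]; nlinarith only [hP₀pos, hθ0, mul_nonneg hP₀pos.le hθ0]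
  obtain ⟨C₁, hC₁, htriv⟩ := hpair.exists_trivial
  obtain ⟨C₂, hC₂, hdisp⟩ := exists_norm_freqKernel_bump_le hβ hβ hβc hβc
  obtain ⟨C₃, hC₃, htail⟩ := hpair.exists_tail hcpos
  obtain ⟨c₀, hc₀⟩ : ∃ x : ℝ, x = J₀ * Real.exp (1 * J₀) := ⟨_, rfl⟩
  have hc₀pos : 0 < c₀ := by rw [hc₀]; positivity
  obtain ⟨C₄, hC₄⟩ : ∃ x : ℝ, x = c₀ * (C₁ * (P₀ * J₀) + C₂) := ⟨_, rfl⟩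
  have hC₄0 : 0 ≤ C₄ := by rw [hC₄]; positivity
  obtain ⟨L, hL⟩ : ∃ x : ℝ, x = 12 * C₄ + Real.pi * (c₀ * C₃ * P₀ / (1 - θ)) + 1 := ⟨_, rfl⟩
  have hL1 : 1 ≤ L := by
    rw [hL]
    have : 0 ≤ Real.pi * (c₀ * C₃ * P₀ / (1 - θ)) := by have := Real.pi_pos; positivity
    linarith
  refine ⟨L, by linarith, fun r k T ω f hr hT hk hω hf => ?_⟩
  have hrpos : (0 : ℝ) < 2 ^ r := by positivity
  obtain ⟨P, hP⟩ : ∃ P : ℝ, P = 2 ^ (k + 1) := ⟨_, rfl⟩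
  have hPpos : 0 < P := by rw [hP]; positivity
  have hPP₀ : P ≤ P₀ := by
    rw [hP, hP₀]; exact zpow_le_zpow_right₀ (by norm_num) (by linarith)
  -- the bound for the speeds of the frames, that is `2P / √(1 + 4P²)`
  obtain ⟨V, hV⟩ : ∃ V : ℝ, V = 1 / Real.sqrt (1 + (2 : ℝ) ^ (-2 * k - 4)) := ⟨_, rfl⟩
  have hVpos : 0 < V := by rw [hV]; positivity
  have hVP : V ^ 2 * (1 + 4 * P ^ 2) = 4 * P ^ 2 := by
    have e1 : (2 : ℝ) ^ (-2 * k - 4) = (4 * P ^ 2)⁻¹ := by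
      rw [hP, show (-2 * k - 4 : ℤ) = -(2 + (k + 1) * 2) by ring, zpow_neg, zpow_add₀ (by norm_num),
        zpow_mul]
      norm_cast
    rw [hV, div_pow, one_pow, Real.sq_sqrt (by positivity), e1]
    field_simp
    ring
  have hVJ : 2 * P ≤ V * J₀ := by
    refine le_of_sq_le_sq ?_ (by positivity)
    rw [mul_pow, mul_pow]
    have : 1 + 4 * P ^ 2 ≤ J₀ ^ 2 := by
      rw [hJ₀]; nlinarith only [hPP₀, hPpos, hP₀pos]
    linarith only [mul_le_mul_of_nonneg_left this (sq_nonneg V), hVP]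
  have hD : Bornology.IsBounded (supportLe ρ k) :=
    Metric.isBounded_closedBall.subset fun ξ hξ => by
      rw [mem_closedBall_zero_iff]; exact norm_le_of_mem_supportLe hb hξ
  have hline : ∀ u ∈ Set.Icc (P * -b') (P * b'), |u| ≤ P * b' := fun u hu =>
    abs_le.2 ⟨by linarith [hu.1], hu.2⟩
  have hJge : ∀ u v : ℝ, 1 ≤ lineJ (1 + v ^ 2) u := fun u v =>
    Real.one_le_sqrt.2 (by nlinarith only [sq_nonneg u, sq_nonneg v])
  refine sumNorm_le_of_majorant (S := framesLambda r k ω)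
    (e := fun Θ q => framePoint Θ q.1 q.2.1 q.2.2) (σ := coordT)
    (fun Θ hΘ => isChart_coordT Θ (by rw [(mem_framesLambda.1 hΘ).2]; exact hω)) hD hf T
    (a := fun ξ => c₀ * bump β β P P 1 ω ξ)
    ((integrable_bump hβ.continuous hβ.continuous hβc hβc P P one_pos ω).const_mul c₀)
    (fun ξ => mul_nonneg hc₀pos.le (bump_nonneg hβ0 hβ0 _ _ _ _ _)) ?_ (Θ₀ := (0, ω)) ?_
    (A := C₄ * 2 ^ (-r)) (B := c₀ * C₃ * P ^ 2) (c := 2) (β := P * (1 - θ)) (by positivity)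
    (by positivity) (by norm_num) (by positivity) (by linarith) ?_ ?_
  · intro ξ hξ
    have hn := norm_le_of_mem_supportLe hb hξ
    rw [← hP] at hn
    refine one_le_amplitude zero_le_one (hβone _ ?_) (hβone _ ?_) (J₀ := J₀) ?_ hc₀.ge
    · rw [sub_zero, abs_div, abs_of_pos hPpos, div_le_iff₀ hPpos]
      exact (abs_real_inner_le_norm _ _).trans (by rw [hω, one_mul]; exact hn)
    · rw [sub_zero, abs_div, abs_of_pos hPpos, div_le_iff₀ hPpos]
      exact (abs_real_inner_le_norm _ _).trans (by rw [norm_perp, hω, one_mul]; exact hn)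
    · refine Real.sqrt_le_iff.2 ⟨by positivity, ?_⟩
      have h1 : ‖ξ‖ ≤ 2 * P₀ := hn.trans (mul_le_mul hb2.le hPP₀ hPpos.le zero_le_two)
      rw [hJ₀]
      nlinarith only [norm_nonneg ξ, h1, hP₀pos]
  · refine mem_framesLambda.2 ⟨?_, rfl⟩
    unfold speeds
    rw [if_pos hk]
    exact ⟨0, by simp; positivity, by simp⟩
  · intro p hp
    rw [freqKernel_const_mul, norm_mul, Complex.norm_real, Real.norm_of_nonneg hc₀pos.le]
    -- outside the cone of speed `V` the phase is nonstationary, and the frame of speed `0` carries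
    -- the tail; inside, frames are counted
    by_cases hy : V * |p.1| ≤ |inner ℝ p.2 ω|
    · refine le_add_of_nonneg_of_le (by positivity) ?_
      have hσ : coordT (0, ω) p = inner ℝ p.2 ω := by simp [coordT]
      have h1 := htail P P 1 1 ((1 - θ) * |inner ℝ p.2 ω|) ω p hPpos hPpos one_pos one_pos
        (by positivity) hω
        (by
          have : P ≤ c⁻¹ := hPP₀.trans hcP
          calc c * P ≤ c * c⁻¹ := by gcongr
            _ = 1 := mul_inv_cancel₀ hcpos.ne')
        (by rw [one_mul]; exact hPP₀.trans hcP)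
        (by
          intro u hu v _
          have hJ := hJge u v
          have hp1 : (1 : ℝ) ≤ 1 + v ^ 2 := by nlinarith only [sq_nonneg v]
          refine ⟨hJ, ?_, ?_⟩
          · have h2 : (1 + v ^ 2) / lineJ (1 + v ^ 2) u ^ 3 ≤ 1 := by
              rw [div_le_one₀ (by positivity)]
              calc 1 + v ^ 2 ≤ lineJ (1 + v ^ 2) u ^ 2 := by
                    rw [lineJ_sq hp1]; nlinarith only [sq_nonneg u]
                _ ≤ lineJ (1 + v ^ 2) u ^ 3 := pow_le_pow_right₀ hJ (by norm_num)
            have h3 : 2 * (|p.1| * P) ≤ J₀ * |inner ℝ p.2 ω| := by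
              calc 2 * (|p.1| * P) = |p.1| * (2 * P) := by ring
                _ ≤ |p.1| * (V * J₀) := by gcongr
                _ = J₀ * (V * |p.1|) := by ring
                _ ≤ _ := by gcongr
            calc |p.1| * ((1 + v ^ 2) / lineJ (1 + v ^ 2) u ^ 3) * P ≤ |p.1| * 1 * P := by gcongr
              _ ≤ J₀ * |inner ℝ p.2 ω| := by
                have : 0 ≤ |p.1| * P := by positivity
                linarith
              _ = _ := by rw [hcinv]; field_simp
          · have h4 := hθ P V hPpos hPP₀ hVpos hVP u v (hline u hu)
            have h5 : |p.1 * (u / lineJ (1 + v ^ 2) u)| ≤ θ * |inner ℝ p.2 ω| := by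
              rw [abs_mul]
              calc |p.1| * |u / lineJ (1 + v ^ 2) u| ≤ |p.1| * (θ * V) := by gcongr
                _ = θ * (V * |p.1|) := by ring
                _ ≤ _ := by gcongr
            have h6 := abs_sub_abs_le_abs_sub (inner ℝ p.2 ω) (-(p.1 * (u / lineJ (1 + v ^ 2) u)))
            rw [abs_neg, sub_neg_eq_add] at h6
            linarith)
      rw [hσ]
      calc c₀ * ‖freqKernel (bump β β P P 1 ω) p‖
          ≤ c₀ * (C₃ * (P * P / 1) / (1 + (P * ((1 - θ) * |inner ℝ p.2 ω|)) ^ 2)) := by gcongr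
        _ = c₀ * C₃ * P ^ 2 / (1 + (P * (1 - θ) * inner ℝ p.2 ω) ^ 2) := by
          rw [mul_pow, mul_pow, sq_abs, div_one]; ring
    · push Not at hy
      have ht0 : p.1 ≠ 0 := by
        intro h
        rw [h, abs_zero, mul_zero] at hy
        exact absurd hy (not_lt.2 (abs_nonneg _))
      have ht := abs_pos.2 ht0
      have hcount := le_card_framesLambda_low (r := r) hk hV ht0 (by linarith) hy.le
      refine le_add_of_le_of_nonneg ?_ (by positivity)
      have k1 := htriv P P 1 1 ω p hPpos hPpos one_pos one_pos hω (fun u _ v _ => hJge u v)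
      have k2 := hdisp P P 1 ω p one_pos ht0
      have k3 : C₄ * (min (2 / |p.1|) V / 2)
          ≤ C₄ * 2 ^ (-r) * ((framesLambda r k ω).filter fun Θ => |coordT Θ p| ≤ 2).card := by
        calc C₄ * (min (2 / |p.1|) V / 2)
            = C₄ * 2 ^ (-r) * (2 ^ r * min (2 / |p.1|) V / 2) := by
              rw [zpow_neg]; field_simp
          _ ≤ _ := by gcongr
      refine le_trans ?_ k3
      rcases min_cases (2 / |p.1|) V with ⟨hm, -⟩ | ⟨hm, -⟩
      · rw [hm]
        calc c₀ * ‖freqKernel (bump β β P P 1 ω) p‖ ≤ c₀ * (C₂ / (1 * |p.1|)) := by gcongr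
          _ = c₀ * (0 + C₂) * (1 / |p.1|) := by rw [one_mul]; ring
          _ ≤ C₄ * (1 / |p.1|) := by
            rw [hC₄]
            have : 0 ≤ C₁ * (P₀ * J₀) := by positivity
            gcongr
          _ = _ := by ring
      · rw [hm]
        calc c₀ * ‖freqKernel (bump β β P P 1 ω) p‖ ≤ c₀ * (C₁ * (P * P / 1)) := by gcongr
          _ = c₀ * C₁ * P * (2 * P) / 2 := by ring
          _ ≤ c₀ * C₁ * P₀ * (V * J₀) / 2 := by gcongr
          _ = c₀ * (C₁ * (P₀ * J₀) + 0) * (V / 2) := by ring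
          _ ≤ C₄ * (V / 2) := by rw [hC₄]; gcongr
  · have hcard := card_framesLambda_low_le hr hk ω
    have e1 : 2 * 2 * (C₄ * 2 ^ (-r)) * ((framesLambda r k ω).card : ℝ) ≤ 12 * C₄ := by
      calc 2 * 2 * (C₄ * 2 ^ (-r)) * ((framesLambda r k ω).card : ℝ)
          ≤ 2 * 2 * (C₄ * 2 ^ (-r)) * (3 * 2 ^ r) := by gcongr
        _ = 12 * C₄ := by rw [zpow_neg]; field_simp; ring
    have e2 : Real.pi * (c₀ * C₃ * P ^ 2) / (P * (1 - θ))
        ≤ Real.pi * (c₀ * C₃ * P₀ / (1 - θ)) := by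
      have := Real.pi_pos
      calc Real.pi * (c₀ * C₃ * P ^ 2) / (P * (1 - θ))
          = Real.pi * (c₀ * C₃ * P / (1 - θ)) := by field_simp
        _ ≤ _ := by gcongr
    have e3 : L ≤ L ^ 2 := by nlinarith only [hL1]
    linarith

/-! ### Amplitudes adapted to a sector -/

/-- The part of the dyadic annulus `|ξ| ∼ W` in a sector of aperture comparable to `δ` about `ω`.
The last condition selects the sector about `ω` and not that about `-ω`. -/
def sector (W δ : ℝ) (ω : Plane) : Set Plane :=
  {ξ | W / 4 ≤ ‖ξ‖ ∧ ‖ξ‖ ≤ 4 * W ∧ |inner ℝ (perp ω) ξ| ≤ δ * ‖ξ‖ ∧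
    19 / 20 * ‖ξ‖ ≤ inner ℝ ω ξ}

/-- The box `{u ω + v ω^⊥}` around `sector W δ ω` in which its amplitude is supported. -/
def InBox (W δ u v : ℝ) : Prop := 9 / 40 * W ≤ u ∧ u ≤ 21 / 5 * W ∧ |v| ≤ 25 / 9 * δ * u

theorem isBounded_sector (W δ : ℝ) (ω : Plane) : Bornology.IsBounded (sector W δ ω) :=
  Metric.isBounded_closedBall.subset fun ξ hξ => by
    rw [mem_closedBall_zero_iff]; exact hξ.2.1

theorem inBox_of_mem_Icc {W δ X u v : ℝ} (hδ : 0 < δ) (h₁ : W / 4 ≤ X) (h₂ : X ≤ 2 * W)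
    (hu : u ∈ Set.Icc (X * (9 / 10)) (X * (21 / 10)))
    (hv : v ∈ Set.Icc (δ * X * (-(5 / 2))) (δ * X * (5 / 2))) : InBox W δ u v := by
  refine ⟨by linarith [hu.1], by linarith [hu.2], ?_⟩
  have h3 : δ * X * (5 / 2) ≤ 25 / 9 * δ * u := by
    have := mul_le_mul_of_nonneg_left hu.1 hδ.le
    linarith
  exact abs_le.2 ⟨by linarith [hv.1], by linarith [hv.2]⟩

/-- The factor `5 W e⁵` that normalizes the amplitude turns the area `X · δX / j = O(1)` into
`O(W)`. -/
theorem sector_bump_bound {C W δ X j D : ℝ} (hC : 0 ≤ C) (hW : 1 ≤ W) (hδ : 0 < δ)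
    (hδW : δ * W ≤ 1) (h₂ : X ≤ 2 * W) (hX : 0 < X) (hj : j = 9 / 10 * X) (hD : 0 < D) {F : ℝ}
    (hF : F ≤ C * (X * (δ * X) / j) / D) :
    5 * W * Real.exp 5 * F ≤ 12 * Real.exp 5 * C * W / D := by
  have hXX : X * (δ * X) / j ≤ 20 / 9 := by
    rw [hj, div_le_iff₀ (by positivity)]
    have : δ * X ≤ 2 := by nlinarith
    nlinarith
  calc 5 * W * Real.exp 5 * F ≤ 5 * W * Real.exp 5 * (C * (20 / 9) / D) := by
        gcongr
        refine hF.trans ?_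
        gcongr
    _ = (100 / 9) * Real.exp 5 * C * W / D := by ring
    _ ≤ _ := by gcongr; norm_num

section

variable {β₁ β₂ : ℝ → ℝ}

/-- The four kernel bounds of one piece of the amplitude of a sector. -/
theorem IsBumpPair.exists_piece_bounds
    (h : IsBumpPair β₁ β₂ (9 / 10) (21 / 10) (-(5 / 2)) (5 / 2)) {m : ℝ} (hm : 0 < m) :
    ∃ C : ℝ, 0 ≤ C ∧ ∀ (W δ X : ℝ) (ω : Plane) (p : SpaceTime), 1 ≤ W → 0 < δ → δ * W ≤ 1 →
      W / 4 ≤ X → X ≤ 2 * W → ‖ω‖ = 1 →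
      let F := 5 * W * Real.exp 5 * ‖freqKernel (bump β₁ β₂ X (δ * X) (1 / W) ω) p‖
      F ≤ C * W ∧ (p.1 ≠ 0 → F ≤ C * (W ^ 2 / |p.1|)) ∧
      (∀ Φ : ℝ, 0 ≤ Φ → |p.1| ≤ m * (W ^ 2 * Φ) →
        (∀ u v : ℝ, InBox W δ u v → Φ ≤ |inner ℝ p.2 ω + p.1 * (u / lineJ (1 + v ^ 2) u)|) →
        F ≤ C * W / (1 + (W * Φ) ^ 2)) ∧
      (∀ Φ : ℝ, 0 ≤ Φ → |p.1| * δ ≤ m * Φ →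
        (∀ u v : ℝ, InBox W δ u v →
          Φ ≤ |inner ℝ p.2 (perp ω) + p.1 * (v / lineJ (1 + v ^ 2) u)|) →
        F ≤ C * W / (1 + (δ * W * Φ) ^ 2)) := by
  obtain ⟨e, he⟩ : ∃ e : ℝ, e = 2 + 600 * m + 2 * m := ⟨_, rfl⟩
  have hepos : 0 < e := by rw [he]; positivity
  obtain ⟨C₁, hC₁, htriv⟩ := h.exists_trivial
  obtain ⟨C₂, hC₂, hdisp⟩ := exists_norm_freqKernel_bump_le h.smooth₁ h.smooth₂ h.compact₁ h.compact₂
  obtain ⟨C₃, hC₃, htail⟩ := h.exists_tail (inv_pos.2 hepos)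
  obtain ⟨C₄, hC₄, htail'⟩ := h.exists_tail_perp (inv_pos.2 hepos)
  rw [inv_inv] at htail htail'
  refine ⟨12 * Real.exp 5 * (C₁ + C₂ + 16 * C₃ + 16 * C₄), by positivity,
    fun W δ X ω p hW hδ hδW h₁ h₂ hω => ?_⟩
  have hWpos : 0 < W := by linarith
  have hX : 0 < X := by linarith
  have hY : 0 < δ * X := by positivity
  have hε : 0 < 1 / W := by positivity
  have hεX : 1 / W * X ≤ e := by
    rw [one_div, inv_mul_le_iff₀ hWpos, he]; nlinarith
  have hδX : δ * X ≤ 2 := by nlinarith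
  obtain ⟨j, hj⟩ : ∃ j : ℝ, j = 9 / 10 * X := ⟨_, rfl⟩
  have hjpos : 0 < j := by rw [hj]; positivity
  have he2 : e⁻¹ ≤ 1 / 2 := by
    rw [← one_div]
    exact one_div_le_one_div_of_le two_pos (by rw [he]; linarith)
  have hJ : ∀ u ∈ Set.Icc (X * (9 / 10)) (X * (21 / 10)), ∀ v : ℝ,
      0 < u ∧ j ≤ u ∧ u ≤ lineJ (1 + v ^ 2) u ∧ (1 : ℝ) ≤ 1 + v ^ 2 := by
    intro u hu v
    have hp : (1 : ℝ) ≤ 1 + v ^ 2 := by linarith [sq_nonneg v]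
    have h0 : 0 < u := by linarith [hu.1]
    exact ⟨h0, by rw [hj]; linarith [hu.1], (le_abs_self u).trans (abs_le_lineJ hp u), hp⟩
  have hcoef : ∀ x : ℝ, 0 ≤ x → ∀ C : ℝ, 0 ≤ C → C ≤ C₁ + C₂ + 16 * C₃ + 16 * C₄ →
      12 * Real.exp 5 * C * x ≤ 12 * Real.exp 5 * (C₁ + C₂ + 16 * C₃ + 16 * C₄) * x := by
    intro x hx C _ hC
    gcongr
  refine ⟨?_, fun ht => ?_, fun Φ hΦ htΦ hΦb => ?_, fun Φ hΦ htΦ hΦb => ?_⟩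
  · have k := htriv X (δ * X) j (1 / W) ω p hX hY hjpos hε hω fun u hu v _ =>
      (hJ u hu v).2.1.trans (hJ u hu v).2.2.1
    have k2 := sector_bump_bound hC₁ hW hδ hδW h₂ hX hj one_pos (k.trans_eq (div_one _).symm)
    rw [div_one] at k2
    exact k2.trans (hcoef W hWpos.le C₁ hC₁ (by linarith))
  · have k := hdisp X (δ * X) (1 / W) ω p hε ht
    have ht' := abs_pos.2 ht
    calc 5 * W * Real.exp 5 * ‖freqKernel (bump β₁ β₂ X (δ * X) (1 / W) ω) p‖
        ≤ 5 * W * Real.exp 5 * (C₂ / (1 / W * |p.1|)) := by gcongr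
      _ = 5 * Real.exp 5 * C₂ * (W ^ 2 / |p.1|) := by field_simp
      _ ≤ 12 * Real.exp 5 * C₂ * (W ^ 2 / |p.1|) := by gcongr; norm_num
      _ ≤ _ := hcoef _ (by positivity) C₂ hC₂ (by linarith)
  · have k := htail X (δ * X) j (1 / W) Φ ω p hX hY hjpos hε hΦ hω
      (by rw [hj]; nlinarith) hεX (by
        intro u hu v hv
        obtain ⟨hu0, hju, huJ, hp⟩ := hJ u hu v
        have hJpos := lineJ_pos hp u
        refine ⟨hju.trans huJ, ?_, hΦb u v (inBox_of_mem_Icc hδ h₁ h₂ hu hv)⟩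
        have hv2 : 1 + v ^ 2 ≤ 26 := by
          have : |v| ≤ 5 := abs_le.2 ⟨by linarith [hv.1], by linarith [hv.2]⟩
          have := pow_le_pow_left₀ (abs_nonneg v) this 2
          rw [sq_abs] at this
          linarith
        have hfrac : (1 + v ^ 2) / lineJ (1 + v ^ 2) u ^ 3 * X ≤ 600 / W ^ 2 := by
          have h3 : (9 / 10 * X) ^ 3 ≤ lineJ (1 + v ^ 2) u ^ 3 := by
            gcongr
            rw [← hj]; exact hju.trans huJ
          calc (1 + v ^ 2) / lineJ (1 + v ^ 2) u ^ 3 * X ≤ 26 / (9 / 10 * X) ^ 3 * X := by gcongr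
            _ = 26 * (1000 / 729) / X ^ 2 := by field_simp; norm_num
            _ ≤ 26 * (1000 / 729) / (W / 4) ^ 2 := by gcongr
            _ = 26 * (1000 / 729) * 16 / W ^ 2 := by ring
            _ ≤ 600 / W ^ 2 := by gcongr; norm_num
        calc |p.1| * ((1 + v ^ 2) / lineJ (1 + v ^ 2) u ^ 3) * X
            = |p.1| * ((1 + v ^ 2) / lineJ (1 + v ^ 2) u ^ 3 * X) := by ring
          _ ≤ m * (W ^ 2 * Φ) * (600 / W ^ 2) := by gcongr
          _ = 600 * m * Φ := by field_simp
          _ ≤ e * Φ := by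
            rw [he]
            gcongr
            linarith)
    have k2 := sector_bump_bound hC₃ hW hδ hδW h₂ hX hj (by positivity) k
    refine k2.trans ?_
    have hXΦ : 1 + (W * Φ) ^ 2 ≤ 16 * (1 + (X * Φ) ^ 2) := by
      have : W * Φ ≤ 4 * (X * Φ) := by nlinarith
      have := pow_le_pow_left₀ (by positivity) this 2
      nlinarith
    calc 12 * Real.exp 5 * C₃ * W / (1 + (X * Φ) ^ 2)
        = 12 * Real.exp 5 * (16 * C₃) * W / (16 * (1 + (X * Φ) ^ 2)) := by field_simp
      _ ≤ 12 * Real.exp 5 * (16 * C₃) * W / (1 + (W * Φ) ^ 2) := by gcongr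
      _ ≤ _ := by
        refine div_le_div_of_nonneg_right ?_ (by positivity)
        exact hcoef W hWpos.le _ (by positivity) (by linarith)
  · have k := htail' X (δ * X) j (1 / W) Φ ω p hX hY hjpos hε hΦ hω
      (by
        have hδ1 : δ ≤ 1 := by nlinarith
        rw [hj]; nlinarith)
      (by
        have hδ1 : δ ≤ 1 := by nlinarith
        refine le_trans ?_ hεX
        gcongr
        nlinarith)
      (by
        intro u hu v hv
        obtain ⟨hu0, hju, huJ, hp⟩ := hJ u hu v
        have hJpos := lineJ_pos hp u
        rw [← lineJ_comm u v]
        refine ⟨hju.trans huJ, ?_, hΦb u v (inBox_of_mem_Icc hδ h₁ h₂ hu hv)⟩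
        have hfrac : (1 + u ^ 2) / lineJ (1 + v ^ 2) u ^ 3 * (δ * X) ≤ 2 * δ := by
          have h3 : 1 + u ^ 2 ≤ lineJ (1 + v ^ 2) u ^ 2 := by
            rw [lineJ_sq hp]; linarith [sq_nonneg v]
          calc (1 + u ^ 2) / lineJ (1 + v ^ 2) u ^ 3 * (δ * X)
              ≤ lineJ (1 + v ^ 2) u ^ 2 / lineJ (1 + v ^ 2) u ^ 3 * (δ * X) := by gcongr
            _ = δ * X / lineJ (1 + v ^ 2) u := by field_simp
            _ ≤ δ * X / (9 / 10 * X) := by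
              gcongr
              rw [← hj]; exact hju.trans huJ
            _ = 10 / 9 * δ := by field_simp
            _ ≤ 2 * δ := by gcongr; norm_num
        calc |p.1| * ((1 + u ^ 2) / lineJ (1 + v ^ 2) u ^ 3) * (δ * X)
            = |p.1| * ((1 + u ^ 2) / lineJ (1 + v ^ 2) u ^ 3 * (δ * X)) := by ring
          _ ≤ |p.1| * (2 * δ) := by gcongr
          _ = 2 * (|p.1| * δ) := by ring
          _ ≤ 2 * (m * Φ) := by gcongr
          _ = 2 * m * Φ := by ring
          _ ≤ e * Φ := by
            rw [he]
            gcongr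
            linarith)
    have k2 := sector_bump_bound hC₄ hW hδ hδW h₂ hX hj (by positivity) k
    refine k2.trans ?_
    have hXΦ : 1 + (δ * W * Φ) ^ 2 ≤ 16 * (1 + (δ * X * Φ) ^ 2) := by
      have : δ * W * Φ ≤ 4 * (δ * X * Φ) := by
        have := mul_le_mul_of_nonneg_left h₁ (mul_nonneg hδ.le hΦ)
        linarith
      have := pow_le_pow_left₀ (by positivity) this 2
      linarith
    calc 12 * Real.exp 5 * C₄ * W / (1 + (δ * X * Φ) ^ 2)
        = 12 * Real.exp 5 * (16 * C₄) * W / (16 * (1 + (δ * X * Φ) ^ 2)) := by field_simp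
      _ ≤ 12 * Real.exp 5 * (16 * C₄) * W / (1 + (δ * W * Φ) ^ 2) := by gcongr
      _ ≤ _ := by
        refine div_le_div_of_nonneg_right ?_ (by positivity)
        exact hcoef W hWpos.le _ (by positivity) (by linarith)

end

theorem freqKernel_sum {ι : Type*} (s : Finset ι) (a : ι → Plane → ℝ) (p : SpaceTime)
    (h : ∀ i ∈ s, Integrable fun ξ => (a i ξ : ℂ) * Complex.exp (-(Complex.I *
        (inner ℝ p.2 ξ + p.1 * japanese ξ)))) :
    freqKernel (fun ξ => ∑ i ∈ s, a i ξ) p = ∑ i ∈ s, freqKernel (a i) p := by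
  unfold freqKernel
  rw [← integral_finsetSum s h]
  refine integral_congr_ae (Eventually.of_forall fun ξ => ?_)
  push_cast
  rw [Finset.sum_mul]

/-- The annulus `W/4 ≤ |ξ| ≤ 4W` is covered by four dyadic annuli. -/
theorem exists_dyadic_scale {W x : ℝ} (h₁ : W / 4 ≤ x) (h₂ : x ≤ 4 * W) :
    ∃ j ∈ Finset.range 4, W / 4 * 2 ^ j ≤ x ∧ x ≤ 2 * (W / 4 * 2 ^ j) := by
  rcases le_total x (W / 2) with h | h
  · exact ⟨0, by simp, by linarith, by linarith⟩
  rcases le_total x W with h' | h'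
  · exact ⟨1, by simp, by linarith, by linarith⟩
  rcases le_total x (2 * W) with h'' | h''
  · exact ⟨2, by simp, by linarith, by linarith⟩
  · exact ⟨3, by simp, by linarith, by linarith⟩

/-- An amplitude that is at least one on a sector, with the four bounds of its kernel: the trivial
bound, the dispersive bound, and the tails along `ω` and along `ω^⊥`. -/
theorem exists_sector_amplitude {m : ℝ} (hm : 0 < m) :
    ∃ C : ℝ, 0 ≤ C ∧ ∀ (W δ : ℝ) (ω : Plane), 1 ≤ W → 0 < δ → δ * W ≤ 1 → ‖ω‖ = 1 →
      ∃ a : Plane → ℝ, Integrable a ∧ (∀ ξ, 0 ≤ a ξ) ∧ (∀ ξ ∈ sector W δ ω, 1 ≤ a ξ) ∧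
      ∀ p : SpaceTime, ‖freqKernel a p‖ ≤ C * W ∧
      (p.1 ≠ 0 → ‖freqKernel a p‖ ≤ C * (W ^ 2 / |p.1|)) ∧
      (∀ Φ : ℝ, 0 ≤ Φ → |p.1| ≤ m * (W ^ 2 * Φ) →
        (∀ u v : ℝ, InBox W δ u v → Φ ≤ |inner ℝ p.2 ω + p.1 * (u / lineJ (1 + v ^ 2) u)|) →
        ‖freqKernel a p‖ ≤ C * W / (1 + (W * Φ) ^ 2)) ∧
      (∀ Φ : ℝ, 0 ≤ Φ → |p.1| * δ ≤ m * Φ →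
        (∀ u v : ℝ, InBox W δ u v →
          Φ ≤ |inner ℝ p.2 (perp ω) + p.1 * (v / lineJ (1 + v ^ 2) u)|) →
        ‖freqKernel a p‖ ≤ C * W / (1 + (δ * W * Φ) ^ 2)) := by
  obtain ⟨β₁, hβ₁, hc₁, hs₁, h0₁, hone₁⟩ := exists_bump (3 / 2) (r := 11 / 20) (R := 3 / 5)
    (by norm_num) (by norm_num)
  obtain ⟨β₂, hβ₂, hc₂, hs₂, h0₂, hone₂⟩ := exists_bump 0 (r := 2) (R := 5 / 2)
    (by norm_num) (by norm_num)
  have hpair : IsBumpPair β₁ β₂ (9 / 10) (21 / 10) (-(5 / 2)) (5 / 2) :=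
    ⟨hβ₁, hβ₂, hc₁, hc₂, by norm_num, by norm_num, by convert hs₁ using 2 <;> norm_num,
      by convert hs₂ using 2 <;> norm_num⟩
  obtain ⟨C, hC, hpiece⟩ := hpair.exists_piece_bounds hm
  refine ⟨4 * C, by positivity, fun W δ ω hW hδ hδW hω => ?_⟩
  have hWpos : 0 < W := by linarith
  have hε : 0 < 1 / W := by positivity
  -- one bump at each of the dyadic scales `W/4, W/2, W, 2W`
  obtain ⟨X, hXdef⟩ : ∃ X : ℕ → ℝ, X = fun j => W / 4 * 2 ^ j := ⟨_, rfl⟩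
  have hX : ∀ j ∈ Finset.range 4, W / 4 ≤ X j ∧ X j ≤ 2 * W := by
    intro j hj
    rw [Finset.mem_range] at hj
    have h1 : (1 : ℝ) ≤ 2 ^ j := one_le_pow₀ one_le_two
    have h2 : (2 : ℝ) ^ j ≤ 2 ^ 3 := pow_le_pow_right₀ one_le_two (by linarith)
    rw [hXdef]
    constructor <;> nlinarith only [h1, h2, hWpos]
  -- `⟨ξ⟩ ≤ 5W` on the sector and `ε = 1 / W`, so `A` compensates `e^{-ε⟨ξ⟩} / ⟨ξ⟩`
  obtain ⟨A, hAdef⟩ : ∃ A : ℝ, A = 5 * W * Real.exp 5 := ⟨_, rfl⟩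
  have hA : 0 < A := by rw [hAdef]; positivity
  have hnn : ∀ j ξ, 0 ≤ A * bump β₁ β₂ (X j) (δ * X j) (1 / W) ω ξ := fun j ξ =>
    mul_nonneg hA.le (bump_nonneg h0₁ h0₂ _ _ _ _ _)
  refine ⟨fun ξ => ∑ j ∈ Finset.range 4, A * bump β₁ β₂ (X j) (δ * X j) (1 / W) ω ξ, ?_,
    fun ξ => Finset.sum_nonneg fun j _ => hnn j ξ, ?_, fun p => ?_⟩
  · exact integrable_finsetSum _ fun j _ =>
      (integrable_bump hβ₁.continuous hβ₂.continuous hc₁ hc₂ _ _ hε ω).const_mul A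
  · intro ξ hξ
    obtain ⟨n1, n2, n3, n4⟩ := hξ
    obtain ⟨j, hj, j1, j2⟩ := exists_dyadic_scale n1 n2
    have hXj : X j = W / 4 * 2 ^ j := by rw [hXdef]
    rw [← hXj] at j1 j2
    have hXpos : 0 < X j := by linarith [(hX j hj).1]
    refine le_trans ?_ (Finset.single_le_sum (fun i _ => hnn i ξ) hj)
    refine one_le_amplitude hε.le (hone₁ _ ?_) (hone₂ _ ?_) (J₀ := 5 * W) ?_ ?_
    · have h1 : inner ℝ ω ξ ≤ ‖ξ‖ := by
        have := real_inner_le_norm ω ξ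
        rwa [hω, one_mul] at this
      have h2 : 19 / 20 ≤ inner ℝ ω ξ / X j := by rw [le_div_iff₀ hXpos]; linarith
      have h3 : inner ℝ ω ξ / X j ≤ 2 := by rw [div_le_iff₀ hXpos]; linarith
      exact abs_le.2 ⟨by linarith, by linarith⟩
    · rw [sub_zero, abs_div, abs_of_pos (by positivity : 0 < δ * X j),
        div_le_iff₀ (by positivity)]
      refine n3.trans ?_
      have := mul_le_mul_of_nonneg_left j2 hδ.le
      linarith
    · refine Real.sqrt_le_iff.2 ⟨by positivity, ?_⟩
      nlinarith only [n2, norm_nonneg ξ, hW]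
    · have h5 : 1 / W * (5 * W) = 5 := by field_simp
      rw [hAdef, h5]
  · have hker : ‖freqKernel (fun ξ => ∑ j ∈ Finset.range 4,
        A * bump β₁ β₂ (X j) (δ * X j) (1 / W) ω ξ) p‖
        ≤ ∑ j ∈ Finset.range 4, 5 * W * Real.exp 5 *
          ‖freqKernel (bump β₁ β₂ (X j) (δ * X j) (1 / W) ω) p‖ := by
      rw [freqKernel_sum]
      · refine (norm_sum_le _ _).trans (Finset.sum_le_sum fun j _ => le_of_eq ?_)
        rw [freqKernel_const_mul, norm_mul, Complex.norm_real, Real.norm_of_nonneg hA.le, hAdef]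
      · intro j _
        refine ((integrable_bump_phase hβ₁.continuous hβ₂.continuous hc₁ hc₂ (X j) (δ * X j) hε ω
          p).const_mul (A : ℂ)).congr (Eventually.of_forall fun ξ => ?_)
        push_cast; ring
    have hsum : ∀ D : ℝ, (∀ j ∈ Finset.range 4, 5 * W * Real.exp 5 *
          ‖freqKernel (bump β₁ β₂ (X j) (δ * X j) (1 / W) ω) p‖ ≤ D) →
        ‖freqKernel (fun ξ => ∑ j ∈ Finset.range 4,
        A * bump β₁ β₂ (X j) (δ * X j) (1 / W) ω ξ) p‖ ≤ 4 * D := by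
      intro D hD
      refine hker.trans ((Finset.sum_le_card_nsmul _ _ D hD).trans ?_)
      simp
    have hp := fun j hj => hpiece W δ (X j) ω p hW hδ hδW (hX j hj).1 (hX j hj).2 hω
    refine ⟨?_, fun ht => ?_, fun Φ hΦ h1 h2 => ?_, fun Φ hΦ h1 h2 => ?_⟩
    · exact (hsum _ fun j hj => (hp j hj).1).trans_eq (by ring)
    · exact (hsum _ fun j hj => (hp j hj).2.1 ht).trans_eq (by ring)
    · exact (hsum _ fun j hj => (hp j hj).2.2.1 Φ hΦ h1 h2).trans_eq (by ring)
    · exact (hsum _ fun j hj => (hp j hj).2.2.2 Φ hΦ h1 h2).trans_eq (by ring)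

/-! ### Group speeds at high frequency -/

/-- The group speed `(1 + x)^{-1/2}` as a function of `x = (1 + ξ₂²) / ξ₁²`. -/
def speed (x : ℝ) : ℝ := 1 / Real.sqrt (1 + x)

/-- Difference quotients of `speed` lie between `-1/2` and `-1/6` on `[0, 1]`. -/
theorem speed_sub {x y : ℝ} (hx : 0 ≤ x) (hy : 0 ≤ y) :
    ∃ d : ℝ, 2 ≤ d ∧ (x ≤ 1 → y ≤ 1 → d ≤ 6) ∧ speed x - speed y = (y - x) / d := by
  have hx2 : Real.sqrt (1 + x) ^ 2 = 1 + x := Real.sq_sqrt (by linarith)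
  have hy2 : Real.sqrt (1 + y) ^ 2 = 1 + y := Real.sq_sqrt (by linarith)
  have hx1 : 1 ≤ Real.sqrt (1 + x) := Real.one_le_sqrt.2 (by linarith)
  have hy1 : 1 ≤ Real.sqrt (1 + y) := Real.one_le_sqrt.2 (by linarith)
  unfold speed
  generalize Real.sqrt (1 + x) = a at *
  generalize Real.sqrt (1 + y) = b at *
  have ha : 0 < a := by linarith
  have hb : 0 < b := by linarith
  refine ⟨a * b * (a + b), ?_, fun h1 h2 => ?_, ?_⟩
  · have : 1 ≤ a * b := by nlinarith
    nlinarith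
  · have ha' : a ≤ 3 / 2 := by nlinarith
    have hb' : b ≤ 3 / 2 := by nlinarith
    have hab : a * b ≤ 2 := by nlinarith [sq_nonneg (a - b)]
    calc a * b * (a + b) ≤ 2 * (3 / 2 + 3 / 2) := by gcongr
      _ = 6 := by norm_num
  · field_simp
    linear_combination hy2 - hx2

theorem speed_sub_le {x y : ℝ} (hx : 0 ≤ x) (hxy : x ≤ y) : speed x - speed y ≤ (y - x) / 2 := by
  obtain ⟨d, h1, -, h3⟩ := speed_sub hx (hx.trans hxy)
  rw [h3]
  have : 0 ≤ y - x := by linarith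
  gcongr

theorem le_speed_sub {x y : ℝ} (hx : 0 ≤ x) (hxy : x ≤ y) (hy : y ≤ 1) :
    (y - x) / 6 ≤ speed x - speed y := by
  obtain ⟨d, h1, h2, h3⟩ := speed_sub hx (hx.trans hxy)
  rw [h3]
  have : 0 ≤ y - x := by linarith
  exact div_le_div_of_nonneg_left this (by linarith) (h2 (hxy.trans hy) hy)

theorem abs_speed_sub_le {x y : ℝ} (hx : 0 ≤ x) (hy : 0 ≤ y) :
    |speed x - speed y| ≤ |x - y| / 2 := by
  obtain ⟨d, h1, -, h3⟩ := speed_sub hx hy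
  rw [h3, abs_div, abs_sub_comm y x, abs_of_pos (by linarith : 0 < d)]
  gcongr

/-- The range of the group speed on the box of a sector. -/
theorem InBox.speed_eq {W u v : ℝ} (hW : 0 < W) (h : InBox W (1 / W) u v) :
    ∃ q : ℝ, 1 / 18 / W ^ 2 ≤ q ∧ q ≤ 28 / W ^ 2 ∧ u / lineJ (1 + v ^ 2) u = speed q := by
  obtain ⟨h1, h2, h3⟩ := h
  have hu : 0 < u := lt_of_lt_of_le (by positivity) h1
  refine ⟨(1 + v ^ 2) / u ^ 2, ?_, ?_, ?_⟩
  · rw [div_le_div_iff₀ (by positivity) (by positivity)]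
    have := pow_le_pow_left₀ hu.le h2 2
    nlinarith [mul_nonneg (sq_nonneg v) (sq_nonneg W)]
  · rw [div_le_div_iff₀ (by positivity) (by positivity)]
    have k1 := pow_le_pow_left₀ (by positivity) h1 2
    have k2 : W * |v| ≤ 25 / 9 * u := by
      have := mul_le_mul_of_nonneg_left h3 hW.le
      calc W * |v| ≤ W * (25 / 9 * (1 / W) * u) := this
        _ = _ := by field_simp
    have k3 := pow_le_pow_left₀ (by positivity) k2 2
    rw [mul_pow, sq_abs] at k3
    nlinarith
  · unfold speed lineJ
    have : Real.sqrt (1 + v ^ 2 + u ^ 2) = u * Real.sqrt (1 + (1 + v ^ 2) / u ^ 2) := by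
      rw [← Real.sqrt_sq hu.le, ← Real.sqrt_mul (sq_nonneg u), Real.sqrt_sq hu.le]
      congr 1
      field_simp
      ring
    rw [this]
    field_simp

theorem lam_eq_speed (k : ℤ) : lam k = speed (1 / ((2 : ℝ) ^ k) ^ 2) := by
  unfold lam speed
  congr 3
  rw [one_div, ← zpow_natCast, ← zpow_mul, ← zpow_neg]
  congr 1
  push_cast; ring

theorem abs_coordT_le (Θ : ℝ × Plane) (p : SpaceTime) :
    |coordT Θ p| ≤ |Θ.1 * p.1 + inner ℝ p.2 Θ.2| := by
  unfold coordT
  rw [abs_div, abs_of_nonneg (Real.sqrt_nonneg _)]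
  exact div_le_self (abs_nonneg _) (Real.one_le_sqrt.2 (by nlinarith [sq_nonneg Θ.1]))

/-- If `w` is not a speed between those at frequencies `W/8` and `8W`, then its distance to the
speeds in the box controls the distance to the central speed. The speeds in the box are `speed q`
with `q W²` in `[1/18, 28]`, well inside the interval `[1/64, 64]`. -/
theorem InBox.speed_gap {W u v w : ℝ} (hW : 64 ≤ W) (h : InBox W (1 / W) u v)
    (hw : w < speed (64 / W ^ 2) ∨ speed (1 / 64 / W ^ 2) < w) :
    |speed (1 / W ^ 2) - w| / 100 ≤ |u / lineJ (1 + v ^ 2) u - w| ∧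
      1 / (200 * W ^ 2) ≤ |u / lineJ (1 + v ^ 2) u - w| := by
  have hWpos : 0 < W := by linarith
  obtain ⟨q, hq1, hq2, hq⟩ := h.speed_eq hWpos
  rw [hq]
  obtain ⟨x, hx⟩ : ∃ x, x = 1 / W ^ 2 := ⟨_, rfl⟩
  have hx0 : 0 < x := by rw [hx]; positivity
  have hx1 : 64 * x ≤ 1 := by
    rw [hx, mul_one_div, div_le_one₀ (by positivity)]; nlinarith
  have e1 : 64 / W ^ 2 = 64 * x := by rw [hx]; ring
  have e2 : 1 / 64 / W ^ 2 = 1 / 64 * x := by rw [hx]; ring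
  have e3 : 1 / (200 * W ^ 2) = x / 200 := by rw [hx]; field_simp
  have e4 : 1 / 18 / W ^ 2 = 1 / 18 * x := by rw [hx]; ring
  have e5 : 28 / W ^ 2 = 28 * x := by rw [hx]; ring
  rw [e1, e2] at hw
  rw [e4] at hq1
  rw [e5] at hq2
  rw [e3, ← hx]
  rcases hw with hw | hw
  · have k1 := le_speed_sub (x := q) (y := 64 * x) (by linarith) (by linarith) hx1
    have k2 := speed_sub_le (x := x) (y := 64 * x) hx0.le (by linarith)
    have k3 := le_speed_sub (x := x) (y := 64 * x) hx0.le (by linarith) hx1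
    rw [abs_of_pos (by linarith), abs_of_pos (by linarith)]
    constructor <;> linarith
  · have k1 := le_speed_sub (x := 1 / 64 * x) (y := q) (by linarith) (by linarith) (by linarith)
    have k2 := speed_sub_le (x := 1 / 64 * x) (y := x) (by linarith) (by linarith)
    have k3 := le_speed_sub (x := 1 / 64 * x) (y := x) (by linarith) (by linarith) (by linarith)
    rw [abs_of_neg (by linarith), abs_of_neg (by linarith)]
    constructor <;> linarith

/-- Intermediate values of the speed between the frequencies `W/8` and `8W`. -/
theorem exists_frequency_of_speed {W w : ℝ} (hW : 0 < W) (h₁ : speed (64 / W ^ 2) ≤ w)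
    (h₂ : w ≤ speed (1 / 64 / W ^ 2)) :
    ∃ m : ℝ, W / 8 ≤ m ∧ m ≤ 8 * W ∧ speed ((m ^ 2)⁻¹) = w := by
  have hcont : ContinuousOn (fun m : ℝ => speed ((m ^ 2)⁻¹)) (Set.Icc (W / 8) (8 * W)) := by
    unfold speed
    intro m hm
    have hm0 : m ≠ 0 := by linarith [hm.1]
    have h1 : Real.sqrt (1 + (m ^ 2)⁻¹) ≠ 0 := (Real.sqrt_pos.2 (by positivity)).ne'
    refine ContinuousAt.continuousWithinAt ?_
    fun_prop (disch := first | assumption | positivity)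
  have := intermediate_value_Icc (by linarith) hcont
  have e1 : ((W / 8) ^ 2)⁻¹ = 64 / W ^ 2 := by field_simp; norm_num
  have e2 : ((8 * W) ^ 2)⁻¹ = 1 / 64 / W ^ 2 := by field_simp; norm_num
  rw [e1, e2] at this
  obtain ⟨m, hm, hmw⟩ := this ⟨h₁, h₂⟩
  exact ⟨m, hm.1, hm.2, hmw⟩

theorem abs_speed_frequency_sub_le {W m m' : ℝ} (hW : 0 < W) (h : W / 8 ≤ m) (h' : W / 8 ≤ m') :
    |speed ((m ^ 2)⁻¹) - speed ((m' ^ 2)⁻¹)| ≤ 512 * |m - m'| / W ^ 3 := by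
  have hm : 0 < m := by linarith
  have hm' : 0 < m' := by linarith
  refine (abs_speed_sub_le (by positivity) (by positivity)).trans ?_
  have e1 : (m ^ 2)⁻¹ - (m' ^ 2)⁻¹ = (m' - m) * (m⁻¹ * m'⁻¹ * m'⁻¹ + m⁻¹ * m⁻¹ * m'⁻¹) := by
    field_simp
    ring
  have i1 : m⁻¹ ≤ 8 / W := by
    rw [← one_div, div_le_div_iff₀ hm hW]; linarith
  have i2 : m'⁻¹ ≤ 8 / W := by
    rw [← one_div, div_le_div_iff₀ hm' hW]; linarith
  rw [e1, abs_mul, abs_sub_comm m' m, abs_of_pos (by positivity :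
    0 < m⁻¹ * m'⁻¹ * m'⁻¹ + m⁻¹ * m⁻¹ * m'⁻¹)]
  calc |m - m'| * (m⁻¹ * m'⁻¹ * m'⁻¹ + m⁻¹ * m⁻¹ * m'⁻¹) / 2
      ≤ |m - m'| * (8 / W * (8 / W) * (8 / W) + 8 / W * (8 / W) * (8 / W)) / 2 := by gcongr
    _ = _ := by ring

/-! ### The frames `Λ_{k,ω}` -/

/-- The speeds of the frames are those of the frequencies `h i` in `[W/8, 8W]`, with `W = 2^k`, `R
= 2^r` and `h = W² / (2^20 R)`. -/
theorem mem_speeds_grid {r k : ℤ} (hk : 100 ≤ k) (hkr : k < r + 20) {v : ℝ} :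
    v ∈ speeds r k ↔ ∃ i : ℤ, (2 : ℝ) ^ k / 8 ≤ ((2 : ℝ) ^ k) ^ 2 / (2 ^ 20 * 2 ^ r) * i ∧
      ((2 : ℝ) ^ k) ^ 2 / (2 ^ 20 * 2 ^ r) * i ≤ 8 * (2 : ℝ) ^ k ∧
      v = speed (((((2 : ℝ) ^ k) ^ 2 / (2 ^ 20 * 2 ^ r) * i) ^ 2)⁻¹) := by
  have e1 : (2 : ℝ) ^ (2 * k - r - 20) = ((2 : ℝ) ^ k) ^ 2 / (2 ^ 20 * 2 ^ r) := by
    rw [zpow_sub₀ two_ne_zero, zpow_sub₀ two_ne_zero, mul_comm 2 k, zpow_mul, div_div, mul_comm]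
    norm_cast
  have e2 : (2 : ℝ) ^ (k - 3) = 2 ^ k / 8 := by
    rw [zpow_sub₀ two_ne_zero]; norm_num
  have e3 : (2 : ℝ) ^ (k + 3) = 8 * 2 ^ k := by
    rw [zpow_add₀ two_ne_zero]; norm_num; ring
  unfold speeds
  rw [if_neg (by linarith), if_pos hkr, e1, e2, e3]
  constructor
  · rintro ⟨m, ⟨i, rfl⟩, hm, rfl⟩
    exact ⟨i, hm.1, hm.2, rfl⟩
  · rintro ⟨i, h1, h2, rfl⟩
    exact ⟨_, ⟨i, rfl⟩, ⟨h1, h2⟩, rfl⟩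

/-- For `k < r + 20`, the frequency `2^k` is a point of the grid. -/
theorem lam_mem_speeds {r k : ℤ} (hk : 100 ≤ k) : lam k ∈ speeds r k := by
  by_cases hkr : k < r + 20
  · rw [mem_speeds_grid hk hkr]
    obtain ⟨n, hn⟩ := Int.eq_ofNat_of_zero_le (show 0 ≤ r + 20 - k by linarith)
    have hW : (0 : ℝ) < 2 ^ k := by positivity
    have hr : (0 : ℝ) < 2 ^ r := by positivity
    have h1 : (2 : ℝ) ^ n * 2 ^ k = 2 ^ 20 * 2 ^ r := by
      rw [← zpow_natCast, ← zpow_natCast (2 : ℝ) 20, ← zpow_add₀ two_ne_zero,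
        ← zpow_add₀ two_ne_zero]
      congr 1
      push_cast
      linarith
    have h2 : ((2 : ℝ) ^ k) ^ 2 / (2 ^ 20 * 2 ^ r) * (((2 ^ n : ℕ) : ℤ) : ℝ) = 2 ^ k := by
      rw [← h1]
      push_cast
      field_simp
    refine ⟨((2 ^ n : ℕ) : ℤ), ?_, ?_, ?_⟩
    · rw [h2]; linarith
    · rw [h2]; linarith
    · rw [h2, lam_eq_speed, one_div]
  · unfold speeds
    rw [if_neg (by linarith), if_neg hkr]
    rfl

theorem card_framesLambda_grid_le {r k : ℤ} (hk : 100 ≤ k) (hkr : k < r + 20) (ω : Plane) :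
    ((framesLambda r k ω).card : ℝ) ≤ 2 ^ 24 * (2 ^ r / 2 ^ k) := by
  obtain ⟨W, hW⟩ : ∃ W : ℝ, W = 2 ^ k := ⟨_, rfl⟩
  obtain ⟨R, hR⟩ : ∃ R : ℝ, R = 2 ^ r := ⟨_, rfl⟩
  have hWpos : 0 < W := by rw [hW]; positivity
  have hRpos : 0 < R := by rw [hR]; positivity
  have hWR : W ≤ 2 ^ 20 * R := by
    rw [hW, hR, ← zpow_natCast (2 : ℝ) 20, ← zpow_add₀ two_ne_zero]
    exact zpow_le_zpow_right₀ (by norm_num) (by push_cast; linarith)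
  obtain ⟨h, hh⟩ : ∃ h : ℝ, h = W ^ 2 / (2 ^ 20 * R) := ⟨_, rfl⟩
  have hhpos : 0 < h := by rw [hh]; positivity
  have hcard := card_le_of_forall_exists (S := framesLambda r k ω)
    (Finset.Icc ⌈W / 8 / h⌉ ⌊8 * W / h⌋) (fun i => (speed (((h * i) ^ 2)⁻¹), ω)) (by
      intro Θ hΘ
      obtain ⟨h1, h2⟩ := mem_framesLambda.1 hΘ
      rw [mem_speeds_grid hk hkr, ← hW, ← hR, ← hh] at h1
      obtain ⟨i, k1, k2, k3⟩ := h1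
      refine ⟨i, Finset.mem_Icc.2 ⟨Int.ceil_le.2 ?_, Int.le_floor.2 ?_⟩, Prod.ext k3.symm h2.symm⟩
      · rw [div_le_iff₀ hhpos]; linarith
      · rw [le_div_iff₀ hhpos]; linarith)
  have hle : W / 8 / h ≤ 8 * W / h := by gcongr; linarith
  have h3 := card_Icc_ceil_floor_le hle
  have h4 : ((framesLambda r k ω).card : ℝ)
      ≤ ((Finset.Icc ⌈W / 8 / h⌉ ⌊8 * W / h⌋).card : ℝ) := by exact_mod_cast hcard
  have e1 : 8 * W / h = 8 * (2 ^ 20 * R / W) := by rw [hh]; field_simp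
  have e2 : 0 ≤ W / 8 / h := by positivity
  have e3 : 1 ≤ 2 ^ 20 * R / W := by rwa [one_le_div₀ hWpos]
  have e4 : 2 ^ 24 * (R / W) = 16 * (2 ^ 20 * R / W) := by ring
  rw [← hW, ← hR, e4]
  linarith

/-- A lower bound for the number of frames whose speed is close to a given speed. -/
theorem le_card_framesLambda_grid {r k : ℤ} (hk : 100 ≤ k) (hkr : k < r + 20) {ω : Plane}
    {p : SpaceTime} (hp0 : p.1 ≠ 0) (hp : |p.1| ≤ 2 * (2 : ℝ) ^ r) {m : ℝ}
    (hm₁ : (2 : ℝ) ^ k / 8 ≤ m) (hm₂ : m ≤ 8 * (2 : ℝ) ^ k)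
    (hm : inner ℝ p.2 ω = -(p.1 * speed ((m ^ 2)⁻¹))) :
    2 ^ 10 * (2 : ℝ) ^ r * min (1 / |p.1|) (1 / 2 ^ k)
      ≤ ((framesLambda r k ω).filter fun Θ => |coordT Θ p| ≤ 2 / 2 ^ k).card := by
  obtain ⟨W, hW⟩ : ∃ W : ℝ, W = 2 ^ k := ⟨_, rfl⟩
  obtain ⟨R, hR⟩ : ∃ R : ℝ, R = 2 ^ r := ⟨_, rfl⟩
  have hWpos : 0 < W := by rw [hW]; positivity
  have hRpos : 0 < R := by rw [hR]; positivity
  have hWR : 2 * W ≤ 2 ^ 20 * R := by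
    have : 2 * W = 2 ^ (k + 1) := by rw [hW, zpow_add₀ two_ne_zero, zpow_one, mul_comm]
    rw [this, hR, ← zpow_natCast (2 : ℝ) 20, ← zpow_add₀ two_ne_zero]
    exact zpow_le_zpow_right₀ (by norm_num) (by push_cast; linarith)
  have ht := abs_pos.2 hp0
  obtain ⟨h, hh⟩ : ∃ h : ℝ, h = W ^ 2 / (2 ^ 20 * R) := ⟨_, rfl⟩
  have hhpos : 0 < h := by rw [hh]; positivity
  rw [← hR] at hp ⊢
  rw [← hW] at hm₁ hm₂ ⊢
  have eN : 8 * W / h - W / 8 / h = 63 / 8 * (2 ^ 20 * R / W) := by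
    rw [hh]; field_simp; ring
  have h2 : 2 ≤ 2 ^ 20 * R / W := by rwa [le_div_iff₀ hWpos]
  -- frequencies within `h D` of `m`: their speeds differ from that of `m` by `O(h D / W³)`, which
  -- is `O(1 / (W |t|))` for this `D`
  obtain ⟨s, hs, hcard⟩ := exists_int_finset_near (N₁ := W / 8 / h) (N₂ := 8 * W / h)
    (z := m / h) (D := 2 ^ 11 * R / |p.1|) (by gcongr) (by gcongr)
    (by rw [le_div_iff₀ ht]; linarith) (by rw [eN]; linarith)
  rw [eN] at hcard
  have hmin : 2 ^ 10 * R * min (1 / |p.1|) (1 / W)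
      ≤ min (2 ^ 11 * R / |p.1|) (63 / 8 * (2 ^ 20 * R / W) / 2) / 2 := by
    rw [mul_min_of_nonneg _ _ (by positivity), le_div_iff₀ two_pos, min_mul_of_nonneg _ _ two_pos.le]
    refine min_le_min (le_of_eq (by ring)) ?_
    have : 0 ≤ R / W := by positivity
    calc 2 ^ 10 * R * (1 / W) * 2 = 2 ^ 11 * (R / W) := by ring
      _ ≤ 63 / 8 * 2 ^ 20 / 2 * (R / W) := by gcongr; norm_num
      _ = _ := by ring
  refine hmin.trans (hcard.trans ?_)
  have hle : s.card ≤ ((framesLambda r k ω).filter fun Θ => |coordT Θ p| ≤ 2 / W).card := by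
    refine Finset.card_le_card_of_injOn (fun i => (speed (((h * i) ^ 2)⁻¹), ω)) ?_ ?_
    · intro i hi
      obtain ⟨h1, h2, h3⟩ := hs i hi
      rw [div_le_iff₀ hhpos] at h1
      rw [le_div_iff₀ hhpos] at h2
      simp only [Finset.coe_filter, Set.mem_ofPred_eq, mem_framesLambda]
      refine ⟨⟨?_, trivial⟩, (abs_coordT_le _ _).trans ?_⟩
      · rw [mem_speeds_grid hk hkr, ← hW, ← hR, ← hh]
        exact ⟨i, by linarith, by linarith, rfl⟩
      · simp only
        have e1 : speed (((h * i) ^ 2)⁻¹) * p.1 + inner ℝ p.2 ω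
            = p.1 * (speed (((h * i) ^ 2)⁻¹) - speed ((m ^ 2)⁻¹)) := by rw [hm]; ring
        have e2 : |h * i - m| ≤ h * (2 ^ 11 * R / |p.1|) := by
          have : h * i - m = h * (i - m / h) := by field_simp
          rw [this, abs_mul, abs_of_pos hhpos]
          gcongr
        rw [e1, abs_mul]
        calc |p.1| * |speed (((h * i) ^ 2)⁻¹) - speed ((m ^ 2)⁻¹)|
            ≤ |p.1| * (512 * |h * i - m| / W ^ 3) := by
              gcongr
              exact abs_speed_frequency_sub_le hWpos (by linarith) hm₁
          _ ≤ |p.1| * (512 * (h * (2 ^ 11 * R / |p.1|)) / W ^ 3) := by gcongr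
          _ = 1 / W := by rw [hh]; field_simp; norm_num
          _ ≤ 2 / W := by gcongr; norm_num
    · intro i hi j hj hij
      have hpos : ∀ i ∈ s, (0 : ℝ) < h * i := fun i hi => by
        obtain ⟨h1, -, -⟩ := hs i hi
        rw [div_le_iff₀ hhpos] at h1
        linarith
      have h1 := congrArg Prod.fst hij
      simp only [speed] at h1
      have k1 := hpos i hi
      have k2 := hpos j hj
      have h3 : Real.sqrt (1 + ((h * i) ^ 2)⁻¹) = Real.sqrt (1 + ((h * j) ^ 2)⁻¹) := by
        rw [one_div, one_div] at h1
        exact inv_injective h1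
      rw [Real.sqrt_inj (by positivity) (by positivity), add_right_inj, inv_inj,
        sq_eq_sq₀ k1.le k2.le] at h3
      exact_mod_cast mul_left_cancel₀ hhpos.ne' h3
  exact_mod_cast hle

theorem two_pow_hundred_le {k : ℤ} (hk : 100 ≤ k) : (2 : ℝ) ^ 100 ≤ 2 ^ k := by
  rw [← zpow_natCast]
  exact zpow_le_zpow_right₀ (by norm_num) (by exact_mod_cast hk)

/-- The tail bound away from the speeds of the frames. -/
theorem tail_phase_bound {W u v : ℝ} {p : SpaceTime} {y : ℝ} (hW : 64 ≤ W)
    (hb : InBox W (1 / W) u v)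
    (hout : p.1 = 0 ∨ (-y / p.1 < speed (64 / W ^ 2) ∨ speed (1 / 64 / W ^ 2) < -y / p.1)) :
    max (|speed (1 / W ^ 2) * p.1 + y| / 100) (|p.1| / (200 * W ^ 2))
      ≤ |y + p.1 * (u / lineJ (1 + v ^ 2) u)| := by
  by_cases ht : p.1 = 0
  · rw [ht]
    simp only [mul_zero, zero_add, zero_mul, add_zero, abs_zero, zero_div]
    exact max_le (by linarith [abs_nonneg y]) (abs_nonneg y)
  · have h := hb.speed_gap hW (hout.resolve_left ht)
    have e1 : ∀ s : ℝ, y + p.1 * s = p.1 * (s - -y / p.1) := fun s => by field_simp; ring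
    rw [add_comm (speed _ * _), mul_comm (speed _), e1, e1, abs_mul, abs_mul]
    have ht' := abs_nonneg p.1
    refine max_le ?_ ?_
    · calc |p.1| * |speed (1 / W ^ 2) - -y / p.1| / 100
          = |p.1| * (|speed (1 / W ^ 2) - -y / p.1| / 100) := by ring
        _ ≤ _ := by gcongr; exact h.1
    · calc |p.1| / (200 * W ^ 2) = |p.1| * (1 / (200 * W ^ 2)) := by ring
        _ ≤ _ := by gcongr; exact h.2

/-- On times at most `W / 2^{19}` all speeds of the box are alike. -/
theorem short_time_phase_bound {W u v : ℝ} {p : SpaceTime} {y : ℝ} (hW : 64 ≤ W)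
    (hb : InBox W (1 / W) u v) (ht : |p.1| ≤ W / 2 ^ 19)
    (hy : 1 / W ≤ |speed (1 / W ^ 2) * p.1 + y|) :
    |speed (1 / W ^ 2) * p.1 + y| / 2 ≤ |y + p.1 * (u / lineJ (1 + v ^ 2) u)| := by
  have hWpos : 0 < W := by linarith
  obtain ⟨q, hq1, hq2, hq⟩ := hb.speed_eq hWpos
  rw [hq]
  have hq0 : 0 ≤ q := le_trans (by positivity) hq1
  have h1 := abs_speed_sub_le hq0 (y := 1 / W ^ 2) (by positivity)
  have h2 : |q - 1 / W ^ 2| ≤ 28 / W ^ 2 := by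
    have e : 28 / W ^ 2 = 28 * (1 / W ^ 2) := by ring
    have e' : 0 < 1 / W ^ 2 := by positivity
    rw [e] at hq2 ⊢
    exact abs_le.2 ⟨by linarith, by linarith⟩
  have h3 : |p.1 * (speed q - speed (1 / W ^ 2))| ≤ 1 / W / 2 := by
    rw [abs_mul]
    calc |p.1| * |speed q - speed (1 / W ^ 2)| ≤ W / 2 ^ 19 * (28 / W ^ 2 / 2) := by
          gcongr
          exact h1.trans (by gcongr)
      _ = 14 / 2 ^ 19 / W := by field_simp; norm_num
      _ ≤ 1 / 2 / W := div_le_div_of_nonneg_right (by norm_num) hWpos.le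
      _ = _ := by ring
  have h4 := abs_sub_abs_le_abs_sub (speed (1 / W ^ 2) * p.1 + y)
    (-(p.1 * (speed q - speed (1 / W ^ 2))))
  rw [abs_neg] at h4
  have e1 : speed (1 / W ^ 2) * p.1 + y - -(p.1 * (speed q - speed (1 / W ^ 2)))
      = y + p.1 * speed q := by ring
  rw [e1] at h4
  linarith

theorem div_one_add_sq_le {B a b : ℝ} (hB : 0 ≤ B) (h : |a| ≤ |b|) :
    B / (1 + b ^ 2) ≤ B / (1 + a ^ 2) := by
  have := sq_le_sq.2 h
  gcongr

theorem le_mul_min_of_le {C W t F : ℝ} (h₁ : F ≤ C * W)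
    (h₂ : F ≤ C * (W ^ 2 / t)) (hW : 0 < W) :
    F ≤ C * W ^ 2 * min (1 / t) (1 / W) := by
  rcases min_cases (1 / t) (1 / W) with ⟨h, -⟩ | ⟨h, -⟩
  · rw [h]
    exact h₂.trans_eq (by ring)
  · rw [h]
    exact h₁.trans_eq (by field_simp)

/-- The estimate in the frames `Λ_{k,ω}`, `k ≥ 100`, for frequencies in a sector of aperture
comparable to `2^{-k}`. -/
theorem exists_sumNorm_framesLambda :
    ∃ C : ℝ, 0 ≤ C ∧ ∀ (r k : ℤ) (T : ℝ) (ω : Plane) (f : L2), 0 < r → T ≤ (2 : ℝ) ^ r →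
      100 ≤ k → ‖ω‖ = 1 → FourierSupportedIn f (sector (2 ^ k) (1 / 2 ^ k) ω) →
      sumNorm normL2TLinfX (framesLambda r k ω) (truncatedWave T f)
        ≤ ENNReal.ofReal (C * ‖f‖) := by
  obtain ⟨C, hC, hamp⟩ := exists_sector_amplitude (m := 200) (by norm_num)
  obtain ⟨L, hL⟩ : ∃ L : ℝ, L = 4 * 2 ^ 14 * C + Real.pi * (200 * C) + 1 := ⟨_, rfl⟩
  have hπ := Real.pi_pos
  have hL1 : 1 ≤ L := by
    rw [hL]
    have : 0 ≤ 4 * 2 ^ 14 * C + Real.pi * (200 * C) := by positivity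
    linarith
  refine ⟨L, by linarith, fun r k T ω f _ hT hk hω hf => ?_⟩
  have hbig := two_pow_hundred_le hk
  obtain ⟨W, hW⟩ : ∃ W : ℝ, W = 2 ^ k := ⟨_, rfl⟩
  obtain ⟨R, hR⟩ : ∃ R : ℝ, R = 2 ^ r := ⟨_, rfl⟩
  have hRpos : 0 < R := by rw [hR]; positivity
  rw [← hW] at hbig
  have hW64 : 64 ≤ W := le_trans (by norm_num) hbig
  have hWpos : 0 < W := by linarith
  obtain ⟨a, hai, ha0, ha1, hker⟩ := hamp W (1 / W) ω (by linarith) (by positivity)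
    (by field_simp; exact le_rfl) hω
  have hlam : lam k = speed (1 / W ^ 2) := by rw [hW]; exact lam_eq_speed k
  -- for `k ≥ r + 20` the tail in the single frame is enough
  obtain ⟨A, hA⟩ : ∃ A : ℝ, A = if k < r + 20 then C * W ^ 2 / (2 ^ 10 * R) else 0 := ⟨_, rfl⟩
  have hA0 : 0 ≤ A := by rw [hA]; split_ifs <;> positivity
  rw [← hW] at hf
  refine sumNorm_le_of_majorant (S := framesLambda r k ω)
    (e := fun Θ q => framePoint Θ q.1 q.2.1 q.2.2) (σ := coordT)
    (fun Θ hΘ => isChart_coordT Θ (by rw [(mem_framesLambda.1 hΘ).2]; exact hω))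
    (isBounded_sector _ _ _) hf T hai ha0 ha1 (Θ₀ := (lam k, ω))
    (mem_framesLambda.2 ⟨lam_mem_speeds hk, rfl⟩)
    (A := A) (B := 2 * C * W) (c := 2 / W) (β := W / 100) hA0
    (by positivity) (by positivity) (by positivity) (by linarith) ?_ ?_
  · intro p hp
    have hp' : |p.1| ≤ 2 * R := by rw [hR]; linarith
    obtain ⟨hk1, hk2, hk3, -⟩ := hker p
    have hσ := abs_coordT_le (lam k, ω) p
    rw [hlam] at hσ ⊢
    simp only at hσ
    have htailB : ∀ s : ℝ, |coordT (speed (1 / W ^ 2), ω) p| / 100 ≤ s →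
        C * W / (1 + (W * s) ^ 2)
          ≤ 2 * C * W / (1 + (W / 100 * coordT (speed (1 / W ^ 2), ω) p) ^ 2) := by
      intro s hs
      have hs0 : 0 ≤ s := le_trans (by positivity) hs
      refine (div_one_add_sq_le (by positivity) (a := W / 100 * coordT (speed (1 / W ^ 2), ω) p)
        ?_).trans ?_
      · rw [abs_mul, abs_mul, abs_of_pos hWpos, abs_of_pos (by positivity : 0 < W / 100),
          abs_of_nonneg hs0]
        calc W / 100 * |coordT (speed (1 / W ^ 2), ω) p|
            = W * (|coordT (speed (1 / W ^ 2), ω) p| / 100) := by ring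
          _ ≤ W * s := by gcongr
      · gcongr
        linarith [mul_nonneg hC hWpos.le]
    by_cases hkr : k < r + 20
    · -- if `-x·ω / t` is not among the speeds of the grid, then the phase is nonstationary;
      -- otherwise frames near this speed are counted
      by_cases hout : p.1 = 0 ∨ (-inner ℝ p.2 ω / p.1 < speed (64 / W ^ 2)
          ∨ speed (1 / 64 / W ^ 2) < -inner ℝ p.2 ω / p.1)
      · refine le_add_of_nonneg_of_le (by positivity) ?_
        refine (hk3 _ (le_trans (by positivity) (le_max_left _ _)) ?_
          fun u v huv => tail_phase_bound hW64 huv hout).trans (htailB _ ?_)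
        · calc |p.1| = 200 * (W ^ 2 * (|p.1| / (200 * W ^ 2))) := by field_simp
            _ ≤ _ := by gcongr; exact le_max_right _ _
        · exact le_trans (by gcongr) (le_max_left _ _)
      · push Not at hout
        obtain ⟨ht, hlo, hhi⟩ := hout
        obtain ⟨m, hm1, hm2, hm⟩ := exists_frequency_of_speed hWpos hlo hhi
        have hcount := le_card_framesLambda_grid hk hkr ht (by rw [← hR]; exact hp') (m := m)
          (ω := ω) (by rw [← hW]; exact hm1) (by rw [← hW]; exact hm2)
          (by rw [hm]; field_simp)
        rw [← hW, ← hR] at hcount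
        refine le_add_of_le_of_nonneg ?_ (by positivity)
        refine (le_mul_min_of_le hk1 (hk2 ht) hWpos).trans ?_
        rw [hA, if_pos hkr]
        calc C * W ^ 2 * min (1 / |p.1|) (1 / W)
            = C * W ^ 2 / (2 ^ 10 * R) * (2 ^ 10 * R * min (1 / |p.1|) (1 / W)) := by
              field_simp
          _ ≤ _ := by gcongr
    · refine le_add_of_nonneg_of_le (by positivity) ?_
      have ht : |p.1| ≤ W / 2 ^ 19 := by
        have h1 : 2 ^ 20 * R ≤ W := by
          rw [hR, hW, ← zpow_natCast (2 : ℝ) 20, ← zpow_add₀ two_ne_zero]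
          exact zpow_le_zpow_right₀ (by norm_num) (by push_cast; linarith)
        rw [le_div_iff₀ (by positivity)]
        linarith
      -- for `|t_Θ| ≤ 1 / W` the trivial bound is as good as the tail
      by_cases hy : 1 / W ≤ |speed (1 / W ^ 2) * p.1 + inner ℝ p.2 ω|
      · refine (hk3 (|speed (1 / W ^ 2) * p.1 + inner ℝ p.2 ω| / 2) (by positivity) ?_
          fun u v huv => short_time_phase_bound hW64 huv ht hy).trans (htailB _ ?_)
        swap
        · linarith only [hσ, abs_nonneg (speed (1 / W ^ 2) * p.1 + inner ℝ p.2 ω)]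
        rw [div_le_iff₀ hWpos] at hy
        have h2 : W ≤ W ^ 2 * |speed (1 / W ^ 2) * p.1 + inner ℝ p.2 ω| := by
          calc W = W * 1 := (mul_one W).symm
            _ ≤ W * (|speed (1 / W ^ 2) * p.1 + inner ℝ p.2 ω| * W) := by gcongr
            _ = _ := by ring
        have h3 : W / 2 ^ 19 ≤ W := div_le_self hWpos.le (by norm_num)
        linarith
      · push Not at hy
        refine hk1.trans ?_
        rw [le_div_iff₀ (by positivity)]
        have h1 : |W / 100 * coordT (speed (1 / W ^ 2), ω) p| ≤ 1 := by
          rw [abs_mul, abs_of_pos (by positivity : 0 < W / 100)]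
          calc W / 100 * |coordT (speed (1 / W ^ 2), ω) p| ≤ W / 100 * (1 / W) := by
                gcongr; exact hσ.trans hy.le
            _ = 1 / 100 := by field_simp
            _ ≤ 1 := by norm_num
        have h2 := (sq_le_one_iff_abs_le_one _).2 h1
        calc C * W * (1 + (W / 100 * coordT (speed (1 / W ^ 2), ω) p) ^ 2) ≤ C * W * (1 + 1) := by
              gcongr
          _ = _ := by ring
  · have e1 : Real.pi * (2 * C * W) / (W / 100) = Real.pi * (200 * C) := by field_simp; ring
    have e2 : 2 * (2 / W) * A * ((framesLambda r k ω).card : ℝ) ≤ 4 * 2 ^ 14 * C := by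
      rw [hA]
      split_ifs with hkr
      · have hcard := card_framesLambda_grid_le hk hkr ω
        rw [← hW, ← hR] at hcard
        calc 2 * (2 / W) * (C * W ^ 2 / (2 ^ 10 * R)) * ((framesLambda r k ω).card : ℝ)
            ≤ 2 * (2 / W) * (C * W ^ 2 / (2 ^ 10 * R)) * (2 ^ 24 * (R / W)) := by gcongr
          _ = 4 * 2 ^ 14 * C := by field_simp; norm_num; ring
      · simp; positivity
    have e3 : L ≤ L ^ 2 := by nlinarith only [hL1]
    linarith

/-! ### The frames `Ω_{k,ω}` -/

theorem rotate_eq_planeMap (θ : ℝ) (ω : Plane) :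
    rotate θ ω = planeMap ω (Real.cos θ, Real.sin θ) := rfl

theorem norm_rotate {ω : Plane} (hω : ‖ω‖ = 1) (θ : ℝ) : ‖rotate θ ω‖ = 1 := by
  have h := norm_sq_planeMap hω (Real.cos θ, Real.sin θ)
  rw [← rotate_eq_planeMap] at h
  simp only [Real.cos_sq_add_sin_sq] at h
  exact (pow_eq_one_iff_of_nonneg (norm_nonneg _) two_ne_zero).1 h

theorem perp_rotate (θ : ℝ) (ω : Plane) :
    perp (rotate θ ω) = Real.cos θ • perp ω - Real.sin θ • ω := by
  ext i
  fin_cases i <;> simp [perp, rotate] <;> ring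

theorem coordX2_rotate (lm θ : ℝ) (ω : Plane) (p : SpaceTime) :
    coordX2 (lm, rotate θ ω) p
      = Real.cos θ * inner ℝ p.2 (perp ω) - Real.sin θ * inner ℝ p.2 ω := by
  unfold coordX2
  simp only [perp_rotate, inner_sub_right, inner_smul_right]

theorem rotate_injOn {ω : Plane} (hω : ‖ω‖ = 1) :
    Set.InjOn (fun θ => rotate θ ω) (Set.Icc (-1) 1) := by
  intro θ hθ θ' hθ' h
  have h1 := congrArg (fun x => inner ℝ x (perp ω)) h
  simp only [rotate_eq_planeMap, inner_planeMap_perp hω] at h1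
  have hpi := Real.pi_gt_three
  exact Real.injOn_sin ⟨by linarith [hθ.1], by linarith [hθ.2]⟩
    ⟨by linarith [hθ'.1], by linarith [hθ'.2]⟩ h1

theorem abs_arctan_le (x : ℝ) : |Real.arctan x| ≤ |x| := by
  have key : ∀ y : ℝ, 0 ≤ y → |Real.arctan y| ≤ |y| := by
    intro y hy
    have h0 : 0 ≤ Real.arctan y := Real.arctan_nonneg.2 hy
    rw [abs_of_nonneg h0, abs_of_nonneg hy]
    have := Real.le_tan h0 (Real.arctan_lt_pi_div_two y)
    rwa [Real.tan_arctan] at this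
  rcases le_total 0 x with h | h
  · exact key x h
  · have := key (-x) (by linarith)
    rwa [Real.arctan_neg, abs_neg, abs_neg] at this

/-- Rotating by nearly the angle of `(x₁, x₂)` makes the second coordinate small. -/
theorem abs_rotated_coord_le {x₁ x₂ φ : ℝ} (hx₁ : x₁ ≠ 0) (h : |x₂ / x₁| ≤ 1) :
    |Real.cos φ * x₂ - Real.sin φ * x₁| ≤ 2 * |x₁| * |φ - Real.arctan (x₂ / x₁)| := by
  obtain ⟨θ, hθ⟩ : ∃ θ, θ = Real.arctan (x₂ / x₁) := ⟨_, rfl⟩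
  have htan : Real.tan θ = x₂ / x₁ := by rw [hθ, Real.tan_arctan]
  have hcos : 0 < Real.cos θ := by rw [hθ]; exact Real.cos_arctan_pos _
  have hcos2 : 1 / 2 ≤ Real.cos θ := by
    rw [hθ, Real.cos_arctan]
    apply one_div_le_one_div_of_le (by positivity)
    rw [Real.sqrt_le_left (by norm_num)]
    have := (sq_le_one_iff_abs_le_one _).2 h
    linarith
  have hx2 : x₂ = x₁ * (Real.sin θ / Real.cos θ) := by
    rw [← Real.tan_eq_sin_div_cos, htan]; field_simp
  have e : Real.cos φ * x₂ - Real.sin φ * x₁ = -(x₁ / Real.cos θ * Real.sin (φ - θ)) := by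
    rw [hx2, Real.sin_sub]; field_simp; ring
  rw [← hθ, e, abs_neg, abs_mul, abs_div, abs_of_pos hcos]
  have h3 : |Real.sin (φ - θ)| ≤ |φ - θ| := Real.abs_sin_le_abs
  have h4 : |x₁| / Real.cos θ ≤ 2 * |x₁| := by
    rw [div_le_iff₀ hcos]
    nlinarith [abs_nonneg x₁]
  gcongr

theorem directions_bound_eq (r k : ℤ) :
    (2 : ℝ) ^ (-k - 8 + r) = 2 ^ r / (256 * 2 ^ k) := by
  rw [zpow_add₀ two_ne_zero, zpow_sub₀ two_ne_zero, zpow_neg]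
  norm_num
  field_simp

theorem card_framesOmega_le (r k : ℤ) (ω : Plane) :
    ((framesOmega r k ω).card : ℝ) ≤ 2 * (2 ^ r / (256 * 2 ^ k)) + 1 := by
  obtain ⟨N, hN⟩ : ∃ N : ℝ, N = 2 ^ r / (256 * 2 ^ k) := ⟨_, rfl⟩
  have hN0 : 0 ≤ N := by rw [hN]; positivity
  have h := card_le_of_forall_exists (S := framesOmega r k ω) (Finset.Icc ⌈-N⌉ ⌊N⌋)
    (fun i => (lam k, rotate (i * (2 : ℝ) ^ (-r)) ω)) (by
      intro Θ hΘ
      obtain ⟨h1, i, hi, h2⟩ := mem_framesOmega.1 hΘ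
      rw [directions_bound_eq, ← hN] at hi
      obtain ⟨h3, h4⟩ := abs_le.1 hi
      exact ⟨i, Finset.mem_Icc.2 ⟨Int.ceil_le.2 h3, Int.le_floor.2 h4⟩,
        Prod.ext h1.symm h2.symm⟩)
  have h2 := card_Icc_ceil_floor_le (a := -N) (b := N) (by linarith)
  have h3 : ((framesOmega r k ω).card : ℝ) ≤ ((Finset.Icc ⌈-N⌉ ⌊N⌋).card : ℝ) := by
    exact_mod_cast h
  rw [← hN]
  linarith

/-- A lower bound for the number of directions `R^i ω` that are nearly parallel to `x`. The first
bound serves when `Ω_{k,ω}` has only a bounded number of frames. -/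
theorem le_card_framesOmega {r k : ℤ} (hr : 0 < r) (hk : 100 ≤ k) {ω : Plane} (hω : ‖ω‖ = 1)
    {p : SpaceTime} (hp0 : p.1 ≠ 0) (hp : |p.1| ≤ 2 * (2 : ℝ) ^ r)
    (h₁ : 9 / 10 * |p.1| ≤ |inner ℝ p.2 ω|) (h₂ : |inner ℝ p.2 ω| ≤ 2 * |p.1|)
    (h₃ : |inner ℝ p.2 (perp ω)| ≤ 7 / 2 * (1 / (1024 * 2 ^ k)) * |p.1|) :
    1 ≤ (((framesOmega r k ω).filter fun Θ => |coordX2 Θ p| ≤ 8).card : ℝ) ∧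
    (2 : ℝ) ^ r / 512 * min (1 / |p.1|) (1 / 2 ^ k)
      ≤ ((framesOmega r k ω).filter fun Θ => |coordX2 Θ p| ≤ 8).card := by
  obtain ⟨W, hW⟩ : ∃ W : ℝ, W = 2 ^ k := ⟨_, rfl⟩
  obtain ⟨R, hR⟩ : ∃ R : ℝ, R = 2 ^ r := ⟨_, rfl⟩
  have hRpos : 0 < R := by rw [hR]; positivity
  have hR1 : 1 ≤ R := by rw [hR]; exact one_le_zpow₀ (by norm_num) hr.le
  have hW1 : 1 ≤ W := by
    rw [hW]; exact le_trans (by norm_num) (two_pow_hundred_le hk)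
  have hWpos : 0 < W := by linarith
  have ht := abs_pos.2 hp0
  rw [← hW] at h₃
  rw [← hR] at hp
  have hx₁ : 0 < |inner ℝ p.2 ω| := lt_of_lt_of_le (by positivity) h₁
  have hratio : |inner ℝ p.2 (perp ω) / inner ℝ p.2 ω| ≤ 1 / (256 * W) := by
    rw [abs_div, div_le_iff₀ hx₁]
    calc |inner ℝ p.2 (perp ω)| ≤ 7 / 2 * (1 / (1024 * W)) * |p.1| := h₃
      _ = 7 / 8 * (1 / (256 * W)) * |p.1| := by field_simp; norm_num
      _ ≤ 1 / (256 * W) * (9 / 10 * |p.1|) := by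
        have : 0 ≤ 1 / (256 * W) * |p.1| := by positivity
        linarith
      _ ≤ _ := by gcongr
  have hratio1 : |inner ℝ p.2 (perp ω) / inner ℝ p.2 ω| ≤ 1 := by
    refine hratio.trans ?_
    rw [div_le_one₀ (by positivity)]; linarith
  obtain ⟨θ, hθ⟩ : ∃ θ, θ = Real.arctan (inner ℝ p.2 (perp ω) / inner ℝ p.2 ω) := ⟨_, rfl⟩
  have hθle : |θ| ≤ 1 / (256 * W) := by
    rw [hθ]
    exact (abs_arctan_le _).trans hratio
  -- rotations by `i 2^{-r}` within `2 / |t|` of the angle `θ` of `x` to `ω`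
  obtain ⟨s, hs, hone, hcard⟩ := exists_int_finset_near_symm (N := R / (256 * W)) (z := θ * R)
    (D := 2 * R / |p.1|)
    (by
      rw [abs_mul, abs_of_pos hRpos]
      calc |θ| * R ≤ 1 / (256 * W) * R := by gcongr
        _ = _ := by ring)
    (by rwa [one_le_div₀ ht])
  have hmin : R / 512 * min (1 / |p.1|) (1 / W) ≤ min (2 * R / |p.1|) (R / (256 * W)) / 2 := by
    rw [mul_min_of_nonneg _ _ (by positivity), le_div_iff₀ two_pos, min_mul_of_nonneg _ _ two_pos.le]
    refine min_le_min ?_ (le_of_eq (by field_simp; norm_num))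
    have : 0 ≤ R / |p.1| := by positivity
    calc R / 512 * (1 / |p.1|) * 2 = 1 / 256 * (R / |p.1|) := by ring
      _ ≤ 2 * (R / |p.1|) := by gcongr; norm_num
      _ = _ := by ring
  have hle : s.card ≤ ((framesOmega r k ω).filter fun Θ => |coordX2 Θ p| ≤ 8).card := by
    have e0 : (2 : ℝ) ^ (-r) = 1 / R := by rw [hR, zpow_neg, one_div]
    refine Finset.card_le_card_of_injOn (fun i => (lam k, rotate (i * (2 : ℝ) ^ (-r)) ω)) ?_ ?_
    · intro i hi
      obtain ⟨k1, k2⟩ := hs i hi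
      simp only [Finset.coe_filter, Set.mem_ofPred_eq, mem_framesOmega, coordX2_rotate]
      refine ⟨⟨trivial, i, by rw [directions_bound_eq, ← hW, ← hR]; exact k1, rfl⟩, ?_⟩
      refine (abs_rotated_coord_le (abs_pos.1 hx₁) hratio1).trans ?_
      rw [← hθ]
      have e1 : (i : ℝ) * (2 : ℝ) ^ (-r) - θ = 1 / R * ((i : ℝ) - θ * R) := by
        rw [e0]; field_simp
      rw [e1, abs_mul, abs_of_pos (by positivity : 0 < 1 / R)]
      calc 2 * |inner ℝ p.2 ω| * (1 / R * |(i : ℝ) - θ * R|)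
          ≤ 2 * (2 * |p.1|) * (1 / R * (2 * R / |p.1|)) := by gcongr
        _ = 8 := by field_simp; norm_num
    · intro i hi j hj hij
      have hI : ∀ i ∈ s, (i : ℝ) * (2 : ℝ) ^ (-r) ∈ Set.Icc (-1 : ℝ) 1 := fun i hi => by
        obtain ⟨k1, -⟩ := hs i hi
        rw [Set.mem_Icc, ← abs_le, abs_mul, e0, abs_of_pos (by positivity : 0 < 1 / R), mul_one_div,
          div_le_one₀ hRpos]
        exact k1.trans (div_le_self hRpos.le (by linarith))
      have h1 := rotate_injOn hω (hI i hi) (hI j hj) (congrArg Prod.snd hij)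
      have h2 : (2 : ℝ) ^ (-r) ≠ 0 := by positivity
      exact_mod_cast mul_right_cancel₀ h2 h1
  have hle' : (s.card : ℝ)
      ≤ (((framesOmega r k ω).filter fun Θ => |coordX2 Θ p| ≤ 8).card : ℝ) := by exact_mod_cast hle
  rw [← hR, ← hW]
  exact ⟨hone.trans hle', hmin.trans (hcard.trans hle')⟩

/-- The estimate in the frames `Ω_{k,ω}` for frequencies in a sector of aperture comparable to
`2^{-k-10}`. -/
theorem exists_sumNorm_framesOmega :
    ∃ C : ℝ, 0 ≤ C ∧ ∀ (r k : ℤ) (T : ℝ) (ω : Plane) (f : L2), 0 < r → T ≤ (2 : ℝ) ^ r →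
      100 ≤ k → ‖ω‖ = 1 → FourierSupportedIn f (sector (2 ^ k) (1 / (1024 * 2 ^ k)) ω) →
      sumNorm normL2X2LinfTX1 (framesOmega r k ω) (truncatedWave T f)
        ≤ ENNReal.ofReal (C * Real.sqrt (2 ^ k) * ‖f‖) := by
  obtain ⟨C, hC, hamp⟩ := exists_sector_amplitude (m := 200) (by norm_num)
  obtain ⟨L, hL⟩ : ∃ L : ℝ, L = 96 * C + Real.pi * (5120 * C) + 1 := ⟨_, rfl⟩
  have hπ := Real.pi_pos
  have hL1 : 1 ≤ L := by
    rw [hL]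
    have : 0 ≤ 96 * C + Real.pi * (5120 * C) := by positivity
    linarith
  refine ⟨L, by linarith, fun r k T ω f hr hT hk hω hf => ?_⟩
  have hbig := two_pow_hundred_le hk
  obtain ⟨W, hW⟩ : ∃ W : ℝ, W = 2 ^ k := ⟨_, rfl⟩
  obtain ⟨R, hR⟩ : ∃ R : ℝ, R = 2 ^ r := ⟨_, rfl⟩
  have hRpos : 0 < R := by rw [hR]; positivity
  rw [← hW] at hbig hf ⊢
  have hW64 : 1000 ≤ W := le_trans (by norm_num) hbig
  have hWpos : 0 < W := by linarith
  obtain ⟨δ, hδ⟩ : ∃ δ : ℝ, δ = 1 / (1024 * W) := ⟨_, rfl⟩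
  have hδpos : 0 < δ := by rw [hδ]; positivity
  have hδW : δ * W = 1 / 1024 := by rw [hδ]; field_simp
  rw [← hδ] at hf
  obtain ⟨a, hai, ha0, ha1, hker⟩ := hamp W δ ω (by linarith) hδpos
    (by rw [hδW]; norm_num) hω
  -- the two cases are those of many directions and of a bounded number of them
  obtain ⟨A, hA⟩ : ∃ A : ℝ, A = if 1 ≤ R / (256 * W) then 512 * C * W ^ 2 / R else C * W :=
    ⟨_, rfl⟩
  have hA0 : 0 ≤ A := by rw [hA]; split_ifs <;> positivity
  have hzero : (lam k, ω) ∈ framesOmega r k ω :=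
    mem_framesOmega.2 ⟨rfl, 0, by simp; positivity, by simp [rotate]⟩
  refine sumNorm_le_of_majorant (S := framesOmega r k ω)
    (e := fun Θ q => framePoint Θ q.2.1 q.2.2 q.1) (σ := coordX2)
    (fun Θ hΘ => isChart_coordX2 Θ (by
      obtain ⟨-, i, -, h⟩ := mem_framesOmega.1 hΘ
      rw [h]; exact norm_rotate hω _))
    (isBounded_sector _ _ _) hf T hai ha0 ha1 hzero
    (A := A) (B := C * W) (c := 8) (β := 1 / 5120) hA0
    (by positivity) (by norm_num) (by norm_num) (by positivity) ?_ ?_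
  · intro p hp
    have hp' : |p.1| ≤ 2 * R := by rw [hR]; linarith
    obtain ⟨hk1, hk2, hk3, hk4⟩ := hker p
    have hσ : coordX2 (lam k, ω) p = inner ℝ p.2 (perp ω) := rfl
    rw [hσ]
    -- the velocities transversal to `ω` are at most `25/9 δ`, so here the phase is nonstationary
    -- along `ω^⊥`
    by_cases hx2 : 7 / 2 * δ * |p.1| ≤ |inner ℝ p.2 (perp ω)|
    · refine le_add_of_nonneg_of_le (by positivity) ?_
      have h := hk4 (|inner ℝ p.2 (perp ω)| / 5) (by positivity)
        (by linarith [abs_nonneg (inner ℝ p.2 (perp ω))]) (by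
        intro u v huv
        have hp1 : (1 : ℝ) ≤ 1 + v ^ 2 := by linarith [sq_nonneg v]
        have hJ := lineJ_pos hp1 u
        have hu : u ≤ lineJ (1 + v ^ 2) u := (le_abs_self u).trans (abs_le_lineJ hp1 u)
        have h1 : |p.1 * (v / lineJ (1 + v ^ 2) u)| ≤ |p.1| * (25 / 9 * δ) := by
          rw [abs_mul, abs_div, abs_of_pos hJ]
          gcongr
          rw [div_le_iff₀ hJ]
          exact huv.2.2.trans (by gcongr)
        have h2 := abs_sub_abs_le_abs_sub (inner ℝ p.2 (perp ω))
          (-(p.1 * (v / lineJ (1 + v ^ 2) u)))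
        rw [abs_neg, sub_neg_eq_add] at h2
        have h3 : 25 / 9 * (δ * |p.1|) ≤ 4 / 5 * (7 / 2 * δ * |p.1|) := by
          have : 0 ≤ δ * |p.1| := by positivity
          linarith
        linarith)
      refine h.trans (le_of_eq ?_)
      rw [hδW, show (1 / 1024 * (|inner ℝ p.2 (perp ω)| / 5)) = 1 / 5120 * |inner ℝ p.2 (perp ω)| by ring,
        mul_pow, mul_pow, sq_abs]
    · push Not at hx2
      have ht : 0 < |p.1| := by
        by_contra h
        have : |p.1| = 0 := le_antisymm (not_lt.1 h) (abs_nonneg _)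
        rw [this, mul_zero] at hx2
        exact absurd hx2 (not_lt.2 (abs_nonneg _))
      -- the velocities along `ω` lie in `[39/40, 1]`; when `|x·ω| / |t|` is far from them the
      -- phase is nonstationary along `ω`, and the decay in `|t|` implies decay in `x·ω^⊥`, which
      -- is smaller
      by_cases hmid : 9 / 10 * |p.1| ≤ |inner ℝ p.2 ω| ∧ |inner ℝ p.2 ω| ≤ 2 * |p.1|
      · obtain ⟨hone, hcount⟩ := le_card_framesOmega hr hk hω (abs_pos.1 ht)
          (by rw [← hR]; exact hp') hmid.1 hmid.2 (by rw [← hW, ← hδ]; exact hx2.le)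
        rw [← hW, ← hR] at hcount
        refine le_add_of_le_of_nonneg ?_ (by positivity)
        rw [hA]
        split_ifs
        · refine (le_mul_min_of_le hk1 (hk2 (abs_pos.1 ht)) hWpos).trans ?_
          calc C * W ^ 2 * min (1 / |p.1|) (1 / W)
              = 512 * C * W ^ 2 / R * (R / 512 * min (1 / |p.1|) (1 / W)) := by field_simp
            _ ≤ _ := by gcongr
        · exact hk1.trans (le_mul_of_one_le_right (by positivity) hone)
      · refine le_add_of_nonneg_of_le (by positivity) ?_
        have h := hk3 (|p.1| / 20) (by positivity) (by
            have h1 : (1 : ℝ) ≤ W ^ 2 := one_le_pow₀ (by linarith)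
            calc |p.1| ≤ 10 * (1 * |p.1|) := by linarith
              _ ≤ 10 * (W ^ 2 * |p.1|) := by gcongr
              _ = _ := by ring) (by
          intro u v huv
          have huv' : InBox W (1 / W) u v := by
            refine ⟨huv.1, huv.2.1, huv.2.2.trans ?_⟩
            have hu : 0 ≤ u := le_trans (by positivity) huv.1
            have : δ ≤ 1 / W := by
              rw [hδ]; gcongr; linarith
            gcongr
          obtain ⟨q, hq1, hq2, hq⟩ := huv'.speed_eq hWpos
          rw [hq]
          have hq0 : 0 ≤ q := le_trans (by positivity) hq1
          have hs := speed_sub_le (x := 0) (y := q) le_rfl hq0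
          have hs1 : speed 0 = 1 := by simp [speed]
          have hs2 : speed q ≤ 1 := by
            unfold speed
            rw [div_le_one₀ (by positivity)]
            exact Real.one_le_sqrt.2 (by linarith)
          have hq3 : q ≤ 1 / 20 := by
            refine hq2.trans ?_
            rw [div_le_iff₀ (by positivity)]
            nlinarith only [hW64]
          have hs3 : 39 / 40 ≤ speed q := by linarith
          have e1 : |p.1 * speed q| = |p.1| * speed q := by
            rw [abs_mul, abs_of_pos (a := speed q) (by linarith)]
          rcases not_and_or.1 hmid with h | h
          · push Not at h
            have h2 := abs_sub_abs_le_abs_sub (p.1 * speed q) (-inner ℝ p.2 ω)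
            rw [abs_neg, sub_neg_eq_add, e1, add_comm] at h2
            have h3 : |p.1| * (39 / 40) ≤ |p.1| * speed q := by gcongr
            linarith
          · push Not at h
            have h2 := abs_sub_abs_le_abs_sub (inner ℝ p.2 ω) (-(p.1 * speed q))
            rw [abs_neg, sub_neg_eq_add, e1] at h2
            have h3 : |p.1| * speed q ≤ |p.1| * 1 := by gcongr
            linarith)
        refine h.trans (div_one_add_sq_le (by positivity) ?_)
        rw [abs_mul, abs_of_pos (by norm_num : (0 : ℝ) < 1 / 5120), abs_of_nonneg (a := W * (|p.1| / 20)) (by positivity)]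
        have hδ1 : δ ≤ 1 := by
          rw [hδ, div_le_one₀ (by positivity)]; linarith
        calc 1 / 5120 * |inner ℝ p.2 (perp ω)| ≤ 1 / 5120 * (7 / 2 * δ * |p.1|) := by gcongr
          _ ≤ 1 / 5120 * (7 / 2 * 1 * |p.1|) := by gcongr
          _ ≤ 1 * (|p.1| / 20) := by linarith
          _ ≤ _ := by gcongr; linarith
  · have e1 : Real.pi * (C * W) / (1 / 5120) = Real.pi * (5120 * C) * W := by ring
    have hcard := card_framesOmega_le r k ω
    rw [← hW, ← hR] at hcard
    have e2 : 2 * 8 * A * ((framesOmega r k ω).card : ℝ) ≤ 96 * C * W := by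
      rw [hA]
      split_ifs with hN
      · calc 2 * 8 * (512 * C * W ^ 2 / R) * ((framesOmega r k ω).card : ℝ)
            ≤ 2 * 8 * (512 * C * W ^ 2 / R) * (3 * (R / (256 * W))) := by gcongr; linarith
          _ = 96 * C * W := by field_simp; ring
      · push Not at hN
        calc 2 * 8 * (C * W) * ((framesOmega r k ω).card : ℝ) ≤ 2 * 8 * (C * W) * 3 := by
              gcongr; linarith
          _ = 48 * (C * W) := by ring
          _ ≤ 96 * (C * W) := by gcongr; norm_num
          _ = _ := by ring
    have e3 : L ≤ L ^ 2 := by nlinarith only [hL1]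
    have e4 : (96 * C + Real.pi * (5120 * C)) * W ≤ L ^ 2 * W := by
      gcongr
      linarith
    rw [mul_pow, Real.sq_sqrt hWpos.le]
    linarith

/-! ### Supports of the frequency cutoffs -/

theorem chiTilde_eq (ρ : ℝ → ℝ) (k : ℤ) (ξ : Plane) :
    chiTilde ρ k ξ = ρ ((2 : ℝ) ^ (-k - 1) * ‖ξ‖) - ρ ((2 : ℝ) ^ (-k + 2) * ‖ξ‖) := by
  unfold chiTilde chi
  rw [show -(k - 1) = -k + 1 by ring, show -(k + 1) = -k - 1 by ring,
    show -k - 1 + 1 = -k by ring, show -k + 1 + 1 = -k + 2 by ring]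
  ring

theorem norm_mem_of_chiTilde_ne_zero {ρ : ℝ → ℝ} (hρ : IsRadialCutoff ρ) {k : ℤ} {ξ : Plane}
    (h : chiTilde ρ k ξ ≠ 0) : 2 ^ k / 4 ≤ ‖ξ‖ ∧ ‖ξ‖ ≤ 4 * 2 ^ k := by
  obtain ⟨W, hW⟩ : ∃ W : ℝ, W = 2 ^ k := ⟨_, rfl⟩
  have hWpos : 0 < W := by rw [hW]; positivity
  have e1 : (2 : ℝ) ^ (-k - 1) = 1 / (2 * W) := by
    rw [hW, zpow_sub₀ two_ne_zero, zpow_neg]; field_simp; try norm_num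
  have e2 : (2 : ℝ) ^ (-k + 2) = 4 / W := by
    rw [hW, zpow_add₀ two_ne_zero, zpow_neg]; field_simp; try norm_num
  obtain ⟨b, -, hb, hρb⟩ := hρ.exists_radius
  rw [chiTilde_eq, e1, e2] at h
  rw [← hW]
  constructor
  · by_contra hlt
    push Not at hlt
    refine h ?_
    rw [hρ.eq_one, hρ.eq_one, sub_self]
    · rw [abs_of_nonneg (by positivity), div_mul_eq_mul_div, div_le_one₀ hWpos]; linarith
    · rw [abs_of_nonneg (by positivity), div_mul_eq_mul_div, div_le_one₀ (by positivity)]; linarith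
  · by_contra hlt
    push Not at hlt
    have hz : ∀ s : ℝ, 2 < s → ρ s = 0 := fun s hs => by
      by_contra hne
      have := (le_abs_self s).trans (hρb s hne)
      linarith
    refine h ?_
    rw [hz, hz, sub_self]
    · rw [div_mul_eq_mul_div, lt_div_iff₀ hWpos]; linarith
    · rw [div_mul_eq_mul_div, lt_div_iff₀ (by positivity)]; linarith

theorem inner_sq_add_inner_perp_sq {ω : Plane} (hω : ‖ω‖ = 1) (ξ : Plane) :
    inner ℝ ω ξ ^ 2 + inner ℝ (perp ω) ξ ^ 2 = ‖ξ‖ ^ 2 := by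
  have h1 : ω 0 ^ 2 + ω 1 ^ 2 = 1 := by
    have := EuclideanSpace.norm_sq_eq ω
    rw [hω] at this
    simpa [Fin.sum_univ_two] using this.symm
  rw [EuclideanSpace.norm_sq_eq]
  simp only [perp, PiLp.inner_apply, Fin.sum_univ_two]
  simp
  linear_combination (ξ 0 ^ 2 + ξ 1 ^ 2) * h1

theorem inner_eq_norm_mul_cos_angle {ω : Plane} (hω : ‖ω‖ = 1) (ξ : Plane) :
    inner ℝ ω ξ = ‖ξ‖ * Real.cos (InnerProductGeometry.angle ξ ω) := by
  have h := InnerProductGeometry.cos_angle_mul_norm_mul_norm ξ ω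
  rw [hω, mul_one] at h
  rw [real_inner_comm, ← h, mul_comm]

theorem abs_inner_perp_eq {ω : Plane} (hω : ‖ω‖ = 1) (ξ : Plane) :
    |inner ℝ (perp ω) ξ| = ‖ξ‖ * Real.sin (InnerProductGeometry.angle ξ ω) := by
  have h := inner_sq_add_inner_perp_sq hω ξ
  rw [inner_eq_norm_mul_cos_angle hω] at h
  have hs := InnerProductGeometry.sin_angle_nonneg ξ ω
  rw [← abs_of_nonneg (mul_nonneg (norm_nonneg ξ) hs), ← sq_eq_sq_iff_abs_eq_abs]
  linear_combination h - ‖ξ‖ ^ 2 * Real.sin_sq_add_cos_sq (InnerProductGeometry.angle ξ ω)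

/-- A cone of small aperture lies in the sector. -/
theorem mem_sector_of_angle_le {W δ : ℝ} {ω ξ : Plane} (hω : ‖ω‖ = 1) (hδ : δ ≤ 1 / 4)
    (h₁ : W / 4 ≤ ‖ξ‖) (h₂ : ‖ξ‖ ≤ 4 * W) (h : InnerProductGeometry.angle ξ ω ≤ δ) :
    ξ ∈ sector W δ ω := by
  have h0 := InnerProductGeometry.angle_nonneg ξ ω
  refine ⟨h₁, h₂, ?_, ?_⟩
  · rw [abs_inner_perp_eq hω, mul_comm]
    gcongr
    exact (Real.sin_le h0).trans h
  · rw [inner_eq_norm_mul_cos_angle hω, mul_comm]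
    gcongr
    have h1 := Real.one_sub_sq_div_two_le_cos (x := InnerProductGeometry.angle ξ ω)
    have h2 : InnerProductGeometry.angle ξ ω ^ 2 ≤ (1 / 4) ^ 2 := by
      gcongr; linarith
    linarith

/-- The closed support of `η̃_κ χ̃_k` lies in an annulus and in the closed cone over the arc of
diameter `2 · 2^{-l}`; the annulus keeps it away from the vertex, where the angle jumps. -/
theorem CapSystem.supportCap_subset (K : CapSystem) {ρ : ℝ → ℝ} (hρ : IsRadialCutoff ρ) (k : ℤ)
    {l : ℕ} {κ : Plane} (hκ : κ ∈ K.caps l) :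
    K.supportCap ρ k l κ ⊆ {ξ | 2 ^ k / 4 ≤ ‖ξ‖ ∧ ‖ξ‖ ≤ 4 * 2 ^ k ∧
      InnerProductGeometry.angle ξ κ ≤ (2 : ℝ) ^ (-(l : ℤ))} := by
  have hκ1 := K.norm_center l κ hκ
  obtain ⟨C, hC⟩ := K.etaTilde_cutoff
  have hθ0 : (0 : ℝ) ≤ (2 : ℝ) ^ (-(l : ℤ)) := by positivity
  have hθπ : (2 : ℝ) ^ (-(l : ℤ)) ≤ Real.pi := by
    refine le_trans ?_ (le_trans (by norm_num : (1 : ℝ) ≤ 3) Real.pi_gt_three.le)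
    exact zpow_le_one_of_nonpos₀ one_le_two (by simp)
  obtain ⟨θ, hθ⟩ : ∃ θ : ℝ, θ = (2 : ℝ) ^ (-(l : ℤ)) := ⟨_, rfl⟩
  obtain ⟨W, hW⟩ : ∃ W : ℝ, W = (2 : ℝ) ^ k := ⟨_, rfl⟩
  have hpos : 0 < W := by rw [hW]; positivity
  rw [← hθ] at hθ0 hθπ
  rw [← hθ, ← hW]
  -- the cone, described by a closed condition that makes sense at the vertex
  have hclosed : IsClosed {ξ : Plane | W / 4 ≤ ‖ξ‖ ∧ ‖ξ‖ ≤ 4 * W ∧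
      ‖ξ‖ * Real.cos θ ≤ inner ℝ κ ξ} :=
    (isClosed_le continuous_const continuous_norm).and
      ((isClosed_le continuous_norm continuous_const).and
        (isClosed_le (continuous_norm.mul continuous_const)
          (continuous_const.inner continuous_id)))
  have hsub : K.supportCap ρ k l κ ⊆ {ξ : Plane | W / 4 ≤ ‖ξ‖ ∧ ‖ξ‖ ≤ 4 * W ∧
      ‖ξ‖ * Real.cos θ ≤ inner ℝ κ ξ} := by
    refine closure_minimal (fun ξ hξ => ?_) hclosed
    rw [Function.mem_support] at hξ
    have h1 := norm_mem_of_chiTilde_ne_zero hρ (right_ne_zero_of_mul hξ)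
    rw [← hW] at h1
    have hξ0 : ξ ≠ 0 := norm_pos_iff.1 (lt_of_lt_of_le (by positivity) h1.1)
    have h2 := ((hC l κ hκ).supp ξ hξ0 (left_ne_zero_of_mul hξ)).resolve_left hξ0
    rw [← hθ] at h2
    have h3 : InnerProductGeometry.angle ξ κ ≤ θ := by linarith
    refine ⟨h1.1, h1.2, ?_⟩
    rw [inner_eq_norm_mul_cos_angle hκ1]
    exact mul_le_mul_of_nonneg_left (Real.cos_le_cos_of_nonneg_of_le_pi
      (InnerProductGeometry.angle_nonneg ξ κ) hθπ h3) (norm_nonneg ξ)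
  intro ξ hξ
  obtain ⟨h1, h1', h2⟩ := hsub hξ
  refine ⟨h1, h1', ?_⟩
  have hn : 0 < ‖ξ‖ := lt_of_lt_of_le (by positivity) h1
  rw [inner_eq_norm_mul_cos_angle hκ1] at h2
  have h3 := le_of_mul_le_mul_left h2 hn
  by_contra hlt
  exact absurd h3 (not_le.2 (Real.cos_lt_cos_of_nonneg_of_le_pi hθ0
    (InnerProductGeometry.angle_le_pi _ _) (not_le.1 hlt)))

theorem FourierSupportedIn.mono {f : L2} {S S' : Set Plane} (h : FourierSupportedIn f S)
    (hS : S ⊆ S') : FourierSupportedIn f S' := by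
  filter_upwards [h] with ξ hξ hne
  exact hξ fun hmem => hne (hS hmem)

/-! ### Counting caps -/

/-- Every unit vector is a rotation of `ω` by plus or minus their angle. -/
theorem exists_eq_rotate {ω κ : Plane} (hω : ‖ω‖ = 1) (hκ : ‖κ‖ = 1) :
    ∃ φ : ℝ, |φ| = InnerProductGeometry.angle κ ω ∧ κ = rotate φ ω := by
  have h1 := inner_eq_norm_mul_cos_angle hω κ
  have h2 := abs_inner_perp_eq hω κ
  rw [hκ, one_mul] at h1 h2
  have h0 := InnerProductGeometry.angle_nonneg κ ω
  have hdec : κ = inner ℝ ω κ • ω + inner ℝ (perp ω) κ • perp ω := by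
    have h1 : ω 0 ^ 2 + ω 1 ^ 2 = 1 := by
      have := EuclideanSpace.norm_sq_eq ω
      rw [hω] at this
      simpa [Fin.sum_univ_two] using this.symm
    ext i
    fin_cases i <;> simp [perp, PiLp.inner_apply, Fin.sum_univ_two]
    · linear_combination -(κ 0) * h1
    · linear_combination -(κ 1) * h1
  rcases abs_choice (inner ℝ (perp ω) κ) with h | h
  · refine ⟨_, abs_of_nonneg h0, ?_⟩
    rw [rotate, ← h1, ← h2, h]; exact hdec
  · refine ⟨-InnerProductGeometry.angle κ ω, by rw [abs_neg, abs_of_nonneg h0], ?_⟩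
    rw [rotate, Real.cos_neg, Real.sin_neg, ← h1, ← h2, h, neg_neg]; exact hdec

/-- An inequality only, as `|a - b|` may exceed `π`. -/
theorem angle_rotate_le {ω : Plane} (hω : ‖ω‖ = 1) (a b : ℝ) :
    InnerProductGeometry.angle (rotate a ω) (rotate b ω) ≤ |a - b| := by
  by_cases h : |a - b| ≤ Real.pi
  · have h1 : ω 0 ^ 2 + ω 1 ^ 2 = 1 := by
      have := EuclideanSpace.norm_sq_eq ω
      rw [hω] at this
      simpa [Fin.sum_univ_two] using this.symm
    have hi : inner ℝ (rotate a ω) (rotate b ω) = Real.cos |a - b| := by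
      rw [Real.cos_abs, Real.cos_sub]
      simp [rotate, perp, PiLp.inner_apply, Fin.sum_univ_two]
      linear_combination (Real.cos a * Real.cos b + Real.sin a * Real.sin b) * h1
    rw [InnerProductGeometry.angle, norm_rotate hω, norm_rotate hω, mul_one, div_one, hi,
      Real.arccos_cos (abs_nonneg _) h]
  · exact (InnerProductGeometry.angle_le_pi _ _).trans (not_le.1 h).le

open Classical in
/-- At most `(2M+1)N` caps of `𝒦_l` have their centres within the angle `M 2^{-l}` of a given
direction: each of them contains one of `2M+1` points at distance `2^{-l}` from each other. -/
theorem CapSystem.card_caps_near_le (K : CapSystem) {N : ℕ}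
    (hN : ∀ l (x : Plane), ‖x‖ = 1 → {κ : Plane | κ ∈ K.caps l ∧ x ∈ arc l κ}.ncard ≤ N)
    (l M : ℕ) {ω : Plane} (hω : ‖ω‖ = 1) :
    ((K.caps l).filter fun κ => InnerProductGeometry.angle κ ω ≤ M * (2 : ℝ) ^ (-(l : ℤ))).card
      ≤ (2 * M + 1) * N := by
  obtain ⟨h, hh⟩ : ∃ h : ℝ, h = (2 : ℝ) ^ (-(l : ℤ)) := ⟨_, rfl⟩
  have hpos : 0 < h := by rw [hh]; positivity
  have hsub : ((K.caps l).filter fun κ =>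
      InnerProductGeometry.angle κ ω ≤ M * (2 : ℝ) ^ (-(l : ℤ))) ⊆
      (Finset.Icc (-(M : ℤ)) M).biUnion fun i =>
        (K.caps l).filter fun κ => rotate (i * h) ω ∈ arc l κ := by
    intro κ hκ
    rw [Finset.mem_filter, ← hh] at hκ
    obtain ⟨φ, hφ, hφκ⟩ := exists_eq_rotate hω (K.norm_center l κ hκ.1)
    rw [← hφ] at hκ
    have hr := abs_sub_round (φ / h)
    have hb : |φ / h| ≤ M := by
      rw [abs_div, abs_of_pos hpos, div_le_iff₀ hpos]; exact hκ.2
    have hi : |round (φ / h)| ≤ (M : ℤ) := by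
      have h1 : |((round (φ / h) : ℤ) : ℝ)| < M + 1 := by
        have := abs_sub_abs_le_abs_sub ((round (φ / h) : ℤ) : ℝ) (φ / h)
        rw [abs_sub_comm] at this
        linarith
      have h2 : |round (φ / h)| < (M : ℤ) + 1 := by exact_mod_cast h1
      linarith
    rw [Finset.mem_biUnion]
    refine ⟨round (φ / h), Finset.mem_Icc.2 (abs_le.1 hi), Finset.mem_filter.2 ⟨hκ.1,
      norm_rotate hω _, ?_⟩⟩
    rw [← hh, hφκ]
    refine (angle_rotate_le hω _ _).trans ?_
    have e : (round (φ / h) : ℝ) * h - φ = -(h * (φ / h - round (φ / h))) := by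
      field_simp; ring
    rw [e, abs_neg, abs_mul, abs_of_pos hpos]
    nlinarith only [hr, hpos]
  refine (Finset.card_le_card hsub).trans (Finset.card_biUnion_le.trans ?_)
  have hone : ∀ i ∈ Finset.Icc (-(M : ℤ)) M,
      ((K.caps l).filter fun κ => rotate (i * h) ω ∈ arc l κ).card ≤ N := fun i _ => by
    have := hN l (rotate (i * h) ω) (norm_rotate hω _)
    rwa [← Finset.coe_filter, Set.ncard_coe_finset] at this
  refine (Finset.sum_le_card_nsmul _ _ _ hone).trans (le_of_eq ?_)
  rw [Int.card_Icc, smul_eq_mul]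
  congr 1
  omega

/-! ### Almost orthogonality of the projections to caps -/

theorem ae_ne_zero_plane : ∀ᵐ ξ : Plane, ξ ≠ 0 := by simp [ae_iff]

theorem eq_zero_of_fourierSupportedIn_empty {f : L2} (h : FourierSupportedIn f ∅) : f = 0 := by
  have h1 : (𝓕 f : L2) = 0 := by
    refine (Lp.eq_zero_iff_ae_eq_zero).2 ?_
    filter_upwards [h] with ξ hξ
    exact hξ (Set.notMem_empty _)
  rw [← norm_eq_zero, ← Lp.norm_fourier_eq, h1, norm_zero]

/-- `P̃_κ f` has its frequencies in those of `f` and in the cone over the cap. -/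
theorem CapSystem.fourierSupportedIn_projTilde (K : CapSystem) {l : ℕ} {κ : Plane}
    (hκ : κ ∈ K.caps l) {f : L2} {S : Set Plane} (hf : FourierSupportedIn f S) :
    FourierSupportedIn (K.projTilde l κ f)
      (S ∩ {ξ | ξ = 0 ∨ InnerProductGeometry.angle ξ κ ≤ (2 : ℝ) ^ (-(l : ℤ))}) := by
  obtain ⟨C, hC⟩ := K.etaTilde_cutoff
  filter_upwards [hf, K.fourier_projTilde l κ hκ f] with ξ hξ hP hne
  rw [hP]
  by_contra h0
  refine hne ⟨by_contra fun hS => right_ne_zero_of_mul h0 (hξ hS), ?_⟩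
  by_cases hz : (2 * Real.pi) • ξ = 0
  · exact Or.inl hz
  · have h1 := (hC l κ hκ).supp _ hz (by exact_mod_cast left_ne_zero_of_mul h0)
    rcases h1 with h1 | h1
    · exact Or.inl h1
    · exact Or.inr (by linarith)

/-- Almost orthogonality of the `P̃_κ`, `κ ∈ 𝒦_l`: at most `3N` of the cones overlap. -/
theorem CapSystem.exists_sum_sq_projTilde_le (K : CapSystem) :
    ∃ B : ℝ, 0 ≤ B ∧ ∀ (l : ℕ) (f : L2),
      ∑ κ ∈ K.caps l, ‖K.projTilde l κ f‖ ^ 2 ≤ B * ‖f‖ ^ 2 := by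
  classical
  obtain ⟨C, hC⟩ := K.etaTilde_cutoff
  obtain ⟨N, hN⟩ := K.finite_overlap
  refine ⟨3 * N * C 0 ^ 2, by positivity, fun l f => ?_⟩
  have hpi : (2 * Real.pi) ≠ 0 := by positivity
  have hpt : ∀ ξ : Plane, ξ ≠ 0 →
      ∑ κ ∈ K.caps l, K.etaTilde l κ ξ ^ 2 ≤ 3 * N * C 0 ^ 2 := by
    intro ξ hξ
    obtain ⟨ω, hω⟩ : ∃ ω : Plane, ω = ‖ξ‖⁻¹ • ξ := ⟨_, rfl⟩
    have hn : 0 < ‖ξ‖⁻¹ := inv_pos.2 (norm_pos_iff.2 hξ)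
    have hω1 : ‖ω‖ = 1 := by
      rw [hω, norm_smul, Real.norm_of_nonneg hn.le, inv_mul_cancel₀ (norm_ne_zero_iff.2 hξ)]
    have hcard := K.card_caps_near_le hN l 1 hω1
    rw [← Finset.sum_filter_of_ne (p := fun κ =>
      InnerProductGeometry.angle κ ω ≤ (1 : ℕ) * (2 : ℝ) ^ (-(l : ℤ)))]
    · refine (Finset.sum_le_card_nsmul _ _ (C 0 ^ 2) ?_).trans ?_
      · intro κ hκ
        have := (hC l κ (Finset.mem_filter.1 hκ).1).deriv_bound 0 ξ hξ
        have h1 : |K.etaTilde l κ ξ| ≤ C 0 := by simpa using this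
        exact sq_le_sq' (abs_le.1 h1).1 (abs_le.1 h1).2
      · rw [nsmul_eq_mul]
        gcongr
        exact_mod_cast hcard
    · intro κ hκ hne
      have h1 := ((hC l κ hκ).supp ξ hξ (fun h => hne (by rw [h]; norm_num))).resolve_left hξ
      rw [InnerProductGeometry.angle_comm, hω,
        InnerProductGeometry.angle_smul_left_of_pos _ _ hn, Nat.cast_one]
      linarith
  have hlin : ∑ κ ∈ K.caps l, ENNReal.ofReal (‖K.projTilde l κ f‖ ^ 2)
      ≤ ENNReal.ofReal (3 * N * C 0 ^ 2) * ENNReal.ofReal (‖f‖ ^ 2) := by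
    have e : ∀ κ ∈ K.caps l, ENNReal.ofReal (‖K.projTilde l κ f‖ ^ 2)
        = ∫⁻ ξ : Plane, ENNReal.ofReal (K.etaTilde l κ ((2 * Real.pi) • ξ) ^ 2)
          * ‖(𝓕 f : L2) ξ‖ₑ ^ 2 := by
      intro κ hκ
      rw [← Lp.norm_fourier_eq, ← lintegral_enorm_sq_eq]
      refine lintegral_congr_ae ?_
      filter_upwards [K.fourier_projTilde l κ hκ f] with ξ hξ
      rw [hξ, enorm_mul, mul_pow]
      congr 1
      rw [← ofReal_norm, ← ENNReal.ofReal_pow (norm_nonneg _), Complex.norm_real,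
        Real.norm_eq_abs, sq_abs]
    have hm : ∀ κ ∈ K.caps l, AEMeasurable (fun ξ : Plane =>
        ENNReal.ofReal (K.etaTilde l κ ((2 * Real.pi) • ξ) ^ 2) * ‖(𝓕 f : L2) ξ‖ₑ ^ 2) := by
      intro κ hκ
      refine AEMeasurable.mul ?_ ((Lp.aestronglyMeasurable _).enorm.pow_const 2)
      have hc : ContinuousOn (fun ξ : Plane => K.etaTilde l κ ((2 * Real.pi) • ξ)) {0}ᶜ := by
        refine (hC l κ hκ).smooth.continuousOn.comp (by fun_prop) ?_
        intro ξ hξ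
        exact smul_ne_zero hpi hξ
      have h1 := hc.aemeasurable (μ := (volume : Measure Plane))
        (measurableSet_singleton 0).compl
      rw [Measure.restrict_eq_self_of_ae_mem (by simpa using ae_ne_zero_plane)] at h1
      exact (h1.pow_const 2).ennreal_ofReal
    rw [Finset.sum_congr rfl e, ← lintegral_finsetSum' _ hm, ← Lp.norm_fourier_eq,
      ← lintegral_enorm_sq_eq, ← lintegral_const_mul' _ _ ENNReal.ofReal_ne_top]
    refine lintegral_mono_ae ?_
    filter_upwards [ae_ne_zero_plane] with ξ hξ
    rw [← Finset.sum_mul, ← ENNReal.ofReal_sum_of_nonneg fun _ _ => sq_nonneg _]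
    gcongr
    exact hpt _ (smul_ne_zero hpi hξ)
  rw [← ENNReal.ofReal_sum_of_nonneg fun _ _ => sq_nonneg _,
    ← ENNReal.ofReal_mul (by positivity)] at hlin
  exact (ENNReal.ofReal_le_ofReal_iff (by positivity)).1 hlin

/-- For frequencies over a cap of size `2^{-l}`, only `O(2^{k-l})` of the caps of `𝒦_k`
contribute, and Cauchy--Schwarz loses `2^{(k-l)/2}`. -/
theorem CapSystem.exists_sum_projTilde_le (K : CapSystem) :
    ∃ B : ℝ, 0 ≤ B ∧ ∀ (k l : ℕ) (κ₁ : Plane) (f : L2), l ≤ k → κ₁ ∈ K.caps l →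
      FourierSupportedIn f {ξ | ξ ≠ 0 ∧ InnerProductGeometry.angle ξ κ₁ ≤ (2 : ℝ) ^ (-(l : ℤ))} →
      ∑ κ ∈ K.caps k, ‖K.projTilde k κ f‖ ≤ B * Real.sqrt (2 ^ (k - l)) * ‖f‖ := by
  classical
  obtain ⟨N, hN⟩ := K.finite_overlap
  obtain ⟨B, hB, hsq⟩ := K.exists_sum_sq_projTilde_le
  refine ⟨Real.sqrt (5 * N * B), by positivity, fun k l κ₁ f hlk hκ₁ hf => ?_⟩
  have e1 : (2 : ℝ) ^ (-(l : ℤ)) = (2 : ℝ) ^ (k - l) * (2 : ℝ) ^ (-(k : ℤ)) := by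
    rw [← zpow_natCast, ← zpow_add₀ two_ne_zero]
    congr 1
    omega
  -- the cap `κ₁` reaches `2^{k-l}` units `2^{-k}` from its centre, and the cone over `κ` one more
  obtain ⟨M, hM⟩ : ∃ M : ℕ, M = 2 ^ (k - l) + 1 := ⟨_, rfl⟩
  rw [← Finset.sum_filter_of_ne (p := fun κ =>
    InnerProductGeometry.angle κ κ₁ ≤ M * (2 : ℝ) ^ (-(k : ℤ)))]
  · have hcard := K.card_caps_near_le hN k M (K.norm_center l κ₁ hκ₁)
    obtain ⟨F, hF⟩ : ∃ F : Finset Plane, F = (K.caps k).filter fun κ =>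
      InnerProductGeometry.angle κ κ₁ ≤ M * (2 : ℝ) ^ (-(k : ℤ)) := ⟨_, rfl⟩
    rw [← hF] at hcard ⊢
    have hcs := sq_sum_le_card_mul_sum_sq (s := F) (f := fun κ => ‖K.projTilde k κ f‖)
    have h2 : ∑ κ ∈ F, ‖K.projTilde k κ f‖ ^ 2 ≤ B * ‖f‖ ^ 2 :=
      (Finset.sum_le_sum_of_subset_of_nonneg (by rw [hF]; exact Finset.filter_subset _ _)
        fun _ _ _ => sq_nonneg _).trans (hsq k f)
    have h3 : (F.card : ℝ) ≤ 5 * 2 ^ (k - l) * N := by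
      have h4 : 2 * M + 1 ≤ 5 * 2 ^ (k - l) := by
        have := Nat.one_le_two_pow (n := k - l)
        omega
      exact_mod_cast hcard.trans (Nat.mul_le_mul_right N h4)
    refine abs_le_of_sq_le_sq' ?_ (by positivity) |>.2
    refine hcs.trans ((mul_le_mul h3 h2 (Finset.sum_nonneg fun _ _ => sq_nonneg _)
      (by positivity)).trans (le_of_eq ?_))
    rw [mul_pow, mul_pow, Real.sq_sqrt (by positivity), Real.sq_sqrt (by positivity)]
    ring
  · intro κ hκ hne
    by_contra hfar
    refine hne (norm_eq_zero.2 (eq_zero_of_fourierSupportedIn_empty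
      ((K.fourierSupportedIn_projTilde hκ hf).mono ?_)))
    rintro ξ ⟨⟨hξ0, hξ1⟩, hξ2⟩
    refine absurd ?_ hfar
    have h1 := hξ2.resolve_left hξ0
    have h2 := InnerProductGeometry.angle_le_angle_add_angle κ ξ κ₁
    rw [InnerProductGeometry.angle_comm κ ξ] at h2
    rw [e1] at hξ1
    rw [hM]
    push_cast
    linarith

end KleinGordon

end

open KleinGordon in
theorem theorem2p1 (ρ : ℝ → ℝ) (hρ : KleinGordon.IsRadialCutoff ρ) (K : KleinGordon.CapSystem) :
    ∃ C : ℝ, ∀ (r : ℤ) (T : ℝ), 0 < r → 0 < T → T ≤ (2 : ℝ) ^ r →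
      (∀ (k : ℤ) (ω : KleinGordon.Plane) (f : KleinGordon.L2), k ≤ 99 → ‖ω‖ = 1 →
        KleinGordon.FourierSupportedIn f (KleinGordon.supportLe ρ k) →
        KleinGordon.sumNorm KleinGordon.normL2TLinfX (KleinGordon.framesLambda r k ω)
            (KleinGordon.truncatedWave T f)
          ≤ ENNReal.ofReal (C * ‖f‖)) ∧
      (∀ (k : ℕ) (κ : KleinGordon.Plane) (f : KleinGordon.L2), 100 ≤ k → κ ∈ K.caps (k + 10) →
        KleinGordon.FourierSupportedIn f (K.supportCap ρ k (k + 10) κ) →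
        KleinGordon.sumNorm KleinGordon.normL2TLinfX (KleinGordon.framesLambda r k κ)
            (KleinGordon.truncatedWave T f)
          ≤ ENNReal.ofReal (C * ‖f‖) ∧
        KleinGordon.sumNorm KleinGordon.normL2X2LinfTX1 (KleinGordon.framesOmega r k κ)
            (KleinGordon.truncatedWave T f)
          ≤ ENNReal.ofReal (C * (2 : ℝ) ^ ((k : ℝ) / 2) * ‖f‖)) ∧
      (∀ (k l : ℕ) (κ₁ : KleinGordon.Plane) (f : KleinGordon.L2), 100 ≤ k → 1 ≤ l → l ≤ k →
        κ₁ ∈ K.caps l →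
        KleinGordon.FourierSupportedIn f (K.supportCap ρ k l κ₁) →
        ∑ κ ∈ K.caps k,
            KleinGordon.sumNorm KleinGordon.normL2TLinfX (KleinGordon.framesLambda r k κ)
              (KleinGordon.truncatedWave T (K.projTilde k κ f))
          ≤ ENNReal.ofReal (C * (2 : ℝ) ^ (((k : ℝ) - l) / 2) * ‖f‖)) := by
  obtain ⟨C₁, hC₁, h₁⟩ := exists_sumNorm_low_frequency hρ
  obtain ⟨C₂, hC₂, h₂⟩ := exists_sumNorm_framesLambda
  obtain ⟨C₃, hC₃, h₃⟩ := exists_sumNorm_framesOmega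
  obtain ⟨B, hB, h₄⟩ := K.exists_sum_projTilde_le
  have hprod : 0 ≤ C₂ * B := mul_nonneg hC₂ hB
  obtain ⟨C, hC⟩ : ∃ C : ℝ, C = C₁ + C₂ + C₃ + C₂ * B := ⟨_, rfl⟩
  refine ⟨C, fun r T hr _ hT => ⟨?_, ?_, ?_⟩⟩
  · intro k ω f hk hω hf
    refine (h₁ r k T ω f hr hT hk hω hf).trans (ENNReal.ofReal_le_ofReal ?_)
    gcongr
    linarith
  · intro k κ f hk hκ hf
    have hω := K.norm_center _ κ hκ
    obtain ⟨W, hW⟩ : ∃ W : ℝ, W = 2 ^ (k : ℤ) := ⟨_, rfl⟩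
    have hk' : (100 : ℤ) ≤ k := by exact_mod_cast hk
    have hbig := two_pow_hundred_le hk'
    rw [← hW] at hbig
    have hW1 : (1 : ℝ) ≤ W := le_trans (by norm_num) hbig
    have hsub : K.supportCap ρ k (k + 10) κ ⊆ sector (2 ^ (k : ℤ)) (1 / (1024 * 2 ^ (k : ℤ))) κ := by
      intro ξ hξ
      obtain ⟨k1, k2, k3⟩ := K.supportCap_subset hρ k hκ hξ
      refine mem_sector_of_angle_le hω ?_ k1 k2 (k3.trans (le_of_eq ?_))
      · rw [← hW]
        exact one_div_le_one_div_of_le (by norm_num) (by linarith)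
      · push_cast
        rw [neg_add, zpow_add₀ two_ne_zero, zpow_neg]
        field_simp
        norm_num
    have hsub' : sector (2 ^ (k : ℤ)) (1 / (1024 * 2 ^ (k : ℤ))) κ
        ⊆ sector (2 ^ (k : ℤ)) (1 / 2 ^ (k : ℤ)) κ := by
      rintro ξ ⟨k1, k2, k3, k4⟩
      refine ⟨k1, k2, k3.trans ?_, k4⟩
      gcongr
      rw [← hW]
      linarith
    have hf' := hf.mono hsub
    refine ⟨(h₂ r k T κ f hr hT hk' hω (hf'.mono hsub')).trans (ENNReal.ofReal_le_ofReal ?_),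
      (h₃ r k T κ f hr hT hk' hω hf').trans (ENNReal.ofReal_le_ofReal ?_)⟩
    · gcongr
      linarith
    · have e : Real.sqrt ((2 : ℝ) ^ (k : ℤ)) = (2 : ℝ) ^ ((k : ℝ) / 2) := by
        rw [Real.sqrt_eq_rpow, zpow_natCast, ← Real.rpow_natCast, ← Real.rpow_mul zero_le_two,
          mul_one_div]
      rw [e]
      gcongr
      linarith
  · intro k l κ₁ f hk hl hlk hκ₁ hf
    have hk' : (100 : ℤ) ≤ k := by exact_mod_cast hk
    have hbig := two_pow_hundred_le hk'
    have hf' := hf.mono (K.supportCap_subset hρ k hκ₁)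
    have hsum := h₄ k l κ₁ f hlk hκ₁ (hf'.mono fun ξ hξ =>
      ⟨norm_pos_iff.1 (lt_of_lt_of_le (by positivity) hξ.1), hξ.2.2⟩)
    have hone : ∀ κ ∈ K.caps k,
        sumNorm normL2TLinfX (framesLambda r k κ) (truncatedWave T (K.projTilde k κ f))
          ≤ ENNReal.ofReal (C₂ * ‖K.projTilde k κ f‖) := by
      intro κ hκ
      have hω := K.norm_center _ κ hκ
      refine h₂ r k T κ _ hr hT hk' hω ((K.fourierSupportedIn_projTilde hκ hf').mono ?_)
      rintro ξ ⟨⟨k1, k2, -⟩, k3⟩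
      have hξ0 : ξ ≠ 0 := norm_pos_iff.1 (lt_of_lt_of_le (by positivity) k1)
      refine mem_sector_of_angle_le hω ?_ k1 k2 ?_
      · exact one_div_le_one_div_of_le (by norm_num) (le_trans (by norm_num) hbig)
      · rw [one_div, ← zpow_neg]
        exact k3.resolve_left hξ0
    refine (Finset.sum_le_sum hone).trans ?_
    rw [← ENNReal.ofReal_sum_of_nonneg fun _ _ => by positivity, ← Finset.mul_sum]
    refine ENNReal.ofReal_le_ofReal ?_
    have e : Real.sqrt ((2 : ℝ) ^ (k - l)) = (2 : ℝ) ^ (((k : ℝ) - l) / 2) := by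
      rw [Real.sqrt_eq_rpow, ← Real.rpow_natCast, ← Real.rpow_mul zero_le_two,
        mul_one_div, Nat.cast_sub hlk]
    rw [e] at hsum
    calc C₂ * ∑ κ ∈ K.caps k, ‖K.projTilde k κ f‖
        ≤ C₂ * (B * (2 : ℝ) ^ (((k : ℝ) - l) / 2) * ‖f‖) := by gcongr
      _ = C₂ * B * (2 : ℝ) ^ (((k : ℝ) - l) / 2) * ‖f‖ := by ring
      _ ≤ _ := by gcongr; linarith
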